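/- Let $p$ be a prime and let $G$ be a finite group with a split BN-pair of characteristic $p$: there are subgroups $B,N\le G$ and a finite set $S$ of involutions of $W:=N/T$, $T:=B\cap N$, such that $G=\langle B,N\rangle$, $T\trianglelefteq N$, $W=\langle S\rangle$, and $sBw\subseteq BwB\cup BswB$, $sBs\not\subseteq B$ for all $s\in S$, $w\in W$; moreover $B=U\rtimes T$ with $U$ a normal $p$-subgroup of $B$ and $T$ commutative of order prime to $p$, $\bigcap_{n\in N}nBn^{-1}=T$, and for each $I\subseteq S$ the subgroup $\bigcap_{w\in W_I}wUw^{-1}$ is normal in $U$, where $W_I:=\langle I\rangle\le W$. For $I\subseteq S$ let $P_I=BW_IB$, let $U_I$ be the largest normal $p$-subgroup of $P_I$, and let $L_I=P_I\cap P_I^-$ be the Levi subgroup of $P_I$, where $P_I^-=B^-W_IB^-$ with $B^-=w_SBw_S$, $w_S$ the longest element of $W$; thus $P_I=U_I\rtimes L_I$, and $L_I$ has a split BN-pair with subgroups $B\cap L_I$, $N\cap L_I$, and Weyl group $(W_I,I)$. Let $R$ be a commutative ring in which $p$ is invertible, and let $e_I=|U_I|^{-1}\sum_{u\in U_I}u\in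 RG$. Fix a total ordering on $S$. Let $X(G)$ be the bounded complex of $RG$-bimodules with term $\bigoplus_{|I|=i}X(G)^I$ in degree $i$, where $X(G)^I=RGe_I\otimes_{RP_I}e_IRG$, and with differential $\sum_{s\in S\setminus I}(-1)^{n(I,s)}\varphi_{I\cup\{s\},I}$ on $X(G)^I$, where $n(I,s)$ is the number of elements of $I$ that are $<s$, and, for $I\subseteq J$, $\varphi_{J,I}\colon X(G)^I\to X(G)^J$ is $x\otimes_{RP_I}y\mapsto x\otimes_{RP_J}y$. For $I_0\subseteq S$, let $X(L_{I_0})$ be the complex of $RL_{I_0}$-bimodules defined in the same way from the split BN-pair of $L_{I_0}$ and the induced ordering on $I_0$. Then, for every $I_0\subseteq S$, $$X(G)e_{I_0}\;\cong\; RGe_{I_0}\otimes_{RL_{I_0}}X(L_{I_0})\quad\text{in } K^b\bigl(RG\otimes(RL_{I_0})^\circ\bigr)$$ and $$e_{I_0}X(G)\;\cong\; X(L_{I_0})\otimes_{RL_{I_0}}e_{I_0}RG\quad\text{in } K^b\bigl(RL_{I_0}\otimes(RG)^\circ\bigr),$$ where $K^b(A)$ is the homotopy category of bounded cochain complexes of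 $A$-modules, $\circ$ denotes the opposite ring, and $\otimes$ without index is over $\mathbb Z$. -/

import Mathlib

open CategoryTheory TensorProduct MulOpposite

universe u v w

noncomputable section

namespace SplitBN

/-! ### Bimodules -/

/-- `A`-`B`-bimodules, as modules over `A ⊗_ℤ Bᵒᵖ`. -/
abbrev Bimod (A : Type*) (B : Type*) [Ring A] [Ring B] := ModuleCat.{w} (A ⊗[ℤ] Bᵐᵒᵖ)

section Tensor

variable {A B B' B'' C : Type*} [Ring A] [Ring B] [Ring B'] [Ring B''] [Ring C]

/-- The left action of `A` on an `A`-`B`-bimodule. -/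
def leftAct (M : Bimod.{w} A B) : A →+* Module.End ℤ M :=
  (Module.toModuleEnd ℤ (S := A ⊗[ℤ] Bᵐᵒᵖ) M).comp Algebra.TensorProduct.includeLeftRingHom

/-- The right action of `B` on an `A`-`B`-bimodule. -/
def rightAct (M : Bimod.{w} A B) : Bᵐᵒᵖ →+* Module.End ℤ M :=
  (Module.toModuleEnd ℤ (S := A ⊗[ℤ] Bᵐᵒᵖ) M).comp
    (Algebra.TensorProduct.includeRight : Bᵐᵒᵖ →ₐ[ℤ] A ⊗[ℤ] Bᵐᵒᵖ).toRingHom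

/-- The action of `A ⊗ Cᵒᵖ` on `M ⊗_ℤ N` through the left action on `M` and the right action
on `N`. -/
def tensorAction (M : Bimod.{w} A B) (N : Bimod.{w} B C) :
    A ⊗[ℤ] Cᵐᵒᵖ →+* Module.End ℤ (M ⊗[ℤ] N) :=
  ((Module.endTensorEndAlgHom (R := ℤ) (S := ℤ) (A := ℤ)).comp
    (Algebra.TensorProduct.map (leftAct M).toIntAlgHom (rightAct N).toIntAlgHom)).toRingHom

/-- The tensor product over `ℤ` of the additive groups underlying `M` and `N`. -/
def PreTensor (M : Bimod.{w} A B) (N : Bimod.{w} B C) : Type w := M ⊗[ℤ] N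

instance (M : Bimod.{w} A B) (N : Bimod.{w} B C) : AddCommGroup (PreTensor M N) :=
  inferInstanceAs (AddCommGroup (M ⊗[ℤ] N))

instance (M : Bimod.{w} A B) (N : Bimod.{w} B C) : Module (A ⊗[ℤ] Cᵐᵒᵖ) (PreTensor M N) :=
  Module.compHom (M ⊗[ℤ] N) (tensorAction M N)

def PreTensor.tmul {M : Bimod.{w} A B} {N : Bimod.{w} B C} (m : M) (n : N) : PreTensor M N :=
  m ⊗ₜ[ℤ] n

theorem PreTensor.smul_tmul {M : Bimod.{w} A B} {N : Bimod.{w} B C} (a : A) (c : Cᵐᵒᵖ)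
    (m : M) (n : N) :
    (a ⊗ₜ[ℤ] c : A ⊗[ℤ] Cᵐᵒᵖ) • PreTensor.tmul m n =
      PreTensor.tmul ((a ⊗ₜ[ℤ] (1 : Bᵐᵒᵖ) : A ⊗[ℤ] Bᵐᵒᵖ) • m)
        (((1 : B) ⊗ₜ[ℤ] c : B ⊗[ℤ] Cᵐᵒᵖ) • n) := rfl

/-- The subbimodule of `M ⊗_ℤ N` generated by the elements `m b ⊗ n - m ⊗ b n`. -/
def balancedRel (M : Bimod.{w} A B) (N : Bimod.{w} B C) :
    Submodule (A ⊗[ℤ] Cᵐᵒᵖ) (PreTensor M N) :=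
  Submodule.span _ {x | ∃ (m : M) (b : B) (n : N), x =
    PreTensor.tmul (((1 : A) ⊗ₜ[ℤ] op b : A ⊗[ℤ] Bᵐᵒᵖ) • m) n -
      PreTensor.tmul m ((b ⊗ₜ[ℤ] (1 : Cᵐᵒᵖ) : B ⊗[ℤ] Cᵐᵒᵖ) • n)}

/-- The tensor product `M ⊗_B N` of an `A`-`B`-bimodule and a `B`-`C`-bimodule, as an
`A`-`C`-bimodule. -/
def bimodTensor (M : Bimod.{w} A B) (N : Bimod.{w} B C) : Bimod.{w} A C :=
  ModuleCat.of _ (PreTensor M N ⧸ balancedRel M N)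


/-- `m ⊗ n` in `M ⊗_B N`. -/
def bimodTensor.tmul {M : Bimod.{w} A B} {N : Bimod.{w} B C} (m : M) (n : N) : bimodTensor M N :=
  (balancedRel M N).mkQ (PreTensor.tmul m n)

theorem bimodTensor.smul_tmul {M : Bimod.{w} A B} {N : Bimod.{w} B C} (a : A) (c : Cᵐᵒᵖ)
    (m : M) (n : N) :
    (a ⊗ₜ[ℤ] c : A ⊗[ℤ] Cᵐᵒᵖ) • (bimodTensor.tmul m n : bimodTensor M N) =
      bimodTensor.tmul ((a ⊗ₜ[ℤ] (1 : Bᵐᵒᵖ) : A ⊗[ℤ] Bᵐᵒᵖ) • m)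
        (((1 : B) ⊗ₜ[ℤ] c : B ⊗[ℤ] Cᵐᵒᵖ) • n) := rfl

theorem bimodTensor.tmul_balanced {M : Bimod.{w} A B} {N : Bimod.{w} B C} (m : M) (b : B) (n : N) :
    (bimodTensor.tmul (((1 : A) ⊗ₜ[ℤ] op b : A ⊗[ℤ] Bᵐᵒᵖ) • m) n : bimodTensor M N) =
      bimodTensor.tmul m ((b ⊗ₜ[ℤ] (1 : Cᵐᵒᵖ) : B ⊗[ℤ] Cᵐᵒᵖ) • n) := by
  refine (Submodule.Quotient.eq _).2 (Submodule.subset_span ⟨m, b, n, rfl⟩)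

theorem bimodTensor.hom_ext {M : Bimod.{w} A B} {N : Bimod.{w} B C} {Y : Bimod.{w} A C}
    {f g : bimodTensor M N ⟶ Y}
    (h : ∀ m n, f.hom (bimodTensor.tmul m n) = g.hom (bimodTensor.tmul m n)) : f = g := by
  refine ModuleCat.hom_ext (LinearMap.ext fun x => ?_)
  obtain ⟨y, rfl⟩ := Submodule.mkQ_surjective _ x
  refine TensorProduct.induction_on (motive := fun y : M ⊗[ℤ] N =>
    f.hom ((balancedRel M N).mkQ (show PreTensor M N from y)) =
      g.hom ((balancedRel M N).mkQ (show PreTensor M N from y))) y ?_ h ?_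
  · exact (map_zero f.hom).trans (map_zero g.hom).symm
  · intro a b ha hb
    exact (map_add f.hom _ _).trans ((congrArg₂ (· + ·) ha hb).trans (map_add g.hom _ _).symm)

theorem PreTensor.induction {M : Bimod.{w} A B} {N : Bimod.{w} B C} {P : PreTensor M N → Prop}
    (zero : P 0) (tmul : ∀ m n, P (PreTensor.tmul m n)) (add : ∀ x y, P x → P y → P (x + y))
    (x : PreTensor M N) : P x :=
  TensorProduct.induction_on (motive := P) x zero tmul add

def preTensorMapAdd {M : Bimod.{w} A B} {M' : Bimod.{w} A B'} {N : Bimod.{w} B C}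
    {N' : Bimod.{w} B' C} (f : M →+ M') (g : N →+ N') : PreTensor M N →+ PreTensor M' N' :=
  (TensorProduct.map f.toIntLinearMap g.toIntLinearMap).toAddMonoidHom

def preTensorMap (β : B →+* B') {M : Bimod.{w} A B} {M' : Bimod.{w} A B'} {N : Bimod.{w} B C}
    {N' : Bimod.{w} B' C} (f : M →+ M') (g : N →+ N')
    (hf : ∀ (a : A) (b : B) (m : M), f ((a ⊗ₜ[ℤ] op b : A ⊗[ℤ] Bᵐᵒᵖ) • m) =
      (a ⊗ₜ[ℤ] op (β b) : A ⊗[ℤ] B'ᵐᵒᵖ) • f m)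
    (hg : ∀ (b : B) (c : Cᵐᵒᵖ) (n : N), g ((b ⊗ₜ[ℤ] c : B ⊗[ℤ] Cᵐᵒᵖ) • n) =
      (β b ⊗ₜ[ℤ] c : B' ⊗[ℤ] Cᵐᵒᵖ) • g n) :
    PreTensor M N →ₗ[A ⊗[ℤ] Cᵐᵒᵖ] PreTensor M' N' where
  toFun := preTensorMapAdd f g
  map_add' := map_add _
  map_smul' r x := by
    change preTensorMapAdd f g (r • x) = r • preTensorMapAdd f g x
    induction r using TensorProduct.induction_on with
    | zero =>
      refine (congrArg (preTensorMapAdd f g) (zero_smul (A ⊗[ℤ] Cᵐᵒᵖ) x)).trans ?_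
      exact (map_zero _).trans (zero_smul (A ⊗[ℤ] Cᵐᵒᵖ) (preTensorMapAdd f g x)).symm
    | add r s hr hs => rw [add_smul, add_smul, map_add, hr, hs]
    | tmul a c =>
      induction x using PreTensor.induction with
      | zero => rw [smul_zero, map_zero, smul_zero]
      | add y z hy hz => rw [smul_add, map_add, map_add, smul_add, hy, hz]
      | tmul m n =>
        change PreTensor.tmul (f _) (g _) = PreTensor.tmul _ _
        have h1 := hf a 1 m
        have h2 := hg 1 c n
        rw [map_one] at h1 h2
        exact congrArg₂ PreTensor.tmul h1 h2

/-- For a ring homomorphism `β : B → B'`, an additive map `f : M → M'` and an additive map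
`g : N → N'` compatible with the actions along `β`, the map
`M ⊗_B N → M' ⊗_{B'} N'`, `m ⊗ n ↦ f m ⊗ g n`. -/
def bimodTensorMap (β : B →+* B') {M : Bimod.{w} A B} {M' : Bimod.{w} A B'} {N : Bimod.{w} B C}
    {N' : Bimod.{w} B' C} (f : M →+ M') (g : N →+ N')
    (hf : ∀ (a : A) (b : B) (m : M), f ((a ⊗ₜ[ℤ] op b : A ⊗[ℤ] Bᵐᵒᵖ) • m) =
      (a ⊗ₜ[ℤ] op (β b) : A ⊗[ℤ] B'ᵐᵒᵖ) • f m)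
    (hg : ∀ (b : B) (c : Cᵐᵒᵖ) (n : N), g ((b ⊗ₜ[ℤ] c : B ⊗[ℤ] Cᵐᵒᵖ) • n) =
      (β b ⊗ₜ[ℤ] c : B' ⊗[ℤ] Cᵐᵒᵖ) • g n) :
    bimodTensor M N ⟶ bimodTensor M' N' :=
  ModuleCat.ofHom (Submodule.mapQ _ _ (preTensorMap β f g hf hg) (by
    refine Submodule.span_le.2 ?_
    rintro x ⟨m, b, n, rfl⟩
    have h1 := hf 1 b m
    have h2 := hg b 1 n
    refine Submodule.subset_span ⟨f m, β b, g n, ?_⟩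
    rw [← h1, ← h2, map_sub]
    rfl))

theorem bimodTensorMap_tmul (β : B →+* B') {M : Bimod.{w} A B} {M' : Bimod.{w} A B'}
    {N : Bimod.{w} B C} {N' : Bimod.{w} B' C} (f : M →+ M') (g : N →+ N') (hf hg) (m : M) (n : N) :
    (bimodTensorMap β f g hf hg).hom (bimodTensor.tmul m n) = bimodTensor.tmul (f m) (g n) := rfl

/-- The functor `M ⊗_B -` from `B`-`C`-bimodules to `A`-`C`-bimodules. -/
def tensorLeft (C : Type*) [Ring C] (M : Bimod.{w} A B) : Bimod.{w} B C ⥤ Bimod.{w} A C where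
  obj N := bimodTensor M N
  map g := bimodTensorMap (RingHom.id B) (AddMonoidHom.id M) g.hom.toAddMonoidHom
    (fun _ _ _ => rfl) (fun _ _ _ => map_smul g.hom _ _)
  map_id _ := bimodTensor.hom_ext fun _ _ => rfl
  map_comp _ _ := bimodTensor.hom_ext fun _ _ => rfl

/-- The functor `- ⊗_B N` from `A`-`B`-bimodules to `A`-`C`-bimodules. -/
def tensorRight (A : Type*) [Ring A] (N : Bimod.{w} B C) : Bimod.{w} A B ⥤ Bimod.{w} A C where
  obj M := bimodTensor M N
  map f := bimodTensorMap (RingHom.id B) f.hom.toAddMonoidHom (AddMonoidHom.id N)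
    (fun _ _ _ => map_smul f.hom _ _) (fun _ _ _ => rfl)
  map_id _ := bimodTensor.hom_ext fun _ _ => rfl
  map_comp _ _ := bimodTensor.hom_ext fun _ _ => rfl

theorem bimodTensor.tmul_add {M : Bimod.{w} A B} {N : Bimod.{w} B C} (m : M) (n n' : N) :
    (bimodTensor.tmul m (n + n') : bimodTensor M N) =
      bimodTensor.tmul m n + bimodTensor.tmul m n' :=
  congrArg (balancedRel M N).mkQ (TensorProduct.tmul_add (R := ℤ) m n n')

theorem bimodTensor.add_tmul {M : Bimod.{w} A B} {N : Bimod.{w} B C} (m m' : M) (n : N) :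
    (bimodTensor.tmul (m + m') n : bimodTensor M N) =
      bimodTensor.tmul m n + bimodTensor.tmul m' n :=
  congrArg (balancedRel M N).mkQ (TensorProduct.add_tmul (R := ℤ) m m' n)

instance (M : Bimod.{w} A B) : (tensorLeft C M).Additive where
  map_add := bimodTensor.hom_ext fun _ _ => bimodTensor.tmul_add _ _ _

instance (N : Bimod.{w} B C) : (tensorRight A N).Additive where
  map_add := bimodTensor.hom_ext fun _ _ => bimodTensor.add_tmul _ _ _

end Tensor

/-! ### Cutting by an element -/

section Cut

/-- For `φ : S' → S` and `ε ∈ S` commuting with `φ(S')`, the map `m ↦ ε m` of an `S`-module `M`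
is `S'`-linear. -/
def cutEnd {S S' : Type*} [Ring S] [Ring S'] (φ : S' →+* S) (ε : S)
    (h : ∀ x, Commute ε (φ x)) (M : ModuleCat.{w} S) :
    (ModuleCat.restrictScalars φ).obj M →ₗ[S'] (ModuleCat.restrictScalars φ).obj M where
  toFun m := (ε • (show M from m) : M)
  map_add' m n := smul_add ε (show M from m) n
  map_smul' x m := by
    change (ε • (φ x • (show M from m)) : M) = φ x • (ε • (show M from m))
    rw [smul_smul, smul_smul, (h x).eq]

/-- The functor `M ↦ ε M` from `S`-modules to `S'`-modules. -/
def cut {S S' : Type*} [Ring S] [Ring S'] (φ : S' →+* S) (ε : S)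
    (h : ∀ x, Commute ε (φ x)) : ModuleCat.{w} S ⥤ ModuleCat.{w} S' where
  obj M := ModuleCat.of S' (LinearMap.range (cutEnd φ ε h M))
  map {M N} f := ModuleCat.ofHom
    (((ModuleCat.restrictScalars φ).map f).hom.restrict (p := LinearMap.range (cutEnd φ ε h M))
      (q := LinearMap.range (cutEnd φ ε h N)) (by
        rintro _ ⟨m, rfl⟩
        exact ⟨(show N from f.hom (show M from m)), (map_smul f.hom ε (show M from m)).symm⟩))
  map_id _ := rfl
  map_comp _ _ := rfl

instance {S S' : Type*} [Ring S] [Ring S'] (φ : S' →+* S) (ε : S)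
    (h : ∀ x, Commute ε (φ x)) : (cut.{w} φ ε h).Additive where
  map_add := rfl

variable (A : Type*) {B C : Type*} [Ring A] [Ring B] [Ring C]

def mapRight (f : C →+* B) : A ⊗[ℤ] Cᵐᵒᵖ →+* A ⊗[ℤ] Bᵐᵒᵖ :=
  (Algebra.TensorProduct.map (AlgHom.id ℤ A) (RingHom.op f).toIntAlgHom).toRingHom

def mapLeft (f : C →+* B) : C ⊗[ℤ] Aᵐᵒᵖ →+* B ⊗[ℤ] Aᵐᵒᵖ :=
  (Algebra.TensorProduct.map f.toIntAlgHom (AlgHom.id ℤ Aᵐᵒᵖ)).toRingHom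

theorem commute_mapRight (f : C →+* B) (e : B) (h : ∀ c, Commute e (f c)) (x : A ⊗[ℤ] Cᵐᵒᵖ) :
    Commute ((1 : A) ⊗ₜ[ℤ] op e : A ⊗[ℤ] Bᵐᵒᵖ) (mapRight A f x) := by
  induction x using TensorProduct.induction_on with
  | zero => rw [map_zero]; exact Commute.zero_right _
  | add x y hx hy => rw [map_add]; exact hx.add_right hy
  | tmul a c =>
    change _ * (a ⊗ₜ[ℤ] op (f c.unop)) = (a ⊗ₜ[ℤ] op (f c.unop)) * _
    rw [Algebra.TensorProduct.tmul_mul_tmul, Algebra.TensorProduct.tmul_mul_tmul, one_mul, mul_one,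
      ← op_mul, ← op_mul, (h _).eq]

theorem commute_mapLeft (f : C →+* B) (e : B) (h : ∀ c, Commute e (f c)) (x : C ⊗[ℤ] Aᵐᵒᵖ) :
    Commute (e ⊗ₜ[ℤ] (1 : Aᵐᵒᵖ) : B ⊗[ℤ] Aᵐᵒᵖ) (mapLeft A f x) := by
  induction x using TensorProduct.induction_on with
  | zero => rw [map_zero]; exact Commute.zero_right _
  | add x y hx hy => rw [map_add]; exact hx.add_right hy
  | tmul c a =>
    change _ * (f c ⊗ₜ[ℤ] a) = (f c ⊗ₜ[ℤ] a) * _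
    rw [Algebra.TensorProduct.tmul_mul_tmul, Algebra.TensorProduct.tmul_mul_tmul, one_mul, mul_one,
      (h _).eq]

/-- The functor `M ↦ M e` from `A`-`B`-bimodules to `A`-`C`-bimodules, for `f : C → B` and an
element `e ∈ B` commuting with `f(C)`. -/
def rightCut (f : C →+* B) (e : B) (h : ∀ c, Commute e (f c)) : Bimod.{w} A B ⥤ Bimod.{w} A C :=
  cut (mapRight A f) (1 ⊗ₜ[ℤ] op e) (commute_mapRight A f e h)

/-- The functor `M ↦ e M` from `B`-`A`-bimodules to `C`-`A`-bimodules, for `f : C → B` and an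
element `e ∈ B` commuting with `f(C)`. -/
def leftCut (f : C →+* B) (e : B) (h : ∀ c, Commute e (f c)) : Bimod.{w} B A ⥤ Bimod.{w} C A :=
  cut (mapLeft A f) (e ⊗ₜ[ℤ] 1) (commute_mapLeft A f e h)

instance (f : C →+* B) (e : B) (h : ∀ c, Commute e (f c)) : (rightCut.{w} A f e h).Additive :=
  inferInstanceAs (cut _ _ _).Additive

instance (f : C →+* B) (e : B) (h : ∀ c, Commute e (f c)) : (leftCut.{w} A f e h).Additive :=
  inferInstanceAs (cut _ _ _).Additive

/-- `A` as an `A`-`A`-bimodule. -/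
def regular (A : Type w) [Ring A] : Bimod.{w} A A :=
  letI : Module (A ⊗[ℤ] Aᵐᵒᵖ) A := TensorProduct.Algebra.module
  ModuleCat.of _ A

theorem regular_smul (A : Type w) [Ring A] (a : A) (b : A) (x : A) :
    ((a ⊗ₜ[ℤ] op b : A ⊗[ℤ] Aᵐᵒᵖ) • (show regular A from x) : regular A) =
      (show regular A from (a * x * b)) := by
  let : Module (A ⊗[ℤ] Aᵐᵒᵖ) A := TensorProduct.Algebra.module
  exact (TensorProduct.Algebra.smul_def a (op b) x).trans (mul_assoc a x b).symm

end Cut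

section Piece

variable {A : Type w} {C C' C'' : Type*} [Ring A] [Ring C] [Ring C'] [Ring C'']

/-- The `A`-`C`-bimodule `A e`. -/
def rightPiece (f : C →+* A) (e : A) (h : ∀ c, Commute e (f c)) : Bimod.{w} A C :=
  (rightCut A f e h).obj (regular A)

/-- The `C`-`A`-bimodule `e A`. -/
def leftPiece (f : C →+* A) (e : A) (h : ∀ c, Commute e (f c)) : Bimod.{w} C A :=
  (leftCut A f e h).obj (regular A)

variable {f : C →+* A} {e : A} {h : ∀ c, Commute e (f c)}
  {f' : C' →+* A} {e' : A} {h' : ∀ c, Commute e' (f' c)}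

/-- The element of `A` underlying an element of `A e`. -/
def rightPiece.val : rightPiece f e h →+ A where
  toFun x := x.1
  map_zero' := rfl
  map_add' _ _ := rfl

/-- The element of `A` underlying an element of `e A`. -/
def leftPiece.val : leftPiece f e h →+ A where
  toFun x := x.1
  map_zero' := rfl
  map_add' _ _ := rfl

theorem rightPiece.val_injective : Function.Injective (rightPiece.val (f := f) (e := e) (h := h)) :=
  fun _ _ hxy => Subtype.ext hxy

theorem leftPiece.val_injective : Function.Injective (leftPiece.val (f := f) (e := e) (h := h)) :=
  fun _ _ hxy => Subtype.ext hxy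

theorem rightPiece.val_mem (x : rightPiece f e h) : ∃ z, z * e = rightPiece.val x := by
  obtain ⟨x, m, rfl⟩ := x
  exact ⟨m, ((regular_smul A 1 e m).trans (congrArg (· * e) (one_mul (show A from m)))).symm⟩

theorem leftPiece.val_mem (x : leftPiece f e h) : ∃ z, e * z = leftPiece.val x := by
  obtain ⟨x, m, rfl⟩ := x
  exact ⟨m, ((regular_smul A e 1 m).trans (mul_one (e * (show A from m)))).symm⟩

/-- The element of `A e` given by an element of `A` of the form `z e`. -/
def rightPiece.mk (x : A) (hx : ∃ z, z * e = x) : rightPiece f e h :=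
  ⟨x, by
    obtain ⟨z, rfl⟩ := hx
    exact ⟨z, (regular_smul A 1 e z).trans (congrArg (fun y : A => y * e) (one_mul (z : A)))⟩⟩

/-- The element of `e A` given by an element of `A` of the form `e z`. -/
def leftPiece.mk (x : A) (hx : ∃ z, e * z = x) : leftPiece f e h :=
  ⟨x, by
    obtain ⟨z, rfl⟩ := hx
    exact ⟨z, (regular_smul A e 1 z).trans (mul_one (e * z : A))⟩⟩

theorem rightPiece.val_smul (a : A) (c : C) (x : rightPiece f e h) :
    rightPiece.val ((a ⊗ₜ[ℤ] op c : A ⊗[ℤ] Cᵐᵒᵖ) • x) = a * rightPiece.val x * f c :=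
  regular_smul A a (f c) x.1

theorem leftPiece.val_smul (c : C) (a : Aᵐᵒᵖ) (x : leftPiece f e h) :
    leftPiece.val ((c ⊗ₜ[ℤ] a : C ⊗[ℤ] Aᵐᵒᵖ) • x) = f c * leftPiece.val x * a.unop :=
  regular_smul A (f c) a.unop x.1

/-- The inclusion of `A e` into `A e'`, when `e e' = e`. -/
def rightPiece.inclusion (he : e * e' = e) : rightPiece f e h →+ rightPiece f' e' h' where
  toFun x := rightPiece.mk (rightPiece.val x) (by
    obtain ⟨z, hz⟩ := rightPiece.val_mem x
    exact ⟨z * e, by rw [mul_assoc, he, hz]⟩)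
  map_zero' := rfl
  map_add' _ _ := rfl

/-- The inclusion of `e A` into `e' A`, when `e' e = e`. -/
def leftPiece.inclusion (he : e' * e = e) : leftPiece f e h →+ leftPiece f' e' h' where
  toFun x := leftPiece.mk (leftPiece.val x) (by
    obtain ⟨z, hz⟩ := leftPiece.val_mem x
    exact ⟨e * z, by rw [← mul_assoc, he, hz]⟩)
  map_zero' := rfl
  map_add' _ _ := rfl

theorem rightPiece.val_inclusion (he : e * e' = e) (x : rightPiece f e h) :
    rightPiece.val (rightPiece.inclusion (f' := f') (h' := h') he x) = rightPiece.val x := rfl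

theorem leftPiece.val_inclusion (he : e' * e = e) (x : leftPiece f e h) :
    leftPiece.val (leftPiece.inclusion (f' := f') (h' := h') he x) = leftPiece.val x := rfl

theorem rightPiece.inclusion_smul (he : e * e' = e) (β : C →+* C') (hβ : ∀ c, f' (β c) = f c)
    (a : A) (c : C) (x : rightPiece f e h) :
    rightPiece.inclusion (f' := f') (h' := h') he ((a ⊗ₜ[ℤ] op c : A ⊗[ℤ] Cᵐᵒᵖ) • x) =
      (a ⊗ₜ[ℤ] op (β c) : A ⊗[ℤ] C'ᵐᵒᵖ) • rightPiece.inclusion he x := by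
  apply rightPiece.val_injective
  rw [rightPiece.val_smul, rightPiece.val_inclusion, rightPiece.val_inclusion,
    rightPiece.val_smul, hβ]

theorem leftPiece.inclusion_smul (he : e' * e = e) (β : C →+* C') (hβ : ∀ c, f' (β c) = f c)
    (c : C) (a : Aᵐᵒᵖ) (x : leftPiece f e h) :
    leftPiece.inclusion (f' := f') (h' := h') he ((c ⊗ₜ[ℤ] a : C ⊗[ℤ] Aᵐᵒᵖ) • x) =
      (β c ⊗ₜ[ℤ] a : C' ⊗[ℤ] Aᵐᵒᵖ) • leftPiece.inclusion he x := by
  apply leftPiece.val_injective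
  rw [leftPiece.val_smul, leftPiece.val_inclusion, leftPiece.val_inclusion,
    leftPiece.val_smul, hβ]

/-- The map `A e ⊗_C e A → A e' ⊗_{C'} e' A`, `x ⊗ y ↦ x ⊗ y`. -/
def pieceRestr (he : e * e' = e) (he' : e' * e = e) (β : C →+* C') (hβ : ∀ c, f' (β c) = f c) :
    bimodTensor (rightPiece f e h) (leftPiece f e h) ⟶
      bimodTensor (rightPiece f' e' h') (leftPiece f' e' h') :=
  bimodTensorMap β (rightPiece.inclusion he) (leftPiece.inclusion he')
    (rightPiece.inclusion_smul he β hβ) (leftPiece.inclusion_smul he' β hβ)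

theorem pieceRestr_tmul (he : e * e' = e) (he' : e' * e = e) (β : C →+* C')
    (hβ : ∀ c, f' (β c) = f c) (x : rightPiece f e h) (y : leftPiece f e h) :
    (pieceRestr (h' := h') he he' β hβ).hom (bimodTensor.tmul x y) =
      bimodTensor.tmul (rightPiece.inclusion he x) (leftPiece.inclusion he' y) := rfl

theorem pieceRestr_self (he : e * e = e) (β : C →+* C) (hβ : ∀ c, f (β c) = f c) :
    pieceRestr (h := h) (h' := h) he he β hβ = 𝟙 _ :=
  bimodTensor.hom_ext fun _ _ => rfl

theorem pieceRestr_comp {f'' : C'' →+* A} {e'' : A} {h'' : ∀ c, Commute e'' (f'' c)}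
    (he₁ : e * e' = e) (he₁' : e' * e = e) (β₁ : C →+* C') (hβ₁ : ∀ c, f' (β₁ c) = f c)
    (he₂ : e' * e'' = e') (he₂' : e'' * e' = e') (β₂ : C' →+* C'') (hβ₂ : ∀ c, f'' (β₂ c) = f' c)
    (he₃ : e * e'' = e) (he₃' : e'' * e = e) (β₃ : C →+* C'') (hβ₃ : ∀ c, f'' (β₃ c) = f c) :
    pieceRestr (h := h) (h' := h'') he₃ he₃' β₃ hβ₃ =
      pieceRestr (h' := h') he₁ he₁' β₁ hβ₁ ≫ pieceRestr he₂ he₂' β₂ hβ₂ :=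
  bimodTensor.hom_ext fun _ _ => rfl

end Piece

/-! ### The complex of a coefficient system -/

section Coeff

variable {S : Type*} [Ring S] {σ : Type} [LinearOrder σ]

/-- `n(I, s)`: the number of elements of `I` that are `< s`. -/
def numLT (I : Finset σ) (s : σ) : ℕ := (I.filter (· < s)).card

/-- A coefficient system on `2^σ` is a functor from the poset of subsets of `σ`. -/
abbrev CoeffSystem (σ : Type) (S : Type*) [Ring S] := Finset σ ⥤ ModuleCat.{w} S

/-- The component `M^i = ⊕_{|I| = i} M^I`; as the sum is finite it is the product. -/
abbrev coeffX (M : CoeffSystem.{w} σ S) (i : ℤ) : Type w :=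
  ∀ I : {I : Finset σ // (I.card : ℤ) = i}, M.obj I.1

/-- The differential: its component at `K` is `∑_{s ∈ K} (-1)^{n(K∖s,s)} φ_{K,K∖s}`, that is, on
`M^I` it is `∑_{s ∉ I} (-1)^{n(I,s)} φ_{I∪s,I}`. -/
def coeffD (M : CoeffSystem.{w} σ S) (i j : ℤ) : coeffX M i →ₗ[S] coeffX M j :=
  LinearMap.pi fun K => ∑ s ∈ K.1,
    if h : ((K.1.erase s).card : ℤ) = i then
      (-1 : ℤ) ^ numLT (K.1.erase s) s •
        ((M.map (homOfLE (Finset.erase_subset s K.1))).hom ∘ₗ LinearMap.proj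
          (⟨K.1.erase s, h⟩ : {I : Finset σ // (I.card : ℤ) = i}))
    else 0

theorem coeffD_apply (M : CoeffSystem.{w} σ S) (i j : ℤ) (h : i + 1 = j) (x : coeffX M i)
    (K : {I : Finset σ // (I.card : ℤ) = j}) :
    coeffD M i j x K = ∑ s ∈ K.1.attach, (-1 : ℤ) ^ numLT (K.1.erase s.1) s.1 •
        (M.map (homOfLE (Finset.erase_subset s.1 K.1))).hom
          (x ⟨K.1.erase s.1, by
            have := Finset.card_erase_add_one s.2
            have := K.2
            omega⟩) := by
  simp only [coeffD, LinearMap.pi_apply, LinearMap.sum_apply]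
  rw [← Finset.sum_attach]
  refine Finset.sum_congr rfl fun s _ => ?_
  have hs : ((K.1.erase s.1).card : ℤ) = i := by
    have := Finset.card_erase_add_one s.2
    have := K.2
    omega
  rw [dif_pos hs]
  rfl

theorem numLT_sign (K : Finset σ) {s t : σ} (hs : s ∈ K) (ht : t ∈ K) (hst : s ≠ t) :
    (-1 : ℤ) ^ (numLT (K.erase s) s) * (-1) ^ (numLT ((K.erase s).erase t) t) =
      -((-1 : ℤ) ^ (numLT (K.erase t) t) * (-1) ^ (numLT ((K.erase t).erase s) s)) := by
  have e1 : ∀ (I : Finset σ) (s : σ), numLT (I.erase s) s = numLT I s := by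
    intro I s
    unfold numLT
    congr 1
    ext x
    simp only [Finset.mem_filter, Finset.mem_erase]
    exact ⟨fun h => ⟨h.1.2, h.2⟩, fun h => ⟨⟨h.2.ne, h.1⟩, h.2⟩⟩
  have e2 : ∀ (s t : σ), s ∈ K → s < t → numLT (K.erase s) t + 1 = numLT K t := by
    intro s t hs hst
    unfold numLT
    rw [Finset.filter_erase]
    exact Finset.card_erase_add_one (Finset.mem_filter.2 ⟨hs, hst⟩)
  have e3 : ∀ (s t : σ), s < t → numLT (K.erase t) s = numLT K s := by
    intro s t hst
    unfold numLT
    congr 1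
    ext x
    simp only [Finset.mem_filter, Finset.mem_erase]
    exact ⟨fun h => ⟨h.1.2, h.2⟩, fun h => ⟨⟨(h.2.trans hst).ne, h.1⟩, h.2⟩⟩
  simp only [e1]
  rcases lt_or_gt_of_ne hst with h | h
  · rw [e3 s t h, ← e2 s t hs h]; ring
  · rw [e3 t s h, ← e2 t s ht h]; ring

theorem coeffD_comp (M : CoeffSystem.{w} σ S) (i j k : ℤ) (hij : i + 1 = j) (hjk : j + 1 = k)
    (x : coeffX M i) : coeffD M j k (coeffD M i j x) = 0 := by
  funext K
  have aux : ∀ (I I' : Finset σ) (hI : I ≤ K.1) (hI' : I' ≤ K.1) (h : (I.card : ℤ) = i)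
      (h' : (I'.card : ℤ) = i), I = I' → (M.map (homOfLE hI)).hom (x ⟨I, h⟩) =
        (M.map (homOfLE hI')).hom (x ⟨I', h'⟩) := by
    rintro I I' hI hI' h h' rfl; rfl
  have hc : ∀ (s t : σ), s ∈ K.1 → t ∈ K.1.erase s → ((((K.1).erase s).erase t).card : ℤ) = i := by
    intro s t hs ht
    have h1 := Finset.card_erase_add_one hs
    have h2 := Finset.card_erase_add_one ht
    have := K.2
    omega
  have hle : ∀ (s t : σ), (K.1.erase s).erase t ≤ K.1 := fun s t =>
    (Finset.erase_subset _ _).trans (Finset.erase_subset _ _)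
  rw [coeffD_apply M j k hjk]
  have step : ∀ s ∈ K.1.attach, (-1 : ℤ) ^ numLT (K.1.erase s.1) s.1 •
        (M.map (homOfLE (Finset.erase_subset s.1 K.1))).hom
          (coeffD M i j x ⟨K.1.erase s.1, by
            have := Finset.card_erase_add_one s.2
            have := K.2
            omega⟩) = ∑ t ∈ (K.1.erase s.1).attach,
        ((-1 : ℤ) ^ (numLT (K.1.erase s.1) s.1) *
          (-1) ^ (numLT ((K.1.erase s.1).erase t.1) t.1)) •
        (M.map (homOfLE (hle s.1 t.1))).hom (x ⟨_, hc s.1 t.1 s.2 t.2⟩) := by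
    intro s _
    rw [coeffD_apply M i j hij, map_sum, Finset.smul_sum]
    refine Finset.sum_congr rfl fun t _ => ?_
    rw [map_zsmul, smul_smul]
    congr 1
    rw [← LinearMap.comp_apply, ← ModuleCat.hom_comp, ← M.map_comp]
    rfl
  rw [Finset.sum_congr rfl step, Finset.sum_sigma']
  refine Finset.sum_involution (fun a _ => ⟨⟨a.2.1, Finset.mem_of_mem_erase a.2.2⟩,
    ⟨a.1.1, Finset.mem_erase.2 ⟨(Finset.ne_of_mem_erase a.2.2).symm, a.1.2⟩⟩⟩) ?_ ?_ ?_ ?_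
  · rintro ⟨⟨s, hs⟩, ⟨t, ht⟩⟩ _
    dsimp only
    rw [numLT_sign K.1 hs (Finset.mem_of_mem_erase ht) (Finset.ne_of_mem_erase ht).symm,
      aux _ _ (hle s t) (hle t s) _ (hc t s (Finset.mem_of_mem_erase ht)
        (Finset.mem_erase.2 ⟨(Finset.ne_of_mem_erase ht).symm, hs⟩)) Finset.erase_right_comm,
      neg_smul, neg_add_cancel]
  · rintro ⟨⟨s, hs⟩, ⟨t, ht⟩⟩ _ _ h
    have := congrArg (fun z => z.1.1) h
    exact Finset.ne_of_mem_erase ht this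
  · intro _ _
    simp
  · rintro ⟨⟨s, hs⟩, ⟨t, ht⟩⟩ _
    rfl

/-- The complex associated to a coefficient system. -/
def coeffComplex (M : CoeffSystem.{w} σ S) : CochainComplex (ModuleCat.{w} S) ℤ where
  X i := ModuleCat.of S (coeffX M i)
  d i j := ModuleCat.ofHom (coeffD M i j)
  shape i j hij := by
    refine ModuleCat.hom_ext (LinearMap.ext fun x => funext fun K => ?_)
    change coeffD M i j x K = 0
    simp only [coeffD, LinearMap.pi_apply, LinearMap.sum_apply]
    refine Finset.sum_eq_zero fun s hs => ?_
    rw [dif_neg, LinearMap.zero_apply]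
    intro h
    have := Finset.card_erase_add_one hs
    have := K.2
    exact hij (by change i + 1 = j; omega)
  d_comp_d' i j k hij hjk := by
    refine ModuleCat.hom_ext (LinearMap.ext fun x => ?_)
    exact coeffD_comp M i j k hij hjk x

end Coeff

/-! ### The bounded homotopy category -/

section Kb

open CategoryTheory.Limits

/-- The complexes with only finitely many nonzero terms, as objects of the homotopy category. -/
def boundedProp (𝒜 : Type*) [Category* 𝒜] [Preadditive 𝒜] :
    ObjectProperty (HomotopyCategory 𝒜 (ComplexShape.up ℤ)) :=
  fun X => ∃ a b : ℤ, ∀ n : ℤ, n < a ∨ b < n → IsZero (X.as.X n)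

/-- The bounded homotopy category `K^b(𝒜)`. -/
abbrev Kb (𝒜 : Type*) [Category* 𝒜] [Preadditive 𝒜] := (boundedProp 𝒜).FullSubcategory

/-- The functor `K^b(𝒜) ⥤ K^b(ℬ)` induced by an additive functor `𝒜 ⥤ ℬ`. -/
def mapKb {𝒜 ℬ : Type*} [Category* 𝒜] [Preadditive 𝒜] [Category* ℬ] [Preadditive ℬ]
    (F : 𝒜 ⥤ ℬ) [F.Additive] : Kb 𝒜 ⥤ Kb ℬ :=
  (boundedProp ℬ).lift ((boundedProp 𝒜).ι ⋙ F.mapHomotopyCategory (ComplexShape.up ℤ)) (by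
    rintro ⟨X, a, b, h⟩
    exact ⟨a, b, fun n hn => F.map_isZero (h n hn)⟩)

/-- The complex of a coefficient system on a finite set, as an object of `K^b`. -/
def coeffKb {S : Type*} [Ring S] {σ : Type} [LinearOrder σ] [Fintype σ]
    (M : CoeffSystem.{w} σ S) : Kb (ModuleCat.{w} S) where
  obj := (HomotopyCategory.quotient _ _).obj (coeffComplex M)
  property := by
    refine ⟨0, Fintype.card σ, fun n hn => ?_⟩
    have : IsEmpty {I : Finset σ // (I.card : ℤ) = n} := by
      refine ⟨fun I => ?_⟩
      have h1 := I.2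
      have h2 := Finset.card_le_univ I.1
      omega
    have : Subsingleton (coeffX M n) := inferInstance
    exact ModuleCat.isZero_of_subsingleton (ModuleCat.of S (coeffX M n))

end Kb

/-! ### Group algebras -/

section GroupAlgebra

variable {G : Type u} [Group G] (R : Type v) [CommRing R]

/-- The inclusion `RH → RG` for a subgroup `H` of `G`. -/
def incl (H : Subgroup G) : MonoidAlgebra R H →+* MonoidAlgebra R G :=
  MonoidAlgebra.mapDomainRingHom R H.subtype

/-- `∑_{v ∈ V} v` -/
def sumOf (V : Subgroup G) : MonoidAlgebra R G := ∑ᶠ v : V, MonoidAlgebra.of R G (v : G)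

/-- `|V|⁻¹ ∑_{v ∈ V} v`, for a subgroup `V` of order invertible in `R`. -/
def idem (V : Subgroup G) : MonoidAlgebra R G :=
  Ring.inverse (Nat.card V : R) • sumOf R V

variable [Finite G]

theorem idem_commute (H V : Subgroup G) (hV : ∀ h ∈ H, ∀ v ∈ V, h * v * h⁻¹ ∈ V)
    (x : MonoidAlgebra R H) : Commute (idem R V) (incl R H x) := by
  classical
  have := Fintype.ofFinite V
  refine Commute.smul_left ?_ _
  have key : ∀ h : H, Commute (sumOf R V) (MonoidAlgebra.of R G (h : G)) := by
    intro h
    change _ * _ = _ * _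
    unfold sumOf
    rw [finsum_eq_sum_of_fintype, Finset.sum_mul, Finset.mul_sum]
    simp only [← map_mul]
    refine Finset.sum_bij' (fun v _ => ⟨(h : G)⁻¹ * v * h, ?_⟩) (fun v _ => ⟨h * v * (h : G)⁻¹, ?_⟩)
      ?_ ?_ ?_ ?_ ?_
    · simpa using hV _ (H.inv_mem h.2) v v.2
    · exact hV _ h.2 v v.2
    · intros; exact Finset.mem_univ _
    · intros; exact Finset.mem_univ _
    · intro v _; ext; simp [mul_assoc]
    · intro v _; ext; simp [mul_assoc]
    · intro v _; simp [mul_assoc]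
  induction x using MonoidAlgebra.induction_on with
  | of h => simpa [incl] using key h
  | add x y hx hy => rw [map_add]; exact hx.add_right hy
  | smul r x hx =>
    have : incl R H (r • x) = r • incl R H x := by
      simp [incl]
    rw [this]; exact hx.smul_right r

theorem idem_mul (V V' : Subgroup G) (h : V' ≤ V) :
    idem R V * idem R V' = idem R V ∧ idem R V' * idem R V = idem R V := by
  classical
  have := Fintype.ofFinite V
  have := Fintype.ofFinite V'
  have h1 : sumOf R V * sumOf R V' = (Nat.card V' : R) • sumOf R V := by
    have : ∀ v' : V', sumOf R V * MonoidAlgebra.of R G (v' : G) = sumOf R V := by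
      intro v'
      unfold sumOf
      rw [finsum_eq_sum_of_fintype, Finset.sum_mul]
      simp only [← map_mul]
      exact Fintype.sum_equiv (Equiv.mulRight (⟨v', h v'.2⟩ : V)) _ _ fun _ => rfl
    conv_lhs => rw [sumOf.eq_def R V', finsum_eq_sum_of_fintype, Finset.mul_sum]
    rw [Finset.sum_congr rfl fun v' _ => this v']
    simp [Nat.cast_smul_eq_nsmul]
  have h2 : sumOf R V' * sumOf R V = (Nat.card V' : R) • sumOf R V := by
    have : ∀ v' : V', MonoidAlgebra.of R G (v' : G) * sumOf R V = sumOf R V := by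
      intro v'
      unfold sumOf
      rw [finsum_eq_sum_of_fintype, Finset.mul_sum]
      simp only [← map_mul]
      exact Fintype.sum_equiv (Equiv.mulLeft (⟨v', h v'.2⟩ : V)) _ _ fun _ => rfl
    conv_lhs => rw [sumOf.eq_def R V', finsum_eq_sum_of_fintype, Finset.sum_mul]
    rw [Finset.sum_congr rfl fun v' _ => this v']
    simp [Nat.cast_smul_eq_nsmul]
  have h3 : Ring.inverse (Nat.card V : R) * (Ring.inverse (Nat.card V' : R) * (Nat.card V' : R)) =
      Ring.inverse (Nat.card V : R) := by
    by_cases hu : IsUnit (Nat.card V' : R)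
    · rw [Ring.inverse_mul_cancel _ hu, mul_one]
    · rw [Ring.inverse_non_unit (Nat.card V : R), zero_mul]
      intro hV
      obtain ⟨k, hk⟩ := Subgroup.card_dvd_of_le h
      rw [hk, Nat.cast_mul] at hV
      exact hu (isUnit_of_mul_isUnit_left hV)
  constructor
  · rw [idem, idem, smul_mul_smul_comm, h1, smul_smul, mul_assoc, h3]
  · rw [idem, idem, smul_mul_smul_comm, h2, smul_smul, mul_comm (Ring.inverse _) (Ring.inverse _),
      mul_assoc, h3]

end GroupAlgebra
theorem incl_inclusion {G : Type u} [Group G] (R : Type v) [CommRing R] {H H' : Subgroup G}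
    (h : H ≤ H') (x : MonoidAlgebra R H) :
    incl R H' (MonoidAlgebra.mapDomainRingHom R (Subgroup.inclusion h) x) = incl R H x := by
  change ((MonoidAlgebra.mapDomainRingHom R H'.subtype).comp
    (MonoidAlgebra.mapDomainRingHom R (Subgroup.inclusion h))) x = _
  rw [← MonoidAlgebra.mapDomainRingHom_comp]
  rfl

/-! ### Split BN-pairs -/

/-- The data underlying a split BN-pair on `G`: subgroups `B`, `U` (with `B = U ⋊ T`) and `N`, and
for every simple reflection (indexed by `σ`) a representative `r s ∈ N`. The set `S ⊆ N/T` is the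
set of the cosets `r s T`. Everything below depends on `r s` only through `r s T`. -/
structure BNData (G : Type u) [Group G] (σ : Type) where
  B : Subgroup G
  U : Subgroup G
  N : Subgroup G
  r : σ → G

/-- `g H g⁻¹` -/
def conj {G : Type u} [Group G] (g : G) (H : Subgroup G) : Subgroup G :=
  H.map (MulAut.conj g).toMonoidHom

theorem mem_conj {G : Type u} [Group G] {g x : G} {H : Subgroup G} :
    x ∈ conj g H ↔ g⁻¹ * x * g ∈ H := by
  constructor
  · rintro ⟨y, hy, rfl⟩
    simpa [mul_assoc] using hy
  · intro h
    exact ⟨_, h, by simp [mul_assoc]⟩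

namespace BNData

variable {G : Type u} [Group G] {σ : Type} (D : BNData G σ)

/-- `T = B ∩ N` -/
def T : Subgroup G := D.B ⊓ D.N

/-- The preimage `N_I` in `N` of the subgroup `W_I` of `W = N/T` generated by `I`. -/
def weyl (I : Finset σ) : Subgroup G := D.T ⊔ Subgroup.closure (D.r '' I)

/-- The parabolic subgroup `P_I = B W_I B`, the subgroup generated by `B` and `I`. -/
def parabolic (I : Finset σ) : Subgroup G := D.B ⊔ D.weyl I

/-- The intersection `U_I` of the `P_I`-conjugates of `U`. For a split BN-pair of characteristic
`p`, `U` is a Sylow `p`-subgroup of `P_I`, and so `U_I` is the largest normal `p`-subgroup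
of `P_I`. -/
def unip (I : Finset σ) : Subgroup G := ⨅ g ∈ D.parabolic I, conj g D.U

/-- The opposite Borel subgroup `B⁻ = n B n⁻¹`, for the `n ∈ N` with `B ∩ n B n⁻¹ = T`; these `n`
form one coset of `T`, the longest element of `W`. -/
def oppBorel : Subgroup G := ⨆ n ∈ {n ∈ D.N | D.B ⊓ conj n D.B = D.T}, conj n D.B

/-- The opposite parabolic subgroup `P_I⁻ = B⁻ W_I B⁻`. -/
def oppParabolic (I : Finset σ) : Subgroup G := D.oppBorel ⊔ D.weyl I

/-- The Levi subgroup `L_I = P_I ∩ P_I⁻`. -/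
def levi (I : Finset σ) : Subgroup G := D.parabolic I ⊓ D.oppParabolic I

theorem r_mem_weyl {I : Finset σ} {s : σ} (h : s ∈ I) : D.r s ∈ D.weyl I :=
  (le_sup_right : _ ≤ D.weyl I) (Subgroup.subset_closure ⟨s, h, rfl⟩)

theorem weyl_le_levi (I : Finset σ) : D.weyl I ≤ D.levi I := le_inf le_sup_right le_sup_right

/-- The subgroups `B ∩ L_I`, `U ∩ L_I`, `N ∩ L_I` of `L_I` and the simple reflections in `I`. -/
def leviData (I : Finset σ) : BNData (D.levi I) I where
  B := D.B.subgroupOf (D.levi I)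
  U := D.U.subgroupOf (D.levi I)
  N := D.N.subgroupOf (D.levi I)
  r s := ⟨D.r s, D.weyl_le_levi I (D.r_mem_weyl s.2)⟩

/-- `(B, N, S)` is a BN-pair of `G`, split of characteristic `p`. -/
structure IsSplit (p : ℕ) : Prop where
  /-- `G` is generated by `B` and `N`. -/
  gen : D.B ⊔ D.N = ⊤
  /-- `T = B ∩ N` is normal in `N`. -/
  T_normal : ∀ n ∈ D.N, ∀ t ∈ D.T, n * t * n⁻¹ ∈ D.T
  r_mem : ∀ s, D.r s ∈ D.N
  /-- Different indices give different elements of `W = N/T`. -/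
  r_inj : ∀ s t, (D.r s)⁻¹ * D.r t ∈ D.T → s = t
  /-- `S` consists of elements of order two of `W`. -/
  r_notMem : ∀ s, D.r s ∉ D.T
  r_sq : ∀ s, D.r s * D.r s ∈ D.T
  /-- `S` generates `W`. -/
  r_gen : D.T ⊔ Subgroup.closure (Set.range D.r) = D.N
  /-- `s B w ⊆ B w B ∪ B s w B` -/
  mul_mem : ∀ s, ∀ b ∈ D.B, ∀ n ∈ D.N, ∃ b₁ ∈ D.B, ∃ b₂ ∈ D.B,
    D.r s * b * n = b₁ * n * b₂ ∨ D.r s * b * n = b₁ * (D.r s * n) * b₂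
  /-- `s B s ⊄ B` -/
  thick : ∀ s, ∃ b ∈ D.B, D.r s * b * (D.r s)⁻¹ ∉ D.B
  /-- `B` is the semi-direct product of the normal `p`-subgroup `U` and of the commutative group
  `T`, of order prime to `p`. -/
  U_le : D.U ≤ D.B
  U_normal : ∀ b ∈ D.B, ∀ u ∈ D.U, b * u * b⁻¹ ∈ D.U
  U_pGroup : IsPGroup p D.U
  UT : D.U ⊔ D.T = D.B
  T_comm : ∀ t ∈ D.T, ∀ t' ∈ D.T, t * t' = t' * t
  T_card : (Nat.card D.T).Coprime p
  /-- `T` is the intersection of the `N`-conjugates of `B`. -/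
  saturated : ⨅ n ∈ D.N, conj n D.B = D.T
  /-- For every `I ⊆ S`, the subgroup `⋂_{w ∈ W_I} U^w` (which is `U ∩ U^{w_I}` for the longest
  element `w_I` of `W_I`) is normal in `U`. -/
  strong : ∀ I : Finset σ, ∀ u ∈ D.U, ∀ x ∈ ⨅ n ∈ D.weyl I, conj n D.U,
    u * x * u⁻¹ ∈ ⨅ n ∈ D.weyl I, conj n D.U

theorem parabolic_mono {I J : Finset σ} (h : I ≤ J) : D.parabolic I ≤ D.parabolic J :=
  sup_le_sup_left (sup_le_sup_left (Subgroup.closure_mono (Set.image_mono h)) _) _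

theorem unip_anti {I J : Finset σ} (h : I ≤ J) : D.unip J ≤ D.unip I :=
  biInf_mono fun _ hg => D.parabolic_mono h hg

theorem unip_normal (I : Finset σ) {H : Subgroup G} (hH : H ≤ D.parabolic I) :
    ∀ h ∈ H, ∀ v ∈ D.unip I, h * v * h⁻¹ ∈ D.unip I := by
  intro h hh v hv
  simp only [unip, Subgroup.mem_iInf, mem_conj] at hv ⊢
  intro g hg
  have := hv (h⁻¹ * g) ((D.parabolic I).mul_mem ((D.parabolic I).inv_mem (hH hh)) hg)
  simpa [mul_assoc] using this

/-! ### The complex `X(G)` -/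

section X

variable [Finite G] (R : Type v) [CommRing R]

/-- `e_I = |U_I|⁻¹ ∑_{u ∈ U_I} u` -/
def e (I : Finset σ) : MonoidAlgebra R G := idem R (D.unip I)

theorem e_commute (I : Finset σ) {H : Subgroup G} (hH : H ≤ D.parabolic I)
    (x : MonoidAlgebra R H) : Commute (D.e R I) (incl R H x) :=
  idem_commute R H _ (D.unip_normal I hH) x

theorem e_mul_e {I J : Finset σ} (h : I ≤ J) :
    D.e R I * D.e R J = D.e R I ∧ D.e R J * D.e R I = D.e R I :=
  idem_mul R _ _ (D.unip_anti h)

/-- For `H ≤ P_I`, the `RG`-`RH`-bimodule `RG e_I`. -/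
abbrev RGe (I : Finset σ) (H : Subgroup G) (hH : H ≤ D.parabolic I) :
    Bimod.{max u v} (MonoidAlgebra R G) (MonoidAlgebra R H) :=
  rightPiece (incl R H) (D.e R I) (D.e_commute R I hH)

/-- For `H ≤ P_I`, the `RH`-`RG`-bimodule `e_I RG`. -/
abbrev eRG (I : Finset σ) (H : Subgroup G) (hH : H ≤ D.parabolic I) :
    Bimod.{max u v} (MonoidAlgebra R H) (MonoidAlgebra R G) :=
  leftPiece (incl R H) (D.e R I) (D.e_commute R I hH)

/-- The coefficient system `X(G)`: `I ↦ RGe_I ⊗_{P_I} e_I RG`, with restriction maps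
`x ⊗ y ↦ x ⊗ y`. -/
def coeffX : CoeffSystem.{max u v} σ (MonoidAlgebra R G ⊗[ℤ] (MonoidAlgebra R G)ᵐᵒᵖ) where
  obj I := bimodTensor (D.RGe R I (D.parabolic I) le_rfl) (D.eRG R I (D.parabolic I) le_rfl)
  map φ := pieceRestr (D.e_mul_e R (leOfHom φ)).1 (D.e_mul_e R (leOfHom φ)).2
    (MonoidAlgebra.mapDomainRingHom R (Subgroup.inclusion (D.parabolic_mono (leOfHom φ))))
    (incl_inclusion R _)
  map_id _ := pieceRestr_self _ _ _
  map_comp _ _ := pieceRestr_comp _ _ _ _ _ _ _ _ _ _ _ _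

/-- The complex `X(G)` of `RG`-bimodules, as an object of `K^b(RG ⊗ RG°)`. -/
def X [LinearOrder σ] [Fintype σ] :
    Kb (Bimod.{max u v} (MonoidAlgebra R G) (MonoidAlgebra R G)) :=
  coeffKb (D.coeffX R)

/-- The functor `Y ↦ Y e_I` from `RG`-bimodules to `RG`-`RL_I`-bimodules. -/
abbrev mulE (I : Finset σ) : Bimod.{max u v} (MonoidAlgebra R G) (MonoidAlgebra R G) ⥤
    Bimod.{max u v} (MonoidAlgebra R G) (MonoidAlgebra R (D.levi I)) :=
  rightCut _ (incl R (D.levi I)) (D.e R I) (D.e_commute R I inf_le_left)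

/-- The functor `Y ↦ e_I Y` from `RG`-bimodules to `RL_I`-`RG`-bimodules. -/
abbrev eMul (I : Finset σ) : Bimod.{max u v} (MonoidAlgebra R G) (MonoidAlgebra R G) ⥤
    Bimod.{max u v} (MonoidAlgebra R (D.levi I)) (MonoidAlgebra R G) :=
  leftCut _ (incl R (D.levi I)) (D.e R I) (D.e_commute R I inf_le_left)

/-- The functor `RG e_I ⊗_{L_I} -`. -/
abbrev RGeTensor (I : Finset σ) :
    Bimod.{max u v} (MonoidAlgebra R (D.levi I)) (MonoidAlgebra R (D.levi I)) ⥤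
      Bimod.{max u v} (MonoidAlgebra R G) (MonoidAlgebra R (D.levi I)) :=
  tensorLeft _ (D.RGe R I (D.levi I) inf_le_left)

/-- The functor `- ⊗_{L_I} e_I RG`. -/
abbrev tensorERG (I : Finset σ) :
    Bimod.{max u v} (MonoidAlgebra R (D.levi I)) (MonoidAlgebra R (D.levi I)) ⥤
      Bimod.{max u v} (MonoidAlgebra R (D.levi I)) (MonoidAlgebra R G) :=
  tensorRight _ (D.eRG R I (D.levi I) inf_le_left)

end X
end BNData

end SplitBN

end

/-! Write `P⁻`, `U⁻` and `e⁻` for the opposite parabolic subgroup of `I₀`, its unipotent radical and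
the idempotent of `U⁻`. A theorem of Howlett and Lehrer (`exists_e_eq_mul`, `exists_oppE_eq_mul`)
shows that right multiplication by `e⁻` identifies `Y e_{I₀}` with `Y e⁻` for every `RG`-bimodule
`Y`. Consequently (`thetaE_injective`, `exists_thetaE_eq`) the term `X(G)^I e_{I₀}` becomes the
space of functions `f(a, b)` on `G × G` with `f(ah, h⁻¹b) = f(a, b)` for `h ∈ P_I` that are
invariant under `U_I` on the left of `b` and under `U⁻` on the right of `b`. The maps `φ_{J,I}`
become sums over representatives of `P_J / P_I` (`thetaE_phi`).

The variable `b` runs through the double cosets `P_I b P⁻`. Each of them has a `label` in `W`: the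
representative `w` that is minimal in `w W_{I₀}` and for which `w w_{I₀}` is maximal in its left
`W_I`-coset. Passing from `I` to a larger set never shortens the label (`label_le`). If `s` is a
left descent of the label for `I`, then the label for `I ∪ {s}` is the same (`label_insert`), the
larger double coset contains only one `P_I`-double coset with this label
(`mem_parabolic_of_label_eq`), and the two invariance conditions agree there
(`exists_unip_insert_mul`). So on these cells `φ_{I∪s,I}` is invertible up to longer labels.

The label is `1` exactly when `I ⊆ I₀` and `b` lies in `P_I P⁻ = U_{I₀} L_{I₀} U⁻`. Restricting `b`
to `L_{I₀}` therefore gives a surjective chain map `rho` onto `RGe_{I₀} ⊗ X(L_{I₀})`, whose kernel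
consists of the functions that vanish on the cells with label `1`. For each `w ≠ 1` a left descent
is chosen, and `psi` keeps the values on the cells whose chosen descent is the generator being
removed. The degree `-1` map built from `psi` gives a null homotopic `θ` with image in the kernel
such that `1 - θ` raises the filtration by the length of the label. Lengths are bounded by that of
the longest element, so `1 - θ` is nilpotent on the kernel, and `nonempty_quotient_iso` makes the
restriction map a homotopy equivalence.

The Howlett–Lehrer theorem is proved over `R` as the statement `e_K ∈ RG e_K⁻ e_K`, by induction on
`K`. Modulo the left ideal generated by the `e_M h` with `M ⊊ K` and `h ∈ P_K`, the idempotent `e_K`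
lies in `RG e_{K₁} d e_K` for every `d` that conjugates the generators in `K` to those in `K₁`
(`e_mem_of_move`). This is reduced to elementary moves in rank `|K| + 1` (`e_mem_of_insert`), where
a sum over a `p`-subgroup is evaluated term by term. The element `d = w₀ w_K` turns `e_{K₁}` into
`e_K⁻`.

The group theory underneath is convexity: an intersection `U^a ∩ U^c` lies in `U^b` whenever `b` is
on a minimal gallery from `a` to `c` (`Uc_inf_le`). The containments between unipotent groups used
here largely reduce to identities between lengths in `W`.

The second isomorphism is the image of the first one under the anti-involution `g ↦ g⁻¹` of the
group algebras. -/

noncomputable section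
namespace SplitBN

/-! ### Groups generated by involutions with the exchange property -/

section Coxeter

variable {W : Type*} [Group W] {σ : Type*} (s : σ → W)

/-- The product of a word in the generators. -/
def wprod (ω : List σ) : W := (ω.map s).prod

/-- The length with respect to the generators. -/
def len (w : W) : ℕ := sInf {k | ∃ ω : List σ, wprod s ω = w ∧ ω.length = k}

/-- The elements `s i` are involutions or trivial, and generate. -/
structure IsGen : Prop where
  sq : ∀ i, s i * s i = 1
  gen : ∀ w, ∃ ω, wprod s ω = w

/-- The generators `s` are involutions satisfying the exchange property. -/
structure IsCox : Prop extends IsGen s where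
  inj : Function.Injective s
  ne : ∀ i w, len s (s i * w) ≠ len s w
  -- The folding condition: the form of the exchange property that the axiom on `s B w` yields
  -- directly.
  fold : ∀ i j w, len s w < len s (s i * w) → len s w < len s (w * s j) →
    len s (s i * w * s j) < len s (w * s j) → s i * w = w * s j

/-- The parabolic subgroup generated by `I`. -/
def par (I : Set σ) : Subgroup W := Subgroup.closure (s '' I)

/-- These conditions only compare with one generator at a time; `RMin.len_mul`, `RMax.len_mul` and
their left versions turn them into length formulas on whole cosets. -/
def LMin (I : Set σ) (d : W) : Prop := ∀ t ∈ I, len s d < len s (s t * d)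
def RMin (I : Set σ) (d : W) : Prop := ∀ t ∈ I, len s d < len s (d * s t)
def LMax (I : Set σ) (d : W) : Prop := ∀ t ∈ I, len s (s t * d) < len s d
def RMax (I : Set σ) (d : W) : Prop := ∀ t ∈ I, len s (d * s t) < len s d

variable {s}

theorem wprod_nil : wprod s [] = 1 := rfl

theorem wprod_cons (i : σ) (ω : List σ) : wprod s (i :: ω) = s i * wprod s ω := by
  simp [wprod]

theorem wprod_append (ω ω' : List σ) : wprod s (ω ++ ω') = wprod s ω * wprod s ω' := by
  simp [wprod]

theorem len_wprod_le (ω : List σ) : len s (wprod s ω) ≤ ω.length :=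
  Nat.sInf_le ⟨ω, rfl, rfl⟩

theorem mem_par {I : Set σ} {i : σ} (h : i ∈ I) : s i ∈ par s I :=
  Subgroup.subset_closure ⟨i, h, rfl⟩

theorem par_mono {I J : Set σ} (h : I ⊆ J) : par s I ≤ par s J :=
  Subgroup.closure_mono (Set.image_mono h)

theorem wprod_mem_par {I : Set σ} {ω : List σ} (h : ∀ i ∈ ω, i ∈ I) : wprod s ω ∈ par s I := by
  induction ω with
  | nil => exact one_mem _
  | cons i ω ih =>
    rw [wprod_cons]
    exact mul_mem (mem_par (h i (by simp))) (ih fun j hj => h j (by simp [hj]))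

theorem len_one : len s (1 : W) = 0 :=
  Nat.le_zero.1 (len_wprod_le (s := s) [])

namespace IsGen

variable (hs : IsGen s)
include hs

theorem inv_s (i : σ) : (s i)⁻¹ = s i := inv_eq_of_mul_eq_one_left (hs.sq i)

theorem s_mul_s_mul (i : σ) (w : W) : s i * (s i * w) = w := by rw [← mul_assoc, hs.sq, one_mul]

theorem mul_s_mul_s (i : σ) (w : W) : w * s i * s i = w := by rw [mul_assoc, hs.sq, mul_one]

theorem exists_word (w : W) : ∃ ω, wprod s ω = w ∧ ω.length = len s w :=
  Nat.sInf_mem (s := {k | ∃ ω : List σ, wprod s ω = w ∧ ω.length = k}) (by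
    obtain ⟨ω, h⟩ := hs.gen w
    exact ⟨_, ω, h, rfl⟩)

theorem len_eq_zero {w : W} : len s w = 0 ↔ w = 1 := by
  refine ⟨fun h => ?_, fun h => h ▸ len_one⟩
  obtain ⟨ω, rfl, h'⟩ := hs.exists_word w
  rw [h, List.length_eq_zero_iff] at h'
  rw [h', wprod_nil]

theorem wprod_reverse (ω : List σ) : wprod s ω.reverse = (wprod s ω)⁻¹ := by
  induction ω with
  | nil => simp [wprod]
  | cons i ω ih =>
    rw [List.reverse_cons, wprod_append, ih, wprod_cons i ω, mul_inv_rev, wprod_cons, wprod_nil,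
      mul_one, hs.inv_s]

theorem len_inv (w : W) : len s w⁻¹ = len s w := by
  have key : ∀ w, len s w⁻¹ ≤ len s w := by
    intro w
    obtain ⟨ω, rfl, h'⟩ := hs.exists_word w
    rw [← h', ← hs.wprod_reverse]
    exact (len_wprod_le _).trans (by simp)
  refine le_antisymm (key w) ?_
  simpa using key w⁻¹

theorem len_mul_le (x y : W) : len s (x * y) ≤ len s x + len s y := by
  obtain ⟨ω, rfl, h⟩ := hs.exists_word x
  obtain ⟨ω', rfl, h'⟩ := hs.exists_word y
  rw [← h, ← h', ← wprod_append, ← List.length_append]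
  exact len_wprod_le _

theorem len_le_mul (x y : W) : len s y ≤ len s x + len s (x * y) := by
  have := hs.len_mul_le x⁻¹ (x * y)
  rwa [inv_mul_cancel_left, hs.len_inv] at this

theorem len_le_mul' (x y : W) : len s x ≤ len s y + len s (x * y) := by
  have := hs.len_mul_le (x * y) y⁻¹
  rw [mul_inv_cancel_right, hs.len_inv] at this
  omega

theorem exists_left_descent {w : W} (h : w ≠ 1) :
    ∃ i w', w = s i * w' ∧ len s w = len s w' + 1 := by
  obtain ⟨ω, rfl, h'⟩ := hs.exists_word w
  cases ω with
  | nil => exact absurd rfl h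
  | cons i ω =>
    refine ⟨i, wprod s ω, wprod_cons _ _, ?_⟩
    have h1 := len_wprod_le (s := s) ω
    have h2 := len_wprod_le (s := s) [i]
    have h3 := hs.len_mul_le (s i) (wprod s ω)
    rw [← wprod_cons] at h3
    simp only [wprod, List.map_cons, List.map_nil, List.prod_cons, List.prod_nil, mul_one,
      List.length_cons, List.length_nil] at h1 h2 h3 h' ⊢
    omega

theorem exists_right_descent {w : W} (h : w ≠ 1) :
    ∃ i w', w = w' * s i ∧ len s w = len s w' + 1 := by
  obtain ⟨i, w', h1, h2⟩ := hs.exists_left_descent (inv_ne_one.2 h)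
  refine ⟨i, w'⁻¹, ?_, ?_⟩
  · rw [← inv_inv w, h1, mul_inv_rev, hs.inv_s]
  · rw [← hs.len_inv, h2, hs.len_inv]

end IsGen

namespace IsCox

variable (hs : IsCox s)
include hs

theorem len_s (i : σ) : len s (s i) = 1 := by
  have h1 := len_wprod_le (s := s) [i]
  have h2 := hs.ne i 1
  rw [mul_one, len_one] at h2
  simp [wprod] at h1
  omega

theorem len_s_mul (i : σ) (w : W) :
    len s (s i * w) = len s w + 1 ∨ len s (s i * w) + 1 = len s w := by
  have h1 := hs.len_mul_le (s i) w
  have h2 := hs.len_le_mul (s i) w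
  have h3 := hs.ne i w
  rw [hs.len_s] at h1 h2
  omega

theorem len_mul_s_eq (i : σ) (w : W) : len s (w * s i) = len s (s i * w⁻¹) := by
  rw [← hs.len_inv (w * s i), mul_inv_rev, hs.inv_s]

theorem len_mul_s (i : σ) (w : W) :
    len s (w * s i) = len s w + 1 ∨ len s (w * s i) + 1 = len s w := by
  rw [hs.len_mul_s_eq, ← hs.len_inv w]
  exact hs.len_s_mul i w⁻¹

theorem eq_s_of_len_eq_one {w : W} (h : len s w = 1) : ∃ i, w = s i := by
  obtain ⟨ω, rfl, h'⟩ := hs.exists_word w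
  rw [h, List.length_eq_one_iff] at h'
  obtain ⟨i, rfl⟩ := h'
  exact ⟨i, by simp [wprod]⟩

theorem rmin_iff_lmin_inv {I : Set σ} {d : W} : RMin s I d ↔ LMin s I d⁻¹ := by
  unfold RMin LMin
  simp only [hs.len_mul_s_eq, hs.len_inv]

theorem rmax_iff_lmax_inv {I : Set σ} {d : W} : RMax s I d ↔ LMax s I d⁻¹ := by
  unfold RMax LMax
  simp only [hs.len_mul_s_eq, hs.len_inv]

/-- If `y t > y` and `ω y t < ω y`, the exchange takes place at a letter of `ω`. -/
theorem exists_fold (ω : List σ) (y : W) (t : σ) (h1 : len s y < len s (y * s t))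
    (h2 : len s (wprod s ω * y * s t) < len s (wprod s ω * y)) :
    ∃ ω₁ a ω₂, ω = ω₁ ++ a :: ω₂ ∧ s a * (wprod s ω₂ * y) = wprod s ω₂ * y * s t := by
  induction ω with
  | nil =>
    rw [wprod_nil, one_mul] at h2
    omega
  | cons a ω ih =>
    by_cases h : len s (wprod s ω * y * s t) < len s (wprod s ω * y)
    · obtain ⟨ω₁, b, ω₂, rfl, hb⟩ := ih h
      exact ⟨a :: ω₁, b, ω₂, rfl, hb⟩
    -- The comparison between `z` and `z s_t` changes its direction exactly at the letter `a`, which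
    -- is where the folding condition applies.
    · refine ⟨[], a, ω, rfl, hs.fold a t _ ?_ ?_ ?_⟩
      all_goals
        rw [wprod_cons, mul_assoc (s a), mul_assoc (s a)] at h2
        have e1 := hs.len_s_mul a (wprod s ω * y)
        have e2 := hs.len_s_mul a (wprod s ω * y * s t)
        have e3 := hs.len_mul_s t (wprod s ω * y)
        try rw [mul_assoc (s a)]
        omega

/-- If `y t > y` and `u y t < u y`, then `u y t y⁻¹ < u`. -/
theorem len_lt_of_fold (u y : W) (t : σ) (h1 : len s y < len s (y * s t))
    (h2 : len s (u * y * s t) < len s (u * y)) : len s (u * (y * s t * y⁻¹)) < len s u := by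
  obtain ⟨ω, rfl, hω⟩ := hs.exists_word u
  obtain ⟨ω₁, a, ω₂, rfl, h⟩ := hs.exists_fold ω y t h1 h2
  -- Carried through `ω₂`, the reflection `y s_t y⁻¹` becomes the letter `a` and cancels it, so that
  -- one letter of a reduced word is lost.
  have : wprod s (ω₁ ++ a :: ω₂) * (y * s t * y⁻¹) = wprod s (ω₁ ++ ω₂) := by
    rw [wprod_append, wprod_append, wprod_cons]
    have h' : wprod s ω₂ * (y * s t * y⁻¹) = s a * wprod s ω₂ := by
      rw [← mul_assoc, ← mul_assoc, ← h]
      group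
    rw [mul_assoc, mul_assoc (s a), h', hs.s_mul_s_mul]
  rw [this, ← hω]
  refine Nat.lt_of_le_of_lt (len_wprod_le _) ?_
  simp

/-- A sign change inside a coset `a W_I`. -/
theorem conj_mem_par {I : Set σ} {a b : W} {i : σ} (hb : b ∈ par s I)
    (h1 : len s a < len s (s i * a)) (h2 : len s (s i * a * b) < len s (a * b)) :
    a⁻¹ * s i * a ∈ par s I := by
  obtain ⟨ω, hω, rfl⟩ : ∃ ω : List σ, (∀ j ∈ ω, j ∈ I) ∧ wprod s ω = b := by
    refine Subgroup.closure_induction (p := fun b _ => ∃ ω : List σ, (∀ j ∈ ω, j ∈ I) ∧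
      wprod s ω = b) ?_ ⟨[], by simp, rfl⟩ ?_ ?_ hb
    · rintro _ ⟨j, hj, rfl⟩
      exact ⟨[j], by simpa using hj, by simp [wprod]⟩
    · rintro _ _ _ _ ⟨ω, hω, rfl⟩ ⟨ω', hω', rfl⟩
      refine ⟨ω ++ ω', ?_, wprod_append _ _⟩
      intro j hj
      rcases List.mem_append.1 hj with h | h
      exacts [hω j h, hω' j h]
    · rintro _ _ ⟨ω, hω, rfl⟩
      exact ⟨ω.reverse, fun j hj => hω j (List.mem_reverse.1 hj), hs.wprod_reverse ω⟩
  -- The fold is taken for the inverses, with a word for `b⁻¹` in the letters of `I` acting on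
  -- `a⁻¹`; the folding letter `c` then belongs to `I`.
  obtain ⟨ω₁, c, ω₂, he, h⟩ := hs.exists_fold ω.reverse a⁻¹ i
    (by rw [hs.len_mul_s_eq, hs.len_inv, inv_inv]; exact h1)
    (by
      rw [hs.len_mul_s_eq, hs.wprod_reverse, ← mul_inv_rev, inv_inv, hs.len_inv, ← mul_assoc]
      exact h2)
  have hc : ∀ j ∈ ω₁ ++ c :: ω₂, j ∈ I := fun j hj => hω j (List.mem_reverse.1 (he ▸ hj))
  have h2 : wprod s ω₂ ∈ par s I := wprod_mem_par fun j hj => hc j (by simp [hj])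
  have hc' : s c ∈ par s I := mem_par (hc c (by simp))
  have : a⁻¹ * s i * a = (wprod s ω₂)⁻¹ * s c * wprod s ω₂ := by
    rw [mul_assoc _ (s c), eq_inv_mul_iff_mul_eq, ← mul_assoc, ← mul_assoc, ← h]
    group
  rw [this]
  exact mul_mem (mul_mem (inv_mem h2) hc') h2

/-- Elements of `W_I` have reduced words in `I`. -/
theorem exists_word_par {I : Set σ} {x : W} (hx : x ∈ par s I) :
    ∃ ω : List σ, (∀ j ∈ ω, j ∈ I) ∧ wprod s ω = x ∧ ω.length = len s x := by
  refine Subgroup.closure_induction_left (p := fun x _ => ∃ ω : List σ, (∀ j ∈ ω, j ∈ I) ∧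
    wprod s ω = x ∧ ω.length = len s x) ⟨[], by simp, rfl, by simp [len_one]⟩ ?_ ?_ hx
  all_goals
    rintro _ ⟨i, hi, rfl⟩ y _ ⟨ω, hω, rfl, hl⟩
    try rw [hs.inv_s]
    rcases hs.len_s_mul i (wprod s ω) with h | h
    · refine ⟨i :: ω, ?_, wprod_cons _ _, by rw [h, ← hl]; rfl⟩
      intro j hj
      rcases List.mem_cons.1 hj with rfl | h
      exacts [hi, hω j h]
    -- When `s_i` shortens the product, folding with base element `1` deletes a letter of the given
    -- word, so no letter outside `I` appears.
    · obtain ⟨ω₁, c, ω₂, he, h'⟩ := hs.exists_fold ω.reverse 1 i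
        (by rw [len_one, one_mul, hs.len_s]; exact one_pos)
        (by
          rw [hs.len_mul_s_eq, mul_one, hs.wprod_reverse, inv_inv, hs.len_inv]
          omega)
      have he' : ω = (ω₁ ++ c :: ω₂).reverse := by rw [← he, List.reverse_reverse]
      have hprod : s i * wprod s ω = wprod s (ω₁ ++ ω₂).reverse := by
        rw [he', hs.wprod_reverse, hs.wprod_reverse, wprod_append, wprod_cons, wprod_append]
        rw [mul_one] at h'
        rw [h', mul_inv_rev, mul_inv_rev, hs.inv_s, mul_inv_rev, mul_assoc, hs.s_mul_s_mul]
      have hlen : (ω₁ ++ ω₂).reverse.length + 1 = ω.length := by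
        rw [he']; simp; omega
      refine ⟨(ω₁ ++ ω₂).reverse, ?_, hprod.symm, by omega⟩
      intro j hj
      refine hω j ?_
      rw [he']
      simp only [List.mem_reverse, List.mem_append, List.mem_cons] at hj ⊢
      tauto

theorem exists_left_descent_par {I : Set σ} {x : W} (hx : x ∈ par s I) (h : x ≠ 1) :
    ∃ i ∈ I, s i * x ∈ par s I ∧ len s (s i * x) + 1 = len s x := by
  obtain ⟨ω, hω, rfl, hl⟩ := hs.exists_word_par hx
  cases ω with
  | nil => exact absurd rfl h
  | cons i ω =>
    have hi := hω i (by simp)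
    refine ⟨i, hi, mul_mem (mem_par hi) hx, ?_⟩
    have h1 := hs.len_s_mul i (wprod s (i :: ω))
    have h2 : len s (s i * wprod s (i :: ω)) ≤ ω.length := by
      rw [wprod_cons, hs.s_mul_s_mul]
      exact len_wprod_le _
    simp only [List.length_cons] at hl
    omega

theorem exists_right_descent_par {I : Set σ} {x : W} (hx : x ∈ par s I) (h : x ≠ 1) :
    ∃ i ∈ I, x * s i ∈ par s I ∧ len s (x * s i) + 1 = len s x := by
  obtain ⟨i, hi, h1, h2⟩ := hs.exists_left_descent_par (inv_mem hx) (inv_ne_one.2 h)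
  refine ⟨i, hi, mul_mem hx (mem_par hi), ?_⟩
  rwa [hs.len_mul_s_eq, ← hs.len_inv x]

theorem mem_of_s_mem_par {I : Set σ} {i : σ} (h : s i ∈ par s I) : i ∈ I := by
  obtain ⟨ω, hω, h1, h2⟩ := hs.exists_word_par h
  rw [hs.len_s, List.length_eq_one_iff] at h2
  obtain ⟨j, rfl⟩ := h2
  have : s j = s i := by simpa [wprod] using h1
  exact hs.inj this ▸ hω j (by simp)

/-- For an element of least length in its coset, a first failure of additivity would, by
`len_lt_of_fold`, produce a shorter element of the same coset. An element that is only minimal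
against single generators is then shown to be this least one. -/
theorem RMin.len_mul {I : Set σ} {d x : W} (hd : RMin s I d) (hx : x ∈ par s I) :
    len s (d * x) = len s d + len s x := by
  -- first for elements of minimal length in the coset
  have key : ∀ (d : W), (∀ y ∈ par s I, len s d ≤ len s (d * y)) → ∀ (n : ℕ) (x : W),
      x ∈ par s I → len s x = n → len s (d * x) = len s d + len s x := by
    intro d hd n
    induction n with
    | zero =>
      intro x _ hn
      rw [hs.len_eq_zero.1 hn, mul_one, len_one, add_zero]
    | succ n ih =>
      intro x hx hn
      have hx1 : x ≠ 1 := by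
        rintro rfl
        rw [len_one] at hn
        omega
      obtain ⟨t, ht, h1, h2⟩ := hs.exists_right_descent_par hx hx1
      have ih' := ih (x * s t) h1 (by omega)
      have e : x * s t * s t = x := hs.mul_s_mul_s t x
      by_contra hne
      have h4 : len s (d * (x * s t) * s t) < len s (d * (x * s t)) := by
        have := hs.len_mul_s t (d * (x * s t))
        rw [mul_assoc d, e] at this ⊢
        omega
      have h5 := hs.len_lt_of_fold d (x * s t) t (by rw [e]; omega) h4
      have h6 := hd (x * s t * s t * (x * s t)⁻¹)
        (mul_mem (mul_mem h1 (mem_par ht)) (inv_mem h1))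
      omega
  obtain ⟨y, hy, hmin⟩ : ∃ y ∈ par s I, ∀ z ∈ par s I, len s (d * y) ≤ len s (d * z) := by
    have hne : ((fun y => len s (d * y)) '' (par s I : Set W)).Nonempty := ⟨_, 1, one_mem _, rfl⟩
    obtain ⟨y, hy, h⟩ := Nat.sInf_mem hne
    exact ⟨y, hy, fun z hz => by rw [show len s (d * y) = _ from h]; exact Nat.sInf_le ⟨z, hz, rfl⟩⟩
  have hmin' : ∀ z ∈ par s I, len s (d * y) ≤ len s (d * y * z) := fun z hz => by
    rw [mul_assoc]; exact hmin _ (mul_mem hy hz)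
  -- With `d y` of least length, lengths add along `d = (d y) y⁻¹`; a last letter `t ∈ I` of `y⁻¹`
  -- would make `d s_t` shorter than `d`.
  have hy1 : y = 1 := by
    by_contra hne
    obtain ⟨t, ht, h1, h2⟩ := hs.exists_right_descent_par (inv_mem hy) (inv_ne_one.2 hne)
    have e1 := key _ hmin' _ _ (inv_mem hy) rfl
    have e2 := key _ hmin' _ _ h1 rfl
    have := hd t ht
    rw [mul_inv_cancel_right] at e1
    rw [← mul_assoc, mul_inv_cancel_right] at e2
    omega
  subst hy1
  simp only [mul_one] at hmin'
  exact key d hmin' _ x hx rfl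

theorem LMin.len_mul {I : Set σ} {d x : W} (hd : LMin s I d) (hx : x ∈ par s I) :
    len s (x * d) = len s x + len s d := by
  have := RMin.len_mul hs (I := I) (d := d⁻¹) (x := x⁻¹)
    (hs.rmin_iff_lmin_inv.2 (by rwa [inv_inv])) (inv_mem hx)
  rw [← mul_inv_rev, hs.len_inv, hs.len_inv, hs.len_inv] at this
  omega

/-- `len_lt_of_fold` transports the inequality `m s_t < m` along `x⁻¹`: every additional letter of
`x` shortens `m x⁻¹` by one. -/
theorem RMax.len_mul {I : Set σ} {m : W} (hm : RMax s I m) {x : W} (hx : x ∈ par s I) :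
    len s (m * x) + len s x = len s m := by
  have key : ∀ (n : ℕ) (x : W), x ∈ par s I → len s x = n →
      len s (m * x⁻¹) + len s x = len s m := by
    intro n
    induction n with
    | zero =>
      intro x _ hn
      rw [hs.len_eq_zero.1 hn, inv_one, mul_one, len_one, add_zero]
    | succ n ih =>
      intro x hx hn
      have hx1 : x ≠ 1 := by
        rintro rfl
        rw [len_one] at hn
        omega
      obtain ⟨t, ht, h1, h2⟩ := hs.exists_right_descent_par hx hx1
      have ih' := ih (x * s t) h1 (by omega)
      have e : x * s t * s t = x := hs.mul_s_mul_s t x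
      have h5 := hs.len_lt_of_fold (m * (x * s t)⁻¹) (x * s t) t (by rw [e]; omega) (by
        rw [inv_mul_cancel_right]; exact hm t ht)
      have e2 : m * (x * s t)⁻¹ * (x * s t * s t * (x * s t)⁻¹) = m * x⁻¹ := by
        rw [mul_inv_rev, hs.inv_s, e, ← mul_assoc, mul_assoc (m * (s t * x⁻¹)), mul_assoc m,
          mul_assoc (s t)]
        group
        simp [mul_assoc, hs.sq]
      rw [e2] at h5
      have := hs.len_le_mul' m x⁻¹
      rw [hs.len_inv] at this
      omega
  have := key _ x⁻¹ (inv_mem hx) rfl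
  rwa [inv_inv, hs.len_inv] at this

theorem LMax.len_mul {I : Set σ} {m : W} (hm : LMax s I m) {x : W} (hx : x ∈ par s I) :
    len s (x * m) + len s x = len s m := by
  have := RMax.len_mul hs (I := I) (m := m⁻¹) (hs.rmax_iff_lmax_inv.2 (by rwa [inv_inv]))
    (inv_mem hx)
  rw [← mul_inv_rev, hs.len_inv, hs.len_inv, hs.len_inv] at this
  omega

/-- Every coset `w W_I` contains an element which is minimal. -/
theorem exists_rmin (I : Set σ) (w : W) : ∃ d, RMin s I d ∧ ∃ b ∈ par s I, w = d * b := by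
  have hne : ((fun y => len s (w * y)) '' (par s I : Set W)).Nonempty := ⟨_, 1, one_mem _, rfl⟩
  obtain ⟨y, hy, h⟩ := Nat.sInf_mem hne
  have hmin : ∀ z ∈ par s I, len s (w * y) ≤ len s (w * z) := fun z hz => by
    rw [show len s (w * y) = _ from h]; exact Nat.sInf_le ⟨z, hz, rfl⟩
  refine ⟨w * y, fun t ht => ?_, y⁻¹, inv_mem hy, by group⟩
  have h1 := hmin (y * s t) (mul_mem hy (mem_par ht))
  have h2 := hs.len_mul_s t (w * y)
  rw [mul_assoc] at h2 ⊢
  omega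

/-- Deodhar's lemma. -/
theorem LMin.mul_s {I : Set σ} {d : W} (hd : LMin s I d) (t : σ) :
    LMin s I (d * s t) ∨ ∃ k ∈ I, d * s t = s k * d := by
  by_cases h : LMin s I (d * s t)
  · exact Or.inl h
  · right
    unfold LMin at h
    push Not at h
    obtain ⟨k, hk, h⟩ := h
    refine ⟨k, hk, (hs.fold k t d (hd k hk) ?_ ?_).symm⟩
    all_goals
      have h1 := hd k hk
      have h2 := hs.len_mul_s t d
      have h3 := hs.len_s_mul k (d * s t)
      have h4 := hs.len_mul_s t (s k * d)
      rw [mul_assoc] at h4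
      try rw [mul_assoc]
      omega

theorem RMin.s_mul {I : Set σ} {d : W} (hd : RMin s I d) (t : σ) :
    RMin s I (s t * d) ∨ ∃ k ∈ I, s t * d = d * s k := by
  rcases LMin.mul_s hs (hs.rmin_iff_lmin_inv.1 hd) t with h | ⟨k, hk, h⟩
  · left
    rw [hs.rmin_iff_lmin_inv, mul_inv_rev, hs.inv_s]
    exact h
  · right
    refine ⟨k, hk, ?_⟩
    have := congrArg (·⁻¹) h
    simpa [hs.inv_s] using this


omit hs in
theorem conj_mem_par_of_gen {K : Set σ} {H : Subgroup W} {x b : W}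
    (h : ∀ k ∈ K, x * s k * x⁻¹ ∈ H) (hb : b ∈ par s K) : x * b * x⁻¹ ∈ H := by
  have : par s K ≤ H.comap (MulAut.conj x).toMonoidHom := by
    refine (Subgroup.closure_le _).2 ?_
    rintro _ ⟨k, hk, rfl⟩
    simpa using h k hk
  simpa using this hb

/-- The cosets `y x` for `y ∈ W_A` and `x` minimal in `x W_K`. -/
theorem exists_decomp {K A : Set σ} {x y : W} (hx : RMin s K x) (hy : y ∈ par s A) :
    ∃ d b, y * x = d * b ∧ RMin s K d ∧ b ∈ par s {k ∈ K | x * s k * x⁻¹ ∈ par s A} := by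
  refine Subgroup.closure_induction_left (p := fun y _ => ∃ d b, y * x = d * b ∧ RMin s K d ∧
    b ∈ par s {k ∈ K | x * s k * x⁻¹ ∈ par s A}) ⟨x, 1, by simp, hx, one_mem _⟩ ?_ ?_ hy
  all_goals
    rintro _ ⟨a, ha, rfl⟩ y hy ⟨d, b, h1, h2, h3⟩
    try rw [hs.inv_s]
    rcases RMin.s_mul hs h2 a with h | ⟨k, hk, h⟩
    · exact ⟨s a * d, b, by rw [mul_assoc, h1, mul_assoc], h, h3⟩
    · refine ⟨d, s k * b, by rw [mul_assoc, h1, ← mul_assoc, ← mul_assoc, h], h2,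
        mul_mem (mem_par ⟨hk, ?_⟩) h3⟩
      -- The new letter satisfies `s_k = d⁻¹ s_a d` with `d = y x b⁻¹`. Since `x b x⁻¹` lies in
      -- `W_A` by induction, so does `x s_k x⁻¹`.
      have hb := conj_mem_par_of_gen (H := par s A) (fun k hk => hk.2) h3
      have hd : d = y * x * b⁻¹ := eq_mul_inv_of_mul_eq h1.symm
      have e : x * s k * x⁻¹ = (x * b * x⁻¹) * (y⁻¹ * s a * y) * (x * b * x⁻¹)⁻¹ := by
        have : s k = d⁻¹ * s a * d := by rw [mul_assoc, h]; group
        rw [this, hd]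
        group
      rw [e]
      exact mul_mem (mul_mem hb (mul_mem (mul_mem (inv_mem hy) (mem_par ha)) hy)) (inv_mem hb)

/-- Induction on the length of `a`. Its last letter `t` lengthens `m b` but shortens `m`, so by
`conj_mem_par` it passes through `m b` into `W_J`; it can thus be moved from `a` to the right-hand
factor. -/
theorem bimax_unique {I J : Set σ} {m m' a b : W} (hm : LMax s I m) (hm' : LMax s I m')
    (hr : RMax s J m) (hr' : RMax s J m') (ha : a ∈ par s I) (hb : b ∈ par s J)
    (h : m' = a * m * b) : m' = m := by
  induction hn : len s a generalizing a b with
  | zero =>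
    rw [hs.len_eq_zero.1 hn, one_mul] at h
    have h1 := RMax.len_mul hs hr hb
    have h2 := RMax.len_mul hs hr' (inv_mem hb)
    rw [h, mul_inv_cancel_right, hs.len_inv] at h2
    have : len s b = 0 := by omega
    rw [h, hs.len_eq_zero.1 this, mul_one]
  | succ n ih =>
    have ha1 : a ≠ 1 := by
      rintro rfl
      rw [len_one] at hn
      omega
    obtain ⟨t, ht, h1, h2⟩ := hs.exists_right_descent_par ha ha1
    have e1 : m * b = a⁻¹ * m' := by rw [h]; group
    have e2 : s t * (m * b) = (a * s t)⁻¹ * m' := by rw [e1, mul_inv_rev, hs.inv_s, mul_assoc]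
    have l1 := LMax.len_mul hs hm' (inv_mem ha)
    have l2 := LMax.len_mul hs hm' (inv_mem h1)
    rw [hs.len_inv] at l1 l2
    have h3 := hs.conj_mem_par (I := J) (a := m * b) (b := b⁻¹) (i := t) (inv_mem hb)
      (by rw [e2, e1]; omega)
      (by rw [mul_assoc, mul_inv_cancel_right]; exact hm t ht)
    refine ih (a := a * s t) (b := m⁻¹ * s t * m * b) h1 ?_ ?_ (by omega)
    · have e3 : m⁻¹ * s t * m * b = b * ((m * b)⁻¹ * s t * (m * b)) := by group
      rw [e3]
      exact mul_mem hb h3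
    · rw [h]
      have : a = a * s t * s t := (hs.mul_s_mul_s t a).symm
      nth_rewrite 1 [this]
      group

variable [Finite W]

theorem exists_bimax (I J : Set σ) (w : W) : ∃ m, LMax s I m ∧ RMax s J m ∧
    (∃ a ∈ par s I, ∃ b ∈ par s J, m = a * w * b) ∧
    ∀ a ∈ par s I, ∀ b ∈ par s J, len s (a * w * b) ≤ len s m := by
  obtain ⟨⟨a, b⟩, ⟨ha, hb⟩, hmax⟩ := Set.exists_max_image
    ({x | x.1 ∈ par s I ∧ x.2 ∈ par s J} : Set (W × W)) (fun x => len s (x.1 * w * x.2))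
    (Set.toFinite _) ⟨(1, 1), one_mem _, one_mem _⟩
  refine ⟨a * w * b, ?_, ?_, ⟨a, ha, b, hb, rfl⟩, fun a' ha' b' hb' => hmax (a', b') ⟨ha', hb'⟩⟩
  · intro t ht
    have h1 := hmax (s t * a, b) ⟨mul_mem (mem_par ht) ha, hb⟩
    have h2 := hs.len_s_mul t (a * w * b)
    simp only [← mul_assoc] at h1 h2 ⊢
    omega
  · intro t ht
    have h1 := hmax (a, b * s t) ⟨ha, mul_mem hb (mem_par ht)⟩
    have h2 := hs.len_mul_s t (a * w * b)
    simp only [← mul_assoc] at h1 h2 ⊢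
    omega

theorem bimax_max {I J : Set σ} {m a b : W} (hm : LMax s I m) (hr : RMax s J m)
    (ha : a ∈ par s I) (hb : b ∈ par s J) :
    len s (a * m * b) ≤ len s m ∧ (len s (a * m * b) = len s m → a * m * b = m) := by
  have key : ∀ m, LMax s I m → RMax s J m → ∀ a ∈ par s I, ∀ b ∈ par s J,
      len s (a * m * b) ≤ len s m := by
    intro m hm hr
    obtain ⟨m', h1, h2, ⟨a', ha', b', hb', h⟩, h3⟩ := hs.exists_bimax I J m
    have : m' = m := hs.bimax_unique hm h1 hr h2 ha' hb' h
    rwa [this] at h3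
  refine ⟨key m hm hr a ha b hb, fun h => ?_⟩
  refine hs.bimax_unique hm ?_ hr ?_ ha hb rfl
  · intro t ht
    have h1 := key m hm hr (s t * a) (mul_mem (mem_par ht) ha) b hb
    have h2 := hs.len_s_mul t (a * m * b)
    simp only [← mul_assoc] at h1 h2 ⊢
    omega
  · intro t ht
    have h1 := key m hm hr a ha (b * s t) (mul_mem hb (mem_par ht))
    have h2 := hs.len_mul_s t (a * m * b)
    simp only [← mul_assoc] at h1 h2 ⊢
    omega

theorem exists_longest (I : Set σ) : ∃ m, m ∈ par s I ∧ RMax s I m := by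
  obtain ⟨m, h1, h2, ⟨a, ha, b, hb, h⟩, -⟩ := hs.exists_bimax I I 1
  exact ⟨m, by rw [h, mul_one]; exact mul_mem ha hb, h2⟩

end IsCox

open Classical in
variable (s) in
/-- The longest element of `W_I`. -/
def longest (I : Set σ) : W := if h : ∃ m, m ∈ par s I ∧ RMax s I m then h.choose else 1

namespace IsCox

variable (hs : IsCox s) [Finite W]
include hs

theorem longest_spec (I : Set σ) : longest s I ∈ par s I ∧ RMax s I (longest s I) := by
  have h := hs.exists_longest I
  rw [longest, dif_pos h]
  exact h.choose_spec

theorem longest_mem (I : Set σ) : longest s I ∈ par s I := (hs.longest_spec I).1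

theorem len_longest_mul {I : Set σ} {x : W} (hx : x ∈ par s I) :
    len s (longest s I * x) + len s x = len s (longest s I) :=
  RMax.len_mul hs (hs.longest_spec I).2 hx

theorem eq_longest {I : Set σ} {m : W} (hm : m ∈ par s I) (h : RMax s I m) :
    m = longest s I := by
  have h1 := RMax.len_mul hs h (mul_mem (inv_mem hm) (hs.longest_mem I))
  have h2 := hs.len_longest_mul (mul_mem (inv_mem (hs.longest_mem I)) hm)
  rw [mul_inv_cancel_left] at h1 h2
  have h3 : len s ((longest s I)⁻¹ * m) = 0 := by omega
  rw [hs.len_eq_zero, inv_mul_eq_one] at h3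
  exact h3.symm

theorem longest_inv (I : Set σ) : (longest s I)⁻¹ = longest s I := by
  have h := hs.len_longest_mul (inv_mem (hs.longest_mem I))
  have h2 := hs.len_longest_mul (mul_mem (inv_mem (hs.longest_mem I)) (inv_mem (hs.longest_mem I)))
  rw [mul_inv_cancel_left, hs.len_inv] at h2
  have h3 : len s ((longest s I)⁻¹ * (longest s I)⁻¹) = 0 := by omega
  rw [hs.len_eq_zero, mul_eq_one_iff_eq_inv, inv_inv] at h3
  exact h3

theorem longest_mul_longest (I : Set σ) : longest s I * longest s I = 1 := by
  nth_rewrite 1 [← hs.longest_inv I]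
  exact inv_mul_cancel _

theorem len_mul_longest {I : Set σ} {x : W} (hx : x ∈ par s I) :
    len s (x * longest s I) + len s x = len s (longest s I) := by
  have := hs.len_longest_mul (inv_mem hx)
  rwa [← hs.len_inv, mul_inv_rev, inv_inv, hs.longest_inv, hs.len_inv] at this

/-- Subtracting lengths twice shows that `w_I s_k w_I` has length `1`, hence is a generator. -/
theorem longest_conj {I : Set σ} {k : σ} (hk : k ∈ I) :
    ∃ k' ∈ I, longest s I * s k = s k' * longest s I := by
  have hk' := mem_par (s := s) hk
  have h1 := hs.len_mul_longest (mul_mem (hs.longest_mem I) hk')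
  have h2 := hs.len_longest_mul hk'
  rw [hs.len_s] at h2
  obtain ⟨j, hj⟩ := hs.eq_s_of_len_eq_one (w := longest s I * s k * longest s I) (by omega)
  refine ⟨j, hs.mem_of_s_mem_par ?_, ?_⟩
  · rw [← hj]
    exact mul_mem (mul_mem (hs.longest_mem I) hk') (hs.longest_mem I)
  · rw [← hj, mul_assoc _ (longest s I), hs.longest_mul_longest, mul_one]

theorem RMin.mul_longest {I : Set σ} {d : W} (hd : RMin s I d) : RMax s I (d * longest s I) := by
  intro t ht
  rw [mul_assoc, RMin.len_mul hs hd (hs.longest_mem I),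
    RMin.len_mul hs hd (mul_mem (hs.longest_mem I) (mem_par ht))]
  have := hs.len_longest_mul (mem_par (s := s) ht)
  rw [hs.len_s] at this
  omega

theorem RMax.mul_longest {I : Set σ} {m : W} (hm : RMax s I m) : RMin s I (m * longest s I) := by
  intro t ht
  have h1 := RMax.len_mul hs hm (hs.longest_mem I)
  have h2 := RMax.len_mul hs hm (mul_mem (hs.longest_mem I) (mem_par ht))
  have := hs.len_longest_mul (mem_par (s := s) ht)
  rw [hs.len_s] at this
  rw [mul_assoc]
  omega

/-! The representatives of the cells. -/

variable (s) in
/-- `w` is minimal in `w W_A` and the longest element of `w W_A` is maximal in its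
`W_I`-coset. -/
def _root_.SplitBN.Good (A I : Set σ) (w : W) : Prop :=
  RMin s A w ∧ LMax s I (w * longest s A)

theorem exists_good (A I : Set σ) (w : W) : ∃ g, Good s A I g ∧
    ∃ a ∈ par s I, ∃ b ∈ par s A, g = a * w * b := by
  obtain ⟨m, h1, h2, ⟨a, ha, b, hb, h⟩, -⟩ := hs.exists_bimax I A w
  refine ⟨m * longest s A, ⟨RMax.mul_longest hs h2, ?_⟩, a, ha, b * longest s A,
    mul_mem hb (hs.longest_mem A), by rw [h, ← mul_assoc]⟩
  rwa [mul_assoc, hs.longest_mul_longest, mul_one]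

/-- Being maximal on both sides, `w' w_A` has the greatest length in its `W_J`-`W_A` double coset,
which contains `w w_A`. This is the source of the monotonicity of labels. -/
theorem good_le {A I J : Set σ} {w w' a b : W} (hw : Good s A I w)
    (hw' : Good s A J w') (ha : a ∈ par s J) (hb : b ∈ par s A) (h : w = a * w' * b) :
    len s w ≤ len s w' ∧ (len s w = len s w' → w = w') := by
  have h1 := hs.bimax_max hw'.2 (RMin.mul_longest hs hw'.1) ha
    (mul_mem (mul_mem (inv_mem (hs.longest_mem A)) hb) (hs.longest_mem A))
  have e : a * (w' * longest s A) * ((longest s A)⁻¹ * b * longest s A) = w * longest s A := by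
    rw [h]; group
  rw [e, RMin.len_mul hs hw.1 (hs.longest_mem A), RMin.len_mul hs hw'.1 (hs.longest_mem A)] at h1
  exact ⟨by omega, fun h2 => mul_right_cancel (h1.2 (by omega))⟩

theorem good_unique {A I : Set σ} {w w' a b : W} (hw : Good s A I w)
    (hw' : Good s A I w') (ha : a ∈ par s I) (hb : b ∈ par s A) (h : w = a * w' * b) :
    w = w' := by
  have h1 := hs.good_le hw hw' ha hb h
  have h2 := hs.good_le hw' hw (inv_mem ha) (inv_mem hb) (by rw [h]; group)
  exact h1.2 (by omega)

/-- Since `w` is minimal in `w W_A`, a left descent of `w` remains one of `w w_A`. A descent of a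
label can therefore be added to `I` without changing the label. -/
theorem good_insert {A I : Set σ} {w : W} (hw : Good s A I w) {i : σ}
    (hi : len s (s i * w) < len s w) : Good s A (insert i I) w := by
  refine ⟨hw.1, fun t ht => ?_⟩
  rcases ht with rfl | ht
  · have h1 := hs.len_mul_le (s t * w) (longest s A)
    rw [RMin.len_mul hs hw.1 (hs.longest_mem A), ← mul_assoc]
    omega
  · exact hw.2 t ht

omit hs [Finite W] in
theorem good_anti {A I J : Set σ} (h : I ⊆ J) {w : W} (hw : Good s A J w) : Good s A I w :=
  ⟨hw.1, fun t ht => hw.2 t (h ht)⟩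

theorem good_one_iff {A I : Set σ} : Good s A I 1 ↔ I ⊆ A := by
  constructor
  · intro h i hi
    have h1 := hs.conj_mem_par (I := A) (a := 1) (b := longest s A) (i := i) (hs.longest_mem A)
      (by rw [len_one, mul_one, hs.len_s]; exact one_pos) (by
        have := h.2 i hi
        rw [one_mul] at this ⊢
        rwa [mul_one])
    simp only [inv_one, one_mul, mul_one] at h1
    exact hs.mem_of_s_mem_par h1
  · intro h
    refine ⟨fun t _ => ?_, fun t ht => ?_⟩
    · rw [one_mul, len_one, hs.len_s]
      exact one_pos
    · rw [one_mul]
      have := hs.len_mul_longest (mem_par (s := s) (h ht))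
      rw [hs.len_s] at this
      omega

/-- Comparing the lengths of `y w w_A` and `y w` computed in two ways shows that the last letter `t`
of `y` satisfies `s_t w > w`, so `t ≠ j`. On the other hand `s_t` shortens `w w_A`, hence `w⁻¹ s_t w
∈ W_A`, and the induction continues with `y s_t`. -/
theorem good_inter {A J : Set σ} {w : W} (hw : Good s A J w) {j : σ}
    (hj : len s (s j * w) < len s w) {y : W} (hy : y ∈ par s J) (hy' : w⁻¹ * y * w ∈ par s A) :
    y ∈ par s (J \ {j}) := by
  induction hn : len s y generalizing y with
  | zero => rw [hs.len_eq_zero.1 hn]; exact one_mem _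
  | succ n ih =>
    have hy1 : y ≠ 1 := by
      rintro rfl
      rw [len_one] at hn
      omega
    obtain ⟨t, ht, h1, h2⟩ := hs.exists_right_descent_par hy hy1
    have l1 := LMax.len_mul hs hw.2 hy
    have e1 : y * (w * longest s A) = w * (w⁻¹ * y * w * longest s A) := by group
    have e2 : w * (w⁻¹ * y * w) = y * w := by group
    have l2 := hs.len_mul_longest hy'
    have l3 := RMin.len_mul hs hw.1 hy'
    rw [e1, RMin.len_mul hs hw.1 (mul_mem hy' (hs.longest_mem A)),
      RMin.len_mul hs hw.1 (hs.longest_mem A)] at l1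
    rw [e2] at l3
    have l4 := hs.len_mul_le (y * s t) (s t * w)
    rw [mul_assoc, hs.s_mul_s_mul] at l4
    have htw : len s w < len s (s t * w) := by omega
    have h3 := hs.conj_mem_par (I := A) (hs.longest_mem A) htw (by
      rw [mul_assoc]; exact hw.2 t ht)
    have htj : t ≠ j := by
      rintro rfl
      omega
    have h4 := ih h1 (by
      have : w⁻¹ * (y * s t) * w = (w⁻¹ * y * w) * (w⁻¹ * s t * w) := by group
      rw [this]
      exact mul_mem hy' h3) (by omega)
    have h5 := mul_mem h4 (mem_par (s := s) (show t ∈ J \ {j} from ⟨ht, htj⟩))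
    rwa [hs.mul_s_mul_s] at h5

end IsCox

/-! Elements moving one set of generators to another one. -/

variable (s) in
/-- `d` is minimal in `d W_K` and conjugates the generators in `K` to those in `K'`. -/
structure Move (d : W) (K K' : Set σ) : Prop where
  rmin : RMin s K d
  map : ∀ k ∈ K, ∃ k' ∈ K', d * s k = s k' * d
  surj : ∀ k' ∈ K', ∃ k ∈ K, d * s k = s k' * d

namespace Move

variable {K K' K'' : Set σ} {d d' : W}

theorem one (hs : IsCox s) (K : Set σ) : Move s 1 K K where
  rmin t _ := by rw [len_one, one_mul, hs.len_s]; exact one_pos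
  map k hk := ⟨k, hk, by simp⟩
  surj k hk := ⟨k, hk, by simp⟩

theorem lmin (h : Move s d K K') : LMin s K' d := fun k' hk' => by
  obtain ⟨k, hk, e⟩ := h.surj k' hk'
  rw [← e]
  exact h.rmin k hk

theorem inv (hs : IsCox s) (h : Move s d K K') : Move s d⁻¹ K' K where
  rmin := by rw [hs.rmin_iff_lmin_inv, inv_inv]; exact h.lmin
  map k' hk' := by
    obtain ⟨k, hk, e⟩ := h.surj k' hk'
    exact ⟨k, hk, by rw [inv_mul_eq_iff_eq_mul, ← mul_assoc, e]; group⟩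
  surj k hk := by
    obtain ⟨k', hk', e⟩ := h.map k hk
    exact ⟨k', hk', by rw [inv_mul_eq_iff_eq_mul, ← mul_assoc, e]; group⟩

theorem conj_mem (h : Move s d K K') {x : W} (hx : x ∈ par s K) :
    d * x * d⁻¹ ∈ par s K' := by
  refine IsCox.conj_mem_par_of_gen (fun k hk => ?_) hx
  obtain ⟨k', hk', e⟩ := h.map k hk
  rw [e, mul_inv_cancel_right]
  exact mem_par hk'

theorem len_conj (hs : IsCox s) (h : Move s d K K') {x : W} (hx : x ∈ par s K) :
    len s (d * x * d⁻¹) = len s x := by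
  have h1 := IsCox.RMin.len_mul hs h.rmin hx
  have h2 := IsCox.LMin.len_mul hs h.lmin (h.conj_mem hx)
  rw [inv_mul_cancel_right] at h2
  omega

theorem longest_eq (hs : IsCox s) [Finite W] (h : Move s d K K') :
    d * longest s K = longest s K' * d := by
  rw [← hs.eq_longest (h.conj_mem (hs.longest_mem K)), inv_mul_cancel_right]
  intro k' hk'
  obtain ⟨k, hk, e⟩ := h.surj k' hk'
  have e2 : d * longest s K * d⁻¹ * s k' = d * (longest s K * s k) * d⁻¹ := by
    have : s k' = d * s k * d⁻¹ := by rw [e]; group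
    rw [this]; group
  rw [e2, h.len_conj hs (mul_mem (hs.longest_mem K) (mem_par hk)),
    h.len_conj hs (hs.longest_mem K)]
  exact (hs.longest_spec K).2 k hk

end Move

namespace IsCox

variable (hs : IsCox s) [Finite W]
include hs

/-- The longest element of `W_J`, up to the longest element of `W_K`, for `K ⊆ J`. -/
theorem exists_move {K J : Set σ} (h : K ⊆ J) :
    ∃ K' ⊆ J, Move s (longest s J * longest s K) K K' := by
  refine ⟨{j ∈ J | ∃ k ∈ K, longest s J * longest s K * s k = s j * (longest s J * longest s K)},
    fun _ h => h.1, ?_, ?_, ?_⟩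
  · exact RMax.mul_longest hs fun t ht => (hs.longest_spec J).2 t (h ht)
  · intro k hk
    obtain ⟨k', hk', e⟩ := hs.longest_conj hk
    obtain ⟨j, hj, e'⟩ := hs.longest_conj (h hk')
    have : longest s J * longest s K * s k = s j * (longest s J * longest s K) := by
      rw [mul_assoc, e, ← mul_assoc, e', mul_assoc]
    exact ⟨j, ⟨hj, k, hk, this⟩, this⟩
  · rintro j ⟨-, k, hk, e⟩
    exact ⟨k, hk, e⟩

/-- An element of `W_J` normalizing `W_K` for `J = K ∪ {i}` is trivial or
`w_J w_K`, if it is minimal in its coset. -/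
theorem eq_of_normalizes {K : Set σ} {i : σ} {x : W} (hx : x ∈ par s (insert i K))
    (hmin : RMin s K x) (h : ∀ k ∈ K, x * s k * x⁻¹ ∈ par s K) :
    x = 1 ∨ x = longest s (insert i K) * longest s K := by
  by_cases hx1 : x = 1
  · exact Or.inl hx1
  · right
    obtain ⟨t, ht, h1, h2⟩ := hs.exists_right_descent_par hx hx1
    have htK : t ∉ K := fun h => by
      have := hmin t h
      omega
    obtain rfl : t = i := by
      rcases ht with rfl | ht
      exacts [rfl, absurd ht htK]
    rw [← hs.eq_longest (m := x * longest s K)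
      (mul_mem hx (par_mono (Set.subset_insert _ _) (hs.longest_mem K)))]
    · rw [mul_assoc, hs.longest_mul_longest, mul_one]
    · rintro k (rfl | hk)
      -- For the extra generator, the factor `x w_K x⁻¹` still lies in `W_K` and is not longer than
      -- `w_K`, while `x s_i` is shorter than `x`.
      · have e : x * longest s K * s k = (x * longest s K * x⁻¹) * (x * s k) := by group
        have h3 := conj_mem_par_of_gen h (hs.longest_mem K)
        have h4 := hs.len_longest_mul h3
        have h5 := hs.len_mul_le (x * longest s K * x⁻¹) (x * s k)
        rw [RMin.len_mul hs hmin (hs.longest_mem K), e]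
        omega
      · exact RMin.mul_longest hs hmin k hk

/-- A nontrivial element moving `K` splits off the elementary move for a descent. -/
theorem Move.exists_split {K K' : Set σ} {d : W} (h : Move s d K K') {i : σ}
    (hi : len s (d * s i) < len s d) :
    ∃ d' K'', Move s (longest s (insert i K) * longest s K) K K'' ∧ Move s d' K'' K' ∧
      d = d' * (longest s (insert i K) * longest s K) ∧
      len s d = len s d' + len s (longest s (insert i K) * longest s K) ∧
      longest s (insert i K) * longest s K ≠ 1 ∧ K'' ⊆ insert i K := by
  set J := insert i K with hJ
  have hKJ : K ⊆ J := Set.subset_insert _ _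
  obtain ⟨K'', hK'', hm⟩ := hs.exists_move hKJ
  set v := longest s J * longest s K with hv
  -- Maximality of `d w_K` for all of `J` makes `d w_K w_J` minimal in its `W_J`-coset, so that
  -- lengths add in `d = d' v`.
  have hmax : RMax s J (d * longest s K) := by
    rintro k (rfl | hk)
    · have e : d * longest s K * s k = longest s K' * (d * s k) := by
        rw [h.longest_eq hs, mul_assoc]
      have h5 := hs.len_mul_le (longest s K') (d * s k)
      have h6 := IsCox.LMin.len_mul hs h.lmin (hs.longest_mem K')
      rw [e, h.longest_eq hs, h6]
      omega
    · exact RMin.mul_longest hs h.rmin k hk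
  have hd' := RMax.mul_longest hs hmax
  set d' := d * longest s K * longest s J with hd'_def
  have hvJ : v ∈ par s J := mul_mem (hs.longest_mem J) (par_mono hKJ (hs.longest_mem K))
  have hd : d = d' * v := by
    rw [hd'_def, hv, mul_assoc _ (longest s J), ← mul_assoc (longest s J), hs.longest_mul_longest,
      one_mul, mul_assoc, hs.longest_mul_longest, mul_one]
  have hlen := RMin.len_mul hs hd' hvJ
  rw [← hd] at hlen
  have hiK : i ∉ K := fun hiK => by
    have := h.rmin i hiK
    omega
  refine ⟨d', K'', hm, ⟨fun t ht => hd' t (hK'' ht), ?_, ?_⟩, hd, hlen, ?_, hK''⟩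
  · intro k'' hk''
    obtain ⟨k, hk, e⟩ := hm.surj k'' hk''
    obtain ⟨k', hk', e'⟩ := h.map k hk
    refine ⟨k', hk', mul_right_cancel (b := v) ?_⟩
    rw [mul_assoc, ← e, ← mul_assoc, ← hd, e', mul_assoc, ← hd]
  · intro k' hk'
    obtain ⟨k, hk, e⟩ := h.surj k' hk'
    obtain ⟨k'', hk'', e'⟩ := hm.map k hk
    refine ⟨k'', hk'', mul_right_cancel (b := v) ?_⟩
    rw [mul_assoc, ← e', ← mul_assoc, ← hd, e, mul_assoc, ← hd]
  -- If `v` were trivial, `w_J` and `w_K` would coincide and `i` would belong to `K`.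
  · intro h1
    rw [hv, mul_eq_one_iff_eq_inv, hs.longest_inv] at h1
    refine hiK ((hs.good_one_iff (A := K) (I := J)).1 ⟨(Move.one hs K).rmin, fun t ht => ?_⟩
      (Set.mem_insert _ _))
    rw [one_mul, ← h1]
    have := hs.len_mul_longest (mem_par (s := s) ht)
    rw [hs.len_s] at this
    omega

end IsCox

end Coxeter
end SplitBN
end

noncomputable section
namespace SplitBN

/-! ### Split BN-pairs: Bruhat decomposition and the Weyl group -/

theorem mem_mul {G : Type u} [Group G] {H : Subgroup G} {a b : G} (ha : a ∈ H) (hb : b ∈ H) :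
    a * b ∈ H := mul_mem ha hb

theorem conj_conj {G : Type u} [Group G] (g h : G) (H : Subgroup G) :
    conj g (conj h H) = conj (g * h) H := by
  ext x
  simp only [mem_conj, mul_inv_rev, mul_assoc]

theorem conj_mono {G : Type u} [Group G] (g : G) {H K : Subgroup G} (h : H ≤ K) :
    conj g H ≤ conj g K := Subgroup.map_mono h

theorem conj_eq_self {G : Type u} [Group G] {g : G} {H : Subgroup G} (h : g ∈ H) :
    conj g H = H := by
  ext x
  rw [mem_conj, Subgroup.mul_mem_cancel_right _ h, Subgroup.mul_mem_cancel_left _ (inv_mem h)]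

theorem conj_inf {G : Type u} [Group G] (g : G) (H K : Subgroup G) :
    conj g (H ⊓ K) = conj g H ⊓ conj g K := by
  ext x
  simp only [mem_conj, Subgroup.mem_inf]

namespace BNData.IsSplit

variable {G : Type u} [Group G] {σ : Type} {D : BNData G σ} {p : ℕ} (hD : D.IsSplit p)

theorem T_le_N (_ : D.IsSplit p) : D.T ≤ D.N := inf_le_right

theorem T_le_B (_ : D.IsSplit p) : D.T ≤ D.B := inf_le_left

theorem T_subgroupOf_normal (hD : D.IsSplit p) : (D.T.subgroupOf D.N).Normal :=
  ⟨fun t ht n => hD.T_normal n n.2 t ht⟩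

/-- The Weyl group `W = N/T`. -/
def W (_ : D.IsSplit p) : Type u := D.N ⧸ D.T.subgroupOf D.N

instance : Group hD.W :=
  have := hD.T_subgroupOf_normal
  inferInstanceAs (Group (D.N ⧸ D.T.subgroupOf D.N))

instance [Finite G] : Finite hD.W := inferInstanceAs (Finite (D.N ⧸ D.T.subgroupOf D.N))

/-- The class of `n ∈ N` in `W`. -/
def cls (n : G) (hn : n ∈ D.N) : hD.W := (QuotientGroup.mk (⟨n, hn⟩ : D.N) : D.N ⧸ _)

/-- A representative in `N` of an element of `W`. -/
def rep (w : hD.W) : G := ((Quotient.out w : D.N) : G)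

theorem rep_mem (w : hD.W) : hD.rep w ∈ D.N := (Quotient.out w : D.N).2

@[simp] theorem cls_rep (w : hD.W) : hD.cls (hD.rep w) (hD.rep_mem w) = w :=
  QuotientGroup.out_eq' w

theorem cls_eq {n m : G} {hn : n ∈ D.N} {hm : m ∈ D.N} :
    hD.cls n hn = hD.cls m hm ↔ n⁻¹ * m ∈ D.T :=
  QuotientGroup.eq.trans Iff.rfl

theorem cls_mul {n m : G} (hn : n ∈ D.N) (hm : m ∈ D.N) :
    hD.cls (n * m) (mem_mul hn hm) = hD.cls n hn * hD.cls m hm := rfl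

theorem cls_inv {n : G} (hn : n ∈ D.N) : hD.cls n⁻¹ (inv_mem hn) = (hD.cls n hn)⁻¹ := rfl

theorem cls_one : hD.cls 1 (one_mem _) = 1 := rfl

theorem cls_eq_one {n : G} {hn : n ∈ D.N} : hD.cls n hn = 1 ↔ n ∈ D.T := by
  rw [← hD.cls_one, eq_comm, cls_eq, inv_one, one_mul]

/-- The simple reflections. -/
def s (i : σ) : hD.W := hD.cls (D.r i) (hD.r_mem i)

theorem s_ne_one (i : σ) : hD.s i ≠ 1 := fun h => hD.r_notMem i (hD.cls_eq_one.1 h)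

theorem isGen : IsGen hD.s where
  sq i := by
    change hD.cls _ (hD.r_mem i) * hD.cls _ (hD.r_mem i) = 1
    rw [← cls_mul, cls_eq_one]
    exact hD.r_sq i
  gen w := by
    have key : ∀ n (hn : n ∈ D.T ⊔ Subgroup.closure (Set.range D.r)) (hn' : n ∈ D.N),
        ∃ ω, wprod hD.s ω = hD.cls n hn' := by
      intro n hn
      rw [← Subgroup.closure_eq D.T, ← Subgroup.closure_union] at hn
      refine Subgroup.closure_induction_left (p := fun n _ => ∀ hn' : n ∈ D.N,
        ∃ ω, wprod hD.s ω = hD.cls n hn') (fun _ => ⟨[], rfl⟩) ?_ ?_ hn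
      · rintro x hx y - ih hn'
        rcases hx with hx | ⟨i, rfl⟩
        · have hx' : x ∈ D.N := hD.T_le_N hx
          obtain ⟨ω, hω⟩ := ih ((Subgroup.mul_mem_cancel_left _ hx').1 hn')
          refine ⟨ω, ?_⟩
          rw [hω, cls_eq]
          have := hD.T_normal y⁻¹ (inv_mem ((Subgroup.mul_mem_cancel_left _ hx').1 hn')) x hx
          simpa [mul_assoc] using this
        · obtain ⟨ω, hω⟩ := ih ((Subgroup.mul_mem_cancel_left _ (hD.r_mem i)).1 hn')
          exact ⟨i :: ω, by rw [wprod_cons, hω]; rfl⟩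
      · rintro x hx y - ih hn'
        rcases hx with hx | ⟨i, rfl⟩
        · have hx' : x⁻¹ ∈ D.N := inv_mem (hD.T_le_N hx)
          obtain ⟨ω, hω⟩ := ih ((Subgroup.mul_mem_cancel_left _ hx').1 hn')
          refine ⟨ω, ?_⟩
          rw [hω, cls_eq]
          have := hD.T_normal y⁻¹ (inv_mem ((Subgroup.mul_mem_cancel_left _ hx').1 hn')) x⁻¹
            (inv_mem hx)
          simpa [mul_assoc] using this
        · have hy := (Subgroup.mul_mem_cancel_left _ (inv_mem (hD.r_mem i))).1 hn'
          obtain ⟨ω, hω⟩ := ih hy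
          refine ⟨i :: ω, ?_⟩
          rw [wprod_cons, hω, s, ← cls_mul, cls_eq]
          have h1 := hD.T_normal y⁻¹ (inv_mem hy) _ (inv_mem (hD.r_sq i))
          have e : (D.r i * y)⁻¹ * ((D.r i)⁻¹ * y) = y⁻¹ * (D.r i * D.r i)⁻¹ * y⁻¹⁻¹ := by group
          rw [e]
          exact h1
    rw [← hD.cls_rep w]
    exact key _ (by rw [hD.r_gen]; exact hD.rep_mem w) _

theorem cls_r_mul (i : σ) {n : G} (hn : n ∈ D.N) :
    hD.cls (D.r i * n) (mem_mul (hD.r_mem i) hn) = hD.s i * hD.cls n hn := rfl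

theorem cls_r_mul_rep (i : σ) (w : hD.W) :
    hD.cls (D.r i * hD.rep w) (mem_mul (hD.r_mem i) (hD.rep_mem w)) = hD.s i * w := by
  rw [cls_r_mul hD i (hD.rep_mem w), cls_rep]

theorem cls_rep_mul_r (i : σ) (w : hD.W) :
    hD.cls (hD.rep w * D.r i) (mem_mul (hD.rep_mem w) (hD.r_mem i)) = w * hD.s i := by
  rw [cls_mul hD (hD.rep_mem w) (hD.r_mem i), cls_rep]
  rfl

theorem cls_r_inv_mul (i : σ) {n : G} (hn : n ∈ D.N) :
    hD.cls ((D.r i)⁻¹ * n) (mem_mul (inv_mem (hD.r_mem i)) hn) = hD.s i * hD.cls n hn := by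
  rw [cls_mul hD (inv_mem (hD.r_mem i)) hn, cls_inv hD (hD.r_mem i)]
  exact congrArg (· * _) (hD.isGen.inv_s i)

/-- The double coset `B w B`. -/
def dc (w : hD.W) : Set G := {g | ∃ b ∈ D.B, ∃ b' ∈ D.B, g = b * hD.rep w * b'}

theorem mem_dc {n : G} (hn : n ∈ D.N) : n ∈ hD.dc (hD.cls n hn) := by
  have h := hD.cls_rep (hD.cls n hn)
  rw [cls_eq] at h
  exact ⟨1, one_mem _, _, hD.T_le_B h, by group⟩

theorem mul_mem_dc {w : hD.W} {g b : G} (hb : b ∈ D.B) (hg : g ∈ hD.dc w) : b * g ∈ hD.dc w := by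
  obtain ⟨a, ha, a', ha', rfl⟩ := hg
  exact ⟨b * a, mem_mul hb ha, a', ha', by simp only [mul_assoc]⟩

theorem dc_mul_mem {w : hD.W} {g b : G} (hb : b ∈ D.B) (hg : g ∈ hD.dc w) : g * b ∈ hD.dc w := by
  obtain ⟨a, ha, a', ha', rfl⟩ := hg
  exact ⟨a, ha, a' * b, mem_mul ha' hb, by simp only [mul_assoc]⟩

theorem mem_dc_iff {w : hD.W} {g n : G} (hn : n ∈ D.N) (hw : hD.cls n hn = w) :
    g ∈ hD.dc w ↔ ∃ b ∈ D.B, ∃ b' ∈ D.B, g = b * n * b' := by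
  constructor
  · rintro ⟨b, hb, b', hb', rfl⟩
    have h := hD.cls_rep w
    rw [← hw, cls_eq] at h
    refine ⟨b, hb, n⁻¹ * hD.rep w * b', mem_mul ?_ hb', by rw [← hw]; group⟩
    rw [← hw, ← inv_inv (n⁻¹ * _), mul_inv_rev, inv_inv]
    exact inv_mem (hD.T_le_B h)
  · rintro ⟨b, hb, b', hb', rfl⟩
    rw [← hw]
    exact hD.dc_mul_mem hb' (hD.mul_mem_dc hb (hD.mem_dc hn))

theorem inv_mem_dc {w : hD.W} {g : G} (hg : g ∈ hD.dc w) : g⁻¹ ∈ hD.dc w⁻¹ := by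
  obtain ⟨b, hb, b', hb', rfl⟩ := hg
  rw [hD.mem_dc_iff (inv_mem (hD.rep_mem w)) (by rw [cls_inv hD (hD.rep_mem w), cls_rep])]
  exact ⟨b'⁻¹, inv_mem hb', b⁻¹, inv_mem hb, by group⟩

theorem mem_dc_one {g : G} : g ∈ hD.dc 1 ↔ g ∈ D.B := by
  rw [hD.mem_dc_iff (one_mem _) hD.cls_one]
  constructor
  · rintro ⟨b, hb, b', hb', rfl⟩
    rw [mul_one]
    exact mem_mul hb hb'
  · intro h
    exact ⟨g, h, 1, one_mem _, by simp⟩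

theorem dc_s_mul {i : σ} {w : hD.W} {g h : G} (hh : h ∈ hD.dc (hD.s i)) (hg : g ∈ hD.dc w) :
    h * g ∈ hD.dc w ∨ h * g ∈ hD.dc (hD.s i * w) := by
  obtain ⟨a, ha, a', ha', rfl⟩ := (hD.mem_dc_iff (hD.r_mem i) rfl).1 hh
  obtain ⟨b, hb, b', hb', rfl⟩ := hg
  obtain ⟨c, hc, c', hc', e⟩ := hD.mul_mem i (a' * b) (mem_mul ha' hb) _ (hD.rep_mem w)
  have e' : a * D.r i * a' * (b * hD.rep w * b') = a * (D.r i * (a' * b) * hD.rep w) * b' := by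
    simp only [mul_assoc]
  rw [e']
  refine e.imp (fun e => ?_) fun e => ?_
  · rw [e, hD.mem_dc_iff (hD.rep_mem w) (hD.cls_rep w)]
    exact ⟨a * c, mem_mul ha hc, c' * b', mem_mul hc' hb', by simp only [mul_assoc]⟩
  · rw [e, hD.mem_dc_iff (mem_mul (hD.r_mem i) (hD.rep_mem w)) (hD.cls_r_mul_rep i w)]
    exact ⟨a * c, mem_mul ha hc, c' * b', mem_mul hc' hb', by simp only [mul_assoc]⟩

theorem dc_mul_s {i : σ} {w : hD.W} {g h : G} (hh : h ∈ hD.dc (hD.s i)) (hg : g ∈ hD.dc w) :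
    g * h ∈ hD.dc w ∨ g * h ∈ hD.dc (w * hD.s i) := by
  have h1 := hD.inv_mem_dc hh
  rw [hD.isGen.inv_s] at h1
  refine (hD.dc_s_mul h1 (hD.inv_mem_dc hg)).imp (fun h => ?_) fun h => ?_
  · have := hD.inv_mem_dc h
    simpa using this
  · have := hD.inv_mem_dc h
    simpa [hD.isGen.inv_s] using this

theorem r_mem_dc (i : σ) : D.r i ∈ hD.dc (hD.s i) := hD.mem_dc (hD.r_mem i)

theorem r_inv_mem_dc (i : σ) : (D.r i)⁻¹ ∈ hD.dc (hD.s i) := by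
  have := hD.inv_mem_dc (hD.r_mem_dc i)
  rwa [hD.isGen.inv_s] at this

/-- Disjointness in the Bruhat decomposition. A left letter of the shorter element is stripped off;
the other element either loses the same letter or is unchanged, and the latter contradicts the
choice of the shorter one. -/
theorem dc_eq_of_mem {w w' : hD.W} {g : G} (hg : g ∈ hD.dc w) (hg' : g ∈ hD.dc w') : w = w' := by
  have key : ∀ (n : ℕ) (w w' : hD.W), len hD.s w = n → len hD.s w ≤ len hD.s w' → ∀ g,
      g ∈ hD.dc w → g ∈ hD.dc w' → w = w' := by
    intro n
    induction n with
    | zero =>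
      intro w w' hn _ g hg hg'
      rw [hD.isGen.len_eq_zero] at hn
      subst hn
      rw [mem_dc_one] at hg
      obtain ⟨b, hb, b', hb', rfl⟩ := hg'
      rw [Subgroup.mul_mem_cancel_right _ hb', Subgroup.mul_mem_cancel_left _ hb] at hg
      rw [← hD.cls_rep w', eq_comm, cls_eq_one]
      exact ⟨hg, hD.rep_mem w'⟩
    | succ n ih =>
      intro w w' hn hle g hg hg'
      have hw1 : w ≠ 1 := by
        rintro rfl
        rw [len_one] at hn
        omega
      obtain ⟨i, w₁, rfl, h1⟩ := hD.isGen.exists_left_descent hw1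
      have hr : D.r i * hD.rep w₁ ∈ hD.dc (hD.s i * w₁) :=
        (hD.mem_dc_iff (mem_mul (hD.r_mem i) (hD.rep_mem w₁)) (hD.cls_r_mul_rep i w₁)).2
          ⟨1, one_mem _, 1, one_mem _, by simp⟩
      have hr' : D.r i * hD.rep w₁ ∈ hD.dc w' := by
        obtain ⟨b, hb, b', hb', rfl⟩ := (hD.mem_dc_iff (mem_mul (hD.r_mem i) (hD.rep_mem w₁))
          (hD.cls_r_mul_rep i w₁)).1 hg
        have := hD.dc_mul_mem (inv_mem hb') (hD.mul_mem_dc (inv_mem hb) hg')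
        simpa [mul_assoc] using this
      have hw₁ : hD.rep w₁ ∈ hD.dc w₁ := by
        have := hD.mem_dc (hD.rep_mem w₁)
        rwa [cls_rep] at this
      have h2 := hD.isGen.len_mul_le (hD.s i) (hD.s i * w')
      rw [← mul_assoc, hD.isGen.sq, one_mul] at h2
      have h3 := len_wprod_le (s := hD.s) [i]
      simp only [wprod, List.map_cons, List.map_nil, List.prod_cons, List.prod_nil, mul_one,
        List.length_cons, List.length_nil] at h3
      rcases hD.dc_s_mul (hD.r_inv_mem_dc i) hr' with h | h
      · rw [inv_mul_cancel_left] at h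
        have := ih w₁ w' (by omega) (by omega) _ hw₁ h
        subst this
        omega
      · rw [inv_mul_cancel_left] at h
        have := ih w₁ (hD.s i * w') (by omega) (by omega) _ hw₁ h
        rw [this, ← mul_assoc, hD.isGen.sq, one_mul]
  rcases le_total (len hD.s w) (len hD.s w') with h | h
  · exact key _ w w' rfl h g hg hg'
  · exact (key _ w' w rfl h g hg' hg).symm

theorem rep_mem_dc (w : hD.W) : hD.rep w ∈ hD.dc w := by
  have := hD.mem_dc (hD.rep_mem w)
  rwa [cls_rep] at this

/-- Write `w = w' s_j`. If the product stayed in `B w B`, removing `s_j` on the right would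
contradict the case of `w'` by disjointness. The hypothesis is a weak inequality because `ℓ(s w) ≠
ℓ(w)` is only deduced from this in `cox`. -/
theorem dc_mul_of_le {i : σ} {w : hD.W} (hle : len hD.s w ≤ len hD.s (hD.s i * w)) {g h : G}
    (hh : h ∈ hD.dc (hD.s i)) (hg : g ∈ hD.dc w) : h * g ∈ hD.dc (hD.s i * w) := by
  induction hn : len hD.s w generalizing w g with
  | zero =>
    rw [hD.isGen.len_eq_zero] at hn
    subst hn
    rw [mul_one]
    exact hD.dc_mul_mem (hD.mem_dc_one.1 hg) hh
  | succ n ih =>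
    have hw1 : w ≠ 1 := by
      rintro rfl
      rw [len_one] at hn
      omega
    obtain ⟨j, w', rfl, h1⟩ := hD.isGen.exists_right_descent hw1
    refine (hD.dc_s_mul hh hg).resolve_left fun hcontra => ?_
    obtain ⟨b, hb, b', hb', rfl⟩ := (hD.mem_dc_iff (mem_mul (hD.rep_mem w') (hD.r_mem j))
      (hD.cls_rep_mul_r j w')).1 hg
    have h3 := len_wprod_le (s := hD.s) [j]
    simp only [wprod, List.map_cons, List.map_nil, List.prod_cons, List.prod_nil, mul_one,
      List.length_cons, List.length_nil] at h3
    have h4 := hD.isGen.len_mul_le (hD.s i * w') (hD.s j)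
    rw [mul_assoc] at h4
    have h5 := ih (w := w') (g := b * hD.rep w') (by omega)
      (hD.mul_mem_dc hb (hD.rep_mem_dc w')) (by omega)
    have h6 := hD.dc_mul_s (hD.r_inv_mem_dc j) (hD.dc_mul_mem (inv_mem hb') hcontra)
    have e : h * (b * (hD.rep w' * D.r j) * b') * b'⁻¹ * (D.r j)⁻¹ = h * (b * hD.rep w') := by
      group
    rw [e, mul_assoc w', hD.isGen.sq, mul_one] at h6
    rcases h6 with h6 | h6
    · have h7 := hD.dc_eq_of_mem h5 h6
      rw [← mul_assoc, h7, mul_assoc w', hD.isGen.sq, mul_one] at hle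
      omega
    · have := hD.dc_eq_of_mem h5 h6
      exact hD.s_ne_one i (mul_eq_right.1 this)

theorem exists_thick (i : σ) :
    ∃ b ∈ D.B, D.r i * b * (D.r i)⁻¹ ∉ D.B ∧ D.r i * b * (D.r i)⁻¹ ∈ hD.dc (hD.s i) := by
  obtain ⟨b, hb, h⟩ := hD.thick i
  refine ⟨b, hb, h, ?_⟩
  have h1 := hD.dc_s_mul (hD.r_mem_dc i) (hD.mul_mem_dc hb (hD.r_inv_mem_dc i))
  rw [hD.isGen.sq, ← mul_assoc, mem_dc_one] at h1
  exact h1.resolve_right h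

theorem r_inv_mul_mem_dc {i : σ} {n : G} {hn : n ∈ D.N} :
    (D.r i)⁻¹ * n ∈ hD.dc (hD.s i * hD.cls n hn) := by
  rw [← cls_r_inv_mul hD i hn]
  exact hD.mem_dc _

/-- Thickness gives an element `r b r⁻¹` of `B s B`. Its product with `w`, or with `w s_j`, can be
located in two ways: as an element of `B s B` times a cell, or by multiplying with `r⁻¹`, `b` and
`r` in turn. If the lengths agreed, or did not fold, disjointness of the cells would give `s = 1`.
-/
theorem cox : IsCox hD.s where
  sq := hD.isGen.sq
  gen := hD.isGen.gen
  inj i j h := hD.r_inj i j (hD.cls_eq.1 h)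
  ne i w hlen := by
    obtain ⟨b, hb, -, h⟩ := hD.exists_thick i
    have h1 := hD.dc_mul_of_le hlen.ge h (hD.rep_mem_dc w)
    have h2 := hD.r_inv_mul_mem_dc (i := i) (n := hD.rep w) (hn := hD.rep_mem w)
    rw [cls_rep] at h2
    have h3 := hD.dc_mul_of_le (w := hD.s i * w) (by
      rw [← mul_assoc, hD.isGen.sq, one_mul, hlen]) (hD.r_mem_dc i) (hD.mul_mem_dc hb h2)
    have e : D.r i * (b * ((D.r i)⁻¹ * hD.rep w)) = D.r i * b * (D.r i)⁻¹ * hD.rep w := by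
      simp only [mul_assoc]
    rw [e] at h3
    have h4 := hD.dc_eq_of_mem h1 h3
    rw [← mul_assoc, hD.isGen.sq, one_mul] at h4
    exact hD.s_ne_one i (mul_eq_right.1 h4)
  fold i j w h1 h2 h3 := by
    obtain ⟨b, hb, -, h⟩ := hD.exists_thick i
    have hn : hD.rep w * D.r j ∈ D.N := mem_mul (hD.rep_mem w) (hD.r_mem j)
    have hmk : hD.cls _ hn = w * hD.s j := hD.cls_rep_mul_r j w
    have h4 := hD.r_inv_mul_mem_dc (i := i) (hn := hn)
    rw [hmk] at h4
    rw [mul_assoc] at h3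
    have h5 := hD.dc_mul_of_le (w := hD.s i * (w * hD.s j)) (by
      rw [← mul_assoc (hD.s i) (hD.s i), hD.isGen.sq, one_mul]; exact h3.le) (hD.r_mem_dc i)
      (hD.mul_mem_dc hb h4)
    have e : D.r i * (b * ((D.r i)⁻¹ * (hD.rep w * D.r j))) =
        D.r i * b * (D.r i)⁻¹ * hD.rep w * D.r j := by
      simp only [mul_assoc]
    rw [e, ← mul_assoc (hD.s i) (hD.s i), hD.isGen.sq, one_mul] at h5
    have h6 := hD.dc_mul_of_le h1.le h (hD.rep_mem_dc w)
    rcases hD.dc_mul_s (hD.r_mem_dc j) h6 with h7 | h7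
    · exact hD.dc_eq_of_mem h7 h5
    · have h8 := hD.dc_eq_of_mem h7 h5
      rw [mul_assoc] at h8
      exact absurd (mul_eq_right.1 h8) (hD.s_ne_one i)

theorem s_mul_mem_dc {i : σ} {w : hD.W} (hlt : len hD.s w < len hD.s (hD.s i * w)) {g h : G}
    (hh : h ∈ hD.dc (hD.s i)) (hg : g ∈ hD.dc w) : h * g ∈ hD.dc (hD.s i * w) :=
  hD.dc_mul_of_le hlt.le hh hg

theorem mul_mem_dc_of_len {x y : hD.W} (h : len hD.s (x * y) = len hD.s x + len hD.s y) {g g' : G}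
    (hg : g ∈ hD.dc x) (hg' : g' ∈ hD.dc y) : g * g' ∈ hD.dc (x * y) := by
  induction hn : len hD.s x generalizing x g with
  | zero =>
    rw [hD.isGen.len_eq_zero] at hn
    subst hn
    rw [one_mul]
    exact hD.mul_mem_dc (hD.mem_dc_one.1 hg) hg'
  | succ n ih =>
    have hx1 : x ≠ 1 := by
      rintro rfl
      rw [len_one] at hn
      omega
    obtain ⟨i, x', rfl, h1⟩ := hD.isGen.exists_left_descent hx1
    obtain ⟨b, hb, b', hb', rfl⟩ := (hD.mem_dc_iff (mem_mul (hD.r_mem i) (hD.rep_mem x'))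
      (hD.cls_r_mul_rep i x')).1 hg
    have h2 := hD.cox.len_s_mul i (x' * y)
    have h3 := hD.cox.len_mul_le x' y
    rw [mul_assoc] at h ⊢
    have h4 := ih (x := x') (g := hD.rep x' * b') (by omega)
      (hD.dc_mul_mem hb' (hD.rep_mem_dc x')) (by omega)
    have h5 := hD.s_mul_mem_dc (by omega) (hD.r_mem_dc i) h4
    have e : b * (D.r i * hD.rep x') * b' * g' = b * (D.r i * (hD.rep x' * b' * g')) := by
      simp only [mul_assoc]
    rw [e]
    exact hD.mul_mem_dc hb h5

/-- Uniqueness of galleries. -/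
theorem mem_B_of_gallery {x y : hD.W} (h : len hD.s (x * y) = len hD.s x + len hD.s y) {n c m : G}
    {hn : n ∈ D.N} (hx : hD.cls n hn = x) (hc : c ∈ D.B) {hm : m ∈ D.N} (hy : hD.cls m hm = y)
    (hcm : n⁻¹ * c * n * m ∈ hD.dc y) : n⁻¹ * c * n ∈ D.B := by
  induction hl : len hD.s x generalizing x n c with
  | zero =>
    rw [hD.isGen.len_eq_zero] at hl
    subst hl
    rw [cls_eq_one] at hx
    exact mem_mul (mem_mul (inv_mem (hD.T_le_B hx)) hc) (hD.T_le_B hx)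
  | succ k ih =>
    have hx1 : x ≠ 1 := by
      rintro rfl
      rw [len_one] at hl
      omega
    obtain ⟨i, x', rfl, h1⟩ := hD.isGen.exists_left_descent hx1
    have h2 := hD.cox.len_s_mul i (x' * y)
    have h3 := hD.cox.len_mul_le x' y
    rw [mul_assoc] at h
    have hn' : (D.r i)⁻¹ * n ∈ D.N := mem_mul (inv_mem (hD.r_mem i)) hn
    have hx' : hD.cls _ hn' = x' := by
      rw [cls_r_inv_mul hD i hn, hx, ← mul_assoc, hD.isGen.sq, one_mul]
    have e : ((D.r i)⁻¹ * n)⁻¹ * ((D.r i)⁻¹ * c * D.r i) * ((D.r i)⁻¹ * n) = n⁻¹ * c * n := by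
      group
    have hd := hD.dc_s_mul (hD.r_inv_mem_dc i) (hD.mul_mem_dc hc (hD.r_mem_dc i))
    rw [hD.isGen.sq, ← mul_assoc, mem_dc_one] at hd
    rcases hd with hd | hd
    -- If `r⁻¹ c r` were in `B s B`, one element would lie in both `B x'y B` and `B s x'y B`.
    · exfalso
      have hz : ((D.r i)⁻¹ * n) * (n⁻¹ * c * n * m) ∈ hD.dc (x' * y) := by
        refine hD.mul_mem_dc_of_len (by omega) ?_ hcm
        rw [← hx']
        exact hD.mem_dc hn'
      have hz' : ((D.r i)⁻¹ * n) * m ∈ hD.dc (x' * y) := by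
        rw [← hx', ← hy, ← cls_mul]
        exact hD.mem_dc _
      have hz'' := hD.s_mul_mem_dc (by omega) hd hz'
      have e' : (D.r i)⁻¹ * c * D.r i * ((D.r i)⁻¹ * n * m) =
          (D.r i)⁻¹ * n * (n⁻¹ * c * n * m) := by group
      rw [e'] at hz''
      exact hD.s_ne_one i (mul_eq_right.1 (hD.dc_eq_of_mem hz'' hz))
    · have := ih (x := x') (n := (D.r i)⁻¹ * n) (c := (D.r i)⁻¹ * c * D.r i) (by omega)
        (hn := hn') hx' hd (by rw [e]; exact hcm) (by omega)
      rwa [e] at this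

/-- When lengths add, `n B` lies on a minimal gallery from `B` to `n m B`, and an element fixing
both ends fixes the gallery. -/
theorem B_inf_conj_le {n m : G} {hn : n ∈ D.N} {hm : m ∈ D.N}
    (h : len hD.s (hD.cls n hn * hD.cls m hm) = len hD.s (hD.cls n hn) + len hD.s (hD.cls m hm)) :
    D.B ⊓ conj (n * m) D.B ≤ conj n D.B := by
  intro c hcc
  obtain ⟨hc, hc'⟩ := Subgroup.mem_inf.1 hcc
  rw [mem_conj] at hc' ⊢
  refine hD.mem_B_of_gallery h rfl hc rfl (hm := hm) ?_
  have e : n⁻¹ * c * n * m = m * ((n * m)⁻¹ * c * (n * m)) := by group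
  rw [e]
  exact hD.dc_mul_mem hc' (hD.mem_dc hm)

/-- The element `n c m` lies in `B n m B`. Writing it as `a n m a'`, uniqueness of galleries shows
that `n⁻¹ a n` is in `B`; this is the first factor, and `m a' m⁻¹` the second. -/
theorem B_eq_mul {n m : G} {hn : n ∈ D.N} {hm : m ∈ D.N}
    (h : len hD.s (hD.cls n hn * hD.cls m hm) = len hD.s (hD.cls n hn) + len hD.s (hD.cls m hm))
    {c : G} (hc : c ∈ D.B) :
    ∃ b₁ ∈ D.B ⊓ conj n⁻¹ D.B, ∃ b₂ ∈ D.B ⊓ conj m D.B, c = b₁ * b₂ := by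
  have h1 := hD.mul_mem_dc_of_len h (hD.mem_dc hn) (hD.mul_mem_dc hc (hD.mem_dc hm))
  obtain ⟨a, ha, a', ha', e⟩ := (hD.mem_dc_iff (mem_mul hn hm) (hD.cls_mul hn hm)).1 h1
  have e1 : n⁻¹ * a * n = c * (m * a'⁻¹ * m⁻¹) := by
    have : a = n * (c * m) * a'⁻¹ * m⁻¹ * n⁻¹ := by rw [e]; group
    rw [this]; group
  have h2 : n⁻¹ * a * n ∈ D.B := hD.mem_B_of_gallery h rfl ha rfl (hm := hm) (by
    have : n⁻¹ * a * n * m = c * m * a'⁻¹ := by rw [e1]; group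
    rw [this]
    exact hD.dc_mul_mem (inv_mem ha') (hD.mul_mem_dc hc (hD.mem_dc hm)))
  refine ⟨n⁻¹ * a * n, Subgroup.mem_inf.2 ⟨h2, ?_⟩, m * a' * m⁻¹, Subgroup.mem_inf.2 ⟨?_, ?_⟩,
    by rw [e1]; group⟩
  · rw [mem_conj]
    have : n⁻¹⁻¹ * (n⁻¹ * a * n) * n⁻¹ = a := by group
    rwa [this]
  · have : m * a' * m⁻¹ = (n⁻¹ * a * n)⁻¹ * c := by rw [e1]; group
    rw [this]
    exact mem_mul (inv_mem h2) hc
  · rw [mem_conj]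
    have : m⁻¹ * (m * a' * m⁻¹) * m = a' := by group
    rwa [this]

end BNData.IsSplit
end SplitBN
end

noncomputable section
set_option linter.unusedSectionVars false
namespace SplitBN

/-! ### Levi decompositions -/

theorem exists_mul_of_mem_sup {G : Type u} [Group G] {H K : Subgroup G}
    (hn : ∀ h ∈ H, ∀ k ∈ K, h * k * h⁻¹ ∈ K) {g : G} (hg : g ∈ K ⊔ H) :
    ∃ k ∈ K, ∃ h ∈ H, g = k * h := by
  rw [← Subgroup.closure_eq H, ← Subgroup.closure_eq K, ← Subgroup.closure_union] at hg
  have key : ∀ x y, x ∈ (K : Set G) ∪ H → (∃ k ∈ K, ∃ h ∈ H, y = k * h) →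
      ∃ k ∈ K, ∃ h ∈ H, x * y = k * h := by
    rintro x _ (hx | hx) ⟨k, hk, h, hh, rfl⟩
    · exact ⟨x * k, mul_mem hx hk, h, hh, by group⟩
    · exact ⟨_, hn x hx k hk, x * h, mul_mem hx hh, by group⟩
  refine Subgroup.closure_induction_left (p := fun g _ => ∃ k ∈ K, ∃ h ∈ H, g = k * h)
    ⟨1, one_mem _, 1, one_mem _, by simp⟩ (fun x hx y _ h => key x y hx h) ?_ hg
  refine fun x hx y _ h => key x⁻¹ y ?_ h
  exact hx.imp (fun h => inv_mem (S := Subgroup G) h) (fun h => inv_mem (S := Subgroup G) h)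

theorem mem_par_univ {σ : Type} {W : Type*} [Group W] {s : σ → W} (hs : IsGen s) (w : W) :
    w ∈ par s Set.univ := by
  obtain ⟨ω, rfl⟩ := hs.gen w
  exact wprod_mem_par fun i _ => Set.mem_univ i

namespace BNData.IsSplit

variable {G : Type u} [Group G] {σ : Type} {D : BNData G σ} {p : ℕ}
  (hD : D.IsSplit p)

theorem exists_UT (hD : D.IsSplit p) {b : G} (hb : b ∈ D.B) : ∃ u ∈ D.U, ∃ t ∈ D.T, b = u * t := by
  rw [← hD.UT] at hb
  exact exists_mul_of_mem_sup (fun t ht u hu => hD.U_normal t (hD.T_le_B ht) u hu) hb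

theorem conj_U (hD : D.IsSplit p) {b : G} (hb : b ∈ D.B) : conj b D.U = D.U := by
  ext x
  rw [mem_conj]
  constructor
  · intro h
    have := hD.U_normal b hb _ h
    simpa [mul_assoc] using this
  · intro h
    have := hD.U_normal b⁻¹ (inv_mem hb) _ h
    simpa [mul_assoc] using this

/-- `w U w⁻¹` -/
def Uc (w : hD.W) : Subgroup G := conj (hD.rep w) D.U

theorem conj_eq_Uc {n : G} (hn : n ∈ D.N) : conj n D.U = hD.Uc (hD.cls n hn) := by
  have h := hD.cls_rep (hD.cls n hn)
  rw [cls_eq] at h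
  have e : n = hD.rep (hD.cls n hn) * ((hD.rep (hD.cls n hn))⁻¹ * n) := by group
  conv_lhs => rw [e]
  rw [← conj_conj, hD.conj_U (hD.T_le_B h)]
  rfl

theorem Uc_one : hD.Uc 1 = D.U := by
  rw [← cls_one, ← hD.conj_eq_Uc (one_mem _)]
  exact conj_eq_self (one_mem _)

theorem conj_Uc {n : G} (hn : n ∈ D.N) (w : hD.W) :
    conj n (hD.Uc w) = hD.Uc (hD.cls n hn * w) := by
  have h := hD.cls_mul hn (hD.rep_mem w)
  rw [cls_rep] at h
  rw [Uc, conj_conj, hD.conj_eq_Uc (mem_mul hn (hD.rep_mem w)), h]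

theorem conj_B {n m : G} {hn : n ∈ D.N} {hm : m ∈ D.N} (h : hD.cls n hn = hD.cls m hm) :
    conj n D.B = conj m D.B := by
  rw [cls_eq] at h
  have e : m = n * (n⁻¹ * m) := by group
  rw [e, ← conj_conj, conj_eq_self (hD.T_le_B h)]

include hD

theorem exists_pow_eq_one {u : G} (hu : u ∈ D.U) : ∃ k : ℕ, u ^ p ^ k = 1 := by
  obtain ⟨k, hk⟩ := hD.U_pGroup ⟨u, hu⟩
  exact ⟨k, by simpa using congrArg Subtype.val hk⟩

variable [Finite G]

theorem eq_one_of_mem_T {t : G} (ht : t ∈ D.T) {k : ℕ} (h : t ^ p ^ k = 1) : t = 1 := by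
  have h1 : orderOf t ∣ Nat.card D.T := by
    have := orderOf_dvd_natCard (⟨t, ht⟩ : D.T)
    rwa [Subgroup.orderOf_mk] at this
  have h2 : orderOf t ∣ p ^ k := orderOf_dvd_of_pow_eq_one h
  rw [← orderOf_eq_one_iff]
  exact Nat.eq_one_of_dvd_coprimes (hD.T_card.pow_right k) h1 h2

theorem eq_one_of_mem {g : G} (hu : g ∈ D.U) (ht : g ∈ D.T) : g = 1 := by
  obtain ⟨k, hk⟩ := hD.exists_pow_eq_one hu
  exact hD.eq_one_of_mem_T ht hk

/-- Modulo `U` the element becomes an element of `T`, whose order is prime to `p`. -/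
theorem mem_U_of_pow {b : G} (hb : b ∈ D.B) {k : ℕ} (h : b ^ p ^ k = 1) : b ∈ D.U := by
  obtain ⟨u, hu, t, ht, rfl⟩ := hD.exists_UT hb
  have key : ∀ n : ℕ, ∃ u' ∈ D.U, (u * t) ^ n = u' * t ^ n := by
    intro n
    induction n with
    | zero => exact ⟨1, one_mem _, by simp⟩
    | succ n ih =>
      obtain ⟨u', hu', e⟩ := ih
      refine ⟨u' * (t ^ n * u * (t ^ n)⁻¹), mem_mul hu'
        (hD.U_normal _ (pow_mem (hD.T_le_B ht) n) u hu), ?_⟩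
      rw [pow_succ, e, pow_succ]
      group
  obtain ⟨u', hu', e⟩ := key (p ^ k)
  rw [h] at e
  have h1 : t ^ p ^ k ∈ D.U := by
    rw [← inv_eq_of_mul_eq_one_right e.symm]
    exact inv_mem hu'
  obtain ⟨j, hj⟩ := hD.exists_pow_eq_one h1
  rw [← pow_mul, ← pow_add] at hj
  rw [hD.eq_one_of_mem_T ht hj, mul_one]
  exact hu

/-- A `p`-element of `n B n⁻¹` is in `n U n⁻¹`. -/
theorem mem_Uc_of_mem {g n : G} {hn : n ∈ D.N} {a : hD.W} (hg : g ∈ hD.Uc a)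
    (h : g ∈ conj n D.B) : g ∈ hD.Uc (hD.cls n hn) := by
  rw [← hD.conj_eq_Uc, mem_conj]
  rw [mem_conj] at h
  rw [Uc, mem_conj] at hg
  obtain ⟨k, hk⟩ := hD.exists_pow_eq_one hg
  refine hD.mem_U_of_pow h (k := k) ?_
  have key : ∀ x : G, (x⁻¹ * g * x) ^ p ^ k = x⁻¹ * g ^ p ^ k * x := by
    intro x
    have := conj_pow (a := x⁻¹) (b := g) (i := p ^ k)
    rwa [inv_inv] at this
  rw [key] at hk ⊢
  have : g ^ p ^ k = 1 := by
    have h2 : hD.rep a * ((hD.rep a)⁻¹ * g ^ p ^ k * hD.rep a) * (hD.rep a)⁻¹ = g ^ p ^ k := by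
      group
    rw [← h2, hk]
    group
  rw [this]
  group

theorem Uc_le_conj_B {n : G} (hn : n ∈ D.N) : hD.Uc (hD.cls n hn) ≤ conj n D.B := by
  rw [← hD.conj_eq_Uc]
  exact conj_mono _ hD.U_le

/-- Convexity. -/
theorem Uc_inf_le {a b c : hD.W}
    (h : len hD.s (a⁻¹ * c) = len hD.s (a⁻¹ * b) + len hD.s (b⁻¹ * c)) :
    hD.Uc a ⊓ hD.Uc c ≤ hD.Uc b := by
  have key : ∀ x y : hD.W, len hD.s (x * y) = len hD.s x + len hD.s y →
      hD.Uc 1 ⊓ hD.Uc (x * y) ≤ hD.Uc x := by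
    intro x y hxy g hg
    obtain ⟨h1, h2⟩ := Subgroup.mem_inf.1 hg
    have e := hD.cls_mul (hD.rep_mem x) (hD.rep_mem y)
    rw [cls_rep, cls_rep] at e
    have h3 := hD.B_inf_conj_le (hn := hD.rep_mem x) (hm := hD.rep_mem y)
      (by rw [cls_rep, cls_rep]; exact hxy)
    rw [← hD.cls_rep x]
    refine hD.mem_Uc_of_mem h1 (h3 (Subgroup.mem_inf.2 ⟨?_, ?_⟩))
    · rw [Uc_one] at h1
      exact hD.U_le h1
    · rw [← e] at h2
      exact hD.Uc_le_conj_B _ h2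
  have h1 := key (a⁻¹ * b) (b⁻¹ * c) (by rw [← h]; congr 1; group)
  have h2 := conj_mono (hD.rep a) h1
  rw [conj_inf, hD.conj_Uc (hD.rep_mem a), hD.conj_Uc (hD.rep_mem a), hD.conj_Uc (hD.rep_mem a),
    cls_rep] at h2
  have e1 : a * (a⁻¹ * b * (b⁻¹ * c)) = c := by group
  have e2 : a * (a⁻¹ * b) = b := by group
  rwa [mul_one, e1, e2] at h2

theorem conj_T_Uc {t : G} (ht : t ∈ D.T) (w : hD.W) : conj t (hD.Uc w) = hD.Uc w := by
  rw [hD.conj_Uc (hD.T_le_N ht), hD.cls_eq_one.2 ht, one_mul]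

theorem T_le_conj_B {n : G} (hn : n ∈ D.N) : D.T ≤ conj n D.B := by
  intro t ht
  rw [mem_conj]
  have := hD.T_normal n⁻¹ (inv_mem hn) t ht
  rw [inv_inv] at this
  exact hD.T_le_B this

/-- This is `B_eq_mul` with the components in `T` collected on the right; their product lies in `U ∩
T = 1`. -/
theorem exists_U_mul {x y : hD.W} (h : len hD.s (x * y) = len hD.s x + len hD.s y) {u : G}
    (hu : u ∈ D.U) : ∃ u₁ ∈ D.U ⊓ hD.Uc x⁻¹, ∃ u₂ ∈ D.U ⊓ hD.Uc y, u = u₁ * u₂ := by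
  obtain ⟨b₁, h1, b₂, h2, rfl⟩ := hD.B_eq_mul (hn := hD.rep_mem x) (hm := hD.rep_mem y)
    (by rw [cls_rep, cls_rep]; exact h) (hD.U_le hu)
  have key : ∀ (n : G) (hn : n ∈ D.N), ∀ b ∈ D.B ⊓ conj n D.B,
      ∃ u ∈ D.U ⊓ hD.Uc (hD.cls n hn), ∃ t ∈ D.T, b = u * t := by
    intro n hn b hb
    obtain ⟨hb, hb'⟩ := Subgroup.mem_inf.1 hb
    obtain ⟨u, hu, t, ht, rfl⟩ := hD.exists_UT hb
    have h1 : u ∈ conj n D.B := by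
      rwa [Subgroup.mul_mem_cancel_right _ (hD.T_le_conj_B hn ht)] at hb'
    refine ⟨u, Subgroup.mem_inf.2 ⟨hu, ?_⟩, t, ht, rfl⟩
    rw [← hD.Uc_one] at hu
    exact hD.mem_Uc_of_mem hu h1
  obtain ⟨u₁, hu₁, t₁, ht₁, rfl⟩ := key _ (inv_mem (hD.rep_mem x)) b₁ h1
  obtain ⟨u₂, hu₂, t₂, ht₂, rfl⟩ := key _ (hD.rep_mem y) b₂ h2
  rw [cls_inv hD (hD.rep_mem x), cls_rep] at hu₁
  rw [cls_rep] at hu₂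
  have h3 : t₁ * u₂ * t₁⁻¹ ∈ D.U ⊓ hD.Uc y := by
    have : conj t₁ (D.U ⊓ hD.Uc y) = D.U ⊓ hD.Uc y := by
      rw [conj_inf, hD.conj_T_Uc ht₁, hD.conj_U (hD.T_le_B ht₁)]
    rw [← this, mem_conj]
    simpa [mul_assoc] using hu₂
  have e : u₁ * t₁ * (u₂ * t₂) = u₁ * (t₁ * u₂ * t₁⁻¹) * (t₁ * t₂) := by group
  have h4 : u₁ * (t₁ * u₂ * t₁⁻¹) ∈ D.U :=
    mem_mul (Subgroup.mem_inf.1 hu₁).1 (Subgroup.mem_inf.1 h3).1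
  rw [e, Subgroup.mul_mem_cancel_left _ h4] at hu
  have h5 := hD.eq_one_of_mem hu (mem_mul ht₁ ht₂)
  exact ⟨u₁, hu₁, _, h3, by rw [e, h5, mul_one]⟩

/-! The longest element. -/

/-- The longest element of `W`. -/
def w0 : hD.W := longest hD.s Set.univ

theorem w0_mul_w0 : hD.w0 * hD.w0 = 1 := hD.cox.longest_mul_longest _

theorem w0_inv : hD.w0⁻¹ = hD.w0 := hD.cox.longest_inv _

theorem len_w0_mul (w : hD.W) : len hD.s (hD.w0 * w) + len hD.s w = len hD.s hD.w0 :=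
  hD.cox.len_longest_mul (mem_par_univ hD.isGen w)

theorem len_mul_w0 (w : hD.W) : len hD.s (w * hD.w0) + len hD.s w = len hD.s hD.w0 :=
  hD.cox.len_mul_longest (mem_par_univ hD.isGen w)

theorem len_w0_conj (w : hD.W) : len hD.s (hD.w0 * w * hD.w0) = len hD.s w := by
  have h1 := hD.len_w0_mul w
  have h2 := hD.len_mul_w0 (hD.w0 * w)
  omega

/-- Every element of `W` is on a minimal gallery from `1` to `w₀`. By convexity the intersection
lies in every `N`-conjugate of `B`, hence in `T` by saturation. -/
theorem B_inf_le {n : G} {hn : n ∈ D.N} (h : hD.cls n hn = hD.w0) : D.B ⊓ conj n D.B = D.T := by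
  refine le_antisymm ?_ (le_inf hD.T_le_B (hD.T_le_conj_B hn))
  rw [← hD.saturated]
  refine le_iInf₂ fun m hm => ?_
  have h1 := hD.B_inf_conj_le (hn := hm) (hm := mem_mul (inv_mem hm) hn) (by
    rw [← cls_mul]
    have e : hD.cls (m * (m⁻¹ * n)) (mem_mul hm (mem_mul (inv_mem hm) hn)) = hD.w0 := by
      rw [← h]; congr 1; group
    rw [e, cls_mul hD (inv_mem hm) hn, cls_inv hD hm, h]
    have h2 := hD.len_mul_w0 (hD.cls m hm)⁻¹
    rw [hD.isGen.len_inv] at h2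
    omega)
  have e : m * (m⁻¹ * n) = n := by group
  rwa [e] at h1

theorem U_inf_Uc_w0 {g : G} (h : g ∈ D.U) (h' : g ∈ hD.Uc hD.w0) : g = 1 := by
  refine hD.eq_one_of_mem h ?_
  rw [← hD.B_inf_le (hD.cls_rep hD.w0)]
  refine Subgroup.mem_inf.2 ⟨hD.U_le h, ?_⟩
  rw [← hD.cls_rep hD.w0] at h'
  exact hD.Uc_le_conj_B _ h'

/-- Otherwise some `w s_i` is longer than `w`. A thick element `b` for `i` factors as `b₁ b₂` with
`r b₁ r⁻¹ ∈ B` and `b₂` in `B ∩ n⁻¹ B n`, which is a conjugate of `T`; then `r b r⁻¹` would lie in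
`B`. This identifies the Borel subgroups allowed in the definition of `oppBorel`. -/
theorem cls_eq_w0 {n : G} (hn : n ∈ D.N) (h : D.B ⊓ conj n D.B = D.T) : hD.cls n hn = hD.w0 := by
  refine hD.cox.eq_longest (mem_par_univ hD.isGen _) fun i _ => ?_
  by_contra hlt
  have h1 := hD.cox.len_mul_s i (hD.cls n hn)
  have h2 := hD.len_w0_mul (hD.s i)
  have hi := hD.cox.len_s i
  set w := hD.cls n hn with hw
  obtain ⟨b, hb, hb', -⟩ := hD.exists_thick i
  have hm : (D.r i)⁻¹ * hD.rep hD.w0 ∈ D.N := mem_mul (inv_mem (hD.r_mem i)) (hD.rep_mem _)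
  have hcm : hD.cls _ hm = hD.s i * hD.w0 := by
    rw [cls_r_inv_mul hD i (hD.rep_mem _), cls_rep]
  have h3 := hD.len_mul_w0 (hD.s i)
  obtain ⟨b₁, hb₁, b₂, hb₂, rfl⟩ := hD.B_eq_mul (hn := hD.r_mem i) (hm := hm) (by
    rw [hcm]
    change len hD.s (hD.s i * (hD.s i * hD.w0)) = len hD.s (hD.s i) + _
    rw [hD.cox.s_mul_s_mul]
    omega) hb
  have h4 : b₂ ∈ conj n⁻¹ D.B := by
    have hk : n * ((D.r i)⁻¹ * hD.rep hD.w0) ∈ D.N := mem_mul hn hm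
    have h5 := hD.B_inf_conj_le (hn := inv_mem hn) (hm := hk) (by
      rw [cls_inv hD hn, cls_mul hD hn hm, hcm, inv_mul_cancel_left, hD.isGen.len_inv, ← hw,
        ← mul_assoc]
      have h6 := hD.len_mul_w0 (w * hD.s i)
      omega)
    refine h5 ?_
    rwa [inv_mul_cancel_left]
  have h5 : n * b₂ * n⁻¹ ∈ D.T := by
    rw [← h]
    rw [mem_conj, inv_inv] at h4
    refine Subgroup.mem_inf.2 ⟨h4, ?_⟩
    rw [mem_conj]
    have : n⁻¹ * (n * b₂ * n⁻¹) * n = b₂ := by group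
    rw [this]
    exact (Subgroup.mem_inf.1 hb₂).1
  have h6 := hD.T_normal n⁻¹ (inv_mem hn) _ h5
  have h7 := hD.T_normal _ (hD.r_mem i) _ h6
  apply hb'
  have h8 := (Subgroup.mem_inf.1 hb₁).2
  rw [mem_conj, inv_inv] at h8
  have e : D.r i * (b₁ * b₂) * (D.r i)⁻¹ =
      D.r i * b₁ * (D.r i)⁻¹ * (D.r i * (n⁻¹ * (n * b₂ * n⁻¹) * n⁻¹⁻¹) * (D.r i)⁻¹) := by group
  rw [e]
  exact mem_mul h8 (hD.T_le_B h7)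

theorem oppBorel_eq : D.oppBorel = conj (hD.rep hD.w0) D.B := by
  refine le_antisymm (iSup₂_le fun n hn => ?_) ?_
  · rw [hD.conj_B (hm := hD.rep_mem hD.w0) (hn := hn.1)]
    rw [cls_rep]
    exact hD.cls_eq_w0 hn.1 hn.2
  · exact le_iSup₂ (f := fun n (_ : n ∈ {n ∈ D.N | D.B ⊓ conj n D.B = D.T}) => conj n D.B)
      (hD.rep hD.w0) ⟨hD.rep_mem _, hD.B_inf_le (hD.cls_rep _)⟩

end BNData.IsSplit
end SplitBN
end

noncomputable section
set_option linter.unusedSectionVars false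
namespace SplitBN

/-! ### Parabolic subgroups -/

namespace BNData.IsSplit

variable {G : Type u} [Group G] {σ : Type} {D : BNData G σ} {p : ℕ} (hD : D.IsSplit p)

theorem dc_mul_par {J : Set σ} {a y : hD.W} (hy : y ∈ par hD.s J) {g h : G} (hg : g ∈ hD.dc a)
    (hh : h ∈ hD.dc y) : ∃ z ∈ par hD.s J, g * h ∈ hD.dc (a * z) := by
  refine Subgroup.closure_induction_left (p := fun y _ => ∀ a g h, g ∈ hD.dc a → h ∈ hD.dc y →
    ∃ z ∈ par hD.s J, g * h ∈ hD.dc (a * z)) ?_ ?_ ?_ hy a g h hg hh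
  · intro a g h hg hh
    exact ⟨1, one_mem _, by rw [mul_one]; exact hD.dc_mul_mem (hD.mem_dc_one.1 hh) hg⟩
  all_goals
    rintro _ ⟨i, hi, rfl⟩ y hy ih a g h hg hh
    try rw [hD.isGen.inv_s] at hh
    obtain ⟨b, hb, b', hb', rfl⟩ := (hD.mem_dc_iff (mem_mul (hD.r_mem i) (hD.rep_mem y))
      (hD.cls_r_mul_rep i y)).1 hh
    have e : g * (b * (D.r i * hD.rep y) * b') = g * b * D.r i * (hD.rep y * b') := by
      simp only [mul_assoc]
    rw [e]
    have h1 := hD.dc_mul_mem hb' (hD.rep_mem_dc y)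
    rcases hD.dc_mul_s (hD.r_mem_dc i) (hD.dc_mul_mem hb hg) with h | h
    · exact ih _ _ _ h h1
    · obtain ⟨z, hz, h2⟩ := ih _ _ _ h h1
      exact ⟨hD.s i * z, mem_mul (mem_par hi) hz, by rwa [← mul_assoc]⟩

theorem par_mul_dc {J : Set σ} {a y : hD.W} (hy : y ∈ par hD.s J) {g h : G} (hg : g ∈ hD.dc a)
    (hh : h ∈ hD.dc y) : ∃ z ∈ par hD.s J, h * g ∈ hD.dc (z * a) := by
  obtain ⟨z, hz, h1⟩ := hD.dc_mul_par (inv_mem hy) (hD.inv_mem_dc hg) (hD.inv_mem_dc hh)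
  exact ⟨z⁻¹, inv_mem hz, by simpa using hD.inv_mem_dc h1⟩

theorem exists_mem_dc {I : Set σ} {g : G} (hg : g ∈ D.B ⊔ (D.T ⊔ Subgroup.closure (D.r '' I))) :
    ∃ w ∈ par hD.s I, g ∈ hD.dc w := by
  rw [← Subgroup.closure_eq D.B, ← Subgroup.closure_eq D.T, ← Subgroup.closure_union,
    ← Subgroup.closure_union] at hg
  have key : ∀ x y : G, x ∈ (D.B : Set G) ∪ (D.T ∪ D.r '' I) ∨ x⁻¹ ∈ (D.B : Set G) ∪ (D.T ∪ D.r '' I) →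
      (∃ w ∈ par hD.s I, y ∈ hD.dc w) → ∃ w ∈ par hD.s I, x * y ∈ hD.dc w := by
    rintro x y hx ⟨w, hw, hy⟩
    have : x ∈ D.B ∨ ∃ i ∈ I, x ∈ hD.dc (hD.s i) := by
      rcases hx with (hx | hx | ⟨i, hi, rfl⟩) | (hx | hx | ⟨i, hi, hx⟩)
      · exact Or.inl hx
      · exact Or.inl (hD.T_le_B hx)
      · exact Or.inr ⟨i, hi, hD.r_mem_dc i⟩
      · exact Or.inl (by simpa using inv_mem (S := Subgroup G) hx)
      · exact Or.inl (by simpa using inv_mem (S := Subgroup G) (hD.T_le_B hx))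
      · refine Or.inr ⟨i, hi, ?_⟩
        rw [← inv_inv x, ← hx]
        exact hD.r_inv_mem_dc i
    rcases this with hx | ⟨i, hi, hx⟩
    · exact ⟨w, hw, hD.mul_mem_dc hx hy⟩
    · rcases hD.dc_s_mul hx hy with h | h
      · exact ⟨w, hw, h⟩
      · exact ⟨_, mem_mul (mem_par hi) hw, h⟩
  refine Subgroup.closure_induction_left (p := fun g _ => ∃ w ∈ par hD.s I, g ∈ hD.dc w)
    ⟨1, one_mem _, hD.mem_dc_one.2 (one_mem _)⟩ (fun x hx y _ => key x y (Or.inl hx))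
    (fun x hx y _ => key x⁻¹ y (Or.inr (by rwa [inv_inv]))) hg

theorem exists_mem_dc' (g : G) : ∃ w, g ∈ hD.dc w := by
  obtain ⟨w, -, h⟩ := hD.exists_mem_dc (I := Set.univ) (g := g) (by
    rw [Set.image_univ, hD.r_gen, hD.gen]; exact Subgroup.mem_top _)
  exact ⟨w, h⟩

theorem weyl_le_N (hD : D.IsSplit p) (I : Finset σ) : D.weyl I ≤ D.N := by
  refine sup_le hD.T_le_N ((Subgroup.closure_le _).2 ?_)
  rintro _ ⟨i, -, rfl⟩
  exact hD.r_mem i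

theorem mem_weyl_of {I : Finset σ} {w : hD.W} (hw : w ∈ par hD.s I) : ∀ n (hn : n ∈ D.N),
    hD.cls n hn = w → n ∈ D.weyl I := by
  refine Subgroup.closure_induction_left (p := fun w _ => ∀ n (hn : n ∈ D.N),
    hD.cls n hn = w → n ∈ D.weyl I) ?_ ?_ ?_ hw
  · intro n hn h
    exact (le_sup_left : _ ≤ D.weyl I) (hD.cls_eq_one.1 h)
  all_goals
    rintro _ ⟨i, hi, rfl⟩ y _ ih n hn h
    try rw [hD.isGen.inv_s] at h
    have h1 := ih ((D.r i)⁻¹ * n) (mem_mul (inv_mem (hD.r_mem i)) hn) (by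
      rw [cls_r_inv_mul hD i hn, h, hD.isGen.s_mul_s_mul])
    rwa [Subgroup.mul_mem_cancel_left _ (inv_mem (D.r_mem_weyl hi))] at h1

theorem mem_parabolic_iff {I : Finset σ} {g : G} :
    g ∈ D.parabolic I ↔ ∃ w ∈ par hD.s I, g ∈ hD.dc w := by
  constructor
  · exact fun h => hD.exists_mem_dc h
  · rintro ⟨w, hw, b, hb, b', hb', rfl⟩
    exact mem_mul (mem_mul ((le_sup_left : _ ≤ D.parabolic I) hb)
      ((le_sup_right : _ ≤ D.parabolic I) (hD.mem_weyl_of hw _ _ (hD.cls_rep w))))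
      ((le_sup_left : _ ≤ D.parabolic I) hb')

theorem cls_mem_par {I : Finset σ} {n : G} (hn : n ∈ D.N) (h : n ∈ D.parabolic I) :
    hD.cls n hn ∈ par hD.s I := by
  obtain ⟨w, hw, h⟩ := hD.mem_parabolic_iff.1 h
  rwa [hD.dc_eq_of_mem (hD.mem_dc hn) h]

theorem mem_weyl_iff {I : Finset σ} {n : G} (hn : n ∈ D.N) :
    n ∈ D.weyl I ↔ hD.cls n hn ∈ par hD.s I :=
  ⟨fun h => hD.cls_mem_par hn ((le_sup_right : _ ≤ D.parabolic I) h),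
    fun h => hD.mem_weyl_of h _ _ rfl⟩

theorem B_le_parabolic (_ : D.IsSplit p) (I : Finset σ) : D.B ≤ D.parabolic I := le_sup_left

theorem weyl_le_parabolic (_ : D.IsSplit p) (I : Finset σ) : D.weyl I ≤ D.parabolic I := le_sup_right

theorem T_le_weyl (_ : D.IsSplit p) (I : Finset σ) : D.T ≤ D.weyl I := le_sup_left

theorem U_le_parabolic (hD : D.IsSplit p) (I : Finset σ) : D.U ≤ D.parabolic I :=
  hD.U_le.trans le_sup_left

theorem rep_mem_weyl {I : Finset σ} {w : hD.W} (hw : w ∈ par hD.s I) : hD.rep w ∈ D.weyl I :=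
  hD.mem_weyl_of hw _ (hD.rep_mem w) (hD.cls_rep w)

theorem mem_iInf_conj {x : G} {I : Finset σ} :
    x ∈ ⨅ n ∈ D.weyl I, conj n D.U ↔ ∀ n ∈ D.weyl I, n⁻¹ * x * n ∈ D.U := by
  simp only [Subgroup.mem_iInf, mem_conj]

/-- The intersection over `W_I` alone is already normalised by `U`, by axiom `strong`, and visibly
by `T` and `W_I`. It is hence normalised by `P_I`, and the other conjugates impose no further
condition. -/
theorem mem_unip_iff (hD : D.IsSplit p) {x : G} {I : Finset σ} :
    x ∈ D.unip I ↔ ∀ n ∈ D.weyl I, n⁻¹ * x * n ∈ D.U := by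
  constructor
  · intro h n hn
    simp only [unip, Subgroup.mem_iInf, mem_conj] at h
    exact h n (hD.weyl_le_parabolic I hn)
  · intro h
    rw [← mem_iInf_conj] at h
    have h1 : D.parabolic I ≤ Subgroup.normalizer (⨅ n ∈ D.weyl I, conj n D.U : Subgroup G) := by
      have key : ∀ H : Subgroup G, (∀ h ∈ H, ∀ x ∈ ⨅ n ∈ D.weyl I, conj n D.U,
          h * x * h⁻¹ ∈ ⨅ n ∈ D.weyl I, conj n D.U) →
          H ≤ Subgroup.normalizer (⨅ n ∈ D.weyl I, conj n D.U : Subgroup G) := by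
        intro H hH h hh
        rw [Subgroup.mem_normalizer_iff]
        refine fun x => ⟨hH h hh x, fun hx => ?_⟩
        have := hH _ (inv_mem hh) _ hx
        simpa [mul_assoc] using this
      have hw : D.weyl I ≤ Subgroup.normalizer (⨅ n ∈ D.weyl I, conj n D.U : Subgroup G) := by
        refine key _ fun h hh x hx => ?_
        rw [mem_iInf_conj] at hx ⊢
        intro n hn
        have := hx _ (mem_mul (inv_mem hh) hn)
        simpa [mul_assoc] using this
      refine sup_le ?_ hw
      rw [← hD.UT]
      exact sup_le (key _ (hD.strong I)) ((hD.T_le_weyl I).trans hw)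
    simp only [unip, Subgroup.mem_iInf, mem_conj]
    intro g hg
    have h2 := (Subgroup.mem_normalizer_iff.1 (h1 (inv_mem hg)) x).1 h
    have h3 := mem_iInf_conj.1 h2 1 (one_mem _)
    simpa using h3

theorem mem_unip {x : G} {I : Finset σ} : x ∈ D.unip I ↔ ∀ w ∈ par hD.s I, x ∈ hD.Uc w := by
  rw [hD.mem_unip_iff]
  constructor
  · intro h w hw
    rw [Uc, mem_conj]
    exact h _ (hD.rep_mem_weyl hw)
  · intro h n hn
    have hn' := hD.weyl_le_N I hn
    rw [← mem_conj, hD.conj_eq_Uc hn']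
    exact h _ ((hD.mem_weyl_iff hn').1 hn)

theorem unip_le_Uc {I : Finset σ} {w : hD.W} (hw : w ∈ par hD.s I) : D.unip I ≤ hD.Uc w :=
  fun _ h => hD.mem_unip.1 h w hw

theorem unip_le_U (hD : D.IsSplit p) (I : Finset σ) : D.unip I ≤ D.U := by
  have := hD.unip_le_Uc (I := I) (one_mem _)
  rwa [Uc_one] at this

theorem conj_unip (_ : D.IsSplit p) {I : Finset σ} {g : G} (hg : g ∈ D.parabolic I) :
    conj g (D.unip I) = D.unip I := by
  ext x
  rw [mem_conj]
  constructor
  · intro h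
    have := D.unip_normal I le_rfl g hg _ h
    simpa [mul_assoc] using this
  · intro h
    have := D.unip_normal I le_rfl _ (inv_mem hg) _ h
    simpa using this

variable [Finite G]

theorem len_inv_mul_longest {I : Set σ} {w : hD.W} (hw : w ∈ par hD.s I) :
    len hD.s (w⁻¹ * longest hD.s I) + len hD.s w = len hD.s (longest hD.s I) := by
  have h1 := hD.cox.len_longest_mul hw
  rwa [← hD.isGen.len_inv, mul_inv_rev, hD.cox.longest_inv] at h1

/-- Each element of `W_I` lies on a minimal gallery from `1` to `w_I`, so convexity leaves only the
two end terms. -/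
theorem unip_eq (I : Finset σ) : D.unip I = D.U ⊓ hD.Uc (longest hD.s I) := by
  refine le_antisymm (le_inf (hD.unip_le_U I) (hD.unip_le_Uc (hD.cox.longest_mem _))) ?_
  intro x hx
  rw [hD.mem_unip]
  intro w hw
  rw [← hD.Uc_one] at hx
  refine hD.Uc_inf_le ?_ hx
  have h1 := hD.len_inv_mul_longest hw
  rw [inv_one, one_mul, one_mul]
  omega

/-- The intersection of `U` and of the Levi subgroup. -/
def leviU (I : Finset σ) : Subgroup G := D.U ⊓ hD.Uc (longest hD.s I * hD.w0)

/-- Factorisation of `U` along `w₀ = w_I · (w_I w₀)`, where lengths add. -/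
theorem exists_unip_mul {I : Finset σ} {u : G} (hu : u ∈ D.U) :
    ∃ u₁ ∈ D.unip I, ∃ u₂ ∈ hD.leviU I, u = u₁ * u₂ := by
  have h1 := hD.exists_U_mul (x := longest hD.s I) (y := longest hD.s I * hD.w0) (by
    rw [← mul_assoc, hD.cox.longest_mul_longest, one_mul]
    have := hD.len_mul_w0 (longest hD.s I)
    omega) hu
  rwa [hD.cox.longest_inv, ← hD.unip_eq] at h1

theorem Uc_inf_Uc_mul_w0 {g : G} {a : hD.W} (h : g ∈ hD.Uc a) (h' : g ∈ hD.Uc (a * hD.w0)) :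
    g = 1 := by
  have e : hD.Uc (a * hD.w0) = conj (hD.rep a) (hD.Uc hD.w0) := by
    rw [hD.conj_Uc (hD.rep_mem a), cls_rep]
  rw [e, mem_conj] at h'
  rw [Uc, mem_conj] at h
  have := hD.U_inf_Uc_w0 h h'
  have h2 : g = hD.rep a * ((hD.rep a)⁻¹ * g * hD.rep a) * (hD.rep a)⁻¹ := by group
  rw [h2, this]
  group

theorem leviU_le_U (I : Finset σ) : hD.leviU I ≤ D.U := inf_le_left

theorem eq_one_of_mem_leviU {I : Finset σ} {g : G} (h : g ∈ D.unip I) (hg : g ∈ hD.leviU I) :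
    g = 1 :=
  hD.Uc_inf_Uc_mul_w0 (hD.unip_le_Uc (hD.cox.longest_mem _) h) (Subgroup.mem_inf.1 hg).2

/-- If `x` has minimal length in `x W_K`, conjugation by `x` maps `U ∩ L_K` to `U`. -/
theorem leviU_le_Uc {K : Finset σ} {x : hD.W} (hx : RMin hD.s K x) : hD.leviU K ≤ hD.Uc x⁻¹ := by
  intro g hg
  rw [leviU, ← hD.Uc_one] at hg
  refine hD.Uc_inf_le ?_ hg
  rw [inv_one, one_mul, one_mul, inv_inv, hD.isGen.len_inv]
  have h1 := IsCox.RMin.len_mul hD.cox hx (hD.cox.longest_mem K)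
  have h2 := hD.len_mul_w0 (longest hD.s K)
  have h3 := hD.len_mul_w0 (x * longest hD.s K)
  rw [mul_assoc] at h3
  omega

/-- By `exists_decomp`, `y x = d b` with `d` minimal in `d W_K` and `b ∈ W_K ∩ W_{K'}`. Then `(y
x)⁻¹` is on a minimal gallery from `b⁻¹`, where `U_{K'}` is visible, to `w_K w₀`, where `U ∩ L_K`
is. Both the collapse of `e_A x e_K` and the analysis of cells with a descent rest on this. -/
theorem unip_inf_leviU_le {K K' : Finset σ} {A : Set σ} {x y : hD.W} (hx : RMin hD.s K x)
    (hy : y ∈ par hD.s A) (hK' : ∀ k ∈ K, x * hD.s k * x⁻¹ ∈ par hD.s A → k ∈ K') {g : G}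
    (hg : g ∈ D.unip K') (hg' : g ∈ hD.leviU K) : g ∈ hD.Uc (y * x)⁻¹ := by
  obtain ⟨d, b, e, hd, hb⟩ := hD.cox.exists_decomp hx hy
  have hbK : b ∈ par hD.s K := par_mono (fun k hk => hk.1) hb
  have hbK' : b ∈ par hD.s K' := par_mono (fun k hk => hK' k hk.1 hk.2) hb
  rw [e]
  refine hD.Uc_inf_le (a := b⁻¹) (c := longest hD.s K * hD.w0) ?_
    (Subgroup.mem_inf.2 ⟨hD.unip_le_Uc (inv_mem hbK') hg, (Subgroup.mem_inf.1 hg').2⟩)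
  have e1 : b⁻¹⁻¹ * (d * b)⁻¹ = d⁻¹ := by group
  rw [e1, hD.isGen.len_inv, inv_inv, inv_inv]
  have h1 := IsCox.RMin.len_mul hD.cox hd (mem_mul hbK (hD.cox.longest_mem K))
  have h2 := hD.len_mul_w0 (b * longest hD.s K)
  have h3 := hD.len_mul_w0 (d * (b * longest hD.s K))
  simp only [mul_assoc] at h2 h3 ⊢
  omega

/-! The opposition involution. -/

/-- `w₀ s_i w₀ = s_{i*}` -/
def star (i : σ) : σ := (hD.cox.longest_conj (Set.mem_univ i)).choose

theorem w0_mul_s (i : σ) : hD.w0 * hD.s i = hD.s (hD.star i) * hD.w0 :=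
  (hD.cox.longest_conj (Set.mem_univ i)).choose_spec.2

theorem star_star (i : σ) : hD.star (hD.star i) = i := by
  apply hD.cox.inj
  have h1 := hD.w0_mul_s i
  have h2 := hD.w0_mul_s (hD.star i)
  have h3 : hD.s (hD.star (hD.star i)) = hD.w0 * (hD.s (hD.star i) * hD.w0) * (hD.w0 * hD.w0)⁻¹ := by
    rw [← mul_assoc, h2]; group
  rw [h3, ← h1, ← mul_assoc, hD.w0_mul_w0]
  group

open Classical in
/-- The image of a subset under the opposition involution. -/
def opp (I : Finset σ) : Finset σ := I.image hD.star

theorem opp_opp (I : Finset σ) : hD.opp (hD.opp I) = I := by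
  classical
  rw [opp, opp, Finset.image_image]
  ext x
  simp [hD.star_star]

theorem w0_conj_mem {I : Finset σ} {w : hD.W} (hw : w ∈ par hD.s I) :
    hD.w0 * w * hD.w0 ∈ par hD.s (hD.opp I : Finset σ) := by
  have h := IsCox.conj_mem_par_of_gen (x := hD.w0) (H := par hD.s (hD.opp I : Finset σ))
    (fun k hk => ?_) hw
  · rwa [w0_inv] at h
  · rw [w0_mul_s, mul_inv_cancel_right]
    exact mem_par (by simpa [opp] using ⟨k, hk, rfl⟩)

theorem w0_conj_mem_iff {I : Finset σ} {w : hD.W} :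
    hD.w0 * w * hD.w0 ∈ par hD.s (hD.opp I : Finset σ) ↔ w ∈ par hD.s I := by
  refine ⟨fun h => ?_, hD.w0_conj_mem⟩
  have h1 := hD.w0_conj_mem h
  rw [opp_opp] at h1
  have e : hD.w0 * (hD.w0 * w * hD.w0) * hD.w0 = w := by
    rw [← mul_assoc, ← mul_assoc, w0_mul_w0, one_mul, mul_assoc, w0_mul_w0, mul_one]
  rwa [e] at h1

/-- A representative of the longest element. -/
def n0 : G := hD.rep hD.w0

theorem n0_mem : hD.n0 ∈ D.N := hD.rep_mem _

theorem cls_n0 : hD.cls hD.n0 hD.n0_mem = hD.w0 := hD.cls_rep _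

theorem n0_mul_n0 : hD.n0 * hD.n0 ∈ D.T := by
  rw [← hD.cls_eq_one (hn := mem_mul hD.n0_mem hD.n0_mem), cls_mul hD hD.n0_mem hD.n0_mem, cls_n0,
    w0_mul_w0]

theorem conj_n0_weyl (I : Finset σ) : conj hD.n0 (D.weyl (hD.opp I)) = D.weyl I := by
  ext x
  rw [mem_conj]
  by_cases hx : x ∈ D.N
  · have h1 : hD.n0⁻¹ * x * hD.n0 ∈ D.N := mem_mul (mem_mul (inv_mem hD.n0_mem) hx) hD.n0_mem
    rw [hD.mem_weyl_iff h1, hD.mem_weyl_iff hx,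
      cls_mul hD (mem_mul (inv_mem hD.n0_mem) hx) hD.n0_mem, cls_mul hD (inv_mem hD.n0_mem) hx,
      cls_inv hD hD.n0_mem, cls_n0, w0_inv, w0_conj_mem_iff]
  · refine iff_of_false (fun h => hx ?_) fun h => hx (hD.weyl_le_N _ h)
    have h1 := mem_mul (mem_mul hD.n0_mem (hD.weyl_le_N _ h)) (inv_mem hD.n0_mem)
    simpa [mul_assoc] using h1

theorem oppParabolic_eq (I : Finset σ) :
    D.oppParabolic I = conj hD.n0 (D.parabolic (hD.opp I)) := by
  rw [oppParabolic, oppBorel_eq hD, ← hD.conj_n0_weyl I]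
  exact (Subgroup.map_sup _ _ _).symm

/-- The unipotent radical of the opposite parabolic subgroup. -/
def oppUnip (I : Finset σ) : Subgroup G := conj hD.n0 (D.unip (hD.opp I))

theorem mem_oppUnip {x : G} {I : Finset σ} :
    x ∈ hD.oppUnip I ↔ ∀ w ∈ par hD.s I, x ∈ hD.Uc (w * hD.w0) := by
  rw [oppUnip, mem_conj, hD.mem_unip]
  have key : ∀ w, hD.n0⁻¹ * x * hD.n0 ∈ hD.Uc w ↔ x ∈ hD.Uc (hD.w0 * w) := by
    intro w
    rw [← mem_conj, hD.conj_Uc hD.n0_mem, cls_n0]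
  simp only [key]
  constructor
  · intro h w hw
    have := h _ (hD.w0_conj_mem hw)
    rwa [← mul_assoc, ← mul_assoc, w0_mul_w0, one_mul] at this
  · intro h w hw
    rw [← hD.opp_opp I] at h
    have := h _ (hD.w0_conj_mem hw)
    rwa [mul_assoc, w0_mul_w0, mul_one] at this

theorem conj_n0_opp_aux {H : Subgroup G} (h : D.T ≤ H) : conj hD.n0 (conj hD.n0 H) = H := by
  rw [conj_conj, conj_eq_self (h hD.n0_mul_n0)]

theorem T_le_parabolic (hD : D.IsSplit p) (I : Finset σ) : D.T ≤ D.parabolic I :=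
  hD.T_le_B.trans (hD.B_le_parabolic I)

theorem conj_n0_oppParabolic (I : Finset σ) :
    conj hD.n0 (D.oppParabolic (hD.opp I)) = D.parabolic I := by
  rw [hD.oppParabolic_eq, opp_opp, conj_n0_opp_aux hD (hD.T_le_parabolic I)]

theorem conj_n0_levi (I : Finset σ) : conj hD.n0 (D.levi (hD.opp I)) = D.levi I := by
  rw [levi, levi, conj_inf, conj_n0_oppParabolic, ← oppParabolic_eq, inf_comm]

theorem conj_n0_oppUnip (I : Finset σ) : conj hD.n0 (hD.oppUnip (hD.opp I)) = D.unip I := by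
  rw [oppUnip, opp_opp, conj_conj, hD.conj_unip (hD.T_le_parabolic I hD.n0_mul_n0)]

theorem conj_oppUnip {I : Finset σ} {g : G} (hg : g ∈ D.oppParabolic I) :
    conj g (hD.oppUnip I) = hD.oppUnip I := by
  rw [hD.oppParabolic_eq, mem_conj] at hg
  have h := hD.conj_unip hg
  rw [oppUnip, conj_conj]
  conv_rhs => rw [← h, conj_conj]
  congr 1
  group

theorem weyl_le_oppParabolic (_ : D.IsSplit p) (I : Finset σ) : D.weyl I ≤ D.oppParabolic I :=
  le_sup_right

theorem Uc_w0_le (I : Finset σ) : hD.Uc hD.w0 ≤ D.oppParabolic I := by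
  rw [oppParabolic_eq]
  exact conj_mono _ (hD.U_le_parabolic _)

theorem Uc_mul_w0_le {I : Finset σ} {a : hD.W} (ha : a ∈ par hD.s I) :
    hD.Uc (a * hD.w0) ≤ D.oppParabolic I := by
  have e : hD.Uc (a * hD.w0) = conj (hD.rep a) (hD.Uc hD.w0) := by
    rw [hD.conj_Uc (hD.rep_mem a), cls_rep]
  rw [e, ← conj_eq_self (hD.weyl_le_oppParabolic I (hD.rep_mem_weyl ha))]
  exact conj_mono _ (hD.Uc_w0_le I)

theorem leviU_le_levi (I : Finset σ) : hD.leviU I ≤ D.levi I :=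
  inf_le_inf (hD.U_le_parabolic I) (hD.Uc_mul_w0_le (hD.cox.longest_mem _))

theorem T_le_levi (hD : D.IsSplit p) (I : Finset σ) : D.T ≤ D.levi I :=
  (hD.T_le_weyl I).trans (D.weyl_le_levi I)

include hD in
theorem exists_unip_mul_B {I : Finset σ} {b : G} (hb : b ∈ D.B) :
    ∃ u ∈ D.unip I, ∃ l ∈ D.B ⊓ D.levi I, b = u * l := by
  obtain ⟨u, hu, t, ht, rfl⟩ := hD.exists_UT hb
  obtain ⟨u₁, h1, u₂, h2, rfl⟩ := hD.exists_unip_mul (I := I) hu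
  exact ⟨u₁, h1, u₂ * t, Subgroup.mem_inf.2 ⟨mem_mul (hD.U_le (hD.leviU_le_U I h2)) (hD.T_le_B ht),
    mem_mul (hD.leviU_le_levi I h2) (hD.T_le_levi I ht)⟩, by rw [mul_assoc]⟩

include hD in
theorem exists_unip_mul_of_mem {I K : Finset σ} (hKI : K ⊆ I) {g : G} (hg : g ∈ D.parabolic K) :
    ∃ u ∈ D.unip I, ∃ l ∈ (D.B ⊓ D.levi I) ⊔ D.weyl K, g = u * l := by
  refine exists_mul_of_mem_sup (fun h hh => D.unip_normal I ?_ h hh) ((sup_le ?_ ?_ :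
    D.parabolic K ≤ D.unip I ⊔ ((D.B ⊓ D.levi I) ⊔ D.weyl K)) hg)
  · refine sup_le (inf_le_right.trans inf_le_left) ((hD.weyl_le_parabolic K).trans ?_)
    exact D.parabolic_mono hKI
  · intro b hb
    obtain ⟨u, hu, l, hl, rfl⟩ := hD.exists_unip_mul_B (I := I) hb
    exact mem_mul ((le_sup_left : _ ≤ D.unip I ⊔ _) hu)
      ((le_sup_right : _ ≤ D.unip I ⊔ _) ((le_sup_left : _ ≤ _ ⊔ D.weyl K) hl))
  · exact le_sup_right.trans (le_sup_right (a := D.unip I))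

include hD in
theorem B_levi_sup_weyl_le {I K : Finset σ} (hKI : K ⊆ I) :
    (D.B ⊓ D.levi I) ⊔ D.weyl K ≤ D.parabolic K ⊓ D.levi I := by
  refine le_inf (sup_le (inf_le_left.trans le_sup_left) le_sup_right) (sup_le inf_le_right ?_)
  exact (sup_le_sup_left (Subgroup.closure_mono (Set.image_mono hKI)) _).trans (D.weyl_le_levi I)

include hD in
/-- `P_I = U_I L_I` -/
theorem exists_unip_mul_levi {I : Finset σ} {g : G} (hg : g ∈ D.parabolic I) :
    ∃ u ∈ D.unip I, ∃ l ∈ D.levi I, g = u * l := by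
  obtain ⟨u, hu, l, hl, rfl⟩ := hD.exists_unip_mul_of_mem subset_rfl hg
  exact ⟨u, hu, l, (Subgroup.mem_inf.1 (hD.B_levi_sup_weyl_le subset_rfl hl)).2, rfl⟩

theorem exists_oppUnip_mul_levi {I : Finset σ} {g : G} (hg : g ∈ D.oppParabolic I) :
    ∃ u ∈ hD.oppUnip I, ∃ l ∈ D.levi I, g = u * l := by
  rw [hD.oppParabolic_eq, mem_conj] at hg
  obtain ⟨u, hu, l, hl, e⟩ := hD.exists_unip_mul_levi hg
  refine ⟨hD.n0 * u * hD.n0⁻¹, ?_, hD.n0 * l * hD.n0⁻¹, ?_, ?_⟩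
  · rw [oppUnip, mem_conj]
    simpa [mul_assoc] using hu
  · rw [← hD.conj_n0_levi, mem_conj]
    simpa [mul_assoc] using hl
  · have : g = hD.n0 * (hD.n0⁻¹ * g * hD.n0) * hD.n0⁻¹ := by group
    rw [this, e]
    group

theorem eq_one_of_mem_U_of_mem {u : G} (hu : u ∈ D.U) (h : u ∈ conj hD.n0 D.B) : u = 1 := by
  rw [← hD.Uc_one] at hu
  have := hD.mem_Uc_of_mem (hn := hD.n0_mem) hu h
  rw [cls_n0] at this
  rw [Uc_one] at hu
  exact hD.U_inf_Uc_w0 hu this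

/-- Multiplication by `w_I w₀` sends the two chambers `1` and `w_{I*} w₀` defining the source to
`w_I w₀` and `1`, which define the target. -/
theorem conj_leviU_opp {I : Finset σ} :
    conj ((hD.rep (longest hD.s I))⁻¹ * hD.n0) (hD.leviU (hD.opp I)) ≤ hD.leviU I := by
  have hn : (hD.rep (longest hD.s I))⁻¹ * hD.n0 ∈ D.N := mem_mul (inv_mem (hD.rep_mem _)) hD.n0_mem
  have hlo : longest hD.s (hD.opp I : Finset σ) = hD.w0 * longest hD.s I * hD.w0 := by
    refine (hD.cox.eq_longest (hD.w0_conj_mem (hD.cox.longest_mem _)) fun t ht => ?_).symm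
    obtain ⟨k, hk, rfl⟩ : ∃ k ∈ I, hD.star k = t := by simpa [opp] using ht
    have e : hD.w0 * longest hD.s I * hD.w0 * hD.s (hD.star k) =
        hD.w0 * (longest hD.s I * hD.s k) * hD.w0 := by
      rw [mul_assoc _ hD.w0, w0_mul_s, star_star]
      simp only [mul_assoc]
    rw [e, len_w0_conj, len_w0_conj]
    exact (hD.cox.longest_spec I).2 k hk
  rw [leviU, conj_inf, ← hD.Uc_one, hD.conj_Uc hn, hD.conj_Uc hn,
    cls_mul hD (inv_mem (hD.rep_mem _)) hD.n0_mem, cls_inv hD (hD.rep_mem _), cls_rep, cls_n0,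
    hD.cox.longest_inv, hlo, mul_one]
  have e : longest hD.s I * hD.w0 * (hD.w0 * longest hD.s I * hD.w0 * hD.w0) = 1 := by
    have h0 := hD.w0_mul_w0
    have h1 := hD.cox.longest_mul_longest (I : Set σ)
    simp only [mul_assoc, h0, mul_one]
    rw [← mul_assoc hD.w0, h0, one_mul, h1]
  rw [e, leviU, hD.Uc_one, inf_comm]

include hD in
/-- `U_I ∩ P_I⁻ = 1` -/
theorem unip_inf_oppParabolic {I : Finset σ} {u : G} (hu : u ∈ D.unip I)
    (h : u ∈ D.oppParabolic I) : u = 1 := by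
  set m := hD.rep (longest hD.s I) with hm
  have hmI : m ∈ D.weyl I := hD.rep_mem_weyl (hD.cox.longest_mem _)
  have hmN : m ∈ D.N := hD.rep_mem _
  -- The twist by `m`, a representative of `w_I`, allows the Levi part of the right Bruhat factor to
  -- be carried back into `U ∩ L_I`, as `x'`.
  have h1 : u * m⁻¹ ∈ D.oppParabolic I := mem_mul h (inv_mem (hD.weyl_le_oppParabolic I hmI))
  rw [hD.oppParabolic_eq, mem_conj] at h1
  obtain ⟨w, hw, b, hb, b', hb', e⟩ := hD.mem_parabolic_iff.1 h1
  obtain ⟨y, hy, t, ht, rfl⟩ := hD.exists_UT hb'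
  obtain ⟨v, hv, x, hx, rfl⟩ := hD.exists_unip_mul (I := hD.opp I) hy
  set n := hD.rep w with hn
  have hwP : n ∈ D.parabolic (hD.opp I) := hD.weyl_le_parabolic _ (hD.rep_mem_weyl hw)
  have hv' : n * v * n⁻¹ ∈ D.B :=
    hD.U_le (hD.unip_le_U _ (D.unip_normal _ le_rfl _ hwP v hv))
  set z := hD.n0⁻¹ * m with hz
  have hzN : z ∈ D.N := mem_mul (inv_mem hD.n0_mem) hmN
  have ht' : z⁻¹ * t * z ∈ D.T := by
    have := hD.T_normal _ (inv_mem hzN) t ht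
    rwa [inv_inv] at this
  set x' := (z⁻¹ * t * z)⁻¹ * (m⁻¹ * hD.n0 * x * (m⁻¹ * hD.n0)⁻¹) * (z⁻¹ * t * z) with hx'
  have hxI : x' ∈ hD.leviU I := by
    have h2 : m⁻¹ * hD.n0 * x * (m⁻¹ * hD.n0)⁻¹ ∈ hD.leviU I := by
      apply hD.conj_leviU_opp (I := I)
      rw [mem_conj, ← hm]
      simpa [mul_assoc] using hx
    have h3 : conj (z⁻¹ * t * z) (hD.leviU I) = hD.leviU I := by
      rw [leviU, conj_inf, hD.conj_T_Uc ht', hD.conj_U (hD.T_le_B ht')]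
    rw [← h3, mem_conj] at h2
    exact h2
  have e2 : hD.n0⁻¹ * (u * x'⁻¹) = (b * (n * v * n⁻¹)) * (n * t * z) := by
    have e3 : hD.n0⁻¹ * u = b * n * (v * x * t) * z := by
      have : hD.n0⁻¹ * u = hD.n0⁻¹ * (u * m⁻¹) * hD.n0 * (hD.n0⁻¹ * m) := by group
      rw [this, e]
    rw [← mul_assoc, e3, hx', hz]
    group
  have hU : u * x'⁻¹ ∈ D.U := mem_mul (hD.unip_le_U I hu) (inv_mem (hD.leviU_le_U I hxI))
  have hN : n * t * z ∈ D.N := mem_mul (mem_mul (hD.rep_mem _) (hD.T_le_N ht)) hzN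
  -- Disjointness of Bruhat cells forces `n t z` to represent `w₀`; therefore `u x'⁻¹` is in `U ∩ n₀
  -- B n₀⁻¹ = 1`, and `u = x'` is in `U_I ∩ (U ∩ L_I) = 1`.
  have h3 : hD.n0⁻¹ * (u * x'⁻¹) ∈ hD.dc (hD.w0)⁻¹ := by
    refine hD.dc_mul_mem (hD.U_le hU) ?_
    have := hD.mem_dc (inv_mem hD.n0_mem)
    rwa [cls_inv hD hD.n0_mem, cls_n0] at this
  have h4 : hD.n0⁻¹ * (u * x'⁻¹) ∈ hD.dc (hD.cls _ hN) := by
    rw [e2]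
    exact hD.mul_mem_dc (mem_mul hb hv') (hD.mem_dc hN)
  have h5 := hD.dc_eq_of_mem h3 h4
  have h6 : hD.cls (n * t * z) hN = hD.cls hD.n0⁻¹ (inv_mem hD.n0_mem) := by
    rw [← h5, cls_inv hD hD.n0_mem, cls_n0]
  have h7 : u * x'⁻¹ = 1 := by
    refine hD.eq_one_of_mem_U_of_mem hU ?_
    rw [mem_conj]
    have h8 := hD.T_normal _ hN _ (hD.cls_eq.1 h6)
    have e4 : hD.n0⁻¹ * (u * x'⁻¹) * hD.n0 = b * (n * v * n⁻¹) *
        (n * t * z * ((n * t * z)⁻¹ * hD.n0⁻¹) * (n * t * z)⁻¹)⁻¹ := by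
      rw [e2]; group
    rw [e4]
    exact mem_mul (mem_mul hb hv') (inv_mem (hD.T_le_B h8))
  rw [mul_inv_eq_one] at h7
  rw [← h7] at hxI
  exact hD.eq_one_of_mem_leviU hu hxI

include hD in
theorem unip_inf_levi {I : Finset σ} {u : G} (hu : u ∈ D.unip I) (h : u ∈ D.levi I) : u = 1 :=
  hD.unip_inf_oppParabolic hu (Subgroup.mem_inf.1 h).2

/-- `U_I⁻ ∩ P_I = 1` -/
theorem oppUnip_inf_parabolic {I : Finset σ} {u : G} (hu : u ∈ hD.oppUnip I)
    (h : u ∈ D.parabolic I) : u = 1 := by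
  rw [← conj_n0_oppParabolic hD, mem_conj] at h
  rw [oppUnip, mem_conj] at hu
  have h1 := hD.unip_inf_oppParabolic hu h
  have h2 : u = hD.n0 * (hD.n0⁻¹ * u * hD.n0) * hD.n0⁻¹ := by group
  rw [h2, h1]
  group

theorem U_inf_levi {I : Finset σ} : D.U ⊓ D.levi I = hD.leviU I := by
  refine le_antisymm (fun x hx => ?_) (le_inf (hD.leviU_le_U I) (hD.leviU_le_levi I))
  obtain ⟨hx, hx'⟩ := Subgroup.mem_inf.1 hx
  obtain ⟨u, hu, y, hy, rfl⟩ := hD.exists_unip_mul (I := I) hx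
  rw [Subgroup.mul_mem_cancel_right _ (hD.leviU_le_levi I hy)] at hx'
  rwa [hD.unip_inf_levi hu hx', one_mul]

theorem oppUnip_le_oppParabolic (I : Finset σ) : hD.oppUnip I ≤ D.oppParabolic I := by
  rw [oppParabolic_eq]
  exact conj_mono _ ((hD.unip_le_U _).trans (hD.U_le_parabolic _))

theorem unip_le_parabolic (hD : D.IsSplit p) (I : Finset σ) : D.unip I ≤ D.parabolic I :=
  (hD.unip_le_U I).trans (hD.U_le_parabolic I)

end BNData.IsSplit
end SplitBN
end

noncomputable section
set_option linter.unusedSectionVars false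
namespace SplitBN

namespace BNData.IsSplit

variable {G : Type u} [Group G] {σ : Type} {D : BNData G σ} {p : ℕ} (hD : D.IsSplit p) [Finite G]

/-! ### The double cosets `B w P⁻` -/

/-- `y ∈ B w P_A⁻` -/
def InCell (A : Finset σ) (w : hD.W) (y : G) : Prop :=
  ∃ b ∈ D.B, ∃ q ∈ D.oppParabolic A, y = b * hD.rep w * q

/-- Right multiplication by `n₀` turns the cells `B w P_A⁻` into unions of ordinary Bruhat cells, to
which the Bruhat decomposition applies; `InCell.exists_dc` makes this precise. -/
theorem exists_inCell (A : Finset σ) (y : G) : ∃ w, hD.InCell A w y := by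
  obtain ⟨w, b, hb, b', hb', e⟩ := hD.exists_mem_dc' (y * hD.n0)
  have hn : hD.rep w * hD.n0⁻¹ ∈ D.N := mem_mul (hD.rep_mem w) (inv_mem hD.n0_mem)
  have h := hD.cls_rep (hD.cls _ hn)
  rw [cls_eq] at h
  refine ⟨hD.cls _ hn, b, hb, (hD.rep (hD.cls _ hn))⁻¹ * (hD.rep w * hD.n0⁻¹) *
    (hD.n0 * b' * hD.n0⁻¹), mem_mul (hD.weyl_le_oppParabolic A (hD.T_le_weyl A h)) ?_, ?_⟩
  · rw [oppParabolic_eq hD, mem_conj]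
    have : hD.n0⁻¹ * (hD.n0 * b' * hD.n0⁻¹) * hD.n0 = b' := by group
    rw [this]
    exact hD.B_le_parabolic _ hb'
  · have : y = y * hD.n0 * hD.n0⁻¹ := by group
    rw [this, e]
    group

theorem InCell.mul_right {A : Finset σ} {w : hD.W} {y q : G} (h : hD.InCell A w y)
    (hq : q ∈ D.oppParabolic A) : hD.InCell A w (y * q) := by
  obtain ⟨b, hb, q', hq', rfl⟩ := h
  exact ⟨b, hb, q' * q, mem_mul hq' hq, by simp only [mul_assoc]⟩

theorem InCell.exists_dc {A : Finset σ} {w : hD.W} {y : G} (h : hD.InCell A w y) :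
    ∃ z ∈ par hD.s A, y * hD.n0 ∈ hD.dc (w * z * hD.w0) := by
  obtain ⟨b, hb, q, hq, rfl⟩ := h
  rw [oppParabolic_eq hD, mem_conj] at hq
  obtain ⟨v, hv, hq⟩ := hD.mem_parabolic_iff.1 hq
  have h1 : b * (hD.rep w * hD.n0) ∈ hD.dc (w * hD.w0) := by
    refine hD.mul_mem_dc hb ?_
    have := hD.mem_dc (mem_mul (hD.rep_mem w) hD.n0_mem)
    rwa [cls_mul hD (hD.rep_mem w) hD.n0_mem, cls_rep, cls_n0] at this
  obtain ⟨z, hz, h2⟩ := hD.dc_mul_par hv h1 hq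
  refine ⟨hD.w0 * z * hD.w0, ?_, ?_⟩
  · have := hD.w0_conj_mem hz
    rwa [opp_opp] at this
  · have e : b * (hD.rep w * hD.n0) * (hD.n0⁻¹ * q * hD.n0) = b * hD.rep w * q * hD.n0 := by group
    rw [e] at h2
    have e2 : w * (hD.w0 * z * hD.w0) * hD.w0 = w * hD.w0 * z := by
      rw [← mul_assoc w, mul_assoc _ hD.w0 hD.w0, w0_mul_w0, mul_one, ← mul_assoc]
    rwa [e2]

theorem inCell_mul {A : Finset σ} {w a : hD.W} {y : G} (h : hD.InCell A w y)
    (ha : a ∈ par hD.s A) : hD.InCell A (w * a) y := by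
  obtain ⟨b, hb, q, hq, rfl⟩ := h
  have hn : hD.rep w * hD.rep a ∈ D.N := mem_mul (hD.rep_mem w) (hD.rep_mem a)
  have h1 := hD.cls_rep (hD.cls _ hn)
  rw [cls_eq] at h1
  have e : hD.cls _ hn = w * a := by rw [cls_mul hD (hD.rep_mem w) (hD.rep_mem a), cls_rep, cls_rep]
  rw [e] at h1
  refine ⟨b, hb, _, mem_mul (mem_mul (hD.weyl_le_oppParabolic A (hD.T_le_weyl A h1))
    (inv_mem (hD.weyl_le_oppParabolic A (hD.rep_mem_weyl ha)))) hq, by group⟩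

theorem inCell_unique {A : Finset σ} {w w' : hD.W} {y : G} (h : hD.InCell A w y)
    (h' : hD.InCell A w' y) : w⁻¹ * w' ∈ par hD.s A := by
  obtain ⟨z, hz, h1⟩ := InCell.exists_dc hD h
  obtain ⟨z', hz', h2⟩ := InCell.exists_dc hD h'
  have := mul_right_cancel (hD.dc_eq_of_mem h1 h2)
  have e : w⁻¹ * w' = z * z'⁻¹ := by
    rw [inv_mul_eq_iff_eq_mul, ← mul_assoc, this]; group
  rw [e]
  exact mem_mul hz (inv_mem hz')

theorem InCell.mul_left {A I : Finset σ} {w : hD.W} {y h : G} (hy : hD.InCell A w y)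
    (hh : h ∈ D.parabolic I) : ∃ a ∈ par hD.s I, hD.InCell A (a * w) (h * y) := by
  obtain ⟨z, hz, h1⟩ := InCell.exists_dc hD hy
  obtain ⟨v, hv, hh'⟩ := hD.mem_parabolic_iff.1 hh
  obtain ⟨a, ha, h2⟩ := hD.par_mul_dc hv h1 hh'
  rw [← mul_assoc a, ← mul_assoc h] at h2
  obtain ⟨w', hw'⟩ := hD.exists_inCell A (h * y)
  obtain ⟨z', hz', h3⟩ := InCell.exists_dc hD hw'
  have h4 := hD.dc_eq_of_mem h2 h3
  refine ⟨a, ha, ?_⟩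
  have e : a * w = w' * (z' * z⁻¹) := by
    have := mul_right_cancel h4
    rw [← mul_assoc w', ← this]; group
  rw [e]
  exact hD.inCell_mul hw' (mem_mul hz' (inv_mem hz))

theorem inCell_rep_mul (A : Finset σ) (a w : hD.W) :
    hD.InCell A (a * w) (hD.rep a * hD.rep w) := by
  have hn : hD.rep a * hD.rep w ∈ D.N := mem_mul (hD.rep_mem a) (hD.rep_mem w)
  have h1 := hD.cls_rep (hD.cls _ hn)
  rw [cls_eq, cls_mul hD (hD.rep_mem a) (hD.rep_mem w), cls_rep, cls_rep] at h1
  exact ⟨1, one_mem _, _, hD.weyl_le_oppParabolic A (hD.T_le_weyl A h1), by group⟩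

theorem exists_label (A I : Finset σ) (y : G) :
    ∃ w, Good hD.s A I w ∧ ∃ h ∈ D.parabolic I, hD.InCell A w (h * y) := by
  obtain ⟨w, hw⟩ := hD.exists_inCell A y
  obtain ⟨g, hg, a, ha, b, hb, rfl⟩ := hD.cox.exists_good (A : Set σ) I w
  refine ⟨_, hg, ?_⟩
  obtain ⟨β, hβ, q, hq, rfl⟩ := hw
  refine ⟨hD.rep a * β⁻¹, mem_mul (hD.weyl_le_parabolic I (hD.rep_mem_weyl ha))
    (inv_mem (hD.B_le_parabolic I hβ)), hD.inCell_mul ?_ hb⟩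
  have e : hD.rep a * β⁻¹ * (β * hD.rep w * q) = hD.rep a * hD.rep w * q := by group
  rw [e]
  exact InCell.mul_right hD (hD.inCell_rep_mul A a w) hq

/-- The representative in `W` of the double coset `P_I y P_A⁻`. -/
def label (A I : Finset σ) (y : G) : hD.W := (hD.exists_label A I y).choose

theorem label_good (A I : Finset σ) (y : G) : Good hD.s A I (hD.label A I y) :=
  (hD.exists_label A I y).choose_spec.1

theorem label_spec (A I : Finset σ) (y : G) :
    ∃ h ∈ D.parabolic I, hD.InCell A (hD.label A I y) (h * y) :=
  (hD.exists_label A I y).choose_spec.2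

theorem label_rel {A I J : Finset σ} (hIJ : I ⊆ J) {w : hD.W} {y h q : G}
    (hh : h ∈ D.parabolic J) (hq : q ∈ D.oppParabolic A) (hw : hD.InCell A w (h * y * q)) :
    ∃ a ∈ par hD.s J, ∃ b ∈ par hD.s A, hD.label A I y = a * w * b := by
  obtain ⟨g, hg, h1⟩ := hD.label_spec A I y
  obtain ⟨a, ha, h2⟩ := InCell.mul_left hD (InCell.mul_right hD hw (inv_mem hq))
    (mem_mul (D.parabolic_mono hIJ hg) (inv_mem hh))
  have e : g * h⁻¹ * (h * y * q * q⁻¹) = g * y := by group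
  rw [e] at h2
  exact ⟨a, ha, _, hD.inCell_unique h2 h1, by group⟩

theorem label_eq {A I : Finset σ} {w : hD.W} (hw : Good hD.s A I w) {y h q : G}
    (hh : h ∈ D.parabolic I) (hq : q ∈ D.oppParabolic A) (h1 : hD.InCell A w (h * y * q)) :
    hD.label A I y = w := by
  obtain ⟨a, ha, b, hb, e⟩ := hD.label_rel subset_rfl hh hq h1
  exact hD.cox.good_unique (hD.label_good A I y) hw ha hb e

theorem label_mul {A I : Finset σ} {y h q : G} (hh : h ∈ D.parabolic I)
    (hq : q ∈ D.oppParabolic A) : hD.label A I (h * y * q) = hD.label A I y := by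
  obtain ⟨g, hg, h1⟩ := hD.label_spec A I y
  refine hD.label_eq (hD.label_good A I y) (mem_mul hg (inv_mem hh)) (inv_mem hq) ?_
  have e : g * h⁻¹ * (h * y * q) * q⁻¹ = g * y := by group
  rwa [e]

/-- Each `P_I`-double coset inside a given `P_J`-double coset has a representative in the same
`W_J`-`W_A` double coset of `W`, so `good_le` compares the labels. This makes the maps `φ` respect
the filtration by length. -/
theorem label_le {A I J : Finset σ} (hIJ : I ⊆ J) {y h : G} (hh : h ∈ D.parabolic J) :
    len hD.s (hD.label A I (h * y)) ≤ len hD.s (hD.label A J y) ∧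
    (len hD.s (hD.label A I (h * y)) = len hD.s (hD.label A J y) →
      hD.label A I (h * y) = hD.label A J y) := by
  obtain ⟨g, hg, h1⟩ := hD.label_spec A J y
  obtain ⟨a, ha, b, hb, e⟩ := hD.label_rel (y := h * y) (h := g * h⁻¹) hIJ
    (mem_mul hg (inv_mem hh)) (D.oppParabolic A).one_mem (w := hD.label A J y) (by
    have e : g * h⁻¹ * (h * y) * 1 = g * y := by group
    rwa [e])
  exact hD.cox.good_le (hD.label_good A I _) (hD.label_good A J y) ha hb e

/-- If `λ = label I y` has `s_i λ < λ`, then it is also the label with respect to `I ∪ {i}`. -/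
theorem label_insert [DecidableEq σ] {A I : Finset σ} {y : G} {i : σ}
    (hi : len hD.s (hD.s i * hD.label A I y) < len hD.s (hD.label A I y)) :
    hD.label A (insert i I) y = hD.label A I y := by
  obtain ⟨g, hg, h1⟩ := hD.label_spec A I y
  refine hD.label_eq ?_ (D.parabolic_mono (Finset.subset_insert i I) hg)
    (D.oppParabolic A).one_mem (by rwa [mul_one])
  rw [Finset.coe_insert]
  exact hD.cox.good_insert (hD.label_good A I y) hi

theorem label_eq_one_iff {A I : Finset σ} {y : G} :
    hD.label A I y = 1 ↔ I ⊆ A ∧ ∃ h ∈ D.parabolic I, h * y ∈ D.oppParabolic A := by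
  constructor
  · intro h
    have h1 := hD.label_good A I y
    obtain ⟨g, hg, b, hb, q, hq, e⟩ := hD.label_spec A I y
    rw [h] at h1 e
    refine ⟨by exact_mod_cast hD.cox.good_one_iff.1 h1, b⁻¹ * g,
      mem_mul (inv_mem (hD.B_le_parabolic I hb)) hg, ?_⟩
    rw [mul_assoc, e]
    have h2 : hD.rep 1 ∈ D.T := by
      rw [← hD.cls_eq_one (hn := hD.rep_mem 1), cls_rep]
    have h3 : b⁻¹ * (b * hD.rep 1 * q) = hD.rep 1 * q := by group
    rw [h3]
    exact mem_mul (hD.weyl_le_oppParabolic A (hD.T_le_weyl A h2)) hq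
  · rintro ⟨hI, h, hh, hy⟩
    refine hD.label_eq (hD.cox.good_one_iff.2 (by exact_mod_cast hI)) hh
      (D.oppParabolic A).one_mem ?_
    have h2 : hD.rep 1 ∈ D.T := by
      rw [← hD.cls_eq_one (hn := hD.rep_mem 1), cls_rep]
    exact ⟨1, one_mem _, (hD.rep 1)⁻¹ * (h * y),
      mem_mul (inv_mem (hD.weyl_le_oppParabolic A (hD.T_le_weyl A h2))) hy, by group⟩

/-! ### Cells fixed by a descent -/

/-- Right multiplication by `w₀` reverses lengths, so maximality of `w w_A` becomes minimality. -/
theorem rmin_of_good {A J : Set σ} {w : hD.W} (hw : Good hD.s A J w) :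
    RMin hD.s J (w * longest hD.s A * hD.w0)⁻¹ := by
  rw [hD.cox.rmin_iff_lmin_inv, inv_inv]
  intro t ht
  have h1 := hw.2 t ht
  have h2 := hD.len_mul_w0 (w * longest hD.s A)
  have h3 := hD.len_mul_w0 (hD.s t * (w * longest hD.s A))
  rw [mul_assoc] at h3
  omega

/-- Apply `unip_inf_leviU_le` to the minimal element `(w w_A w₀)⁻¹` and the set `A*`. Among the
generators in `J` only `j` could violate the hypothesis, and `good_inter` excludes it because `j` is
a descent of `w`. -/
theorem unip_inf_leviU_le_oppUnip {A J I : Finset σ} {w : hD.W} (hw : Good hD.s A J w) {j : σ}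
    (hj : len hD.s (hD.s j * w) < len hD.s w) (hI : ∀ k ∈ J, k ≠ j → k ∈ I) {g : G}
    (hg : g ∈ D.unip I) (hg' : g ∈ hD.leviU J) : g ∈ conj (hD.rep w) (hD.oppUnip A) := by
  rw [mem_conj, mem_oppUnip]
  intro a ha
  rw [← mem_conj, hD.conj_Uc (hD.rep_mem w), cls_rep]
  have hy : hD.w0 * (longest hD.s A * a)⁻¹ * hD.w0 ∈ par hD.s (hD.opp A : Finset σ) :=
    hD.w0_conj_mem (inv_mem (mem_mul (hD.cox.longest_mem _) ha))
  have h := hD.unip_inf_leviU_le (hD.rmin_of_good hw) hy (K' := I) ?_ hg hg'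
  · convert h using 2
    have h0 := hD.w0_mul_w0
    have h1 := hD.cox.longest_mul_longest (A : Set σ)
    simp only [mul_inv_rev, inv_inv, w0_inv, mul_assoc]
    rw [← mul_assoc hD.w0 hD.w0, h0, one_mul, ← mul_assoc (longest hD.s A) (longest hD.s A), h1,
      one_mul]
  · intro k hk hk'
    refine hI k hk ?_
    rintro rfl
    have e : (w * longest hD.s A * hD.w0)⁻¹ * hD.s k * (w * longest hD.s A * hD.w0)⁻¹⁻¹ =
        hD.w0 * ((longest hD.s A)⁻¹ * (w⁻¹ * hD.s k * w) * longest hD.s A) * hD.w0 := by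
      simp only [mul_inv_rev, inv_inv, w0_inv, mul_assoc]
    rw [e, w0_conj_mem_iff] at hk'
    have hl := hD.cox.longest_mem (A : Set σ)
    rw [Subgroup.mul_mem_cancel_right _ hl, Subgroup.mul_mem_cancel_left _ (inv_mem hl)] at hk'
    have := hD.cox.mem_of_s_mem_par (hD.cox.good_inter hw hj (mem_par hk) hk')
    exact this.2 rfl

/-- An element of `P_J` fixing the coset `w P_A⁻` has its Bruhat component `v` in `W_J ∩ w W_A w⁻¹`,
and `good_inter` removes the descent `j` from `v`. So the `P_J`-double coset with label `w` contains
a single `P_I`-double coset with that label. -/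
theorem parabolic_inf_conj_le {A J I : Finset σ} {w : hD.W} (hw : Good hD.s A J w) {j : σ}
    (hj : len hD.s (hD.s j * w) < len hD.s w) (hI : ∀ k ∈ J, k ≠ j → k ∈ I) {h : G}
    (hh : h ∈ D.parabolic J) (hh' : h ∈ conj (hD.rep w) (D.oppParabolic A)) :
    h ∈ D.parabolic I := by
  have hX : hD.leviU J ≤ conj (hD.rep w) (D.oppParabolic A) := by
    intro x hx
    have h1 := hD.leviU_le_Uc (hD.rmin_of_good hw) hx
    rw [inv_inv, mul_assoc] at h1
    rw [mem_conj]
    refine hD.Uc_mul_w0_le (hD.cox.longest_mem (A : Set σ)) ?_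
    rw [← mem_conj, hD.conj_Uc (hD.rep_mem w), cls_rep]
    exact h1
  have hT : D.T ≤ conj (hD.rep w) (D.oppParabolic A) := by
    intro t ht
    rw [mem_conj]
    have := hD.T_normal _ (inv_mem (hD.rep_mem w)) t ht
    rw [inv_inv] at this
    exact hD.weyl_le_oppParabolic A (hD.T_le_weyl A this)
  have hBL : ∀ b ∈ D.B, ∃ u ∈ D.unip J, ∃ x ∈ conj (hD.rep w) (D.oppParabolic A), b = u * x := by
    intro b hb
    obtain ⟨u, hu, t, ht, rfl⟩ := hD.exists_UT hb
    obtain ⟨u₁, h1, u₂, h2, rfl⟩ := hD.exists_unip_mul (I := J) hu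
    exact ⟨u₁, h1, u₂ * t, mem_mul (hX h2) (hT ht), by rw [mul_assoc]⟩
  obtain ⟨v, hv, b, hb, b', hb', e⟩ := hD.mem_parabolic_iff.1 hh
  suffices hvI : v ∈ par hD.s I by
    exact hD.mem_parabolic_iff.2 ⟨v, hvI, b, hb, b', hb', e⟩
  refine par_mono (fun k hk => hI k hk.1 hk.2) (hD.cox.good_inter hw hj hv ?_)
  obtain ⟨u, hu, x, hx, rfl⟩ := hBL b hb
  obtain ⟨u', hu', x', hx', rfl⟩ := hBL b' hb'
  have hnJ : hD.rep v ∈ D.parabolic J := hD.weyl_le_parabolic J (hD.rep_mem_weyl hv)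
  have hxJ : x ∈ D.parabolic J := by
    have := hD.B_le_parabolic J hb
    rwa [Subgroup.mul_mem_cancel_left _ (hD.unip_le_parabolic J hu)] at this
  have h1 : hD.rep v * u' * (hD.rep v)⁻¹ ∈ D.unip J := D.unip_normal J le_rfl _ hnJ _ hu'
  have h2 := D.unip_normal J le_rfl _ (inv_mem hxJ) _ hu
  rw [inv_inv] at h2
  -- After the factors in `w P_A⁻ w⁻¹` are split off on both sides of `h`, only elements of `U_J`
  -- remain next to the representative of `v`; these are absorbed by `B`.
  have e2 : hD.rep v = ((x⁻¹ * u * x) * (hD.rep v * u' * (hD.rep v)⁻¹))⁻¹ *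
      (x⁻¹ * h * x'⁻¹) := by
    rw [e]; group
  have h3 : hD.InCell A w (hD.rep v * hD.rep w) := by
    refine ⟨_, hD.U_le (hD.unip_le_U J (inv_mem (mem_mul h2 h1))),
      (hD.rep w)⁻¹ * (x⁻¹ * h * x'⁻¹) * hD.rep w, ?_, ?_⟩
    · rw [← mem_conj]
      exact mem_mul (mem_mul (inv_mem hx) hh') (inv_mem hx')
    · nth_rewrite 1 [e2]
      group
  have h4 : hD.InCell A (v * w) (hD.rep v * hD.rep w) := hD.inCell_rep_mul A v w
  have := hD.inCell_unique h3 h4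
  rwa [← mul_assoc] at this

/-! ### The BN-data of a Levi subgroup -/

include hD in
theorem map_leviData_weyl {I : Finset σ} (K : Finset I) :
    ((D.leviData I).weyl K).map (D.levi I).subtype =
      D.weyl (K.map (Function.Embedding.subtype _)) := by
  have hT : (D.leviData I).T.map (D.levi I).subtype = D.T := by
    have : (D.leviData I).T = D.T.subgroupOf (D.levi I) := rfl
    rw [this, Subgroup.subgroupOf_map_subtype, inf_eq_left]
    exact hD.T_le_levi I
  rw [weyl, Subgroup.map_sup, hT, MonoidHom.map_closure, weyl]
  congr 2
  ext x
  simp only [Set.mem_image, Finset.mem_coe, Finset.mem_map, Function.Embedding.subtype_apply]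
  constructor
  · rintro ⟨_, ⟨k, hk, rfl⟩, rfl⟩
    exact ⟨k, ⟨k, hk, rfl⟩, rfl⟩
  · rintro ⟨_, ⟨k, hk, rfl⟩, rfl⟩
    exact ⟨_, ⟨k, hk, rfl⟩, rfl⟩

theorem map_subset {I : Finset σ} (K : Finset I) :
    K.map (Function.Embedding.subtype _) ⊆ I := by
  intro x hx
  obtain ⟨k, -, rfl⟩ := Finset.mem_map.1 hx
  exact k.2

include hD in
-- An element of `P_K ∩ L_I` is a product of an element of `U_I` and one of the group generated by
-- `B ∩ L_I` and `W_K`; the first factor lies in `U_I ∩ L_I = 1`.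
theorem map_leviData_parabolic {I : Finset σ} (K : Finset I) :
    ((D.leviData I).parabolic K).map (D.levi I).subtype =
      D.parabolic (K.map (Function.Embedding.subtype _)) ⊓ D.levi I := by
  have hB : (D.leviData I).B.map (D.levi I).subtype = D.B ⊓ D.levi I :=
    Subgroup.subgroupOf_map_subtype _ _
  rw [parabolic, Subgroup.map_sup, hB, hD.map_leviData_weyl]
  refine le_antisymm (hD.B_levi_sup_weyl_le (map_subset K)) ?_
  intro g hg
  obtain ⟨hg, hg'⟩ := Subgroup.mem_inf.1 hg
  obtain ⟨u, hu, l, hl, rfl⟩ := hD.exists_unip_mul_of_mem (map_subset K) hg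
  have hlL := (Subgroup.mem_inf.1 (hD.B_levi_sup_weyl_le (map_subset K) hl)).2
  rw [Subgroup.mul_mem_cancel_right _ hlL] at hg'
  rwa [hD.unip_inf_levi hu hg', one_mul]

include hD in
theorem mem_leviData_parabolic {I : Finset σ} {K : Finset I} {l : D.levi I} :
    l ∈ (D.leviData I).parabolic K ↔
      (l : G) ∈ D.parabolic (K.map (Function.Embedding.subtype _)) := by
  have h := hD.map_leviData_parabolic K
  have h1 : l ∈ (D.leviData I).parabolic K ↔
      (l : G) ∈ ((D.leviData I).parabolic K).map (D.levi I).subtype := by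
    constructor
    · exact fun h => ⟨l, h, rfl⟩
    · rintro ⟨x, hx, e⟩
      rwa [← Subtype.ext e]
  rw [h1, h, Subgroup.mem_inf, and_iff_left l.2]

include hD in
theorem exists_unip_mul_parabolic_inf {I K : Finset σ} (hKI : K ⊆ I) {g : G}
    (hg : g ∈ D.parabolic K) :
    ∃ u ∈ D.unip I, ∃ l ∈ D.parabolic K ⊓ D.levi I, g = u * l := by
  obtain ⟨u, hu, l, hl, rfl⟩ := hD.exists_unip_mul_of_mem hKI hg
  exact ⟨u, hu, l, hD.B_levi_sup_weyl_le hKI hl, rfl⟩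

include hD in
-- Conjugation by `P_K` reduces to conjugation by `P_K ∩ L_I`, because the remaining factor lies in
-- `U_I` and so normalises `U`.
theorem mem_leviData_unip {I : Finset σ} {K : Finset I} {l : D.levi I} :
    l ∈ (D.leviData I).unip K ↔ (l : G) ∈ D.unip (K.map (Function.Embedding.subtype _)) := by
  simp only [unip, Subgroup.mem_iInf, mem_conj]
  constructor
  · intro h g hg
    obtain ⟨u, hu, x, hx, e⟩ := hD.exists_unip_mul_parabolic_inf (map_subset K) (inv_mem hg)
    obtain ⟨hx, hx'⟩ := Subgroup.mem_inf.1 hx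
    have h1 := h (⟨x, hx'⟩⁻¹) (inv_mem (hD.mem_leviData_parabolic.2 hx))
    have h2 : x * l * x⁻¹ ∈ D.U := by rw [inv_inv] at h1; exact h1
    have h3 : g⁻¹ * l * g = u * (x * l * x⁻¹) * u⁻¹ := by
      rw [← inv_inv g, e]; group
    rw [h3]
    exact mem_mul (mem_mul (hD.unip_le_U I hu) h2) (inv_mem (hD.unip_le_U I hu))
  · intro h g hg
    exact h g (hD.mem_leviData_parabolic.1 hg)

include hD in
theorem exists_unip_mul_unip_inf {I K : Finset σ} (hKI : K ⊆ I) {g : G} (hg : g ∈ D.unip K) :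
    ∃ u ∈ D.unip I, ∃ l ∈ D.unip K ⊓ D.levi I, g = u * l := by
  obtain ⟨u, hu, l, hl, rfl⟩ := hD.exists_unip_mul (I := I) (hD.unip_le_U K hg)
  refine ⟨u, hu, l, Subgroup.mem_inf.2 ⟨?_, hD.leviU_le_levi I hl⟩, rfl⟩
  exact (Subgroup.mul_mem_cancel_left _ (D.unip_anti hKI hu)).1 hg

end BNData.IsSplit
end SplitBN
end

noncomputable section
set_option linter.unusedSectionVars false
namespace SplitBN

open MonoidAlgebra (of)

/-! ### Idempotents of subgroups -/

section Idem

variable {G : Type u} [Group G] (R : Type v) [CommRing R] [Finite G]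

theorem idem_eq_sum (V : Subgroup G) [Fintype V] :
    idem R V = Ring.inverse (Nat.card V : R) • ∑ v : V, of R G (v : G) := by
  rw [idem, sumOf, finsum_eq_sum_of_fintype]

theorem of_mul_idem {V : Subgroup G} {v : G} (hv : v ∈ V) :
    of R G v * idem R V = idem R V := by
  have := Fintype.ofFinite V
  rw [idem_eq_sum, mul_smul_comm, Finset.mul_sum]
  simp only [← map_mul]
  congr 1
  exact Fintype.sum_equiv (Equiv.mulLeft (⟨v, hv⟩ : V)) _ _ fun _ => rfl

theorem idem_mul_of {V : Subgroup G} {v : G} (hv : v ∈ V) :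
    idem R V * of R G v = idem R V := by
  have := Fintype.ofFinite V
  rw [idem_eq_sum, smul_mul_assoc, Finset.sum_mul]
  simp only [← map_mul]
  congr 1
  exact Fintype.sum_equiv (Equiv.mulRight (⟨v, hv⟩ : V)) _ _ fun _ => rfl

theorem of_mul_idem_conj (V : Subgroup G) (g : G) :
    of R G g * idem R V = idem R (conj g V) * of R G g := by
  have := Fintype.ofFinite V
  have := Fintype.ofFinite (conj g V)
  let φ : V ≃ conj g V := (V.equivMapOfInjective (MulAut.conj g).toMonoidHom
    (MulAut.conj g).injective).toEquiv
  rw [idem_eq_sum, idem_eq_sum, mul_smul_comm, smul_mul_assoc, Finset.mul_sum, Finset.sum_mul,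
    ← Nat.card_congr φ]
  simp only [← map_mul]
  congr 1
  refine Fintype.sum_equiv φ _ _ fun v => ?_
  change _ = of R G (g * v * g⁻¹ * g)
  rw [inv_mul_cancel_right]

theorem mul_idem_mul_mem {V : Subgroup G} {a b : MonoidAlgebra R G}
    {M : Submodule (MonoidAlgebra R G) (MonoidAlgebra R G)}
    (h : ∀ v ∈ V, a * of R G v * b ∈ M) : a * idem R V * b ∈ M := by
  have := Fintype.ofFinite V
  rw [idem_eq_sum, mul_smul_comm, smul_mul_assoc, Finset.mul_sum, Finset.sum_mul]
  exact Submodule.smul_of_tower_mem _ _ (Submodule.sum_mem _ fun v _ => h v v.2)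

theorem mul_idem_mul {V : Subgroup G} (hV : IsUnit (Nat.card V : R)) {a b : MonoidAlgebra R G}
    (h : ∀ v ∈ V, a * of R G v * b = a * b) : a * idem R V * b = a * b := by
  have := Fintype.ofFinite V
  rw [idem_eq_sum, mul_smul_comm, smul_mul_assoc, Finset.mul_sum, Finset.sum_mul]
  rw [Finset.sum_congr rfl fun (v : V) _ => h v v.2, Finset.sum_const, Finset.card_univ,
    ← Nat.card_eq_fintype_card, ← Nat.cast_smul_eq_nsmul R, smul_smul, Ring.inverse_mul_cancel _ hV,
    one_smul]

theorem idem_mul_self (V : Subgroup G) : idem R V * idem R V = idem R V :=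
  (idem_mul R V V le_rfl).1

theorem of_commute_idem {V : Subgroup G} {g : G} (h : conj g V = V) :
    of R G g * idem R V = idem R V * of R G g := by
  rw [of_mul_idem_conj, h]

/-- The anti-involution of `RG` given by inversion. -/
def invol : MonoidAlgebra R G →ₐ[R] (MonoidAlgebra R G)ᵐᵒᵖ :=
  MonoidAlgebra.lift R (MonoidAlgebra R G)ᵐᵒᵖ G
    { toFun := fun g => op (of R G g⁻¹)
      map_one' := by rw [inv_one, map_one, op_one]
      map_mul' := fun g h => by rw [mul_inv_rev, map_mul, op_mul] }

theorem invol_of (g : G) : invol R (of R G g) = op (of R G g⁻¹) := by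
  simp [invol]

theorem invol_idem (V : Subgroup G) : invol R (idem R V) = op (idem R V) := by
  have := Fintype.ofFinite V
  rw [idem_eq_sum, map_smul, map_sum, op_smul, Finset.op_sum]
  congr 1
  refine Fintype.sum_equiv (Equiv.inv V) _ _ fun v => ?_
  rw [invol_of]
  rfl

end Idem

/-! ### Relations between the idempotents `e_I` and representatives of Weyl group elements -/

namespace BNData.IsSplit

variable {G : Type u} [Group G] {σ : Type} {D : BNData G σ} {p : ℕ} (hD : D.IsSplit p) [Finite G]
  (R : Type v) [CommRing R]

include hD

theorem card_isUnit [Fact p.Prime] (hp : IsUnit (p : R)) {V : Subgroup G} {g : G}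
    (hV : V ≤ conj g D.U) : IsUnit (Nat.card V : R) := by
  have h1 : IsPGroup p V := (hD.U_pGroup.map _).to_le hV
  obtain ⟨n, hn⟩ := IsPGroup.iff_card.1 h1
  rw [hn, Nat.cast_pow]
  exact hp.pow n

theorem card_unip_isUnit [Fact p.Prime] (hp : IsUnit (p : R)) (I : Finset σ) :
    IsUnit (Nat.card (D.unip I) : R) :=
  hD.card_isUnit R hp (g := 1) (by rw [conj_eq_self (one_mem _)]; exact hD.unip_le_U I)

omit hD in
theorem of_mul_e {I : Finset σ} {g : G} (hg : g ∈ D.unip I) :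
    of R G g * D.e R I = D.e R I := of_mul_idem R hg

omit hD in
theorem e_mul_of {I : Finset σ} {g : G} (hg : g ∈ D.unip I) :
    D.e R I * of R G g = D.e R I := idem_mul_of R hg

omit hD in
theorem e_mul_self (I : Finset σ) : D.e R I * D.e R I = D.e R I := idem_mul_self R _

theorem of_commute_e {I : Finset σ} {g : G} (hg : g ∈ D.parabolic I) :
    of R G g * D.e R I = D.e R I * of R G g :=
  of_commute_idem R (hD.conj_unip hg)

/-- For `x` of minimal length in `x W_K`, the element `e_A x e_K` only depends on the part
of `U_K` centralised in this way by `W_A`. -/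
theorem e_mul_of_mul_e_eq [Fact p.Prime] (hp : IsUnit (p : R)) {A K M : Finset σ} (hMK : M ⊆ K)
    {x : hD.W} (hx : RMin hD.s K x)
    (hM : ∀ k ∈ K, x * hD.s k * x⁻¹ ∈ par hD.s A → k ∈ M) :
    D.e R A * of R G (hD.rep x) * D.e R K = D.e R A * of R G (hD.rep x) * D.e R M := by
  have h1 : D.e R A * of R G (hD.rep x) * D.e R M * D.e R K =
      D.e R A * of R G (hD.rep x) * D.e R K := by
    refine mul_idem_mul R (hD.card_unip_isUnit R hp M) fun u hu => ?_
    -- The factor `u₁ ∈ U_K` is absorbed by `e_K`, and the factor `u₂ ∈ U ∩ L_K` is carried across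
    -- `x` into `U_A` and absorbed by `e_A`.
    obtain ⟨u₁, h1, u₂, h2, rfl⟩ := hD.exists_unip_mul (I := K) (hD.unip_le_U M hu)
    have h3 : u₂⁻¹ * u₁ * u₂ ∈ D.unip K := by
      have := D.unip_normal K le_rfl _ (inv_mem (hD.U_le_parabolic K (hD.leviU_le_U K h2))) _ h1
      rwa [inv_inv] at this
    have h4 : u₂ ∈ D.unip M := by
      rwa [Subgroup.mul_mem_cancel_left _ (D.unip_anti hMK h1)] at hu
    have h5 : hD.rep x * u₂ * (hD.rep x)⁻¹ ∈ D.unip A := by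
      rw [hD.mem_unip]
      intro y hy
      have h6 := hD.unip_inf_leviU_le hx (inv_mem hy) hM h4 h2
      have h7 : u₂ ∈ conj (hD.rep x)⁻¹ (hD.Uc y) := by
        rw [hD.conj_Uc (inv_mem (hD.rep_mem x)), cls_inv hD (hD.rep_mem x), cls_rep]
        convert h6 using 2
        group
      rw [mem_conj, inv_inv] at h7
      exact h7
    have e1 : u₁ * u₂ = u₂ * (u₂⁻¹ * u₁ * u₂) := by group
    have e2 : hD.rep x * u₂ = hD.rep x * u₂ * (hD.rep x)⁻¹ * hD.rep x := by group
    rw [e1, map_mul, mul_assoc, mul_assoc (of R G u₂), of_mul_e R h3,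
      ← mul_assoc, mul_assoc (D.e R A), ← map_mul, e2, map_mul, ← mul_assoc, e_mul_of R h5]
  rw [← h1, mul_assoc, (D.e_mul_e R hMK).1]

/-- If `d` conjugates `W_K` to `W_{K'}`, then `U_{K'} ∩ ᵈU ≤ ᵈU_K`. -/
theorem unip_inf_Uc_le {K K' : Finset σ} {d : hD.W} (h : Move hD.s d K K') {g : G}
    (hg : g ∈ D.unip K') (hg' : g ∈ hD.Uc d) : g ∈ conj (hD.rep d) (D.unip K) := by
  rw [mem_conj, hD.mem_unip]
  intro w hw
  rw [← mem_conj, hD.conj_Uc (hD.rep_mem d), cls_rep]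
  have hz := h.conj_mem hw
  have hz2 := h.len_conj hD.cox hw
  have hl := hD.cox.longest_mem (K' : Set σ)
  refine hD.Uc_inf_le (a := longest hD.s K') (c := d) ?_
    (Subgroup.mem_inf.2 ⟨hD.unip_le_Uc hl hg, hg'⟩)
  have h1 := IsCox.LMin.len_mul hD.cox h.lmin (inv_mem hl)
  have h2 := IsCox.LMin.len_mul hD.cox h.lmin (mem_mul (inv_mem hl) hz)
  have e1 : (longest hD.s K')⁻¹ * (d * w * d⁻¹) * d = (longest hD.s K')⁻¹ * (d * w) := by group
  have e2 : (d * w)⁻¹ * d = w⁻¹ := by group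
  rw [e1] at h2
  rw [h1, h2, e2, hD.isGen.len_inv w, hD.cox.longest_inv]
  have h3 := hD.cox.len_longest_mul hz
  omega

/-- The middle idempotent can be removed because each `u ∈ U_{K₂}` splits along `x y`: one factor
moves to the left through `x` into `U_{K₁}`, the other to the right through `y` into `U_K`. -/
theorem e_mul_of_mul_of_mul_e [Fact p.Prime] (hp : IsUnit (p : R)) {K K₁ K₂ : Finset σ}
    {x y : hD.W} (hx : Move hD.s x K₂ K₁) (hy : Move hD.s y K K₂)
    (hxy : len hD.s (x * y) = len hD.s x + len hD.s y) :
    D.e R K₁ * of R G (hD.rep x) * D.e R K₂ * (of R G (hD.rep y) * D.e R K) =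
      D.e R K₁ * of R G (hD.rep x) * (of R G (hD.rep y) * D.e R K) := by
  refine mul_idem_mul R (hD.card_unip_isUnit R hp K₂) fun u hu => ?_
  obtain ⟨α, hα, γ, hγ, rfl⟩ := hD.exists_U_mul hxy (hD.unip_le_U K₂ hu)
  obtain ⟨hαU, hα⟩ := Subgroup.mem_inf.1 hα
  obtain ⟨hγU, hγ⟩ := Subgroup.mem_inf.1 hγ
  obtain ⟨α₁, h1, α₂, h2, rfl⟩ := hD.exists_unip_mul (I := K₂) hαU
  have h3 : α₁ ∈ hD.Uc x⁻¹ := by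
    rwa [Subgroup.mul_mem_cancel_right _ (hD.leviU_le_Uc hx.rmin h2)] at hα
  have h4 : α₂ * γ ∈ hD.Uc y := by
    refine mem_mul ?_ hγ
    have := hD.leviU_le_Uc (hD.cox.rmin_iff_lmin_inv.2 (by rw [inv_inv]; exact hy.lmin)) h2
    rwa [inv_inv] at this
  have h5 : α₂ * γ ∈ D.unip K₂ := by
    rwa [mul_assoc, Subgroup.mul_mem_cancel_left _ h1] at hu
  have h6 := hD.unip_inf_Uc_le (hx.inv hD.cox) h1 h3
  have h7 := hD.unip_inf_Uc_le hy h5 h4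
  have h8 : hD.rep x * α₁ * (hD.rep x)⁻¹ ∈ D.unip K₁ := by
    have hn : hD.rep x * hD.rep x⁻¹ ∈ D.T := by
      rw [← hD.cls_eq_one (hn := mem_mul (hD.rep_mem x) (hD.rep_mem x⁻¹)),
        cls_mul hD (hD.rep_mem x) (hD.rep_mem x⁻¹), cls_rep, cls_rep, mul_inv_cancel]
    have e := hD.conj_unip (hD.T_le_parabolic K₁ hn)
    rw [← e, ← conj_conj, mem_conj]
    have : (hD.rep x)⁻¹ * (hD.rep x * α₁ * (hD.rep x)⁻¹) * hD.rep x = α₁ := by group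
    rwa [this]
  rw [mem_conj] at h7
  have e1 : hD.rep x * α₁ = hD.rep x * α₁ * (hD.rep x)⁻¹ * hD.rep x := by group
  have e2 : α₂ * γ * hD.rep y = hD.rep y * ((hD.rep y)⁻¹ * (α₂ * γ) * hD.rep y) := by group
  have e3 : of R G (α₂ * γ) * (of R G (hD.rep y) * D.e R K) = of R G (hD.rep y) * D.e R K := by
    rw [← mul_assoc, ← map_mul, e2, map_mul, mul_assoc, of_mul_e R h7]
  have e4 : D.e R K₁ * of R G (hD.rep x) * of R G α₁ = D.e R K₁ * of R G (hD.rep x) := by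
    rw [mul_assoc, ← map_mul, e1, map_mul, ← mul_assoc, e_mul_of R h8]
  rw [mul_assoc α₁, map_mul, ← mul_assoc _ (of R G α₁), e4, mul_assoc, e3]

/-- The left ideal generated by the elements `e_M h` for `M ⊊ K` and `h ∈ P_K`. -/
def cuspIdeal (_ : D.IsSplit p) (K : Finset σ) : Ideal (MonoidAlgebra R G) :=
  Ideal.span {x | ∃ M, M ⊂ K ∧ ∃ h ∈ D.parabolic K, x = D.e R M * of R G h}

theorem mem_cuspIdeal {K M : Finset σ} (hM : M ⊂ K) {h : G} (hh : h ∈ D.parabolic K)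
    (a : MonoidAlgebra R G) : a * D.e R M * of R G h ∈ hD.cuspIdeal R K := by
  rw [mul_assoc]
  exact Ideal.mul_mem_left _ _ (Ideal.subset_span ⟨M, hM, h, hh, rfl⟩)

theorem rep_mul_conj_mem {K K' : Finset σ} {d : hD.W} (h : Move hD.s d K K') {l : G}
    (hl : l ∈ (D.B ⊓ D.levi K) ⊔ D.weyl K) :
    hD.rep d * l * (hD.rep d)⁻¹ ∈ D.parabolic K' := by
  have key : (D.B ⊓ D.levi K) ⊔ D.weyl K ≤ conj (hD.rep d)⁻¹ (D.parabolic K') := by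
    refine sup_le (fun b hb => ?_) fun n hn => ?_
    · obtain ⟨hb, hb'⟩ := Subgroup.mem_inf.1 hb
      obtain ⟨u, hu, t, ht, rfl⟩ := hD.exists_UT hb
      refine mem_mul ?_ ?_
      · have h1 : u ∈ hD.leviU K := by
          rw [← hD.U_inf_levi]
          exact Subgroup.mem_inf.2 ⟨hu,
            (Subgroup.mul_mem_cancel_right _ (hD.T_le_levi K ht)).1 hb'⟩
        have h2 := hD.leviU_le_Uc h.rmin h1
        rw [← hD.cls_rep d, ← cls_inv hD (hD.rep_mem d), ← hD.conj_eq_Uc] at h2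
        exact conj_mono _ (hD.U_le_parabolic K') h2
      · rw [mem_conj, inv_inv]
        exact hD.T_le_parabolic K' (hD.T_normal _ (hD.rep_mem d) t ht)
    · have hn' := hD.weyl_le_N K hn
      rw [mem_conj, inv_inv]
      have h1 : hD.rep d * n * (hD.rep d)⁻¹ ∈ D.N :=
        mem_mul (mem_mul (hD.rep_mem d) hn') (inv_mem (hD.rep_mem d))
      refine hD.weyl_le_parabolic K' ((hD.mem_weyl_iff h1).2 ?_)
      rw [cls_mul hD (mem_mul (hD.rep_mem d) hn') (inv_mem (hD.rep_mem d)),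
        cls_mul hD (hD.rep_mem d) hn', cls_inv hD (hD.rep_mem d), cls_rep]
      exact h.conj_mem ((hD.mem_weyl_iff hn').1 hn)
  have := key hl
  rwa [mem_conj, inv_inv] at this

/-- The `U_K`-part of `g` is absorbed by `e_K`; the Levi part commutes with `e_K`, is conjugated by
`d` into `P_{K'}`, and there commutes with `e_{K'}`. -/
theorem e_mul_of_mul_e_mul_of {K K' : Finset σ} {d : hD.W} (h : Move hD.s d K K') {g : G}
    (hg : g ∈ D.parabolic K) : ∃ a, D.e R K' * of R G (hD.rep d) * D.e R K * of R G g =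
      a * (D.e R K' * of R G (hD.rep d) * D.e R K) := by
  obtain ⟨u, hu, l, hl, rfl⟩ := hD.exists_unip_mul_of_mem subset_rfl hg
  have hlK := (Subgroup.mem_inf.1 (hD.B_levi_sup_weyl_le subset_rfl hl)).1
  have h1 := hD.rep_mul_conj_mem h hl
  refine ⟨of R G (hD.rep d * l * (hD.rep d)⁻¹), ?_⟩
  have e1 : D.e R K * of R G (u * l) = of R G l * D.e R K := by
    rw [map_mul, ← mul_assoc, e_mul_of R hu, hD.of_commute_e R hlK]
  have e2 : of R G (hD.rep d) * of R G l =
      of R G (hD.rep d * l * (hD.rep d)⁻¹) * of R G (hD.rep d) := by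
    rw [← map_mul, ← map_mul]; congr 1; group
  rw [mul_assoc (D.e R K' * _), e1, ← mul_assoc, mul_assoc (D.e R K'), e2, ← mul_assoc,
    ← hD.of_commute_e R h1]
  simp only [mul_assoc]

theorem mem_of_conj_mem {K K' M : Finset σ} {d : hD.W} (h : Move hD.s d K K')
    (hd : ∀ k ∈ K, d * hD.s k * d⁻¹ ∈ par hD.s M) : K' ⊆ M := by
  intro k' hk'
  obtain ⟨k, hk, e⟩ := h.surj k' hk'
  have := hd k hk
  rw [e, mul_inv_cancel_right] at this
  exact hD.cox.mem_of_s_mem_par this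

theorem card_le_of_move {K K' : Finset σ} {d : hD.W} (h : Move hD.s d K K') : K'.card ≤ K.card := by
  classical
  choose f hf hf' using h.surj
  refine Finset.card_le_card_of_injOn (fun k => if hk : k ∈ K' then f k hk else k) ?_ ?_
  · intro k hk
    have hk' : k ∈ K' := hk
    simp only [dif_pos hk']
    exact hf k hk'
  · intro k hk l hl hkl
    have hk' : k ∈ K' := hk
    have hl' : l ∈ K' := hl
    simp only [dif_pos hk', dif_pos hl'] at hkl
    have h1 := hf' k hk'
    rw [hkl, hf' l hl'] at h1
    exact (hD.cox.inj (mul_right_cancel h1)).symm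

open Classical in
/-- The case of a parabolic subgroup of rank `|K| + 1`. -/
theorem e_mem_of_insert [Fact p.Prime] (hp : IsUnit (p : R)) {K K₁ : Finset σ} {i : σ}
    {v : hD.W} (hv : v = longest hD.s (insert i K : Finset σ) * longest hD.s K)
    (h : Move hD.s v K K₁) (hK₁ : K₁ ⊆ insert i K) :
    D.e R K ∈ Ideal.span {D.e R K₁ * of R G (hD.rep v) * D.e R K} ⊔ hD.cuspIdeal R K := by
  set J := insert i K with hJ
  have hKJ : K ⊆ J := Finset.subset_insert i K
  set M := Ideal.span {D.e R K₁ * of R G (hD.rep v) * D.e R K} ⊔ hD.cuspIdeal R K with hM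
  -- Since the idempotent of `V` is `v⁻¹ e_{K₁} v`, the product of it with `e_K` on both sides lies
  -- in `M`. Expanded over `V`, the terms from `U_J` all equal `e_K`, and the others will be shown
  -- to lie in `M`.
  set V := conj (hD.rep v)⁻¹ (D.unip K₁) with hV
  have hvJ : v ∈ par hD.s J := by
    rw [hv]
    exact mem_mul (hD.cox.longest_mem _) (par_mono (by exact_mod_cast hKJ) (hD.cox.longest_mem _))
  have hnv : hD.rep v ∈ D.parabolic J := hD.weyl_le_parabolic J (hD.rep_mem_weyl hvJ)
  have hVJ : V ≤ D.parabolic J := by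
    rw [hV, ← conj_eq_self (inv_mem hnv)]
    exact conj_mono _ (hD.unip_le_parabolic K₁ |>.trans (D.parabolic_mono hK₁))
  have hUV : D.unip J ≤ V := by
    rw [hV, ← hD.conj_unip (inv_mem hnv)]
    exact conj_mono _ (D.unip_anti hK₁)
  have hVK : ∀ u ∈ V, u ∈ D.parabolic K → u ∈ D.unip J := by
    intro u hu huK
    rw [hV, mem_conj, inv_inv] at hu
    obtain ⟨a, ha, b, hb, e⟩ := hD.exists_unip_mul (I := J) (hD.unip_le_U K₁ hu)
    have hb1 : b ∈ D.unip K₁ := by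
      rw [e] at hu
      rwa [Subgroup.mul_mem_cancel_left _ (D.unip_anti hK₁ ha)] at hu
    have ha' : (hD.rep v)⁻¹ * a * hD.rep v ∈ D.unip J := by
      have := D.unip_normal J le_rfl _ (inv_mem hnv) _ ha
      rwa [inv_inv] at this
    have hu' : u = (hD.rep v)⁻¹ * a * hD.rep v * ((hD.rep v)⁻¹ * b * hD.rep v) := by
      have : u = (hD.rep v)⁻¹ * (hD.rep v * u * (hD.rep v)⁻¹) * hD.rep v := by group
      rw [this, e]; group
    -- Modulo `U_J`, the group `V` lies in `U_K⁻`, which meets `P_K` trivially.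
    have hb' : (hD.rep v)⁻¹ * b * hD.rep v ∈ hD.oppUnip K := by
      rw [mem_oppUnip]
      intro y hy
      have hx : RMin hD.s J (hD.w0 * longest hD.s J) := by
        refine IsCox.RMax.mul_longest hD.cox fun t _ => ?_
        exact (hD.cox.longest_spec Set.univ).2 t (Set.mem_univ t)
      have hlK := hD.cox.longest_mem (K : Set σ)
      have h0 := hD.w0_mul_w0
      have hJJ := hD.cox.longest_mul_longest (J : Set σ)
      have hKK := hD.cox.longest_mul_longest (K : Set σ)
      have hz : hD.w0 * (y⁻¹ * longest hD.s K) * hD.w0 ∈ par hD.s (hD.opp K : Finset σ) :=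
        hD.w0_conj_mem (mem_mul (inv_mem hy) hlK)
      have h2 := hD.unip_inf_leviU_le hx hz (K' := K₁) (fun k _ hk => ?_) hb1 hb
      · have h3 : b ∈ conj (hD.rep v) (hD.Uc (y * hD.w0)) := by
          rw [hD.conj_Uc (hD.rep_mem v), cls_rep]
          convert h2 using 2
          rw [hv]
          simp only [mul_inv_rev, inv_inv, w0_inv, hD.cox.longest_inv, mul_assoc]
          rw [← mul_assoc hD.w0 hD.w0, h0, one_mul]
        rwa [mem_conj] at h3
      · have e2 : hD.w0 * longest hD.s J * hD.s k * (hD.w0 * longest hD.s J)⁻¹ =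
            hD.w0 * (longest hD.s J * hD.s k * longest hD.s J) * hD.w0 := by
          simp only [mul_inv_rev, w0_inv, hD.cox.longest_inv, mul_assoc]
        rw [e2, w0_conj_mem_iff] at hk
        have h4 := h.conj_mem (mem_mul (mem_mul hlK hk) hlK)
        have e3 : v * (longest hD.s K * (longest hD.s J * hD.s k * longest hD.s J) *
            longest hD.s K) * v⁻¹ = longest hD.s J * (longest hD.s K * longest hD.s K) *
              longest hD.s J * hD.s k * (longest hD.s J * (longest hD.s K * longest hD.s K) *
              longest hD.s J) := by
          rw [hv]
          simp only [mul_inv_rev, hD.cox.longest_inv, mul_assoc]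
        rw [e3, hKK, mul_one, hJJ, one_mul, mul_one] at h4
        exact hD.cox.mem_of_s_mem_par h4
    have hb2 : (hD.rep v)⁻¹ * b * hD.rep v ∈ D.parabolic K := by
      rw [hu'] at huK
      rwa [Subgroup.mul_mem_cancel_left _ (D.parabolic_mono hKJ |> fun _ =>
        hD.U_le_parabolic K (hD.unip_le_U J ha'))] at huK
    rw [hu', hD.oppUnip_inf_parabolic hb' hb2, mul_one]
    exact ha'
  have hcard : IsUnit (Nat.card V : R) :=
    hD.card_isUnit R hp (g := (hD.rep v)⁻¹) (conj_mono _ (hD.unip_le_U K₁))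
  -- the terms outside `U_J`
  have hout : ∀ u ∈ V, u ∉ D.unip J → D.e R K * of R G u * D.e R K ∈ M := by
    intro u hu huJ
    obtain ⟨w, hw, b, hb, b', hb', rfl⟩ := hD.mem_parabolic_iff.1 (hVJ hu)
    obtain ⟨x, hx, c, hc, rfl⟩ := hD.cox.exists_rmin (K : Set σ) w
    have hn : hD.rep x * hD.rep c ∈ D.N := mem_mul (hD.rep_mem x) (hD.rep_mem c)
    have h1 := hD.cls_rep (hD.cls _ hn)
    rw [cls_eq, cls_mul hD (hD.rep_mem x) (hD.rep_mem c), cls_rep, cls_rep] at h1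
    set q := hD.rep c * ((hD.rep (x * c))⁻¹ * (hD.rep x * hD.rep c))⁻¹ * b' with hq
    have hqK : q ∈ D.parabolic K := mem_mul (mem_mul
      (hD.weyl_le_parabolic K (hD.rep_mem_weyl hc)) (hD.T_le_parabolic K (inv_mem h1)))
      (hD.B_le_parabolic K hb')
    have e1 : b * hD.rep (x * c) * b' = b * (hD.rep x * q) := by rw [hq]; group
    have e2 : D.e R K * of R G (b * hD.rep (x * c) * b') * D.e R K =
        of R G b * (D.e R K * of R G (hD.rep x) * D.e R K * of R G q) := by
      rw [e1, map_mul, map_mul, ← mul_assoc, ← hD.of_commute_e R (hD.B_le_parabolic K hb)]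
      simp only [mul_assoc]
      rw [hD.of_commute_e R hqK]
    rw [e2]
    refine Ideal.mul_mem_left _ _ ?_
    -- If `x` normalises `W_K`, then `eq_of_normalizes` leaves only `x = 1`, excluded by `hVK`, and
    -- `x = v`, which gives the generator of `M`. If it does not, `e_K x e_K` collapses to a proper
    -- subset of `K` and falls into the cuspidal ideal.
    by_cases hxK : ∀ k ∈ K, x * hD.s k * x⁻¹ ∈ par hD.s K
    · have hxJ : x ∈ par hD.s (insert i (K : Set σ)) := by
        rw [hJ, Finset.coe_insert] at hw
        exact (Subgroup.mul_mem_cancel_right _ (par_mono (Set.subset_insert _ _) hc)).1 hw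
      rcases hD.cox.eq_of_normalizes hxJ hx hxK with rfl | hxv
      · exfalso
        refine huJ (hVK _ hu ?_)
        rw [e1]
        refine mem_mul (hD.B_le_parabolic K hb) (mem_mul (hD.T_le_parabolic K ?_) hqK)
        rw [← hD.cls_eq_one (hn := hD.rep_mem 1), cls_rep]
      · have hxv' : x = v := by rw [hxv, hv, hJ, Finset.coe_insert]
        subst hxv'
        -- Here `v` itself normalises `W_K`, so the move takes `K` to itself.
        have hKK : K₁ = K := Finset.eq_of_subset_of_card_le (hD.mem_of_conj_mem h hxK)
          (hD.card_le_of_move (h.inv hD.cox))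
        obtain ⟨a, ha⟩ := hD.e_mul_of_mul_e_mul_of R h hqK
        rw [hKK] at ha
        rw [ha, hM, hKK]
        exact Ideal.mul_mem_left _ _ ((le_sup_left : _ ≤ _ ⊔ hD.cuspIdeal R K)
          (Ideal.subset_span rfl))
    · push Not at hxK
      obtain ⟨k, hk, hk'⟩ := hxK
      refine (le_sup_right : hD.cuspIdeal R K ≤ M) ?_
      have h2 := hD.e_mul_of_mul_e_eq R hp (A := K) (K := K)
        (M := K.filter fun k => x * hD.s k * x⁻¹ ∈ par hD.s K) (Finset.filter_subset _ _) hx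
        (fun k hk hk' => Finset.mem_filter.2 ⟨hk, hk'⟩)
      rw [h2]
      refine hD.mem_cuspIdeal R ?_ hqK _
      refine (Finset.ssubset_iff_of_subset (Finset.filter_subset _ _)).2 ⟨k, hk, ?_⟩
      simp [hk']
  have hin : ∀ u ∈ D.unip J, D.e R K * of R G u * D.e R K = D.e R K := fun u hu => by
    rw [e_mul_of R (D.unip_anti hKJ hu)]
    exact idem_mul_self R _
  -- comparison of coefficients
  have hfin := Fintype.ofFinite V
  have hsum : D.e R K * (∑ u : V, of R G (u : G)) * D.e R K ∈ M := by
    have h1 : D.e R K * idem R V * D.e R K ∈ M := by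
      have e : idem R V = of R G (hD.rep v)⁻¹ * D.e R K₁ * of R G (hD.rep v) := by
        rw [e, of_mul_idem_conj, mul_assoc, ← map_mul, inv_mul_cancel, map_one, mul_one]
      have e2 : D.e R K * (of R G (hD.rep v)⁻¹ * D.e R K₁ * of R G (hD.rep v)) * D.e R K =
          D.e R K * of R G (hD.rep v)⁻¹ * (D.e R K₁ * of R G (hD.rep v) * D.e R K) := by
        simp only [mul_assoc]
      rw [e, e2]
      exact Ideal.mul_mem_left _ _ ((le_sup_left : _ ≤ _ ⊔ hD.cuspIdeal R K)
        (Ideal.subset_span rfl))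
    rw [idem_eq_sum, mul_smul_comm, smul_mul_assoc] at h1
    have h2 := Submodule.smul_of_tower_mem M (Nat.card V : R) h1
    rwa [smul_smul, Ring.mul_inverse_cancel _ hcard, one_smul] at h2
  have hdiff : (Nat.card (D.unip J) : R) • D.e R K ∈ M := by
    have hsplit := Finset.sum_filter_add_sum_filter_not (Finset.univ : Finset V)
      (fun u => (u : G) ∈ D.unip J) (fun u => D.e R K * of R G (u : G) * D.e R K)
    have h1 : ∑ u ∈ (Finset.univ : Finset V).filter (fun u : V => (u : G) ∈ D.unip J), D.e R K * of R G (u : G) * D.e R K =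
        (Nat.card (D.unip J) : R) • D.e R K := by
      rw [Finset.sum_congr rfl fun (u : V) hu => hin u (Finset.mem_filter.1 hu).2, Finset.sum_const,
        ← Nat.cast_smul_eq_nsmul R]
      congr 2
      rw [← Fintype.card_subtype, ← Nat.card_eq_fintype_card]
      exact Nat.card_congr (Subgroup.subgroupOfEquivOfLe hUV).toEquiv
    rw [← h1]
    rw [Finset.mul_sum, Finset.sum_mul, ← hsplit] at hsum
    refine (Submodule.add_mem_iff_left M (Submodule.sum_mem _ fun u hu => ?_)).1 hsum
    exact hout u u.2 (Finset.mem_filter.1 hu).2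
  have := Submodule.smul_of_tower_mem M (Ring.inverse (Nat.card (D.unip J) : R)) hdiff
  rwa [smul_smul, Ring.inverse_mul_cancel _ (hD.card_unip_isUnit R hp J), one_smul] at this

theorem rep_inv_mul_conj_mem {K K' : Finset σ} {d : hD.W} (h : Move hD.s d K K') {l : G}
    (hl : l ∈ (D.B ⊓ D.levi K') ⊔ D.weyl K') :
    (hD.rep d)⁻¹ * l * hD.rep d ∈ D.parabolic K := by
  have h1 := hD.rep_mul_conj_mem (h.inv hD.cox) hl
  have hn : hD.rep d⁻¹ * hD.rep d ∈ D.T := by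
    rw [← hD.cls_eq_one (hn := mem_mul (hD.rep_mem d⁻¹) (hD.rep_mem d)),
      cls_mul hD (hD.rep_mem d⁻¹) (hD.rep_mem d), cls_rep, cls_rep, inv_mul_cancel]
  have hn' := hD.T_le_parabolic K hn
  have e : (hD.rep d)⁻¹ * l * hD.rep d = (hD.rep d⁻¹ * hD.rep d)⁻¹ *
      (hD.rep d⁻¹ * l * (hD.rep d⁻¹)⁻¹) * (hD.rep d⁻¹ * hD.rep d) := by group
  rw [e]
  exact mem_mul (mem_mul (inv_mem hn') h1) hn'

/-- For `M ⊊ K'`, the product `e_M v e_K` reduces to the idempotent of the `k ∈ K` with `v s_k v⁻¹ ∈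
W_M`. This set is proper, as otherwise `K' ⊆ M`. -/
theorem cuspIdeal_mul_mem [Fact p.Prime] (hp : IsUnit (p : R)) {K K' : Finset σ} {v : hD.W}
    (h : Move hD.s v K K') {x : MonoidAlgebra R G} (hx : x ∈ hD.cuspIdeal R K') :
    x * of R G (hD.rep v) * D.e R K ∈ hD.cuspIdeal R K := by
  classical
  have key : hD.cuspIdeal R K' ≤ Submodule.comap
      (LinearMap.toSpanSingleton (MonoidAlgebra R G) _ (of R G (hD.rep v) * D.e R K))
      (hD.cuspIdeal R K) := by
    refine Submodule.span_le.2 ?_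
    rintro _ ⟨M, hM, g, hg, rfl⟩
    change D.e R M * of R G g * (of R G (hD.rep v) * D.e R K) ∈ hD.cuspIdeal R K
    obtain ⟨u, hu, l, hl, rfl⟩ := hD.exists_unip_mul_of_mem subset_rfl hg
    have h1 := hD.rep_inv_mul_conj_mem h hl
    have h2 := hD.e_mul_of_mul_e_eq R hp (A := M) (K := K)
      (M := K.filter fun k => v * hD.s k * v⁻¹ ∈ par hD.s M) (Finset.filter_subset _ _) h.rmin
      (fun k hk hk' => Finset.mem_filter.2 ⟨hk, hk'⟩)
    have e1 : D.e R M * of R G (u * l) * (of R G (hD.rep v) * D.e R K) =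
        D.e R M * of R G (hD.rep v) * D.e R K * of R G ((hD.rep v)⁻¹ * l * hD.rep v) := by
      rw [mul_assoc _ (D.e R K), ← hD.of_commute_e R h1, map_mul, ← mul_assoc (D.e R M),
        e_mul_of R (D.unip_anti hM.1 hu)]
      simp only [← mul_assoc]
      simp only [mul_assoc, ← map_mul]
      simp only [← mul_assoc, mul_inv_cancel, one_mul]
    rw [e1, h2]
    refine hD.mem_cuspIdeal R ?_ h1 _
    refine (Finset.filter_subset _ _).ssubset_of_ne fun hK => ?_
    exact hM.2 (hD.mem_of_conj_mem h (Finset.filter_eq_self.1 hK))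
  have := key hx
  change x * (of R G (hD.rep v) * D.e R K) ∈ hD.cuspIdeal R K at this
  rwa [← mul_assoc] at this

/-- Induction on the length of `d`: a right descent splits off an elementary move `v` from `K` to
`K₂`, settled by `e_mem_of_insert`. The induction hypothesis rewrites `e_{K₂}` through the shorter
move `d'`, and the idempotent between `d'` and `v` disappears because lengths add. -/
theorem e_mem_of_move [Fact p.Prime] (hp : IsUnit (p : R)) {K K₁ : Finset σ} {d : hD.W}
    (h : Move hD.s d K K₁) :
    D.e R K ∈ Ideal.span {D.e R K₁ * of R G (hD.rep d) * D.e R K} ⊔ hD.cuspIdeal R K := by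
  classical
  induction hn : len hD.s d using Nat.strong_induction_on generalizing K d with
  | _ n ih =>
    by_cases hd : d = 1
    · subst hd
      have h1 : K₁ = K := Finset.eq_of_subset_of_card_le
        (hD.mem_of_conj_mem h fun k hk => by simpa using mem_par hk)
        (hD.card_le_of_move (h.inv hD.cox))
      subst h1
      have h2 : hD.rep 1 ∈ D.parabolic K₁ := by
        refine hD.T_le_parabolic _ ?_
        rw [← hD.cls_eq_one (hn := hD.rep_mem 1), cls_rep]
      refine (le_sup_left : _ ≤ _ ⊔ hD.cuspIdeal R K₁) (Ideal.mem_span_singleton'.2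
        ⟨of R G (hD.rep 1)⁻¹, ?_⟩)
      rw [← hD.of_commute_e R h2, mul_assoc (of R G (hD.rep 1)), e_mul_self,
        ← mul_assoc, ← map_mul, inv_mul_cancel, map_one, one_mul]
    · obtain ⟨i, d₀, e, hl⟩ := hD.cox.exists_right_descent hd
      obtain ⟨d', K₂, hv, hd', e', hlen, hne, hK₂⟩ := IsCox.Move.exists_split hD.cox h (i := i)
        (by rw [e, hD.isGen.mul_s_mul_s, ← e]; omega)
      rw [← Finset.coe_insert] at hv e' hlen hne hK₂
      have hfin : Set.Finite K₂ := (insert i K).finite_toSet.subset hK₂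
      obtain ⟨K₂, rfl⟩ := hfin.exists_finset_coe
      set v := longest hD.s (insert i K : Finset σ) * longest hD.s K with hvdef
      have hv0 : len hD.s v ≠ 0 := fun h0 => hne (hD.isGen.len_eq_zero.1 h0)
      have h1 := hD.e_mem_of_insert R hp hvdef hv (by exact_mod_cast hK₂)
      have h2 := ih _ (by omega) hd' rfl
      refine (sup_le ?_ le_sup_right : _ ≤ _ ⊔ hD.cuspIdeal R K) h1
      rw [Ideal.span_singleton_le_iff_mem]
      obtain ⟨y, hy, z, hz, e2⟩ := Submodule.mem_sup.1 h2
      obtain ⟨a, rfl⟩ := Ideal.mem_span_singleton'.1 hy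
      rw [← e2, add_mul, add_mul]
      refine add_mem ?_ ((le_sup_right : hD.cuspIdeal R K ≤ _) (hD.cuspIdeal_mul_mem R hp hv hz))
      -- The chosen representatives are multiplicative only up to an element of `T`, which
      -- `e_mul_of_mul_e_mul_of` moves to the left.
      have hn' : hD.rep d' * hD.rep v ∈ D.N := mem_mul (hD.rep_mem _) (hD.rep_mem _)
      have ht := hD.cls_rep (hD.cls _ hn')
      rw [cls_eq, cls_mul hD (hD.rep_mem d') (hD.rep_mem v), cls_rep, cls_rep, ← e'] at ht
      have htK := hD.T_le_parabolic K ht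
      obtain ⟨c, hc⟩ := hD.e_mul_of_mul_e_mul_of R h htK
      have e3 : of R G (hD.rep d') * of R G (hD.rep v) =
          of R G (hD.rep d) * of R G ((hD.rep d)⁻¹ * (hD.rep d' * hD.rep v)) := by
        rw [← map_mul, ← map_mul]; congr 1; group
      have e4 : a * (D.e R K₁ * of R G (hD.rep d') * D.e R K₂) * of R G (hD.rep v) * D.e R K =
          a * c * (D.e R K₁ * of R G (hD.rep d) * D.e R K) := by
        rw [mul_assoc, mul_assoc a, hD.e_mul_of_mul_of_mul_e R hp hd' hv (by rw [← e', hlen]),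
          mul_assoc (D.e R K₁), ← mul_assoc (of R G _) (of R G _), e3, mul_assoc (of R G _),
          hD.of_commute_e R htK, mul_assoc a, ← hc]
        simp only [mul_assoc]
      rw [e4]
      exact Ideal.mul_mem_left _ _ ((le_sup_left : _ ≤ _ ⊔ hD.cuspIdeal R K)
        (Ideal.subset_span rfl))

/-! ### The theorem of Howlett and Lehrer -/

/-- `|U_I⁻|⁻¹ ∑_{u ∈ U_I⁻} u` -/
def oppE (I : Finset σ) : MonoidAlgebra R G := idem R (hD.oppUnip I)

/-- With `d = w₀ w_K` one has `d⁻¹ = w_K w₀`, so the chambers defining `U_{K₁}` are carried to the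
chambers `w w₀`, `w ∈ W_K`, defining `U_K⁻`. -/
theorem conj_inv_unip_eq {K K₁ : Finset σ}
    (h : Move hD.s (longest hD.s Set.univ * longest hD.s K) K K₁) :
    conj (hD.rep (longest hD.s Set.univ * longest hD.s K))⁻¹ (D.unip K₁) = hD.oppUnip K := by
  set d := longest hD.s Set.univ * longest hD.s K with hd
  ext x
  rw [mem_conj, inv_inv, hD.mem_unip, mem_oppUnip]
  have key : ∀ w, hD.rep d * x * (hD.rep d)⁻¹ ∈ hD.Uc w ↔ x ∈ hD.Uc (d⁻¹ * w) := by
    intro w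
    have := hD.conj_Uc (inv_mem (hD.rep_mem d)) w
    rw [cls_inv hD (hD.rep_mem d), cls_rep] at this
    rw [← this, mem_conj, inv_inv]
  have hdi : d⁻¹ = longest hD.s K * hD.w0 := by
    rw [hd, mul_inv_rev, hD.cox.longest_inv, hD.cox.longest_inv]
    rfl
  have hl := hD.cox.longest_mem (K : Set σ)
  simp only [key]
  constructor
  · intro hx w hw
    have h1 := hx _ (h.conj_mem (mem_mul hw hl))
    have e : d⁻¹ * (d * (w * longest hD.s K) * d⁻¹) = w * (longest hD.s K * d⁻¹) := by group
    rwa [e, hdi, ← mul_assoc (longest hD.s K), hD.cox.longest_mul_longest, one_mul] at h1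
  · intro hx w hw
    have h1 := hx (d⁻¹ * w * d⁻¹⁻¹ * longest hD.s K) (mem_mul ((h.inv hD.cox).conj_mem hw) hl)
    rwa [mul_assoc _ (longest hD.s K), ← hdi, inv_mul_cancel_right] at h1

theorem oppUnip_anti {M K : Finset σ} (h : M ⊆ K) : hD.oppUnip K ≤ hD.oppUnip M := by
  intro x hx
  rw [mem_oppUnip] at hx ⊢
  exact fun w hw => hx w (par_mono (by exact_mod_cast h) hw)

theorem of_commute_oppE {I : Finset σ} {g : G} (hg : g ∈ D.oppParabolic I) :
    of R G g * hD.oppE R I = hD.oppE R I * of R G g :=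
  of_commute_idem R (hD.conj_oppUnip hg)

/-- For `d = w₀ w_K` one has `e_{K₁} d = d e_K⁻`, so `e_mem_of_move` proves the claim modulo the
cuspidal ideal. The generators of that ideal are treated by induction on `K`. -/
theorem e_mem_span_oppE [Fact p.Prime] (hp : IsUnit (p : R)) (K : Finset σ) :
    D.e R K ∈ Ideal.span {hD.oppE R K * D.e R K} := by
  induction K using Finset.strongInduction with
  | H K ih =>
    obtain ⟨K₁, -, h⟩ := hD.cox.exists_move (Set.subset_univ (K : Set σ))
    obtain ⟨K₁, rfl⟩ : ∃ K₂ : Finset σ, (K₂ : Set σ) = K₁ := by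
      classical
      choose f hf hf' using h.surj
      have hf2 : Function.Injective fun k : K₁ => (⟨f k k.2, hf k k.2⟩ : K) := by
        intro k l hkl
        have hkl' : f k k.2 = f l l.2 := congrArg Subtype.val hkl
        have h1 := hf' k k.2
        rw [hkl', hf' l l.2] at h1
        exact Subtype.ext (hD.cox.inj (mul_right_cancel h1)).symm
      have := Finite.of_injective _ hf2
      exact (Set.toFinite K₁).exists_finset_coe
    have hV := hD.conj_inv_unip_eq h
    set d := longest hD.s Set.univ * longest hD.s K with hd
    have h1 : D.e R K₁ * of R G (hD.rep d) = of R G (hD.rep d) * hD.oppE R K := by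
      have h2 := of_mul_idem_conj R (D.unip K₁) (hD.rep d)⁻¹
      rw [hV] at h2
      have h3 : of R G (hD.rep d) * (of R G (hD.rep d)⁻¹ * idem R (D.unip K₁)) *
          of R G (hD.rep d) = of R G (hD.rep d) * (idem R (hD.oppUnip K) *
            of R G (hD.rep d)⁻¹) * of R G (hD.rep d) := by rw [h2]
      rwa [← mul_assoc, ← map_mul, mul_inv_cancel, map_one, one_mul, mul_assoc (of R G _),
        mul_assoc (idem R _), ← map_mul, inv_mul_cancel, map_one, mul_one] at h3
    refine (sup_le ?_ ?_ : _ ⊔ hD.cuspIdeal R K ≤ _) (hD.e_mem_of_move R hp h)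
    · rw [Ideal.span_singleton_le_iff_mem, h1, mul_assoc]
      exact Ideal.mul_mem_left _ _ (Ideal.subset_span rfl)
    · refine Ideal.span_le.2 ?_
      rintro _ ⟨M, hM, g, hg, rfl⟩
      obtain ⟨a, ha⟩ := Ideal.mem_span_singleton'.1 (ih M hM)
      have h2 : hD.oppE R M = hD.oppE R M * hD.oppE R K :=
        (idem_mul R _ _ (hD.oppUnip_anti hM.1)).1.symm
      -- The induction hypothesis for `M` supplies `e_M⁻`, which absorbs `e_K⁻` on its right, while
      -- `e_M` absorbs `e_K` on its left. Expanding the remaining `e_M` over `U_M ≤ P_K = U_K L_K`,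
      -- the `U_K`-part is absorbed and the `L_K`-part commutes to the left.
      have h3 : D.e R M * of R G g = a * hD.oppE R M *
          (hD.oppE R K * D.e R K * D.e R M * of R G g) := by
        conv_lhs => rw [← ha, h2]
        rw [mul_assoc (hD.oppE R K), (D.e_mul_e R hM.1).2]
        simp only [mul_assoc]
      rw [SetLike.mem_coe, h3]
      refine Ideal.mul_mem_left _ _ (mul_idem_mul_mem R fun u hu => ?_)
      obtain ⟨u', hu', l, hl, e⟩ := hD.exists_unip_mul_levi
        (mem_mul (hD.unip_le_parabolic M |>.trans (D.parabolic_mono hM.1) <| hu) hg)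
      obtain ⟨hl, hl'⟩ := Subgroup.mem_inf.1 hl
      have h4 : hD.oppE R K * D.e R K * of R G u * of R G g =
          of R G l * (hD.oppE R K * D.e R K) := by
        rw [mul_assoc, ← map_mul, e, map_mul, mul_assoc (hD.oppE R K), ← mul_assoc (D.e R K),
          e_mul_of R hu', ← hD.of_commute_e R hl, ← mul_assoc, ← hD.of_commute_oppE R hl',
          mul_assoc]
      rw [h4]
      exact Ideal.mul_mem_left _ _ (Ideal.subset_span rfl)

/-- The anti-involution by inversion fixes both idempotents and reverses products. This identity
makes right multiplication by `e⁻` injective on `Y e`. -/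
theorem exists_e_eq_mul [Fact p.Prime] (hp : IsUnit (p : R)) (K : Finset σ) :
    ∃ z, D.e R K * hD.oppE R K * z = D.e R K := by
  obtain ⟨z, hz⟩ := Ideal.mem_span_singleton'.1 (hD.e_mem_span_oppE R hp K)
  have h := congrArg (fun x => (invol R x).unop) hz
  simp only [map_mul, unop_mul] at h
  rw [oppE, e, invol_idem, invol_idem] at h
  exact ⟨_, h⟩

/-- Conjugation by `n₀` exchanges the idempotents of `K*` and the opposite ones of `K`. This
identity makes right multiplication by `e⁻` map `Y e` onto `Y e⁻`. -/
theorem exists_oppE_eq_mul [Fact p.Prime] (hp : IsUnit (p : R)) (K : Finset σ) :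
    ∃ z, z * (D.e R K * hD.oppE R K) = hD.oppE R K := by
  obtain ⟨z, hz⟩ := Ideal.mem_span_singleton'.1 (hD.e_mem_span_oppE R hp (hD.opp K))
  refine ⟨of R G hD.n0 * z * of R G hD.n0⁻¹, ?_⟩
  have h1 : of R G hD.n0 * hD.oppE R (hD.opp K) = D.e R K * of R G hD.n0 := by
    rw [oppE, of_mul_idem_conj, conj_n0_oppUnip, e]
  have h2 : of R G hD.n0 * D.e R (hD.opp K) = hD.oppE R K * of R G hD.n0 :=
    of_mul_idem_conj R _ _
  have h3 : of R G hD.n0 * (z * (hD.oppE R (hD.opp K) * D.e R (hD.opp K))) * of R G hD.n0⁻¹ =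
      of R G hD.n0 * D.e R (hD.opp K) * of R G hD.n0⁻¹ := by rw [hz]
  have h4 : of R G hD.n0⁻¹ * of R G hD.n0 = 1 := by rw [← map_mul, inv_mul_cancel, map_one]
  have h5 : of R G hD.n0 * of R G hD.n0⁻¹ = 1 := by rw [← map_mul, mul_inv_cancel, map_one]
  rw [h2, mul_assoc (hD.oppE R K), h5, mul_one] at h3
  refine Eq.trans ?_ h3
  have h6 : of R G hD.n0⁻¹ * D.e R K * hD.oppE R K =
      hD.oppE R (hD.opp K) * D.e R (hD.opp K) * of R G hD.n0⁻¹ := by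
    have h7 : of R G hD.n0⁻¹ * D.e R K = hD.oppE R (hD.opp K) * of R G hD.n0⁻¹ := by
      have := congrArg (fun x => of R G hD.n0⁻¹ * x * of R G hD.n0⁻¹) h1
      simp only [← mul_assoc] at this
      rw [h4, one_mul, mul_assoc _ _ (of R G hD.n0⁻¹), h5, mul_one] at this
      exact this.symm
    have h8 : of R G hD.n0⁻¹ * hD.oppE R K = D.e R (hD.opp K) * of R G hD.n0⁻¹ := by
      have := congrArg (fun x => of R G hD.n0⁻¹ * x * of R G hD.n0⁻¹) h2
      simp only [← mul_assoc] at this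
      rw [h4, one_mul, mul_assoc _ _ (of R G hD.n0⁻¹), h5, mul_one] at this
      exact this.symm
    rw [h7, mul_assoc, h8, mul_assoc]
  rw [mul_assoc (of R G hD.n0 * z), ← mul_assoc _ (D.e R K), h6]
  simp only [mul_assoc]

end BNData.IsSplit
end SplitBN
end

noncomputable section
set_option linter.unusedSectionVars false

namespace SplitBN

/-! ### Homotopy equivalences from nilpotent endomorphisms -/

section Retract

variable {S : Type*} [Ring S] {C D : CochainComplex (ModuleCat.{w} S) ℤ}

theorem exists_iterate (a : C ⟶ C) (f : C ⟶ D) (hf : a ≫ f = f)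
    (ha : (HomotopyCategory.quotient _ _).map a = 𝟙 _) (N : ℕ) :
    ∃ g : C ⟶ C, (HomotopyCategory.quotient _ _).map g = 𝟙 _ ∧ g ≫ f = f ∧
      ∀ i (x : C.X i), g.f i x = (fun y => a.f i y)^[N] x := by
  induction N with
  | zero => exact ⟨𝟙 C, CategoryTheory.Functor.map_id _ _, Category.id_comp _, fun _ _ => rfl⟩
  | succ n ih =>
    obtain ⟨g, h1, h2, h3⟩ := ih
    refine ⟨a ≫ g, ?_, ?_, fun i x => ?_⟩
    · rw [Functor.map_comp, h1, ha, Category.comp_id]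
    · rw [Category.assoc, h2, hf]
    · rw [HomologicalComplex.comp_f, ModuleCat.comp_apply, h3, Function.iterate_succ_apply]

/-- A degreewise surjective chain map `f` is a homotopy equivalence as soon as there is a null
homotopic endomorphism `θ` of its source with `f θ = 0` such that `1 - θ` is nilpotent on the
kernel of `f`. -/
theorem nonempty_quotient_iso (f : C ⟶ D) (hf : ∀ i, Function.Surjective (f.f i)) (θ : C ⟶ C)
    (hθ : Homotopy θ 0) (hθf : θ ≫ f = 0) (N : ℕ)
    (hN : ∀ i (x : C.X i), f.f i x = 0 →
      (fun y => (𝟙 C - θ : C ⟶ C).f i y)^[N] x = 0) :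
    Nonempty ((HomotopyCategory.quotient _ _).obj C ≅ (HomotopyCategory.quotient _ _).obj D) := by
  obtain ⟨g, hq, hgf, hg⟩ := exists_iterate (𝟙 C - θ) f
    (by rw [Preadditive.sub_comp, hθf, sub_zero, Category.id_comp])
    (by rw [Functor.map_sub, HomotopyCategory.eq_of_homotopy _ _ hθ, Functor.map_zero, sub_zero,
        CategoryTheory.Functor.map_id]) N
  replace hg : ∀ i (x : C.X i), f.f i x = 0 → g.f i x = 0 := fun i x hx =>
    (hg i x).trans (hN i x hx)
  -- The power `g` of `1 - θ` is homotopic to the identity and kills the kernel of `f`, so it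
  -- factors through the surjection `f`; the factor is the homotopy inverse.
  let k (i : ℤ) : D.X i →ₗ[S] C.X i :=
    ((LinearMap.ker (f.f i).hom).liftQ (g.f i).hom fun x hx => hg i x hx) ∘ₗ
      ((f.f i).hom.quotKerEquivOfSurjective (hf i)).symm.toLinearMap
  have hk : ∀ i (x : C.X i), k i (f.f i x) = g.f i x := by
    intro i x
    have : ((f.f i).hom.quotKerEquivOfSurjective (hf i)).symm (f.f i x) =
        (LinearMap.ker (f.f i).hom).mkQ x := by
      rw [LinearEquiv.symm_apply_eq]; rfl
    exact congrArg ((LinearMap.ker (f.f i).hom).liftQ (g.f i).hom fun x hx => hg i x hx) this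
  let K : D ⟶ C :=
    { f i := ModuleCat.ofHom (k i)
      comm' i j _ := by
        ext y
        obtain ⟨x, rfl⟩ := hf i y
        change C.d i j (k i (f.f i x)) = k j (D.d i j (f.f i x))
        rw [hk]
        have h1 : D.d i j (f.f i x) = f.f j (C.d i j x) := by
          rw [← ModuleCat.comp_apply, ← ModuleCat.comp_apply, f.comm]
        rw [h1, hk, ← ModuleCat.comp_apply, ← ModuleCat.comp_apply, HomologicalComplex.Hom.comm] }
  have hfK : f ≫ K = g := by
    ext i x
    exact hk i x
  have hKf : K ≫ f = 𝟙 D := by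
    ext i y
    obtain ⟨x, rfl⟩ := hf i y
    change f.f i (k i (f.f i x)) = f.f i x
    rw [hk, ← ModuleCat.comp_apply, ← HomologicalComplex.comp_f, hgf]
  exact ⟨⟨(HomotopyCategory.quotient _ _).map f, (HomotopyCategory.quotient _ _).map K, by
    rw [← Functor.map_comp, hfK, hq], by rw [← Functor.map_comp, hKf, CategoryTheory.Functor.map_id]⟩⟩

end Retract

/-! ### Maps of degree `-1` on the complex of a coefficient system -/

section Coeff

variable {S : Type*} [Ring S] {σ : Type}

open scoped Classical in
/-- The map `M^I → M^J` of a coefficient system, extended by `0` to all pairs. -/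
def CoeffSystem.phi (M : CoeffSystem.{w} σ S) (I J : Finset σ) : M.obj I →ₗ[S] M.obj J :=
  if h : I ≤ J then (M.map (homOfLE h)).hom else 0

theorem CoeffSystem.phi_of_le (M : CoeffSystem.{w} σ S) {I J : Finset σ} (h : I ≤ J) :
    CoeffSystem.phi M I J = (M.map (homOfLE h)).hom := dif_pos h

variable [LinearOrder σ]

theorem coeffD_apply_phi (M : CoeffSystem.{w} σ S) (i j : ℤ) (h : i + 1 = j) (x : coeffX M i)
    (y : ∀ I, M.obj I) (hy : ∀ I : {I : Finset σ // (I.card : ℤ) = i}, x I = y I.1)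
    (K : {I : Finset σ // (I.card : ℤ) = j}) :
    coeffD M i j x K = ∑ s ∈ K.1, (-1 : ℤ) ^ numLT (K.1.erase s) s •
        CoeffSystem.phi M (K.1.erase s) K.1 (y (K.1.erase s)) := by
  rw [coeffD_apply M i j h, ← Finset.sum_attach K.1]
  refine Finset.sum_congr rfl fun s _ => ?_
  rw [hy, CoeffSystem.phi_of_le M (Finset.erase_subset _ _)]

/-- A family of elements in degree `i`, extended by `0`. -/
def coeffExt (M : CoeffSystem.{w} σ S) (i : ℤ) (x : coeffX M i) (I : Finset σ) : M.obj I :=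
  if h : (I.card : ℤ) = i then x ⟨I, h⟩ else 0

theorem coeffExt_apply (M : CoeffSystem.{w} σ S) (i : ℤ) (x : coeffX M i)
    (I : {I : Finset σ // (I.card : ℤ) = i}) : coeffExt M i x I.1 = x I := dif_pos I.2

variable [Fintype σ]

/-- The degree `-1` map with components `(-1)^{n(I,s)} ψ_{I,I∪s}`. -/
def coeffH (M : CoeffSystem.{w} σ S) (ψ : ∀ I J, M.obj J →ₗ[S] M.obj I) (i j : ℤ) :
    coeffX M i →ₗ[S] coeffX M j :=
  LinearMap.pi fun K => ∑ s ∈ K.1ᶜ,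
    if h : ((insert s K.1).card : ℤ) = i then
      (-1 : ℤ) ^ numLT K.1 s • (ψ K.1 (insert s K.1) ∘ₗ LinearMap.proj
          (⟨insert s K.1, h⟩ : {I : Finset σ // (I.card : ℤ) = i}))
    else 0

theorem coeffH_apply (M : CoeffSystem.{w} σ S) (ψ : ∀ I J, M.obj J →ₗ[S] M.obj I) (i j : ℤ)
    (h : j + 1 = i) (x : coeffX M i) (y : ∀ I, M.obj I)
    (hy : ∀ I : {I : Finset σ // (I.card : ℤ) = i}, x I = y I.1)
    (K : {I : Finset σ // (I.card : ℤ) = j}) :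
    coeffH M ψ i j x K = ∑ s ∈ K.1ᶜ, (-1 : ℤ) ^ numLT K.1 s •
      ψ K.1 (insert s K.1) (y (insert s K.1)) := by
  simp only [coeffH, LinearMap.pi_apply, LinearMap.sum_apply]
  refine Finset.sum_congr rfl fun s hs => ?_
  have hc : ((insert s K.1).card : ℤ) = i := by
    have := Finset.card_insert_of_notMem (Finset.mem_compl.1 hs)
    have := K.2
    omega
  rw [dif_pos hc, ← hy ⟨_, hc⟩]
  rfl

/-- Because of this sign, the off-diagonal terms of `dh + hd` combine into differences `φψ - ψφ`. -/
theorem numLT_sign_insert (I : Finset σ) {s t : σ} (hs : s ∈ I) (ht : t ∉ I) :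
    (-1 : ℤ) ^ numLT I t * (-1) ^ numLT ((insert t I).erase s) s =
      -((-1 : ℤ) ^ numLT (I.erase s) s * (-1) ^ numLT (I.erase s) t) := by
  have hst : s ≠ t := fun h => ht (h ▸ hs)
  have h := numLT_sign (insert t I) (Finset.mem_insert_of_mem hs) (Finset.mem_insert_self t I) hst
  rw [Finset.erase_right_comm, Finset.erase_insert ht] at h
  have e1 := neg_one_pow_eq_or ℤ (numLT I t)
  have e2 := neg_one_pow_eq_or ℤ (numLT (I.erase s) t)
  rcases e1 with e1 | e1 <;> rcases e2 with e2 | e2 <;> rw [e1, e2] at h ⊢ <;> linarith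

/-- Removing again the generator just added, or the reverse, returns to the same `I` with sign `+1`
and gives the diagonal part. Exchanging `s ∈ I` with `t ∉ I` is possible in two orders, with
opposite signs. -/
theorem coeffD_coeffH (M : CoeffSystem.{w} σ S) (ψ : ∀ I J, M.obj J →ₗ[S] M.obj I) (i : ℤ)
    (x : coeffX M i) (I : {I : Finset σ // (I.card : ℤ) = i}) :
    coeffH M ψ (i + 1) i (coeffD M i (i + 1) x) I + coeffD M (i - 1) i (coeffH M ψ i (i - 1) x) I =
      (∑ s ∈ I.1, CoeffSystem.phi M (I.1.erase s) I.1 (ψ (I.1.erase s) I.1 (x I)) +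
        ∑ t ∈ I.1ᶜ, ψ I.1 (insert t I.1) (CoeffSystem.phi M I.1 (insert t I.1) (x I))) +
      ∑ s ∈ I.1, ∑ t ∈ I.1ᶜ, ((-1 : ℤ) ^ numLT (I.1.erase s) s * (-1) ^ numLT (I.1.erase s) t) •
        (CoeffSystem.phi M (I.1.erase s) I.1 (ψ (I.1.erase s) (insert t (I.1.erase s))
            (coeffExt M i x (insert t (I.1.erase s)))) -
          ψ I.1 (insert t I.1) (CoeffSystem.phi M (insert t (I.1.erase s)) (insert t I.1)
            (coeffExt M i x (insert t (I.1.erase s))))) := by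
  obtain ⟨I, hI⟩ := I
  set X := coeffExt M i x with hX
  have hxX : ∀ I : {I : Finset σ // (I.card : ℤ) = i}, x I = X I.1 :=
    fun I => (coeffExt_apply M i x I).symm
  let Y : ∀ K, M.obj K := fun K => ∑ s ∈ K, (-1 : ℤ) ^ numLT (K.erase s) s •
    CoeffSystem.phi M (K.erase s) K (X (K.erase s))
  let Z : ∀ K, M.obj K := fun K => ∑ t ∈ Kᶜ, (-1 : ℤ) ^ numLT K t •
      ψ K (insert t K) (X (insert t K))
  rw [coeffH_apply M ψ (i + 1) i rfl _ Y fun K => coeffD_apply_phi M i (i + 1) rfl x X hxX K,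
    coeffD_apply_phi M (i - 1) i (by omega) _ Z fun K => coeffH_apply M ψ i (i - 1) (by omega) x X
      hxX K, hxX ⟨I, hI⟩]
  dsimp only
  have h1 : ∀ t ∈ Iᶜ, (-1 : ℤ) ^ numLT I t • ψ I (insert t I) (Y (insert t I)) =
      ψ I (insert t I) (CoeffSystem.phi M I (insert t I) (X I)) -
        ∑ s ∈ I, ((-1 : ℤ) ^ numLT (I.erase s) s * (-1) ^ numLT (I.erase s) t) •
          ψ I (insert t I) (CoeffSystem.phi M (insert t (I.erase s)) (insert t I)
            (X (insert t (I.erase s)))) := by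
    intro t ht
    have ht' := Finset.mem_compl.1 ht
    dsimp only [Y]
    rw [Finset.sum_insert ht', Finset.erase_insert ht', map_add, map_zsmul, smul_add, smul_smul,
      ← mul_pow, neg_one_mul, neg_neg, one_pow, one_smul, sub_eq_add_neg, map_sum, Finset.smul_sum,
      ← Finset.sum_neg_distrib]
    congr 1
    refine Finset.sum_congr rfl fun s hs => ?_
    have hst : t ≠ s := fun h => ht' (h.symm ▸ hs)
    rw [map_zsmul, smul_smul, numLT_sign_insert I hs ht', neg_smul,
      Finset.erase_insert_of_ne hst]
  have h2 : ∀ s ∈ I, (-1 : ℤ) ^ numLT (I.erase s) s •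
      CoeffSystem.phi M (I.erase s) I (Z (I.erase s)) =
      CoeffSystem.phi M (I.erase s) I (ψ (I.erase s) I (X I)) +
        ∑ t ∈ Iᶜ, ((-1 : ℤ) ^ numLT (I.erase s) s * (-1) ^ numLT (I.erase s) t) •
          CoeffSystem.phi M (I.erase s) I (ψ (I.erase s) (insert t (I.erase s))
            (X (insert t (I.erase s)))) := by
    intro s hs
    dsimp only [Z]
    have hc : (I.erase s)ᶜ = insert s Iᶜ := by
      ext a
      simp only [Finset.mem_compl, Finset.mem_erase, Finset.mem_insert]
      tauto
    rw [hc, Finset.sum_insert (by simpa using hs), Finset.insert_erase hs, map_add, map_zsmul,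
      smul_add, smul_smul, ← mul_pow, neg_one_mul, neg_neg, one_pow, one_smul, map_sum,
      Finset.smul_sum]
    congr 1
    refine Finset.sum_congr rfl fun t ht => ?_
    rw [map_zsmul, smul_smul]
  rw [Finset.sum_congr rfl h1, Finset.sum_congr rfl h2, Finset.sum_sub_distrib,
    Finset.sum_add_distrib, Finset.sum_comm (s := Iᶜ)]
  simp only [smul_sub, Finset.sum_sub_distrib]
  abel

end Coeff

end SplitBN
end

noncomputable section
set_option linter.unusedSectionVars false

namespace SplitBN

/-! ### Comparison of the complexes of two coefficient systems -/

section Coeff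

variable {S : Type*} [Ring S] {σ : Type} [LinearOrder σ]

theorem sum_hom_apply {ι : Type*} {X Y : ModuleCat.{w} S} (s : Finset ι) (f : ι → (X ⟶ Y))
    (x : X) : (∑ i ∈ s, f i).hom x = ∑ i ∈ s, (f i).hom x := by
  rw [ModuleCat.hom_sum, LinearMap.sum_apply]

theorem numLT_map {I₀ : Finset σ} (K : Finset I₀) (s : I₀) :
    numLT (K.map (Function.Embedding.subtype _)) (s : σ) = numLT K s := by
  unfold numLT
  rw [Finset.filter_map, Finset.card_map]
  rfl

/-- The map in degree `i` induced by maps `ρ_K : M^K → M'^K`, `K ⊆ I₀`. -/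
def coeffRestrX (I₀ : Finset σ) (M : CoeffSystem.{w} σ S) (M' : CoeffSystem.{w} I₀ S)
    (ρ : ∀ K : Finset I₀, M.obj (K.map (Function.Embedding.subtype _)) →ₗ[S] M'.obj K) (i : ℤ) :
    coeffX M i →ₗ[S] coeffX M' i :=
  LinearMap.pi fun K : {I : Finset I₀ // (I.card : ℤ) = i} =>
    ρ K.1 ∘ₗ LinearMap.proj (⟨K.1.map (Function.Embedding.subtype _), by
      rw [Finset.card_map]; exact K.2⟩ : {I : Finset σ // (I.card : ℤ) = i})

/-- The chain map induced by maps `ρ_K : M^K → M'^K`, `K ⊆ I₀`. -/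
def coeffRestr (I₀ : Finset σ) (M : CoeffSystem.{w} σ S) (M' : CoeffSystem.{w} I₀ S)
    (ρ : ∀ K : Finset I₀, M.obj (K.map (Function.Embedding.subtype _)) →ₗ[S] M'.obj K)
    (hρφ : ∀ (K L : Finset I₀) (x), K ≤ L → ρ L (CoeffSystem.phi M _ _ x) =
      CoeffSystem.phi M' K L (ρ K x)) : coeffComplex M ⟶ coeffComplex M' where
  f i := ModuleCat.ofHom (coeffRestrX I₀ M M' ρ i)
  comm' i j hij := by
    refine ModuleCat.hom_ext (LinearMap.ext fun (x : coeffX M i) => funext fun K => ?_)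
    change coeffD M' i j (coeffRestrX I₀ M M' ρ i x) K =
      ρ K.1 (coeffD M i j x ⟨K.1.map _, by rw [Finset.card_map]; exact K.2⟩)
    rw [coeffD_apply_phi M' i j hij (coeffRestrX I₀ M M' ρ i x) (fun L => ρ L (coeffExt M i x _))
        (fun L => congrArg (ρ L.1) (coeffExt_apply M i x ⟨L.1.map _, _⟩).symm) K,
      coeffD_apply_phi M i j hij x (coeffExt M i x) (fun L => (coeffExt_apply M i x L).symm)]
    dsimp only
    rw [Finset.sum_map, map_sum]
    refine Finset.sum_congr rfl fun s hs => ?_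
    refine (congrArg _ (hρφ _ _ _ (Finset.erase_subset _ _)).symm).trans ?_
    have aux : ∀ A B : Finset σ, A = B → ∀ J, CoeffSystem.phi M A J (coeffExt M i x A) =
        CoeffSystem.phi M B J (coeffExt M i x B) := by
      rintro A _ rfl J; rfl
    rw [map_zsmul, ← numLT_map]
    refine congrArg₂ (fun (a : ℕ) b => (-1 : ℤ) ^ a • ρ K.1 b)
      (congrArg (fun A => numLT A (s : σ)) (Finset.map_erase _ _ _)) (aux _ _ ?_ _)
    ext a
    simp

variable [Fintype σ]

/-- A criterion for the restriction to the subsets of `I₀` to be a homotopy equivalence. The step `F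
1` of the filtration is the kernel. By `ha` and `hb`, the diagonal part of `dh + hd` is the identity
and the off-diagonal part vanishes, both modulo the next step. So `1 - θ` raises the filtration and
is nilpotent on the kernel. -/
theorem nonempty_coeffKb_iso (I₀ : Finset σ) (M : CoeffSystem.{w} σ S) (M' : CoeffSystem.{w} I₀ S)
    (ρ : ∀ K : Finset I₀, M.obj (K.map (Function.Embedding.subtype _)) →ₗ[S] M'.obj K)
    (hρ : ∀ K, Function.Surjective (ρ K))
    (hρφ : ∀ (K L : Finset I₀) (x), K ≤ L → ρ L (CoeffSystem.phi M _ _ x) =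
      CoeffSystem.phi M' K L (ρ K x))
    (ψ : ∀ I J, M.obj J →ₗ[S] M.obj I) (F : ℕ → ∀ I, AddSubgroup (M.obj I)) (N : ℕ)
    (hF : ∀ (K : Finset I₀) (x), x ∈ F 1 (K.map (Function.Embedding.subtype _)) ↔ ρ K x = 0)
    (hF' : ∀ I, ¬ I ⊆ I₀ → ∀ x, x ∈ F 1 I)
    (hFN : ∀ I, ∀ x ∈ F (N + 1) I, x = 0)
    (hφ : ∀ n I J, I ≤ J → ∀ x ∈ F n I, CoeffSystem.phi M I J x ∈ F n J)
    (hψ : ∀ I s, s ∉ I → ∀ x, ψ I (insert s I) x ∈ F 1 I)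
    (ha : ∀ n I, ∀ x ∈ F (n + 1) I,
      ∑ s ∈ I, CoeffSystem.phi M (I.erase s) I (ψ (I.erase s) I x) +
        ∑ t ∈ Iᶜ, ψ I (insert t I) (CoeffSystem.phi M I (insert t I) x) - x ∈ F (n + 2) I)
    (hb : ∀ (n : ℕ) (I : Finset σ), ∀ s ∈ I, ∀ t ∉ I, ∀ x ∈ F (n + 1) (insert t (I.erase s)),
      CoeffSystem.phi M (I.erase s) I (ψ (I.erase s) (insert t (I.erase s)) x) -
        ψ I (insert t I) (CoeffSystem.phi M (insert t (I.erase s)) (insert t I) x) ∈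
          F (n + 2) I) :
    Nonempty (coeffKb M ≅ coeffKb M') := by
  let h (i j : ℤ) (_ : (ComplexShape.up ℤ).Rel j i) :
    (coeffComplex M).X i ⟶ (coeffComplex M).X j := ModuleCat.ofHom (coeffH M ψ i j)
  let θ := Homotopy.nullHomotopicMap' h
  have hθ : ∀ i (x : coeffX M i) (I : {I : Finset σ // (I.card : ℤ) = i}),
      (θ.f i x : coeffX M i) I = coeffH M ψ (i + 1) i (coeffD M i (i + 1) x) I +
        coeffD M (i - 1) i (coeffH M ψ i (i - 1) x) I := by
    intro i x I
    have := Homotopy.nullHomotopicMap'_f (c := ComplexShape.up ℤ) (k₂ := i - 1) (k₁ := i)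
      (k₀ := i + 1) (sub_add_cancel i 1) rfl h
    dsimp only [θ]
    rw [this]
    rfl
  let f := coeffRestr I₀ M M' ρ hρφ
  have hker : ∀ i (x : coeffX M i), f.f i x = (0 : coeffX M' i) ↔ ∀ I, x I ∈ F 1 I.1 := by
    intro i x
    constructor
    · intro hx I
      by_cases hI : I.1 ⊆ I₀
      · obtain ⟨K, hK⟩ : ∃ K : Finset I₀, K.map (Function.Embedding.subtype _) = I.1 :=
          ⟨I.1.subtype _, Finset.subtype_map_of_mem hI⟩
        obtain ⟨I, hI'⟩ := I
        subst hK
        exact (hF K _).2 (congrFun hx ⟨K, by rw [Finset.card_map] at hI'; exact hI'⟩)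
      · exact hF' _ hI _
    · intro hx
      exact funext fun K => (hF K.1 _).1 (hx ⟨K.1.map _, by
        rw [Finset.card_map]; exact K.2⟩)
  have hext : ∀ n i (x : coeffX M i), (∀ I, x I ∈ F n I.1) → ∀ I, coeffExt M i x I ∈ F n I := by
    intro n i x hx I
    unfold coeffExt
    split_ifs with h
    · exact hx ⟨I, h⟩
    · exact zero_mem _
  have hz : ∀ (n : ℕ) (I : Finset σ) (z : ℤ) (y : M.obj I), y ∈ F n I → z • y ∈ F n I :=
    fun n I z y hy => zsmul_mem hy z
  have hθ1 : ∀ i (x : coeffX M i) I, (θ.f i x : coeffX M i) I ∈ F 1 I.1 := by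
    intro i x I
    rw [hθ, coeffH_apply M ψ (i + 1) i rfl _ (coeffExt M (i + 1) (coeffD M i (i + 1) x))
        fun K => (coeffExt_apply _ _ _ K).symm,
      coeffD_apply_phi M (i - 1) i (by omega) _ (coeffExt M (i - 1) (coeffH M ψ i (i - 1) x))
        fun K => (coeffExt_apply _ _ _ K).symm]
    refine add_mem (sum_mem fun s hs => hz _ _ _ _ (hψ _ _ (Finset.mem_compl.1 hs) _))
      (sum_mem fun s hs => hz _ _ _ _ (hφ _ _ _ (Finset.erase_subset _ _) _
        (hext _ _ _ (fun K => ?_) _)))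
    rw [coeffH_apply M ψ i (i - 1) (by omega) x (coeffExt M i x)
        fun K => (coeffExt_apply _ _ _ K).symm]
    exact sum_mem fun s hs => hz _ _ _ _ (hψ _ _ (Finset.mem_compl.1 hs) _)
  have hθn : ∀ n i (x : coeffX M i), (∀ I, x I ∈ F (n + 1) I.1) → ∀ I,
      x I - (θ.f i x : coeffX M i) I ∈ F (n + 2) I.1 := by
    intro n i x hx I
    rw [hθ, coeffD_coeffH, ← neg_mem_iff, neg_sub, add_sub_right_comm]
    refine add_mem (ha n I.1 _ (hx I)) (sum_mem fun s hs => sum_mem fun t ht => hz _ _ _ _ ?_)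
    exact hb n I.1 s hs t (Finset.mem_compl.1 ht) _ (hext _ _ _ hx _)
  have hsurj : ∀ i, Function.Surjective (f.f i) := by
    intro i y
    -- Preimages are chosen for all `I` at once, with `0` where `I` is not the image of a set `K` of
    -- the right size; the cast identifies the two types.
    have : ∀ I : Finset σ, ∃ z : M.obj I, ∀ (K : Finset I₀) (hK : (K.card : ℤ) = i)
        (e : I = K.map (Function.Embedding.subtype _)), ρ K (e ▸ z) = (y : coeffX M' i) ⟨K, hK⟩ := by
      intro I
      by_cases hI : ∃ (K : Finset I₀) (_ : (K.card : ℤ) = i),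
          I = K.map (Function.Embedding.subtype _)
      · obtain ⟨K, hK, rfl⟩ := hI
        obtain ⟨z, hz⟩ := hρ K ((y : coeffX M' i) ⟨K, hK⟩)
        refine ⟨z, fun K' hK' e => ?_⟩
        obtain rfl := Finset.map_injective _ e
        exact hz
      · exact ⟨0, fun K hK e => absurd ⟨K, hK, e⟩ hI⟩
    choose z hz using this
    exact ⟨fun I : {I : Finset σ // (I.card : ℤ) = i} => z I.1,
      funext fun K : {I : Finset I₀ // (I.card : ℤ) = i} => hz _ K.1 K.2 rfl⟩
  have hθf : θ ≫ f = 0 := by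
    ext i x
    exact (hker i _).2 (hθ1 i x)
  obtain ⟨e⟩ := nonempty_quotient_iso f hsurj θ (Homotopy.nullHomotopy' h) hθf N (by
    intro i x hx
    have : ∀ n, ∀ I, ((fun y => (𝟙 (coeffComplex M) - θ).f i y)^[n] x : coeffX M i) I ∈
        F (n + 1) I.1 := by
      intro n
      induction n with
      | zero => exact (hker i x).1 hx
      | succ n ih =>
        intro I
        rw [Function.iterate_succ_apply']
        exact hθn n i _ ih I
    exact funext fun I => hFN _ _ (this N I))
  exact ⟨ObjectProperty.isoMk _ e⟩

/-! ### Additive functors applied to the complex of a coefficient system -/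

section Map

variable {S' : Type*} [Ring S'] (F : ModuleCat.{w} S ⥤ ModuleCat.{w} S') [F.Additive]

/-- An additive functor commutes with the finite direct sums of the terms of the complex of a
coefficient system. -/
def mapCoeffXIso (M : CoeffSystem.{w} σ S) (i : ℤ) :
    F.obj (ModuleCat.of S (coeffX M i)) ≅
      ModuleCat.of S' (coeffX (M ⋙ F : CoeffSystem.{w} σ S') i) where
  hom := ModuleCat.ofHom (LinearMap.pi fun I =>
    (F.map (X := ModuleCat.of S (coeffX M i)) (ModuleCat.ofHom (LinearMap.proj I))).hom)
  inv := ModuleCat.ofHom (∑ I, (F.map (Y := ModuleCat.of S (coeffX M i))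
    (ModuleCat.ofHom (LinearMap.single S (fun I : {I : Finset σ // (I.card : ℤ) = i} =>
      M.obj I.1) I))).hom ∘ₗ LinearMap.proj I)
  hom_inv_id := by
    have : ∑ I, ModuleCat.ofHom (LinearMap.proj (R := S) (φ := fun I :
        {I : Finset σ // (I.card : ℤ) = i} => M.obj I.1) I) ≫
        ModuleCat.ofHom (LinearMap.single S (fun I : {I : Finset σ // (I.card : ℤ) = i} =>
      M.obj I.1) I) = 𝟙 (ModuleCat.of S (coeffX M i)) := by
      ext x
      simp [ModuleCat.hom_sum]
    rw [← CategoryTheory.Functor.map_id, ← this, Functor.map_sum]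
    ext x
    simp only [ModuleCat.hom_sum, LinearMap.sum_apply, Functor.map_comp]
    change (∑ I, _ ∘ₗ _ : _ →ₗ[S'] _) _ = _
    rw [LinearMap.sum_apply]
    rfl
  inv_hom_id := by
    refine ModuleCat.hom_ext (LinearMap.ext fun x => funext fun J => ?_)
    change (F.map _).hom ((∑ I, _ ∘ₗ _ : _ →ₗ[S'] _) x) = x J
    rw [LinearMap.sum_apply, map_sum, Finset.sum_eq_single J]
    · change (F.map (ModuleCat.ofHom (LinearMap.single S (fun I : {I : Finset σ // (I.card : ℤ) = i}
        => M.obj I.1) J)) ≫ F.map (ModuleCat.ofHom (LinearMap.proj J))).hom (x J) = x J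
      rw [← F.map_comp]
      have : ModuleCat.ofHom (LinearMap.single S (fun I : {I : Finset σ // (I.card : ℤ) = i}
        => M.obj I.1) J) ≫ ModuleCat.ofHom (LinearMap.proj J) = 𝟙 (M.obj J.1) := by
        ext y
        exact Pi.single_eq_same (M := fun I : {I : Finset σ // (I.card : ℤ) = i} => M.obj I.1) J y
      exact congrArg (fun g => g.hom (x J))
        ((congrArg F.map this).trans (CategoryTheory.Functor.map_id _ _))
    · intro I _ hI
      change (F.map (ModuleCat.ofHom (LinearMap.single S (fun I : {I : Finset σ // (I.card : ℤ) = i}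
        => M.obj I.1) I)) ≫ F.map (ModuleCat.ofHom (LinearMap.proj J))).hom (x I) = 0
      rw [← F.map_comp]
      have : ModuleCat.ofHom (LinearMap.single S (fun I : {I : Finset σ // (I.card : ℤ) = i}
        => M.obj I.1) I) ≫ ModuleCat.ofHom (LinearMap.proj J) = (0 : M.obj I.1 ⟶ M.obj J.1) := by
        ext y
        exact Pi.single_eq_of_ne
          (M := fun I : {I : Finset σ // (I.card : ℤ) = i} => M.obj I.1) hI.symm y
      exact congrArg (fun g => g.hom (x I)) ((congrArg F.map this).trans (F.map_zero _ _))
    · exact fun h => absurd (Finset.mem_univ _) h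

/-- An additive functor commutes with the formation of the complex of a coefficient system. -/
def mapCoeffIso (M : CoeffSystem.{w} σ S) :
    (F.mapHomologicalComplex (ComplexShape.up ℤ)).obj (coeffComplex M) ≅
      coeffComplex (M ⋙ F : CoeffSystem.{w} σ S') :=
  HomologicalComplex.Hom.isoOfComponents (fun i => mapCoeffXIso F M i) (by
    intro i j hij
    replace hij : i + 1 = j := hij
    refine ModuleCat.hom_ext (LinearMap.ext
      fun (x : F.obj (ModuleCat.of S (coeffX M i))) => funext fun K => ?_)
    change coeffD (M ⋙ F : CoeffSystem.{w} σ S') i j ((mapCoeffXIso F M i).hom.hom x) K =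
      (F.map (ModuleCat.ofHom (coeffD M i j)) ≫ F.map (Y := M.obj K.1)
        (ModuleCat.ofHom (LinearMap.proj K))).hom x
    have hc : ∀ s : K.1, ((K.1.erase s.1).card : ℤ) = i := by
      intro s
      have := Finset.card_erase_add_one s.2
      have := K.2
      omega
    have : ModuleCat.ofHom (coeffD M i j) ≫ ModuleCat.ofHom (LinearMap.proj K) =
        ∑ s ∈ K.1.attach, (-1 : ℤ) ^ numLT (K.1.erase s.1) s.1 •
          ((ModuleCat.ofHom (LinearMap.proj
            (⟨K.1.erase s.1, hc s⟩ : {I : Finset σ // (I.card : ℤ) = i})) :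
              ModuleCat.of S (coeffX M i) ⟶ M.obj (K.1.erase s.1)) ≫
            M.map (homOfLE (Finset.erase_subset s.1 K.1))) := by
      refine ModuleCat.hom_ext (LinearMap.ext fun (x : coeffX M i) => ?_)
      refine (coeffD_apply M i j hij x K).trans ?_
      refine Eq.symm ((sum_hom_apply (X := ModuleCat.of S (coeffX M i)) (Y := M.obj K.1)
        K.1.attach _ x).trans ?_)
      rfl
    rw [← F.map_comp, coeffD_apply _ i j hij, this, F.map_sum]
    refine Eq.trans ?_ (sum_hom_apply _ _ x).symm
    refine Finset.sum_congr rfl fun s _ => ?_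
    rw [F.map_zsmul, F.map_comp]
    rfl)

/-- `mapKb` commutes with the formation of the complex of a coefficient system. -/
def mapCoeffKbIso (M : CoeffSystem.{w} σ S) :
    (mapKb F).obj (coeffKb M) ≅ coeffKb (M ⋙ F : CoeffSystem.{w} σ S') :=
  ObjectProperty.isoMk _ ((HomotopyCategory.quotient _ _).mapIso (mapCoeffIso F M))

end Map

/-- Isomorphic coefficient systems have isomorphic complexes. -/
theorem nonempty_coeffKb_iso_of_iso {M M' : CoeffSystem.{w} σ S} (e : M ≅ M') :
    Nonempty (coeffKb M ≅ coeffKb M') := by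
  refine ⟨ObjectProperty.isoMk _ ((HomotopyCategory.quotient _ _).mapIso
    (HomologicalComplex.Hom.isoOfComponents (C₁ := coeffComplex M) (C₂ := coeffComplex M')
      (fun i => LinearEquiv.toModuleIso
        (LinearEquiv.piCongrRight fun I : {I : Finset σ // (I.card : ℤ) = i} =>
          (e.app I.1).toLinearEquiv)) ?_))⟩
  intro i j hij
  replace hij : i + 1 = j := hij
  refine ModuleCat.hom_ext (LinearMap.ext fun (x : coeffX M i) => funext fun K => ?_)
  change coeffD M' i j (fun I => (e.hom.app I.1).hom (x I)) K =
    (e.hom.app K.1).hom (coeffD M i j x K)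
  rw [coeffD_apply _ i j hij, coeffD_apply _ i j hij, map_sum]
  refine Finset.sum_congr rfl fun s _ => ?_
  rw [map_zsmul]
  congr 1
  exact (LinearMap.congr_fun (congrArg ModuleCat.Hom.hom
    (e.hom.naturality (homOfLE (Finset.erase_subset s.1 K.1)))) _).symm

end Coeff

end SplitBN
end

noncomputable section
set_option linter.unusedSectionVars false

namespace SplitBN

open MonoidAlgebra (of)

/-! ### Additive maps out of tensor products of bimodules -/

section Lift

variable {A B C : Type*} [Ring A] [Ring B] [Ring C] {M : Bimod.{w} A B} {N : Bimod.{w} B C}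
  {P : Type*} [AddCommGroup P]

/-- The additive map on `M ⊗_ℤ N` given by a biadditive map. -/
def PreTensor.liftAdd (φ : M →+ N →+ P) : PreTensor M N →+ P :=
  TensorProduct.liftAddHom (R := ℤ) φ fun r m n => by
    rw [map_zsmul, map_zsmul, AddMonoidHom.coe_smul, Pi.smul_apply]

/-- The relations form a submodule over `A ⊗ Cᵒᵖ`, whereas `φ` is only biadditive. The claim is
therefore proved for all multiples of `x`; pure tensors send relators to relators because the outer
actions commute with the middle one. -/
theorem PreTensor.liftAdd_eq_zero (φ : M →+ N →+ P)
    (hφ : ∀ m (b : B) n, φ (((1 : A) ⊗ₜ[ℤ] op b : A ⊗[ℤ] Bᵐᵒᵖ) • m) n =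
      φ m ((b ⊗ₜ[ℤ] (1 : Cᵐᵒᵖ) : B ⊗[ℤ] Cᵐᵒᵖ) • n)) {x : PreTensor M N}
    (hx : x ∈ balancedRel M N) : PreTensor.liftAdd φ x = 0 := by
  suffices h : ∀ s : A ⊗[ℤ] Cᵐᵒᵖ, PreTensor.liftAdd φ (s • x) = 0 by
    simpa only [one_smul] using h 1
  induction hx using Submodule.span_induction with
  | zero => intro s; rw [smul_zero, map_zero]
  | add x y _ _ hx hy => intro s; rw [smul_add, map_add, hx, hy, add_zero]
  | smul a x _ hx => intro s; rw [smul_smul]; exact hx _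
  | mem x hx =>
    obtain ⟨m, b, n, rfl⟩ := hx
    intro s
    induction s using TensorProduct.induction_on with
    | zero =>
      exact (congrArg _ (zero_smul (A ⊗[ℤ] Cᵐᵒᵖ) _)).trans (map_zero (PreTensor.liftAdd φ))
    | add x y hx hy => rw [add_smul, map_add, hx, hy, add_zero]
    | tmul a c =>
      rw [smul_sub, PreTensor.smul_tmul, PreTensor.smul_tmul, map_sub, sub_eq_zero]
      have h1 : (a ⊗ₜ[ℤ] (1 : Bᵐᵒᵖ) : A ⊗[ℤ] Bᵐᵒᵖ) •
          (((1 : A) ⊗ₜ[ℤ] op b : A ⊗[ℤ] Bᵐᵒᵖ) • m) =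
          ((1 : A) ⊗ₜ[ℤ] op b : A ⊗[ℤ] Bᵐᵒᵖ) • ((a ⊗ₜ[ℤ] (1 : Bᵐᵒᵖ) : A ⊗[ℤ] Bᵐᵒᵖ) • m) := by
        rw [smul_smul, smul_smul, Algebra.TensorProduct.tmul_mul_tmul,
          Algebra.TensorProduct.tmul_mul_tmul, one_mul, mul_one, one_mul, mul_one]
      have h2 : ((1 : B) ⊗ₜ[ℤ] c : B ⊗[ℤ] Cᵐᵒᵖ) •
          ((b ⊗ₜ[ℤ] (1 : Cᵐᵒᵖ) : B ⊗[ℤ] Cᵐᵒᵖ) • n) =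
          (b ⊗ₜ[ℤ] (1 : Cᵐᵒᵖ) : B ⊗[ℤ] Cᵐᵒᵖ) • (((1 : B) ⊗ₜ[ℤ] c : B ⊗[ℤ] Cᵐᵒᵖ) • n) := by
        rw [smul_smul, smul_smul, Algebra.TensorProduct.tmul_mul_tmul,
          Algebra.TensorProduct.tmul_mul_tmul, one_mul, mul_one, one_mul, mul_one]
      rw [h1, h2]
      exact hφ _ _ _

/-- The additive map on `M ⊗_B N` given by a balanced biadditive map. -/
def bimodTensor.liftAdd (φ : M →+ N →+ P)
    (hφ : ∀ m (b : B) n, φ (((1 : A) ⊗ₜ[ℤ] op b : A ⊗[ℤ] Bᵐᵒᵖ) • m) n =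
      φ m ((b ⊗ₜ[ℤ] (1 : Cᵐᵒᵖ) : B ⊗[ℤ] Cᵐᵒᵖ) • n)) : bimodTensor M N →+ P :=
  QuotientAddGroup.lift (balancedRel M N).toAddSubgroup (PreTensor.liftAdd φ)
    fun _ hx => PreTensor.liftAdd_eq_zero φ hφ hx

theorem bimodTensor.induction {Q : bimodTensor M N → Prop} (zero : Q 0)
    (tmul : ∀ m n, Q (bimodTensor.tmul m n)) (add : ∀ x y, Q x → Q y → Q (x + y))
    (x : bimodTensor M N) : Q x := by
  obtain ⟨y, rfl⟩ := Submodule.mkQ_surjective _ x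
  exact PreTensor.induction (P := fun y => Q ((balancedRel M N).mkQ y)) zero tmul
    (fun a b ha hb => add _ _ ha hb) y

theorem bimodTensor.addHom_ext {f g : bimodTensor M N →+ P}
    (h : ∀ m n, f (bimodTensor.tmul m n) = g (bimodTensor.tmul m n)) : f = g :=
  AddMonoidHom.ext fun z => bimodTensor.induction (Q := fun z => f z = g z) (by rw [map_zero, map_zero]) h
    (fun x y hx hy => by rw [map_add, map_add, hx, hy]) z

/-- `m ⊗ n` as a biadditive map. -/
def bimodTensor.tmulHom (m : M) : N →+ bimodTensor M N :=
  AddMonoidHom.mk' (bimodTensor.tmul m) (bimodTensor.tmul_add m)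

theorem bimodTensor.sum_tmul {ι : Type*} (s : Finset ι) (f : ι → M) (n : N) :
    (bimodTensor.tmul (∑ i ∈ s, f i) n : bimodTensor M N) = ∑ i ∈ s, bimodTensor.tmul (f i) n :=
  map_sum (AddMonoidHom.mk' (fun m => (bimodTensor.tmul m n : bimodTensor M N))
    fun m m' => bimodTensor.add_tmul m m' n) f s

end Lift

/-! ### Restriction of coefficients to a subgroup -/

section Res

variable {G : Type u} [Group G] (R : Type v) [CommRing R] (H : Subgroup G)

/-- The restriction `RG → RH` of coefficients to a subgroup `H`. -/
def res : MonoidAlgebra R G →+ MonoidAlgebra R H where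
  toFun x := .ofCoeff (x.coeff.comapDomain Subtype.val Subtype.val_injective.injOn)
  map_zero' := by ext; simp
  map_add' x y := by ext; simp

theorem coeff_res (x : MonoidAlgebra R G) (h : H) : (res R H x).coeff h = x.coeff h := rfl

theorem res_smul (r : R) (x : MonoidAlgebra R G) : res R H (r • x) = r • res R H x := by
  ext h
  rw [coeff_res, MonoidAlgebra.coeff_smul_apply, MonoidAlgebra.coeff_smul_apply, coeff_res]

theorem incl_of (h : H) : incl R H (of R H h) = of R G h := by
  simp [incl]

theorem incl_single (h : H) (r : R) : incl R H (.single h r) = .single (h : G) r := by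
  simp [incl]

theorem res_single_of_mem {g : G} (hg : g ∈ H) (r : R) :
    res R H (.single g r) = .single ⟨g, hg⟩ r := by
  classical
  ext h
  rw [coeff_res, MonoidAlgebra.coeff_single, MonoidAlgebra.coeff_single, Finsupp.single_apply,
    Finsupp.single_apply]
  simp only [Subtype.ext_iff]

theorem res_single_of_notMem {g : G} (hg : g ∉ H) (r : R) :
    res R H (.single g r) = 0 := by
  classical
  ext h
  rw [coeff_res, MonoidAlgebra.coeff_single, Finsupp.single_apply, if_neg]
  · rfl
  · rintro rfl; exact hg h.2

theorem res_of_of_mem {g : G} (hg : g ∈ H) : res R H (of R G g) = of R H ⟨g, hg⟩ :=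
  res_single_of_mem R H hg 1

theorem res_of_of_notMem {g : G} (hg : g ∉ H) : res R H (of R G g) = 0 :=
  res_single_of_notMem R H hg 1

theorem res_mul_incl (x : MonoidAlgebra R G) (c : MonoidAlgebra R H) :
    res R H (x * incl R H c) = res R H x * c := by
  induction c using MonoidAlgebra.induction_on with
  | of h =>
    ext k
    rw [incl_of, coeff_res, MonoidAlgebra.of_apply, MonoidAlgebra.coeff_mul_single_apply,
      MonoidAlgebra.of_apply, MonoidAlgebra.coeff_mul_single_apply, coeff_res]
    rfl
  | add a b ha hb => rw [map_add, mul_add, map_add, ha, hb, mul_add]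
  | smul r a ha =>
    have h1 : incl R H (r • a) = r • incl R H a := by simp [incl]
    rw [h1, mul_smul_comm, mul_smul_comm, ← ha, res_smul]

theorem res_incl_mul (x : MonoidAlgebra R G) (c : MonoidAlgebra R H) :
    res R H (incl R H c * x) = c * res R H x := by
  induction c using MonoidAlgebra.induction_on with
  | of h =>
    ext k
    rw [incl_of, coeff_res, MonoidAlgebra.of_apply, MonoidAlgebra.coeff_single_mul_apply,
      MonoidAlgebra.of_apply, MonoidAlgebra.coeff_single_mul_apply, coeff_res]
    rfl
  | add a b ha hb => rw [map_add, add_mul, map_add, ha, hb, add_mul]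
  | smul r a ha =>
    have h1 : incl R H (r • a) = r • incl R H a := by simp [incl]
    rw [h1, smul_mul_assoc, smul_mul_assoc, ← ha, res_smul]

variable [Finite G]

theorem sum_of_mul_res [Fintype (G ⧸ H)] (x : MonoidAlgebra R G) :
    ∑ q : G ⧸ H, of R G q.out * incl R H (res R H (of R G q.out⁻¹ * x)) = x := by
  classical
  induction x using MonoidAlgebra.induction_on with
  | of g =>
    rw [Finset.sum_eq_single (g : G ⧸ H)]
    · have hg : (g : G ⧸ H).out⁻¹ * g ∈ H := QuotientGroup.eq.1 (QuotientGroup.out_eq' (g : G ⧸ H))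
      rw [← map_mul, res_of_of_mem R H hg, incl_of, ← map_mul, mul_inv_cancel_left]
    · intro q _ hq
      rw [← map_mul, res_of_of_notMem, map_zero,
        mul_zero]
      intro h
      apply hq
      rw [← QuotientGroup.out_eq' q]
      exact QuotientGroup.eq.2 h
    · exact fun h => absurd (Finset.mem_univ _) h
  | add a b ha hb =>
    conv_rhs => rw [← ha, ← hb]
    rw [← Finset.sum_add_distrib]
    simp only [mul_add, map_add]
  | smul r a ha =>
    conv_rhs => rw [← ha]
    rw [Finset.smul_sum]
    refine Finset.sum_congr rfl fun q _ => ?_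
    have h1 : ∀ a, incl R H (r • a) = r • incl R H a := by simp [incl]
    rw [mul_smul_comm, res_smul, h1, mul_smul_comm]

/-- Summing over a subgroup `V` normalised by `H` commutes with the restriction to `H`. -/
theorem res_mul_idem {V : Subgroup G} (hV : ∀ h ∈ H, ∀ v ∈ V, h * v * h⁻¹ ∈ V)
    (x : MonoidAlgebra R G) : res R H (x * idem R V) = res R H (idem R V * x) := by
  classical
  have := Fintype.ofFinite V
  have key : ∀ g : G, res R H (of R G g * ∑ v : V, of R G (v : G)) =
      res R H ((∑ v : V, of R G (v : G)) * of R G g) := by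
    intro g
    have e1 : ∀ h : H, (∑ v : V, (if (v : G) = g⁻¹ * h then (1 : R) else 0)) =
        if g⁻¹ * h ∈ V then 1 else 0 := by
      intro h
      split_ifs with hv
      · rw [Finset.sum_eq_single ⟨_, hv⟩]
        · rw [if_pos rfl]
        · exact fun b _ hb => if_neg fun h' => hb (Subtype.ext h')
        · exact fun h => absurd (Finset.mem_univ _) h
      · exact Finset.sum_eq_zero fun v _ => if_neg fun h' => hv (by rw [← h']; exact v.2)
    have e2 : ∀ h : H, (∑ v : V, (if (v : G) = h * g⁻¹ then (1 : R) else 0)) =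
        if h * g⁻¹ ∈ V then 1 else 0 := by
      intro h
      split_ifs with hv
      · rw [Finset.sum_eq_single ⟨_, hv⟩]
        · rw [if_pos rfl]
        · exact fun b _ hb => if_neg fun h' => hb (Subtype.ext h')
        · exact fun h => absurd (Finset.mem_univ _) h
      · exact Finset.sum_eq_zero fun v _ => if_neg fun h' => hv (by rw [← h']; exact v.2)
    ext h
    rw [coeff_res, coeff_res, MonoidAlgebra.of_apply, MonoidAlgebra.coeff_single_mul_apply,
      MonoidAlgebra.coeff_mul_single_apply, one_mul, mul_one, MonoidAlgebra.coeff_sum,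
      Finsupp.finsetSum_apply, Finsupp.finsetSum_apply]
    simp only [MonoidAlgebra.of_apply, MonoidAlgebra.coeff_single, Finsupp.single_apply]
    rw [e1, e2]
    congr 1
    refine propext ⟨fun hv => ?_, fun hv => ?_⟩
    · have := hV _ h.2 _ hv
      simpa [mul_assoc] using this
    · have := hV _ (inv_mem h.2) _ hv
      simpa [mul_assoc] using this
  rw [idem_eq_sum, mul_smul_comm, smul_mul_assoc, res_smul, res_smul]
  congr 1
  induction x using MonoidAlgebra.induction_on with
  | of g => exact key g
  | add a b ha hb => rw [add_mul, mul_add, map_add, map_add, ha, hb]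
  | smul r a ha => rw [smul_mul_assoc, mul_smul_comm, res_smul, res_smul, ha]

end Res

end SplitBN
end

noncomputable section
set_option linter.unusedSectionVars false

namespace SplitBN

open MonoidAlgebra (of)

/-! ### Induced bimodules as spaces of functions on the group -/

section Tau

variable {G : Type u} [Group G] {R : Type v} [CommRing R] {H : Subgroup G}
  {e : MonoidAlgebra R G} {he : ∀ c, Commute e (incl R H c)} {C : Type*} [Ring C]
  {Y : Bimod.{max u v} (MonoidAlgebra R H) C}

/-- The value of `tau` at `x ⊗ y`. -/
def tauHom (he : ∀ c, Commute e (incl R H c)) (Y : Bimod.{max u v} (MonoidAlgebra R H) C) :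
    rightPiece (incl R H) e he →+ Y →+ (G → Y) :=
  AddMonoidHom.mk' (fun x => AddMonoidHom.mk'
    (fun y a => leftAct Y (res R H (of R G a⁻¹ * rightPiece.val x)) y)
    fun y y' => funext fun a => map_add _ y y')
    fun x x' => AddMonoidHom.ext fun y => funext fun a => by
      change leftAct Y (res R H (of R G a⁻¹ * rightPiece.val (x + x'))) y =
        leftAct Y (res R H (of R G a⁻¹ * rightPiece.val x)) y +
          leftAct Y (res R H (of R G a⁻¹ * rightPiece.val x')) y
      rw [map_add, mul_add, map_add, map_add]
      rfl

/-- The elements of `RGe ⊗_{RH} Y` as functions on `G` with values in `Y`. -/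
def tau : bimodTensor (rightPiece (incl R H) e he) Y →+ (G → Y) :=
  bimodTensor.liftAdd (tauHom he Y) fun x b y => funext fun a => by
    change leftAct Y (res R H (of R G a⁻¹ * rightPiece.val _)) y =
      leftAct Y (res R H (of R G a⁻¹ * rightPiece.val x)) (leftAct Y b y)
    rw [rightPiece.val_smul, one_mul, ← mul_assoc, res_mul_incl, map_mul]
    rfl

theorem tau_tmul (x : rightPiece (incl R H) e he) (y : Y) (a : G) :
    tau (bimodTensor.tmul x y) a = leftAct Y (res R H (of R G a⁻¹ * rightPiece.val x)) y := rfl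

theorem tau_smul (g : G) (r : R) (c : Cᵐᵒᵖ) (z : bimodTensor (rightPiece (incl R H) e he) Y)
    (a : G) : tau ((MonoidAlgebra.single g r ⊗ₜ[ℤ] c : MonoidAlgebra R G ⊗[ℤ] Cᵐᵒᵖ) • z) a =
      (MonoidAlgebra.single (1 : H) r ⊗ₜ[ℤ] c : MonoidAlgebra R H ⊗[ℤ] Cᵐᵒᵖ) •
        tau z (g⁻¹ * a) := by
  induction z using bimodTensor.induction with
  | zero => simp only [smul_zero, map_zero, Pi.zero_apply]
  | add x y hx hy => simp only [smul_add, map_add, Pi.add_apply, hx, hy]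
  | tmul x y =>
    rw [bimodTensor.smul_tmul, tau_tmul, tau_tmul]
    have h1 : rightPiece.val ((MonoidAlgebra.single g r ⊗ₜ[ℤ] 1 :
        MonoidAlgebra R G ⊗[ℤ] (MonoidAlgebra R H)ᵐᵒᵖ) • x) =
        MonoidAlgebra.single g r * rightPiece.val x := by
      have := rightPiece.val_smul (f := incl R H) (h := he) (.single g r) 1 x
      rwa [map_one, mul_one] at this
    have h2 : of R G a⁻¹ * (MonoidAlgebra.single g r * rightPiece.val x) =
        r • (of R G (g⁻¹ * a)⁻¹ * rightPiece.val x) := by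
      have : (MonoidAlgebra.single g r : MonoidAlgebra R G) = r • of R G g := by
        rw [MonoidAlgebra.of_apply, MonoidAlgebra.smul_single, smul_eq_mul, mul_one]
      rw [this, smul_mul_assoc, mul_smul_comm, ← mul_assoc, ← map_mul, mul_inv_rev, inv_inv]
    rw [h1, h2, res_smul]
    change ((r • _) ⊗ₜ[ℤ] 1 : MonoidAlgebra R H ⊗[ℤ] Cᵐᵒᵖ) • (1 ⊗ₜ[ℤ] c :
      MonoidAlgebra R H ⊗[ℤ] Cᵐᵒᵖ) • y = _ • (_ ⊗ₜ[ℤ] 1 : MonoidAlgebra R H ⊗[ℤ] Cᵐᵒᵖ) • y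
    rw [smul_smul, smul_smul, Algebra.TensorProduct.tmul_mul_tmul,
      Algebra.TensorProduct.tmul_mul_tmul, one_mul, mul_one, mul_one]
    congr 3
    have : (MonoidAlgebra.single (1 : H) r : MonoidAlgebra R H) = r • 1 := by
      rw [MonoidAlgebra.one_def, MonoidAlgebra.smul_single, smul_eq_mul, mul_one]
    rw [this, smul_mul_assoc, one_mul]

theorem tau_mul_mem (z : bimodTensor (rightPiece (incl R H) e he) Y) (a : G) (h : H) :
    tau z (a * h) = leftAct Y (of R H h⁻¹) (tau z a) := by
  induction z using bimodTensor.induction with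
  | zero => simp only [map_zero, Pi.zero_apply]
  | add x y hx hy => simp only [map_add, Pi.add_apply, hx, hy]
  | tmul x y =>
    rw [tau_tmul, tau_tmul, mul_inv_rev, map_mul (of R G), mul_assoc]
    have : of R G (h : G)⁻¹ = incl R H (of R H h⁻¹) := by rw [incl_of]; rfl
    rw [this, res_incl_mul, map_mul]
    rfl

variable [Finite G] {V : Subgroup G}

theorem rightPiece.val_mul_idem {he : ∀ c, Commute (idem R V) (incl R H c)}
    (x : rightPiece (incl R H) (idem R V) he) :
    rightPiece.val x * idem R V = rightPiece.val x := by
  obtain ⟨z, hz⟩ := rightPiece.val_mem x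
  rw [← hz, mul_assoc, idem_mul_self]

variable {he : ∀ c, Commute (idem R V) (incl R H c)}

theorem tau_mul_of_mem (hV : ∀ h ∈ H, ∀ v ∈ V, h * v * h⁻¹ ∈ V)
    (z : bimodTensor (rightPiece (incl R H) (idem R V) he) Y) (a : G) {v : G} (hv : v ∈ V) :
    tau z (a * v) = tau z a := by
  induction z using bimodTensor.induction with
  | zero => simp only [map_zero, Pi.zero_apply]
  | add x y hx hy => simp only [map_add, Pi.add_apply, hx, hy]
  | tmul x y =>
    have h1 : ∀ b : G, res R H (of R G b⁻¹ * rightPiece.val x) =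
        res R H (idem R V * of R G b⁻¹ * rightPiece.val x) := by
      intro b
      rw [mul_assoc, ← res_mul_idem R H hV, mul_assoc, rightPiece.val_mul_idem]
    rw [tau_tmul, tau_tmul, h1, h1, mul_inv_rev, map_mul (of R G), ← mul_assoc (idem R V),
      idem_mul_of R (inv_mem hv)]

/-- `t e` as an element of `RG e`. -/
def ofE (he : ∀ c, Commute (idem R V) (incl R H c)) (t : G) :
    rightPiece (incl R H) (idem R V) he := rightPiece.mk (of R G t * idem R V) ⟨_, rfl⟩

/-- The values at coset representatives recover the tensor, which gives the injectivity of `tau`. -/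
theorem sum_ofE_tmul_tau [Fintype (G ⧸ H)]
    (z : bimodTensor (rightPiece (incl R H) (idem R V) he) Y) :
    ∑ q : G ⧸ H, bimodTensor.tmul (ofE he q.out) (tau z q.out) = z := by
  induction z using bimodTensor.induction with
  | zero =>
    refine Finset.sum_eq_zero fun q _ => ?_
    rw [map_zero]
    exact map_zero (bimodTensor.tmulHom (N := Y) (ofE he q.out))
  | add x y hx hy =>
    conv_rhs => rw [← hx, ← hy]
    rw [← Finset.sum_add_distrib]
    refine Finset.sum_congr rfl fun q _ => ?_
    rw [map_add]
    exact bimodTensor.tmul_add _ _ _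
  | tmul x y =>
    have h1 : ∑ q : G ⧸ H, ((1 : MonoidAlgebra R G) ⊗ₜ[ℤ] op (res R H
        (of R G q.out⁻¹ * rightPiece.val x)) : MonoidAlgebra R G ⊗[ℤ] (MonoidAlgebra R H)ᵐᵒᵖ) •
          ofE he q.out = x := by
      apply rightPiece.val_injective
      rw [map_sum]
      conv_rhs => rw [← rightPiece.val_mul_idem x, ← sum_of_mul_res R H (rightPiece.val x),
        Finset.sum_mul]
      refine Finset.sum_congr rfl fun q _ => ?_
      rw [rightPiece.val_smul, one_mul]
      change of R G q.out * idem R V * _ = _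
      rw [mul_assoc, mul_assoc, (he _).eq]
    conv_rhs => rw [← h1, bimodTensor.sum_tmul]
    refine Finset.sum_congr rfl fun q _ => ?_
    rw [bimodTensor.tmul_balanced]
    rfl

theorem tau_injective : Function.Injective
    (tau (Y := Y) (he := he) : bimodTensor (rightPiece (incl R H) (idem R V) he) Y → (G → Y)) := by
  intro z z' h
  have := Fintype.ofFinite (G ⧸ H)
  rw [← sum_ofE_tmul_tau z, ← sum_ofE_tmul_tau z', h]

theorem leftAct_single_one_sum [Fintype V] (hV : IsUnit (Nat.card V : R)) (y : Y) :
    leftAct Y (.single 1 (Ring.inverse (Nat.card V : R))) (∑ _v : V, y) = y := by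
  rw [Finset.sum_const, Finset.card_univ, ← Nat.card_eq_fintype_card, map_nsmul,
    ← LinearMap.smul_apply, ← map_nsmul]
  have : Nat.card V • (MonoidAlgebra.single (1 : H) (Ring.inverse (Nat.card V : R)) :
      MonoidAlgebra R H) = 1 := by
    rw [MonoidAlgebra.smul_single, nsmul_eq_mul, Ring.mul_inverse_cancel _ hV,
      MonoidAlgebra.one_def]
  rw [this, map_one]
  rfl

/-- The two invariances characterise the image of `tau`. The candidate is the sum of the `q e ⊗
F(q)` over coset representatives `q`; the idempotent averages `F` over `V`, which changes nothing.
-/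
theorem exists_tau_eq (hV : ∀ h ∈ H, ∀ v ∈ V, h * v * h⁻¹ ∈ V) (hu : IsUnit (Nat.card V : R))
    (F : G → Y) (h1 : ∀ a (h : H), F (a * h) = leftAct Y (of R H h⁻¹) (F a))
    (h2 : ∀ a, ∀ v ∈ V, F (a * v) = F a) :
    ∃ z : bimodTensor (rightPiece (incl R H) (idem R V) he) Y, tau z = F := by
  classical
  have := Fintype.ofFinite (G ⧸ H)
  have := Fintype.ofFinite V
  have key : ∀ a : G, ∑ q : G ⧸ H, leftAct Y (res R H (of R G (a⁻¹ * q.out))) (F q.out) = F a := by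
    intro a
    rw [Finset.sum_eq_single (a : G ⧸ H)]
    · have ha : (a : G ⧸ H).out⁻¹ * a ∈ H := QuotientGroup.eq.1 (QuotientGroup.out_eq' (a : G ⧸ H))
      have h3 := h1 (a : G ⧸ H).out ⟨_, ha⟩
      have h4 : a⁻¹ * (a : G ⧸ H).out ∈ H := by simpa using inv_mem ha
      rw [mul_inv_cancel_left] at h3
      rw [h3, res_of_of_mem R H h4]
      congr 3
      ext
      simp
    · intro q _ hq
      rw [res_of_of_notMem, map_zero]
      · rfl
      · intro h
        apply hq
        rw [← QuotientGroup.out_eq' q]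
        refine (QuotientGroup.eq.2 ?_)
        simpa using inv_mem h
    · exact fun h => absurd (Finset.mem_univ _) h
  refine ⟨∑ q : G ⧸ H, bimodTensor.tmul (ofE he q.out) (F q.out), funext fun a => ?_⟩
  rw [map_sum, Finset.sum_apply]
  have h3 : ∀ q : G ⧸ H, tau (bimodTensor.tmul (ofE he q.out) (F q.out)) a =
      leftAct Y (.single 1 (Ring.inverse (Nat.card V : R))) (∑ v : V,
        leftAct Y (res R H (of R G (v * (a⁻¹ * q.out)))) (F q.out)) := by
    intro q
    rw [tau_tmul]
    change leftAct Y (res R H (of R G a⁻¹ * (of R G q.out * idem R V))) (F q.out) = _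
    rw [← mul_assoc, res_mul_idem R H hV, idem_eq_sum, smul_mul_assoc, res_smul, Finset.sum_mul,
      map_sum, ← map_mul]
    have : ∀ x : MonoidAlgebra R H, Ring.inverse (Nat.card V : R) • x =
        MonoidAlgebra.single 1 (Ring.inverse (Nat.card V : R)) * x := by
      intro x
      rw [← one_mul x, ← smul_mul_assoc, MonoidAlgebra.one_def, MonoidAlgebra.smul_single,
        smul_eq_mul, mul_one, ← MonoidAlgebra.one_def, one_mul]
    rw [this, map_mul, map_sum]
    refine congrArg (leftAct Y _) ((LinearMap.sum_apply _ _ _).trans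
      (Finset.sum_congr rfl fun v _ => ?_))
    rw [← map_mul]
  rw [Finset.sum_congr rfl fun q _ => h3 q, ← map_sum, Finset.sum_comm]
  have h4 : ∀ v : V, ∑ q : G ⧸ H, leftAct Y (res R H (of R G (v * (a⁻¹ * q.out)))) (F q.out) =
      F a := by
    intro v
    rw [← h2 a _ (inv_mem v.2), ← key (a * (v : G)⁻¹)]
    refine Finset.sum_congr rfl fun q _ => ?_
    rw [mul_inv_rev, inv_inv, mul_assoc]
  rw [Finset.sum_congr rfl fun v _ => h4 v, leftAct_single_one_sum hu]

end Tau

end SplitBN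
end

noncomputable section
set_option linter.unusedSectionVars false

namespace SplitBN

open MonoidAlgebra (of)

/-! ### The bimodules `RGe ⊗ eRG` as spaces of functions of two variables -/

section Theta

variable {G : Type u} [Group G] {R : Type v} [CommRing R] {H : Subgroup G}

theorem coeff_incl_mul [Fintype H] (c : MonoidAlgebra R H) (y : MonoidAlgebra R G) (b : G) :
    (incl R H c * y).coeff b = ∑ k : H, c.coeff k * y.coeff ((k : G)⁻¹ * b) := by
  classical
  induction c using MonoidAlgebra.induction_on with
  | of h =>
    rw [incl_of, MonoidAlgebra.of_apply, MonoidAlgebra.coeff_single_mul_apply,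
      Finset.sum_eq_single h]
    · rw [MonoidAlgebra.of_apply, MonoidAlgebra.coeff_single, Finsupp.single_eq_same]
    · intro k _ hk
      rw [MonoidAlgebra.of_apply, MonoidAlgebra.coeff_single, Finsupp.single_eq_of_ne hk, zero_mul]
    · exact fun h => absurd (Finset.mem_univ _) h
  | add x z hx hz =>
    rw [map_add, add_mul, MonoidAlgebra.coeff_add, Finsupp.add_apply, hx, hz,
      ← Finset.sum_add_distrib]
    refine Finset.sum_congr rfl fun k _ => ?_
    rw [MonoidAlgebra.coeff_add, Finsupp.add_apply, add_mul]
  | smul r x hx =>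
    have h1 : incl R H (r • x) = r • incl R H x := by simp [incl]
    rw [h1, smul_mul_assoc, MonoidAlgebra.coeff_smul_apply, hx, Finset.smul_sum]
    refine Finset.sum_congr rfl fun k _ => ?_
    rw [MonoidAlgebra.coeff_smul_apply, smul_mul_assoc]

variable {e : MonoidAlgebra R G} {he : ∀ c, Commute e (incl R H c)}
  {e₁ : MonoidAlgebra R G} {he₁ : ∀ c, Commute e₁ (incl R H c)}

/-- The elements of `RGe ⊗_{RH} e₁RG` as functions of two variables. -/
def theta : bimodTensor (rightPiece (incl R H) e he) (leftPiece (incl R H) e₁ he₁) →+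
    (G → G → R) where
  toFun z a b := (leftPiece.val (tau z a)).coeff b
  map_zero' := by
    funext a b
    rw [map_zero, Pi.zero_apply, map_zero]
    rfl
  map_add' z z' := by
    funext a b
    rw [map_add, Pi.add_apply, map_add]
    rfl

theorem theta_apply (z : bimodTensor (rightPiece (incl R H) e he) (leftPiece (incl R H) e₁ he₁))
    (a b : G) : theta z a b = (leftPiece.val (tau z a)).coeff b := rfl

theorem leftPiece.val_leftAct (c : MonoidAlgebra R H) (y : leftPiece (incl R H) e₁ he₁) :
    leftPiece.val (leftAct (leftPiece (incl R H) e₁ he₁) c y) = incl R H c * leftPiece.val y :=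
  (leftPiece.val_smul c 1 y).trans (mul_one _)

theorem theta_tmul [Fintype H] (x : rightPiece (incl R H) e he) (y : leftPiece (incl R H) e₁ he₁)
    (a b : G) : theta (bimodTensor.tmul x y) a b =
      ∑ k : H, (rightPiece.val x).coeff (a * k) * (leftPiece.val y).coeff ((k : G)⁻¹ * b) := by
  rw [theta_apply, tau_tmul, leftPiece.val_leftAct, coeff_incl_mul]
  refine Finset.sum_congr rfl fun k _ => ?_
  rw [coeff_res, MonoidAlgebra.of_apply, MonoidAlgebra.coeff_single_mul_apply, one_mul, inv_inv]

theorem theta_smul (g l : G) (r r' : R)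
    (z : bimodTensor (rightPiece (incl R H) e he) (leftPiece (incl R H) e₁ he₁)) (a b : G) :
    theta ((MonoidAlgebra.single g r ⊗ₜ[ℤ] op (MonoidAlgebra.single l r') :
      MonoidAlgebra R G ⊗[ℤ] (MonoidAlgebra R G)ᵐᵒᵖ) • z) a b =
      r * theta z (g⁻¹ * a) (b * l⁻¹) * r' := by
  rw [theta_apply, tau_smul, leftPiece.val_smul, incl_single, OneMemClass.coe_one, unop_op,
    MonoidAlgebra.coeff_mul_single_apply, MonoidAlgebra.coeff_single_one_mul]
  rfl

theorem theta_mul_mem (z : bimodTensor (rightPiece (incl R H) e he) (leftPiece (incl R H) e₁ he₁))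
    {h : G} (hh : h ∈ H) (a b : G) : theta z (a * h) (h⁻¹ * b) = theta z a b := by
  have h1 := tau_mul_mem z a ⟨h, hh⟩
  rw [theta_apply, h1, leftPiece.val_leftAct, incl_of, MonoidAlgebra.of_apply,
    MonoidAlgebra.coeff_single_mul_apply, one_mul]
  simp [theta_apply]

/-- `T` is a set of representatives of the left cosets of `H` in `H'`. -/
structure IsTransversal (H' H : Subgroup G) (T : Finset G) : Prop where
  subset : ∀ c ∈ T, c ∈ H'
  exists_unique : ∀ h ∈ H', ∃! c, c ∈ T ∧ c⁻¹ * h ∈ H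

theorem exists_isTransversal [Finite G] (H' H : Subgroup G) : ∃ T, IsTransversal H' H T := by
  classical
  have := Fintype.ofFinite (H' ⧸ H.subgroupOf H')
  refine ⟨Finset.univ.image fun q : H' ⧸ H.subgroupOf H' => (q.out : G), ?_, ?_⟩
  · intro c hc
    obtain ⟨q, _, rfl⟩ := Finset.mem_image.1 hc
    exact q.out.2
  · intro h hh
    refine ⟨((⟨h, hh⟩ : H') : H' ⧸ H.subgroupOf H').out,
      ⟨Finset.mem_image_of_mem _ (Finset.mem_univ _), ?_⟩, ?_⟩
    · have := (QuotientGroup.eq (s := H.subgroupOf H')).1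
        (QuotientGroup.out_eq' ((⟨h, hh⟩ : H') : H' ⧸ H.subgroupOf H'))
      exact this
    · rintro c ⟨hc, hch⟩
      obtain ⟨q, _, rfl⟩ := Finset.mem_image.1 hc
      have : (q.out : H' ⧸ H.subgroupOf H') = ((⟨h, hh⟩ : H') : H' ⧸ H.subgroupOf H') :=
        QuotientGroup.eq.2 hch
      rw [QuotientGroup.out_eq'] at this
      rw [this]

theorem IsTransversal.sum_eq {H' H : Subgroup G} {T : Finset G} (hT : IsTransversal H' H T)
    (hH : H ≤ H') [Fintype H] [Fintype H'] {A : Type*} [AddCommMonoid A] (f : G → A) :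
    ∑ h : H', f h = ∑ c ∈ T, ∑ h : H, f (c * h) := by
  classical
  rw [← Finset.sum_product']
  symm
  refine Finset.sum_bij (fun x hx => (⟨x.1 * x.2, mul_mem (hT.subset _ (Finset.mem_product.1 hx).1)
    (hH x.2.2)⟩ : H')) ?_ ?_ ?_ ?_
  · intros; exact Finset.mem_univ _
  · rintro ⟨c, h⟩ hx ⟨c', h'⟩ hx' heq
    have heq : c * h = c' * h' := congrArg Subtype.val heq
    have h1 := (Finset.mem_product.1 hx).1
    have h2 := (Finset.mem_product.1 hx').1
    obtain rfl : c = c' := by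
      refine (hT.exists_unique (c * h) (mul_mem (hT.subset _ h1) (hH h.2))).unique ⟨h1, ?_⟩ ⟨h2, ?_⟩
      · rw [inv_mul_cancel_left]; exact h.2
      · rw [heq, inv_mul_cancel_left]; exact h'.2
    rw [Subtype.ext (mul_left_cancel heq)]
  · intro h _
    obtain ⟨c, ⟨hc, hch⟩, _⟩ := hT.exists_unique h h.2
    exact ⟨(c, ⟨_, hch⟩), Finset.mem_product.2 ⟨hc, Finset.mem_univ _⟩,
      Subtype.ext (mul_inv_cancel_left _ _)⟩
  · intros; rfl

/-- The function of a pure tensor is a sum over the middle group; grouping the sum over `H'` along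
the cosets of `H` turns the change of rings into a trace. -/
theorem theta_pieceRestr [Finite G] {H' : Subgroup G} {e' : MonoidAlgebra R G}
    {he' : ∀ c, Commute e' (incl R H' c)} (hH : H ≤ H') (h₁ : e * e' = e) (h₂ : e' * e = e)
    (β : MonoidAlgebra R H →+* MonoidAlgebra R H') (hβ : ∀ c, incl R H' (β c) = incl R H c)
    {T : Finset G} (hT : IsTransversal H' H T)
    (z : bimodTensor (rightPiece (incl R H) e he) (leftPiece (incl R H) e he)) (a b : G) :
    theta ((pieceRestr (h' := he') h₁ h₂ β hβ).hom z) a b =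
      ∑ c ∈ T, theta z (a * c) (c⁻¹ * b) := by
  have := Fintype.ofFinite H
  have := Fintype.ofFinite H'
  induction z using bimodTensor.induction with
  | zero => simp only [map_zero, Pi.zero_apply, Finset.sum_const_zero]
  | add x y hx hy => simp only [map_add, Pi.add_apply, hx, hy, Finset.sum_add_distrib]
  | tmul x y =>
    rw [pieceRestr_tmul, theta_tmul, hT.sum_eq hH fun k => (rightPiece.val (rightPiece.inclusion
      (f' := incl R H') (h' := he') h₁ x)).coeff (a * k) * (leftPiece.val (leftPiece.inclusion
      (f' := incl R H') (h' := he') h₂ y)).coeff (k⁻¹ * b)]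
    refine Finset.sum_congr rfl fun c _ => ?_
    rw [theta_tmul]
    refine Finset.sum_congr rfl fun k _ => ?_
    rw [rightPiece.val_inclusion, leftPiece.val_inclusion, mul_inv_rev, mul_assoc, mul_assoc]

variable [Finite G] {V : Subgroup G} {he : ∀ c, Commute (idem R V) (incl R H c)}
  {V₁ : Subgroup G} {he₁ : ∀ c, Commute (idem R V₁) (incl R H c)}

theorem theta_injective : Function.Injective (theta (R := R) (he := he) (he₁ := he₁)) := by
  intro z z' h
  refine tau_injective (funext fun a => leftPiece.val_injective ?_)
  ext b
  exact congrFun (congrFun h a) b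

theorem mem_mul_theta (z : bimodTensor (rightPiece (incl R H) (idem R V) he)
    (leftPiece (incl R H) (idem R V₁) he₁)) (a b : G) {v : G} (hv : v ∈ V₁) :
    theta z a (v * b) = theta z a b := by
  have h1 : of R G v⁻¹ * leftPiece.val (tau z a) = leftPiece.val (tau z a) := by
    obtain ⟨y, hy⟩ := leftPiece.val_mem (tau z a)
    rw [← hy, ← mul_assoc, of_mul_idem R (inv_mem hv)]
  have h2 := congrArg (fun y => y.coeff b) h1
  rw [MonoidAlgebra.of_apply] at h2
  rwa [MonoidAlgebra.coeff_single_mul_apply, one_mul, inv_inv] at h2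

theorem idem_mul_eq (hu : IsUnit (Nat.card V₁ : R)) (y : MonoidAlgebra R G)
    (h : ∀ v ∈ V₁, of R G v * y = y) : idem R V₁ * y = y := by
  have := mul_idem_mul R hu (a := 1) (b := y) fun v hv => by rw [one_mul, one_mul, h v hv]
  rwa [one_mul, one_mul] at this

/-- For fixed `a` the function of `b` is an element of `eRG`, and `exists_tau_eq` applies in the
variable `a`. Invariance under `V` in `a` follows from that in `b`, since `V ≤ H`. -/
theorem exists_theta_eq (hV : ∀ h ∈ H, ∀ v ∈ V, h * v * h⁻¹ ∈ V) (hu : IsUnit (Nat.card V : R))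
    (hVH : V ≤ H) (f : G → G → R) (h1 : ∀ a b, ∀ h ∈ H, f (a * h) (h⁻¹ * b) = f a b)
    (h2 : ∀ a b, ∀ v ∈ V, f a (v * b) = f a b) :
    ∃ z : bimodTensor (rightPiece (incl R H) (idem R V) he)
      (leftPiece (incl R H) (idem R V) he), theta z = f := by
  classical
  have := Fintype.ofFinite G
  let y (a : G) : MonoidAlgebra R G := .ofCoeff (Finsupp.equivFunOnFinite.symm (f a))
  have hy : ∀ a b, (y a).coeff b = f a b := fun a b => rfl
  have hey : ∀ a, idem R V * y a = y a := fun a => idem_mul_eq hu _ fun v hv => by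
    ext b
    rw [MonoidAlgebra.of_apply, MonoidAlgebra.coeff_single_mul_apply, one_mul, hy, hy,
      h2 _ _ _ (inv_mem hv)]
  let F (a : G) : leftPiece (incl R H) (idem R V) he := leftPiece.mk (y a) ⟨_, hey a⟩
  have hF1 : ∀ a (h : H), F (a * h) =
      leftAct (leftPiece (incl R H) (idem R V) he) (of R H h⁻¹) (F a) := by
    intro a h
    apply leftPiece.val_injective
    rw [leftPiece.val_leftAct, incl_of]
    ext b
    rw [MonoidAlgebra.of_apply, MonoidAlgebra.coeff_single_mul_apply, one_mul]
    have := h1 a (h * b) h h.2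
    rw [inv_mul_cancel_left] at this
    refine this.trans ?_
    rw [Subgroup.coe_inv, inv_inv]
    rfl
  have hF2 : ∀ a, ∀ v ∈ V, F (a * v) = F a := by
    intro a v hv
    apply leftPiece.val_injective
    ext b
    have := h1 a (v * b) v (hVH hv)
    rw [inv_mul_cancel_left] at this
    exact this.trans (h2 _ _ _ hv)
  obtain ⟨z, hz⟩ := exists_tau_eq (he := he) hV hu F hF1 hF2
  refine ⟨z, funext fun a => funext fun b => ?_⟩
  rw [theta_apply, hz]
  rfl

end Theta

end SplitBN
end

noncomputable section
set_option linter.unusedSectionVars false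

namespace SplitBN

open MonoidAlgebra (of)

/-! ### The function model of `X(G) e_{I₀}` -/

namespace BNData.IsSplit

variable {G : Type u} [Group G] {σ : Type} {D : BNData G σ} {p : ℕ} (hD : D.IsSplit p) [Finite G]
  (R : Type v) [CommRing R] (I₀ : Finset σ)

/-- The coefficient system `X(G) e_{I₀}`. -/
abbrev coeffXe (D : BNData G σ) (I₀ : Finset σ) :
    CoeffSystem.{max u v} σ (MonoidAlgebra R G ⊗[ℤ] (MonoidAlgebra R (D.levi I₀))ᵐᵒᵖ) :=
  D.coeffX R ⋙ D.mulE R I₀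

/-- The coefficient system `RGe_{I₀} ⊗ X(L_{I₀})`. -/
abbrev coeffXLevi (D : BNData G σ) (I₀ : Finset σ) :
    CoeffSystem.{max u v} I₀ (MonoidAlgebra R G ⊗[ℤ] (MonoidAlgebra R (D.levi I₀))ᵐᵒᵖ) :=
  (D.leviData I₀).coeffX R ⋙ D.RGeTensor R I₀

/-- The element of `X(G)` underlying an element of `X(G) e_{I₀}`. -/
def coeffXe.val {I : Finset σ} : (coeffXe R D I₀).obj I →+ (D.coeffX R).obj I where
  toFun z := z.1
  map_zero' := rfl
  map_add' _ _ := rfl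

variable {R I₀}

theorem coeffXe.val_smul {I : Finset σ} (g : MonoidAlgebra R G)
    (l : (MonoidAlgebra R (D.levi I₀))) (z : (coeffXe R D I₀).obj I) :
    coeffXe.val R I₀ ((g ⊗ₜ[ℤ] op l : MonoidAlgebra R G ⊗[ℤ] (MonoidAlgebra R (D.levi I₀))ᵐᵒᵖ) • z) =
      (g ⊗ₜ[ℤ] op (incl R (D.levi I₀) l) : MonoidAlgebra R G ⊗[ℤ] (MonoidAlgebra R G)ᵐᵒᵖ) •
        coeffXe.val R I₀ z := rfl

theorem coeffXe.val_injective {I : Finset σ} :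
    Function.Injective (coeffXe.val R I₀ : (coeffXe R D I₀).obj I → (D.coeffX R).obj I) :=
  fun _ _ h => Subtype.ext h

theorem coeffXe.val_mem {I : Finset σ} (z : (coeffXe R D I₀).obj I) :
    ((1 : MonoidAlgebra R G) ⊗ₜ[ℤ] op (D.e R I₀) :
      MonoidAlgebra R G ⊗[ℤ] (MonoidAlgebra R G)ᵐᵒᵖ) • coeffXe.val R I₀ z =
      coeffXe.val R I₀ z := by
  obtain ⟨_, m, rfl⟩ := z
  change (((1 : MonoidAlgebra R G) ⊗ₜ[ℤ] op (D.e R I₀) :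
    MonoidAlgebra R G ⊗[ℤ] (MonoidAlgebra R G)ᵐᵒᵖ) • (((1 : MonoidAlgebra R G) ⊗ₜ[ℤ] op (D.e R I₀) :
      MonoidAlgebra R G ⊗[ℤ] (MonoidAlgebra R G)ᵐᵒᵖ) • (show (D.coeffX R).obj I from m)) :
        (D.coeffX R).obj I) = ((1 : MonoidAlgebra R G) ⊗ₜ[ℤ] op (D.e R I₀) :
    MonoidAlgebra R G ⊗[ℤ] (MonoidAlgebra R G)ᵐᵒᵖ) • (show (D.coeffX R).obj I from m)
  rw [smul_smul, Algebra.TensorProduct.tmul_mul_tmul, one_mul, ← op_mul, e_mul_self]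

theorem coeffXe.exists_val {I : Finset σ} (z : (D.coeffX R).obj I) :
    ∃ z' : (coeffXe R D I₀).obj I, coeffXe.val R I₀ z' = ((1 : MonoidAlgebra R G) ⊗ₜ[ℤ] op (D.e R I₀) :
      MonoidAlgebra R G ⊗[ℤ] (MonoidAlgebra R G)ᵐᵒᵖ) • z :=
  ⟨⟨_, z, rfl⟩, rfl⟩

theorem coeffXe.val_phi {I J : Finset σ} (z : (coeffXe R D I₀).obj I) :
    coeffXe.val R I₀ (CoeffSystem.phi (coeffXe R D I₀) I J z) =
      CoeffSystem.phi (D.coeffX R) I J (coeffXe.val R I₀ z) := by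
  unfold CoeffSystem.phi
  split_ifs with h
  · rfl
  · rfl

/-- The elements of `X(G)^I` as functions on `G × G`. -/
def thetaX (D : BNData G σ) (I : Finset σ) : (D.coeffX R).obj I →+ (G → G → R) :=
  theta (R := R) (H := D.parabolic I) (he := D.e_commute R I le_rfl)
    (he₁ := D.e_commute R I le_rfl)

theorem thetaX_phi {I J : Finset σ} (h : I ≤ J) {T : Finset G}
    (hT : IsTransversal (D.parabolic J) (D.parabolic I) T) (z : (D.coeffX R).obj I) (a b : G) :
    thetaX D J (CoeffSystem.phi (D.coeffX R) I J z) a b =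
      ∑ c ∈ T, thetaX D I z (a * c) (c⁻¹ * b) := by
  rw [CoeffSystem.phi_of_le _ h]
  exact theta_pieceRestr (D.parabolic_mono h) _ _ _ (incl_inclusion R _) hT z a b

theorem thetaX_smul {I : Finset σ} (g l : G) (r r' : R) (z : (D.coeffX R).obj I) (a b : G) :
    thetaX D I ((MonoidAlgebra.single g r ⊗ₜ[ℤ] op (MonoidAlgebra.single l r') :
      MonoidAlgebra R G ⊗[ℤ] (MonoidAlgebra R G)ᵐᵒᵖ) • z) a b =
      r * thetaX D I z (g⁻¹ * a) (b * l⁻¹) * r' :=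
  theta_smul g l r r' z a b

theorem thetaX_injective {I : Finset σ} :
    Function.Injective (thetaX D I : (D.coeffX R).obj I → (G → G → R)) :=
  theta_injective (V := D.unip I) (V₁ := D.unip I)

theorem thetaX_mul_mem {I : Finset σ} (z : (D.coeffX R).obj I) {h : G} (hh : h ∈ D.parabolic I)
    (a b : G) : thetaX D I z (a * h) (h⁻¹ * b) = thetaX D I z a b :=
  theta_mul_mem z hh a b

theorem thetaX_unip_mul {I : Finset σ} (z : (D.coeffX R).obj I) {v : G} (hv : v ∈ D.unip I)
    (a b : G) : thetaX D I z a (v * b) = thetaX D I z a b :=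
  mem_mul_theta (V := D.unip I) (V₁ := D.unip I) z a b hv

/-- `1 ⊗ e'`, for the idempotent `e'` of the opposite parabolic subgroup of `I₀`. -/
def oppTensor (R : Type v) [CommRing R] (I₀ : Finset σ) :
    MonoidAlgebra R G ⊗[ℤ] (MonoidAlgebra R G)ᵐᵒᵖ :=
  (1 : MonoidAlgebra R G) ⊗ₜ[ℤ] op (hD.oppE R I₀)

/-- The elements of `X(G)^I e_{I₀}` as functions on `G × G`, through multiplication on the right
with the idempotent of the opposite parabolic subgroup. -/
def thetaE (I : Finset σ) : (coeffXe R D I₀).obj I →+ (G → G → R) where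
  toFun z := thetaX D I (hD.oppTensor R I₀ • coeffXe.val R I₀ z)
  map_zero' := by rw [map_zero, smul_zero, map_zero]
  map_add' z z' := by rw [map_add, smul_add, map_add]

theorem thetaE_apply {I : Finset σ} (z : (coeffXe R D I₀).obj I) :
    hD.thetaE I z = thetaX D I (hD.oppTensor R I₀ • coeffXe.val R I₀ z) := rfl

theorem thetaE_phi {I J : Finset σ} (h : I ≤ J) {T : Finset G}
    (hT : IsTransversal (D.parabolic J) (D.parabolic I) T) (z : (coeffXe R D I₀).obj I) (a b : G) :
    hD.thetaE J (CoeffSystem.phi (coeffXe R D I₀) I J z) a b =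
      ∑ c ∈ T, hD.thetaE I z (a * c) (c⁻¹ * b) := by
  rw [thetaE_apply, coeffXe.val_phi, ← map_smul, thetaX_phi h hT]
  rfl

theorem thetaE_smul {I : Finset σ} (g : G) (l : D.levi I₀) (r r' : R)
    (z : (coeffXe R D I₀).obj I) (a b : G) :
    hD.thetaE I ((MonoidAlgebra.single g r ⊗ₜ[ℤ] op (MonoidAlgebra.single l r') :
      MonoidAlgebra R G ⊗[ℤ] (MonoidAlgebra R (D.levi I₀))ᵐᵒᵖ) • z) a b =
      r * hD.thetaE I z (g⁻¹ * a) (b * (l : G)⁻¹) * r' := by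
  rw [thetaE_apply, coeffXe.val_smul, incl_single, smul_smul]
  have h1 : hD.oppTensor R I₀ * (MonoidAlgebra.single g r ⊗ₜ[ℤ] op (MonoidAlgebra.single (l : G) r') :
      MonoidAlgebra R G ⊗[ℤ] (MonoidAlgebra R G)ᵐᵒᵖ) =
      (MonoidAlgebra.single g r ⊗ₜ[ℤ] op (MonoidAlgebra.single (l : G) r') :
      MonoidAlgebra R G ⊗[ℤ] (MonoidAlgebra R G)ᵐᵒᵖ) * hD.oppTensor R I₀ := by
    rw [oppTensor, Algebra.TensorProduct.tmul_mul_tmul, Algebra.TensorProduct.tmul_mul_tmul,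
      one_mul, mul_one, ← op_mul, ← op_mul]
    congr 2
    have h2 := hD.of_commute_oppE R (Subgroup.mem_inf.1 l.2).2
    have h3 : (MonoidAlgebra.single (l : G) r' : MonoidAlgebra R G) = r' • of R G l := by
      rw [MonoidAlgebra.of_apply, MonoidAlgebra.smul_single, smul_eq_mul, mul_one]
    rw [h3, smul_mul_assoc, mul_smul_comm, h2]
  rw [h1, ← smul_smul, thetaX_smul]
  rfl

theorem thetaE_mul_mem {I : Finset σ} (z : (coeffXe R D I₀).obj I) {h : G}
    (hh : h ∈ D.parabolic I) (a b : G) : hD.thetaE I z (a * h) (h⁻¹ * b) = hD.thetaE I z a b :=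
  thetaX_mul_mem _ hh a b

theorem thetaE_unip_mul {I : Finset σ} (z : (coeffXe R D I₀).obj I) {v : G} (hv : v ∈ D.unip I)
    (a b : G) : hD.thetaE I z a (v * b) = hD.thetaE I z a b :=
  thetaX_unip_mul _ hv a b

theorem thetaE_mul_oppUnip {I : Finset σ} (z : (coeffXe R D I₀).obj I) {v : G}
    (hv : v ∈ hD.oppUnip I₀) (a b : G) : hD.thetaE I z a (b * v) = hD.thetaE I z a b := by
  have h1 : ((.single 1 1 : MonoidAlgebra R G) ⊗ₜ[ℤ] op (.single v⁻¹ 1 : MonoidAlgebra R G) :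
      MonoidAlgebra R G ⊗[ℤ] (MonoidAlgebra R G)ᵐᵒᵖ) * hD.oppTensor R I₀ = hD.oppTensor R I₀ := by
    rw [oppTensor, Algebra.TensorProduct.tmul_mul_tmul, ← op_mul, oppE, ← MonoidAlgebra.of_apply,
      ← MonoidAlgebra.of_apply, idem_mul_of R (inv_mem hv), map_one, one_mul]
  rw [thetaE_apply]
  conv_rhs => rw [← h1, ← smul_smul, thetaX_smul, inv_inv, one_mul, mul_one, inv_one, one_mul]

variable [Fact p.Prime] (hp : IsUnit (p : R))
include hD hp

/-- Multiplication by `e⁻` is undone on `Y e_{I₀}` by the element `z₀` with `e e⁻ z₀ = e`. -/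
theorem thetaE_injective {I : Finset σ} :
    Function.Injective (hD.thetaE I : (coeffXe R D I₀).obj I → (G → G → R)) := by
  obtain ⟨z₀, h₀⟩ := hD.exists_e_eq_mul R hp I₀
  have key : ∀ z : (coeffXe R D I₀).obj I, ((1 : MonoidAlgebra R G) ⊗ₜ[ℤ] op z₀ :
      MonoidAlgebra R G ⊗[ℤ] (MonoidAlgebra R G)ᵐᵒᵖ) • hD.oppTensor R I₀ • coeffXe.val R I₀ z =
        coeffXe.val R I₀ z := by
    intro z
    conv_lhs => rw [← coeffXe.val_mem z]
    conv_rhs => rw [← coeffXe.val_mem z]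
    rw [smul_smul, smul_smul, oppTensor, Algebra.TensorProduct.tmul_mul_tmul,
      Algebra.TensorProduct.tmul_mul_tmul, one_mul, one_mul, ← op_mul, ← op_mul, ← mul_assoc, h₀]
  intro z z' h
  apply coeffXe.val_injective
  rw [← key z, ← key z', thetaX_injective h]

theorem exists_thetaX_eq {I : Finset σ} (f : G → G → R)
    (h1 : ∀ a b, ∀ h ∈ D.parabolic I, f (a * h) (h⁻¹ * b) = f a b)
    (h2 : ∀ a b, ∀ v ∈ D.unip I, f a (v * b) = f a b) :
    ∃ z : (D.coeffX R).obj I, thetaX D I z = f :=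
  exists_theta_eq (D.unip_normal I le_rfl) (hD.card_unip_isUnit R hp I) (hD.unip_le_parabolic I)
    f h1 h2

theorem card_oppUnip_isUnit : IsUnit (Nat.card (hD.oppUnip I₀) : R) :=
  hD.card_isUnit R hp (g := hD.n0) (conj_mono _ (hD.unip_le_U _))

/-- An element `z` of `X(G)^I` with `z e⁻ = z` equals `(z z₀ e) e⁻` for the `z₀` with `z₀ e e⁻ =
e⁻`, so it comes from `z z₀ e`. -/
theorem exists_thetaE_eq {I : Finset σ} (f : G → G → R)
    (h1 : ∀ a b, ∀ h ∈ D.parabolic I, f (a * h) (h⁻¹ * b) = f a b)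
    (h2 : ∀ a b, ∀ v ∈ D.unip I, f a (v * b) = f a b)
    (h3 : ∀ a b, ∀ v ∈ hD.oppUnip I₀, f a (b * v) = f a b) :
    ∃ z : (coeffXe R D I₀).obj I, hD.thetaE I z = f := by
  classical
  obtain ⟨z, rfl⟩ := hD.exists_thetaX_eq hp f h1 h2
  obtain ⟨z₀, h₀⟩ := hD.exists_oppE_eq_mul R hp I₀
  -- Invariance under `U⁻` on the right means that averaging over `U⁻` does nothing, since `|U⁻|` is
  -- invertible.
  have hz : hD.oppTensor R I₀ • z = z := by
    have := Fintype.ofFinite (hD.oppUnip I₀)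
    set c := Ring.inverse (Nat.card (hD.oppUnip I₀) : R) with hc
    have h4 : ∀ v : hD.oppUnip I₀, ((1 : MonoidAlgebra R G) ⊗ₜ[ℤ]
        op (.single (v : G) c : MonoidAlgebra R G) :
          MonoidAlgebra R G ⊗[ℤ] (MonoidAlgebra R G)ᵐᵒᵖ) • z =
        ((1 : MonoidAlgebra R G) ⊗ₜ[ℤ] op (.single 1 c : MonoidAlgebra R G) :
          MonoidAlgebra R G ⊗[ℤ] (MonoidAlgebra R G)ᵐᵒᵖ) • z := by
      intro v
      apply thetaX_injective
      funext a b
      rw [MonoidAlgebra.one_def, thetaX_smul, thetaX_smul, h3 _ _ _ (inv_mem v.2), inv_one, mul_one]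
    have h5 : hD.oppTensor R I₀ = ∑ v : hD.oppUnip I₀, ((1 : MonoidAlgebra R G) ⊗ₜ[ℤ]
        op (.single (v : G) c : MonoidAlgebra R G) :
          MonoidAlgebra R G ⊗[ℤ] (MonoidAlgebra R G)ᵐᵒᵖ) := by
      rw [← TensorProduct.tmul_sum, ← Finset.op_sum, oppTensor, oppE, idem_eq_sum, Finset.smul_sum]
      congr 2
      refine Finset.sum_congr rfl fun v _ => ?_
      rw [MonoidAlgebra.of_apply, MonoidAlgebra.smul_single, smul_eq_mul, mul_one]
    have h6 : Fintype.card (hD.oppUnip I₀) • ((1 : MonoidAlgebra R G) ⊗ₜ[ℤ]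
        op (.single 1 c : MonoidAlgebra R G) : MonoidAlgebra R G ⊗[ℤ] (MonoidAlgebra R G)ᵐᵒᵖ) =
        1 := by
      rw [← TensorProduct.tmul_smul, ← op_smul, MonoidAlgebra.smul_single, nsmul_eq_mul,
        ← Nat.card_eq_fintype_card, hc, Ring.mul_inverse_cancel _ (hD.card_oppUnip_isUnit hp),
        ← MonoidAlgebra.one_def]
      rfl
    rw [h5, Finset.sum_smul, Finset.sum_congr rfl fun v _ => h4 v, Finset.sum_const,
      Finset.card_univ, ← smul_assoc, h6, one_smul]
  obtain ⟨z', hz'⟩ := coeffXe.exists_val (I₀ := I₀)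
    (((1 : MonoidAlgebra R G) ⊗ₜ[ℤ] op z₀ : MonoidAlgebra R G ⊗[ℤ] (MonoidAlgebra R G)ᵐᵒᵖ) • z)
  refine ⟨z', ?_⟩
  rw [thetaE_apply, hz', smul_smul, smul_smul, oppTensor, Algebra.TensorProduct.tmul_mul_tmul,
    Algebra.TensorProduct.tmul_mul_tmul, one_mul, one_mul, ← op_mul, ← op_mul, h₀]
  exact congrArg _ hz

end BNData.IsSplit

end SplitBN
end

noncomputable section
set_option linter.unusedSectionVars false

namespace SplitBN

open MonoidAlgebra (of)

/-! ### The function model of `RGe_{I₀} ⊗ X(L_{I₀})` -/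

namespace BNData.IsSplit

variable {G : Type u} [Group G] {σ : Type} {D : BNData G σ} {p : ℕ} (hD : D.IsSplit p) [Finite G]
  {R : Type v} [CommRing R] {I₀ : Finset σ}

/-- The elements of `RGe_{I₀} ⊗ X(L_{I₀})^K` as functions on `G × L_{I₀}`. -/
def thetaL (D : BNData G σ) (K : Finset I₀) :
    (coeffXLevi R D I₀).obj K →+ (G → D.levi I₀ → R) where
  toFun z x l := thetaX (D.leviData I₀) K (tau (Y := ((D.leviData I₀).coeffX R).obj K)
    (he := D.e_commute R I₀ inf_le_left) z x) 1 l
  map_zero' := by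
    funext x l
    exact congrFun (congrFun ((congrArg (thetaX (D.leviData I₀) K)
      (congrFun (map_zero tau) x)).trans (map_zero _)) 1) l
  map_add' z z' := by
    funext x l
    exact congrFun (congrFun ((congrArg (thetaX (D.leviData I₀) K)
      (congrFun (map_add tau z z') x)).trans (map_add _ _ _)) 1) l

/-- The value at an element of `G` of an element of `RGe_{I₀} ⊗ X(L_{I₀})^K`. -/
def tauL (D : BNData G σ) (K : Finset I₀) :
    (coeffXLevi R D I₀).obj K →+ (G → ((D.leviData I₀).coeffX R).obj K) :=
  tau (Y := ((D.leviData I₀).coeffX R).obj K) (he := D.e_commute R I₀ inf_le_left)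

theorem thetaL_apply {K : Finset I₀} (z : (coeffXLevi R D I₀).obj K) (x : G) (l : D.levi I₀) :
    thetaL D K z x l = thetaX (D.leviData I₀) K (tauL D K z x) 1 l := rfl

theorem tauL_phi {K K' : Finset I₀} (h : K ≤ K') (z : (coeffXLevi R D I₀).obj K) (x : G) :
    tauL D K' (CoeffSystem.phi (coeffXLevi R D I₀) K K' z) x =
      CoeffSystem.phi ((D.leviData I₀).coeffX R) K K' (tauL D K z x) := by
  rw [CoeffSystem.phi_of_le _ h, CoeffSystem.phi_of_le _ h]
  refine DFunLike.congr_fun (bimodTensor.addHom_ext (M := D.RGe R I₀ (D.levi I₀) inf_le_left)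
    (N := ((D.leviData I₀).coeffX R).obj K)
    (f := ((Pi.evalAddMonoidHom _ x).comp (tauL D K')).comp
      ((coeffXLevi R D I₀).map (homOfLE h)).hom.toAddMonoidHom)
    (g := (((D.leviData I₀).coeffX R).map (homOfLE h)).hom.toAddMonoidHom.comp
      ((Pi.evalAddMonoidHom _ x).comp (tauL D K))) fun m n => ?_) z
  exact (map_smul (((D.leviData I₀).coeffX R).map (homOfLE h)).hom _ _).symm

theorem thetaX_one_smul {K : Finset I₀} (w : ((D.leviData I₀).coeffX R).obj K)
    (k l : D.levi I₀) : thetaX (D.leviData I₀) K (leftAct _ (of R _ k⁻¹) w) 1 l =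
      thetaX (D.leviData I₀) K w k l := by
  refine (thetaX_smul k⁻¹ 1 1 1 w 1 l).trans ?_
  rw [inv_inv, mul_one, inv_one, mul_one, one_mul, mul_one]

theorem tauL_mul_mem {K : Finset I₀} (z : (coeffXLevi R D I₀).obj K) (x : G) (k : D.levi I₀) :
    tauL D K z (x * k) = leftAct _ (of R _ k⁻¹) (tauL D K z x) :=
  tau_mul_mem z x k

/-- Equivariance under `L_{I₀}` recovers the values at every first argument in `L_{I₀}` from those
at `1`, so nothing is lost by evaluating at `1`. -/
theorem thetaL_mul_mem {K : Finset I₀} (z : (coeffXLevi R D I₀).obj K) (x : G)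
    (k l : D.levi I₀) : thetaL D K z (x * k) l = thetaX (D.leviData I₀) K (tauL D K z x) k l := by
  rw [thetaL_apply, tauL_mul_mem, thetaX_one_smul]

theorem thetaL_phi {K K' : Finset I₀} (h : K ≤ K') {T : Finset (D.levi I₀)}
    (hT : IsTransversal ((D.leviData I₀).parabolic K') ((D.leviData I₀).parabolic K) T)
    (z : (coeffXLevi R D I₀).obj K) (x : G) (l : D.levi I₀) :
    thetaL D K' (CoeffSystem.phi (coeffXLevi R D I₀) K K' z) x l =
      ∑ c ∈ T, thetaL D K z (x * c) (c⁻¹ * l) := by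
  rw [thetaL_apply, tauL_phi h, thetaX_phi h hT]
  refine Finset.sum_congr rfl fun c _ => ?_
  rw [thetaL_mul_mem, one_mul]

theorem thetaL_smul {K : Finset I₀} (g : G) (l : D.levi I₀) (r r' : R)
    (z : (coeffXLevi R D I₀).obj K) (x : G) (m : D.levi I₀) :
    thetaL D K ((MonoidAlgebra.single g r ⊗ₜ[ℤ] op (MonoidAlgebra.single l r') :
      MonoidAlgebra R G ⊗[ℤ] (MonoidAlgebra R (D.levi I₀))ᵐᵒᵖ) • z) x m =
      r * thetaL D K z (g⁻¹ * x) (m * l⁻¹) * r' := by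
  have h1 : tauL D K ((MonoidAlgebra.single g r ⊗ₜ[ℤ] op (MonoidAlgebra.single l r') :
      MonoidAlgebra R G ⊗[ℤ] (MonoidAlgebra R (D.levi I₀))ᵐᵒᵖ) • z) x =
      (MonoidAlgebra.single (1 : D.levi I₀) r ⊗ₜ[ℤ] op (MonoidAlgebra.single l r') :
      MonoidAlgebra R (D.levi I₀) ⊗[ℤ] (MonoidAlgebra R (D.levi I₀))ᵐᵒᵖ) •
        tauL D K z (g⁻¹ * x) := tau_smul g r _ z x
  rw [thetaL_apply, h1, thetaX_smul, inv_one, one_mul]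
  rfl

theorem thetaL_injective {K : Finset I₀} :
    Function.Injective (thetaL D K : (coeffXLevi R D I₀).obj K → (G → D.levi I₀ → R)) := by
  intro z z' h
  have h1 : tauL D K z = tauL D K z' := by
    refine funext fun x => thetaX_injective (funext fun k => funext fun l => ?_)
    rw [← thetaL_mul_mem, ← thetaL_mul_mem, h]
  exact tau_injective (V := D.unip I₀) h1

theorem thetaL_mul_unip {K : Finset I₀} (z : (coeffXLevi R D I₀).obj K) (x : G) {u : G}
    (hu : u ∈ D.unip I₀) (l : D.levi I₀) : thetaL D K z (x * u) l = thetaL D K z x l := by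
  have h1 : tauL D K z (x * u) = tauL D K z x :=
    tau_mul_of_mem (V := D.unip I₀) (D.unip_normal I₀ inf_le_left) z x hu
  rw [thetaL_apply, thetaL_apply, h1]

theorem thetaL_mul_parabolic {K : Finset I₀} (z : (coeffXLevi R D I₀).obj K) (x : G)
    {h : D.levi I₀} (hh : h ∈ (D.leviData I₀).parabolic K) (l : D.levi I₀) :
    thetaL D K z (x * h) (h⁻¹ * l) = thetaL D K z x l := by
  have := thetaX_mul_mem (tauL D K z x) hh 1 l
  rw [one_mul] at this
  rw [thetaL_mul_mem, this, thetaL_apply]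

theorem thetaL_unip_mul {K : Finset I₀} (z : (coeffXLevi R D I₀).obj K) (x : G)
    {u : D.levi I₀} (hu : u ∈ (D.leviData I₀).unip K) (l : D.levi I₀) :
    thetaL D K z x (u * l) = thetaL D K z x l :=
  thetaX_unip_mul (tauL D K z x) hu 1 l

include hD in
theorem leviData_unip_le_parabolic (K : Finset I₀) :
    (D.leviData I₀).unip K ≤ (D.leviData I₀).parabolic K := fun _ hx =>
  hD.mem_leviData_parabolic.2 (hD.unip_le_parabolic _ (hD.mem_leviData_unip.1 hx))

variable [Fact p.Prime] (hp : IsUnit (p : R))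
include hD hp

theorem card_leviData_unip_isUnit (K : Finset I₀) :
    IsUnit (Nat.card ((D.leviData I₀).unip K) : R) := by
  have h1 : ((D.leviData I₀).unip K).map (D.levi I₀).subtype ≤ conj 1 D.U := by
    rintro _ ⟨x, hx, rfl⟩
    rw [mem_conj, inv_one, one_mul, mul_one]
    exact hD.unip_le_U _ (hD.mem_leviData_unip.1 hx)
  have h2 := hD.card_isUnit R hp h1
  rwa [Subgroup.card_subtype] at h2

/-- For each `x`, the function `(k, l) ↦ f(x k, l)` defines an element of `X(L_{I₀})^K`; these
elements depend on `x` in the way `exists_tau_eq` requires. -/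
theorem exists_thetaL_eq {K : Finset I₀} (f : G → D.levi I₀ → R)
    (h1 : ∀ x l, ∀ h ∈ (D.leviData I₀).parabolic K, f (x * h) (h⁻¹ * l) = f x l)
    (h2 : ∀ x l, ∀ u ∈ (D.leviData I₀).unip K, f x (u * l) = f x l)
    (h3 : ∀ x l, ∀ u ∈ D.unip I₀, f (x * u) l = f x l) :
    ∃ z : (coeffXLevi R D I₀).obj K, thetaL D K z = f := by
  have h4 : ∀ x, ∃ w : ((D.leviData I₀).coeffX R).obj K, ∀ k l,
      thetaX (D.leviData I₀) K w k l = f (x * k) l := fun x =>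
    (exists_theta_eq ((D.leviData I₀).unip_normal K le_rfl) (hD.card_leviData_unip_isUnit hp K)
      (hD.leviData_unip_le_parabolic K) (fun (k l : D.levi I₀) => f (x * k) l)
      (fun k l h hh => by rw [Subgroup.coe_mul, ← mul_assoc, h1 _ _ _ hh])
      fun k l v hv => h2 _ _ _ hv).imp fun w hw k l => congrFun (congrFun hw k) l
  choose F hF using h4
  obtain ⟨z, hz⟩ := exists_tau_eq (V := D.unip I₀) (he := D.e_commute R I₀ inf_le_left)
    (Y := ((D.leviData I₀).coeffX R).obj K) (D.unip_normal I₀ inf_le_left)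
    (hD.card_unip_isUnit R hp I₀) F (fun x h => thetaX_injective (funext fun k => funext fun l => by
      rw [hF]
      refine Eq.trans ?_ (thetaX_smul h⁻¹ 1 1 1 (F x) k l).symm
      rw [hF, inv_inv, one_mul, mul_one, inv_one, mul_one, Subgroup.coe_mul, mul_assoc]))
    (fun x u hu => thetaX_injective (funext fun k => funext fun l => by
      rw [hF, hF]
      have h5 : (k : G)⁻¹ * u * k ∈ D.unip I₀ := by
        have := D.unip_normal I₀ inf_le_left _ (inv_mem k.2) _ hu
        rwa [inv_inv] at this
      rw [← h3 (x * k) l _ h5]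
      congr 1
      group))
  refine ⟨z, funext fun x => funext fun l => ?_⟩
  change thetaX (D.leviData I₀) K (tau z x) 1 l = _
  rw [hz, hF, OneMemClass.coe_one, mul_one]

end BNData.IsSplit

end SplitBN
end

noncomputable section
set_option linter.unusedSectionVars false

namespace SplitBN

/-- A map into an `RG`-`RL`-bimodule that is given by a function model compatible with the action
of the group elements is linear. -/
theorem exists_linearMap {G L : Type*} [Group G] [Group L] {R : Type*} [CommRing R]
    {X Y : Bimod.{w} (MonoidAlgebra R G) (MonoidAlgebra R L)} {V : Type*} [AddCommGroup V]
    (θ : Y →+ V) (hθ : Function.Injective θ) (Φ : X →+ V) (hΦ : ∀ x, ∃ y, θ y = Φ x)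
    (h : ∀ g l r r' x y, θ y = Φ x →
      θ ((MonoidAlgebra.single g r ⊗ₜ[ℤ] op (MonoidAlgebra.single l r') :
        MonoidAlgebra R G ⊗[ℤ] (MonoidAlgebra R L)ᵐᵒᵖ) • y) =
      Φ ((MonoidAlgebra.single g r ⊗ₜ[ℤ] op (MonoidAlgebra.single l r') :
        MonoidAlgebra R G ⊗[ℤ] (MonoidAlgebra R L)ᵐᵒᵖ) • x)) :
    ∃ F : X →ₗ[MonoidAlgebra R G ⊗[ℤ] (MonoidAlgebra R L)ᵐᵒᵖ] Y, ∀ x, θ (F x) = Φ x := by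
  choose f hf using hΦ
  refine ⟨⟨⟨f, fun x y => hθ ?_⟩, fun m x => hθ ?_⟩, hf⟩
  · rw [hf, map_add, map_add, hf, hf]
  · change θ (f (m • x)) = θ (m • f x)
    rw [hf]
    have h0 : Φ ((0 : MonoidAlgebra R G ⊗[ℤ] (MonoidAlgebra R L)ᵐᵒᵖ) • x) =
        θ ((0 : MonoidAlgebra R G ⊗[ℤ] (MonoidAlgebra R L)ᵐᵒᵖ) • f x) :=
      ((congrArg Φ (zero_smul (MonoidAlgebra R G ⊗[ℤ] (MonoidAlgebra R L)ᵐᵒᵖ) x)).trans (map_zero Φ)).trans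
        ((congrArg θ (zero_smul (MonoidAlgebra R G ⊗[ℤ] (MonoidAlgebra R L)ᵐᵒᵖ) (f x))).trans (map_zero θ)).symm
    induction m using TensorProduct.induction_on with
    | zero => exact h0
    | add m m' hm hm' => rw [add_smul, add_smul, map_add, map_add, hm, hm']
    | tmul a c =>
      induction a using MonoidAlgebra.induction_linear with
      | zero =>
        rw [TensorProduct.zero_tmul]
        exact h0
      | add a b ha hb => rw [TensorProduct.add_tmul, add_smul, add_smul, map_add, map_add, ha, hb]
      | single g r =>
        induction c using MulOpposite.rec' with
        | _ c =>
        induction c using MonoidAlgebra.induction_linear with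
        | zero =>
          rw [MulOpposite.op_zero, TensorProduct.tmul_zero]
          exact h0
        | add a b ha hb =>
          rw [MulOpposite.op_add, TensorProduct.tmul_add, add_smul, add_smul, map_add, map_add, ha, hb]
        | single l r' => exact (h g l r r' x (f x) (hf x)).symm

namespace BNData.IsSplit

/-! ### Descents of labels -/

section Descent

variable {G : Type u} [Group G] {σ : Type} {D : BNData G σ} {p : ℕ} (hD : D.IsSplit p) [Finite G]
  {A : Finset σ}

/-- `i` is the chosen left descent of `w`. -/
def Desc (w : hD.W) (i : σ) : Prop :=
  ∃ h : ∃ i, len hD.s (hD.s i * w) < len hD.s w, h.choose = i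

variable {hD} in
theorem Desc.lt {w : hD.W} {i : σ} (h : hD.Desc w i) : len hD.s (hD.s i * w) < len hD.s w := by
  obtain ⟨h, rfl⟩ := h
  exact h.choose_spec

variable {hD} in
theorem Desc.eq {w : hD.W} {i j : σ} (h : hD.Desc w i) (h' : hD.Desc w j) : i = j := by
  obtain ⟨h, rfl⟩ := h
  obtain ⟨h', rfl⟩ := h'
  rfl

theorem exists_desc {w : hD.W} (hw : w ≠ 1) : ∃ i, hD.Desc w i := by
  obtain ⟨i, w', e, h⟩ := hD.cox.exists_left_descent hw
  have : ∃ i, len hD.s (hD.s i * w) < len hD.s w := by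
    refine ⟨i, ?_⟩
    rw [e, ← mul_assoc, hD.cox.sq, one_mul, ← e]
    omega
  exact ⟨_, this, rfl⟩

variable {I : Finset σ}

theorem exists_eq_rep_mul (b : G) : ∃ h ∈ D.parabolic I, ∃ q ∈ D.oppParabolic A,
    b = h * hD.rep (hD.label A I b) * q := by
  obtain ⟨h, hh, β, hβ, q, hq, e⟩ := hD.label_spec A I b
  refine ⟨h⁻¹ * β, mem_mul (inv_mem hh) (hD.B_le_parabolic I hβ), q, hq, ?_⟩
  rw [mul_assoc h⁻¹, mul_assoc h⁻¹, ← e, inv_mul_cancel_left]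

theorem label_parabolic_mul {h : G} (hh : h ∈ D.parabolic I) (b : G) :
    hD.label A I (h * b) = hD.label A I b := by
  have := hD.label_mul (A := A) (y := b) hh (one_mem (D.oppParabolic A))
  rwa [mul_one] at this

theorem exists_label_mul_eq {J : Finset σ} (hIJ : I ⊆ J) (b : G) :
    ∃ h ∈ D.parabolic J, hD.label A I (h * b) = hD.label A J b := by
  obtain ⟨h, hh, hc⟩ := hD.label_spec A J b
  refine ⟨h, hh, hD.label_eq (IsCox.good_anti (by exact_mod_cast hIJ) (hD.label_good A J b))
    (one_mem _) (one_mem _) ?_⟩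
  rwa [one_mul, mul_one]

variable [DecidableEq σ] {s : σ}

theorem good_of_lt {b : G}
    (hs : len hD.s (hD.s s * hD.label A I b) < len hD.s (hD.label A I b)) :
    Good hD.s A (insert s I : Finset σ) (hD.label A I b) := by
  rw [← hD.label_insert hs]
  exact hD.label_good _ _ _

/-- Moving `b` and `h b` to the same representative of the label turns `h`, up to `P_I` on both
sides, into an element fixing a coset `w P_A⁻`; `parabolic_inf_conj_le` applies to it. -/
theorem mem_parabolic_of_label_eq {b : G}
    (hs : len hD.s (hD.s s * hD.label A I b) < len hD.s (hD.label A I b)) {h : G}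
    (hh : h ∈ D.parabolic (insert s I)) (e : hD.label A I (h * b) = hD.label A I b) :
    h ∈ D.parabolic I := by
  obtain ⟨x, hx, q, hq, hb⟩ := hD.exists_eq_rep_mul (A := A) (I := I) b
  obtain ⟨y, hy, q', hq', hb'⟩ := hD.exists_eq_rep_mul (A := A) (I := I) (h * b)
  rw [e] at hb'
  set n := hD.rep (hD.label A I b)
  have hII := D.parabolic_mono (Finset.subset_insert s I)
  have h1 : y⁻¹ * h * x = n * (q' * q⁻¹) * n⁻¹ := by
    have : h * b * q⁻¹ * n⁻¹ = h * x := by rw [hb]; group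
    rw [mul_assoc, ← this, hb']
    group
  have h2 := hD.parabolic_inf_conj_le (hD.good_of_lt hs) hs (I := I)
    (fun k hk hks => (Finset.mem_insert.1 hk).resolve_left hks)
    (h := y⁻¹ * h * x) (mem_mul (mem_mul (inv_mem (hII hy)) hh) (hII hx)) (by
      rw [h1, mem_conj]
      have : n⁻¹ * (n * (q' * q⁻¹) * n⁻¹) * n = q' * q⁻¹ := by group
      rw [this]
      exact mem_mul hq' (inv_mem hq))
  have h3 : h = y * (y⁻¹ * h * x) * x⁻¹ := by group
  rw [h3]
  exact mem_mul (mem_mul hy h2) (inv_mem hx)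

/-- Modulo `U_{I∪s}`, an element of `U_I` passes to the right of `b` into `U_A⁻`, by
`unip_inf_leviU_le_oppUnip`. Hence functions invariant under `U_{I∪s}` and `U_A⁻` are automatically
invariant under `U_I` on cells with descent `s`. -/
theorem exists_unip_insert_mul {b : G}
    (hs : len hD.s (hD.s s * hD.label A I b) < len hD.s (hD.label A I b)) {u : G}
    (hu : u ∈ D.unip I) : ∃ a ∈ D.unip (insert s I), ∃ v ∈ hD.oppUnip A, u * b = a * (b * v) := by
  obtain ⟨x, hx, q, hq, hb⟩ := hD.exists_eq_rep_mul (A := A) (I := I) b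
  set n := hD.rep (hD.label A I b) with hn
  have hu' : x⁻¹ * u * x ∈ D.unip I := by
    have := D.unip_normal I le_rfl _ (inv_mem hx) _ hu
    rwa [inv_inv] at this
  obtain ⟨a, ha, c, hc, e⟩ := hD.exists_unip_mul (I := insert s I) (hD.unip_le_U I hu')
  have hc' : c ∈ D.unip I := by
    rw [e] at hu'
    exact (Subgroup.mul_mem_cancel_left _ (D.unip_anti (Finset.subset_insert s I) ha)).1 hu'
  have h1 := hD.unip_inf_leviU_le_oppUnip (hD.good_of_lt hs) hs (I := I)
    (fun k hk hks => (Finset.mem_insert.1 hk).resolve_left hks) hc' hc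
  rw [mem_conj, ← hn] at h1
  refine ⟨x * a * x⁻¹, D.unip_normal _ le_rfl _
    (D.parabolic_mono (Finset.subset_insert s I) hx) _ ha, q⁻¹ * (n⁻¹ * c * n) * q, ?_, ?_⟩
  · rw [← hD.conj_oppUnip (inv_mem hq), mem_conj]
    have : q⁻¹⁻¹ * (q⁻¹ * (n⁻¹ * c * n) * q) * q⁻¹ = n⁻¹ * c * n := by group
    rwa [this]
  · have h2 : u = x * (a * c) * x⁻¹ := by rw [← e]; group
    rw [h2, hb]
    group

end Descent

/-! ### The partial inverses `psi` and the filtration by length of labels -/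

section Contraction

variable {G : Type u} [Group G] {σ : Type} {D : BNData G σ} {p : ℕ} (hD : D.IsSplit p) [Finite G]
  {R : Type v} [CommRing R] {I₀ : Finset σ}

open Classical in
-- Cutting off by the chosen descent commutes with `φ` on the lowest layer: in the sum over cosets
-- the shorter labels do not contribute, and labels of equal length are equal.
theorem sum_desc_apply {I J : Finset σ} (h : I ≤ J) {T : Finset G}
    (hT : IsTransversal (D.parabolic J) (D.parabolic I) T) {n : ℕ}
    {z : (coeffXe R D I₀).obj I}
    (hz : ∀ a b, len hD.s (hD.label I₀ I b) < n → hD.thetaE I z a b = 0) {b : G}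
    (hb : len hD.s (hD.label I₀ J b) < n + 1) (t : σ) (a : G) :
    (if hD.Desc (hD.label I₀ J b) t then
      hD.thetaE J (CoeffSystem.phi (coeffXe R D I₀) I J z) a b else 0) =
      ∑ c ∈ T, if hD.Desc (hD.label I₀ I (c⁻¹ * b)) t then hD.thetaE I z (a * c) (c⁻¹ * b)
        else 0 := by
  rw [hD.thetaE_phi h hT]
  have h0 : (0 : R) = ∑ c ∈ T, 0 := Finset.sum_const_zero.symm
  conv_lhs => rw [h0, ← Finset.sum_ite_irrel]
  refine Finset.sum_congr rfl fun c hc => ?_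
  obtain ⟨h1, h2⟩ := hD.label_le (A := I₀) (y := b) h (inv_mem (hT.subset c hc))
  obtain h3 | h3 := h1.eq_or_lt
  · rw [h2 h3]
  · rw [hz _ _ (by omega), ite_self, ite_self]

theorem thetaE_phi_eq_zero {I J : Finset σ} (h : I ≤ J) {n : ℕ}
    {z : (coeffXe R D I₀).obj I}
    (hz : ∀ a b, len hD.s (hD.label I₀ I b) < n → hD.thetaE I z a b = 0) {b : G}
    (hb : len hD.s (hD.label I₀ J b) < n) (a : G) :
    hD.thetaE J (CoeffSystem.phi (coeffXe R D I₀) I J z) a b = 0 := by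
  obtain ⟨T, hT⟩ := exists_isTransversal (D.parabolic J) (D.parabolic I)
  rw [hD.thetaE_phi h hT]
  refine Finset.sum_eq_zero fun c hc => hz _ _ ?_
  have := (hD.label_le (A := I₀) (y := b) h (inv_mem (hT.subset c hc))).1
  omega

/-- The elements of `X(G)^I e_{I₀}` that vanish on the double cosets with a label of length less
than `n`. -/
def filt (R : Type v) [CommRing R] (I₀ : Finset σ) (n : ℕ) (I : Finset σ) :
    AddSubgroup ((coeffXe R D I₀).obj I) where
  carrier := {z | ∀ a b, len hD.s (hD.label I₀ I b) < n → hD.thetaE I z a b = 0}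
  zero_mem' a b _ := by rw [map_zero]; rfl
  add_mem' {z z'} hz hz' a b h := by
    rw [map_add, Pi.add_apply, Pi.add_apply, hz a b h, hz' a b h, add_zero]
  neg_mem' {z} hz a b h := by
    rw [map_neg, Pi.neg_apply, Pi.neg_apply, hz a b h, neg_zero]

theorem phi_mem_filt {n : ℕ} {I J : Finset σ} (h : I ≤ J) {z : (coeffXe R D I₀).obj I}
    (hz : z ∈ hD.filt R I₀ n I) :
    CoeffSystem.phi (coeffXe R D I₀) I J z ∈ hD.filt R I₀ n J :=
  fun a _ hb => hD.thetaE_phi_eq_zero h hz hb a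

variable [DecidableEq σ] {s : σ}

/-- Only the trivial coset contributes: for any other one the label is strictly shorter, by
`mem_parabolic_of_label_eq`, and `z` vanishes there. -/
theorem thetaE_phi_insert {I : Finset σ} {n : ℕ} {z : (coeffXe R D I₀).obj I}
    (hz : z ∈ hD.filt R I₀ n I) {b : G} (hb : len hD.s (hD.label I₀ I b) < n + 1)
    (hs : hD.Desc (hD.label I₀ I b) s) (a : G) :
    hD.thetaE (insert s I) (CoeffSystem.phi (coeffXe R D I₀) I (insert s I) z) a b =
      hD.thetaE I z a b := by
  obtain ⟨T, hT⟩ := exists_isTransversal (D.parabolic (insert s I)) (D.parabolic I)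
  rw [hD.thetaE_phi (Finset.subset_insert s I) hT]
  obtain ⟨c, ⟨hc, hc1⟩, hu⟩ := hT.exists_unique 1 (one_mem _)
  rw [mul_one] at hc1
  rw [Finset.sum_eq_single_of_mem c hc]
  · exact hD.thetaE_mul_mem z ((inv_mem_iff).1 hc1) a b
  · intro d hd hdc
    have h1 := hD.label_insert hs.lt
    obtain ⟨h2, h3⟩ := hD.label_le (A := I₀) (y := b) (Finset.subset_insert s I)
      (inv_mem (hT.subset d hd))
    rw [h1] at h2 h3
    refine hz _ _ (lt_of_lt_of_le (lt_of_le_of_ne h2 fun h4 => hdc (hu d ⟨hd, ?_⟩)) (by omega))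
    rw [mul_one]
    exact hD.mem_parabolic_of_label_eq hs.lt (inv_mem (hT.subset d hd)) (h3 h4)

variable [Fact p.Prime] (hp : IsUnit (p : R))
include hp

open Classical in
-- Equivariance under `P_{I∪s}` is stronger than under `P_I`; the only condition at stake is
-- invariance under `U_I`, and `exists_unip_insert_mul` provides it on the cells kept.
theorem exists_psi {I J : Finset σ} (hJ : J = insert s I) :
    ∃ ψ : (coeffXe R D I₀).obj J →ₗ[MonoidAlgebra R G ⊗[ℤ] (MonoidAlgebra R (D.levi I₀))ᵐᵒᵖ]
      (coeffXe R D I₀).obj I, ∀ z a b, hD.thetaE I (ψ z) a b =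
        if hD.Desc (hD.label I₀ I b) s then hD.thetaE J z a b else 0 := by
  subst hJ
  let Φ : (coeffXe R D I₀).obj (insert s I) →+ (G → G → R) :=
    { toFun z a b := if hD.Desc (hD.label I₀ I b) s then hD.thetaE (insert s I) z a b else 0
      map_zero' := by
        funext a b
        rw [map_zero]
        exact ite_self _
      map_add' z z' := by
        funext a b
        simp only [map_add, Pi.add_apply]
        split_ifs
        · rfl
        · rw [add_zero] }
  refine (exists_linearMap (hD.thetaE I) (hD.thetaE_injective hp) Φ (fun z => ?_) ?_).imp
    fun F hF z a b => congrFun (congrFun (hF z) a) b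
  · refine hD.exists_thetaE_eq hp _ ?_ ?_ ?_
    · intro a b h hh
      change (if _ then _ else _) = (if _ then _ else _)
      rw [hD.label_parabolic_mul (inv_mem hh),
        hD.thetaE_mul_mem z (D.parabolic_mono (Finset.subset_insert s I) hh)]
    · intro a b v hv
      change (if _ then _ else _) = (if _ then _ else _)
      rw [hD.label_parabolic_mul (hD.unip_le_parabolic I hv)]
      split_ifs with h
      · obtain ⟨u, hu, v, hv, e⟩ := hD.exists_unip_insert_mul h.lt hv
        rw [e, hD.thetaE_unip_mul z hu, hD.thetaE_mul_oppUnip z hv]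
      · rfl
    · intro a b v hv
      change (if _ then _ else _) = (if _ then _ else _)
      have := hD.label_mul (A := I₀) (y := b) (one_mem (D.parabolic I))
        (hD.oppUnip_le_oppParabolic I₀ hv)
      rw [one_mul] at this
      rw [this, hD.thetaE_mul_oppUnip z hv]
  · intro g l r r' z y h
    funext a b
    have h1 := congrFun (congrFun h (g⁻¹ * a)) (b * (l : G)⁻¹)
    rw [thetaE_smul, h1]
    change _ * (if _ then _ else _) * _ = (if _ then _ else _)
    have := hD.label_mul (A := I₀) (y := b) (one_mem (D.parabolic I))
      (inv_mem (Subgroup.mem_inf.1 l.2).2)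
    rw [one_mul] at this
    rw [this, thetaE_smul]
    split_ifs
    · rfl
    · rw [mul_zero, zero_mul]

open Classical in
/-- The partial inverses of the maps `φ_{J,I}`, for `J = I ∪ {s}`. -/
def psi (I J : Finset σ) :
    (coeffXe R D I₀).obj J →ₗ[MonoidAlgebra R G ⊗[ℤ] (MonoidAlgebra R (D.levi I₀))ᵐᵒᵖ]
      (coeffXe R D I₀).obj I :=
  if h : ∃ s, s ∉ I ∧ J = insert s I then (hD.exists_psi hp h.choose_spec.2).choose else 0

open Classical in
theorem thetaE_psi {I : Finset σ} (hs : s ∉ I) (z : (coeffXe R D I₀).obj (insert s I)) (a b : G) :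
    hD.thetaE I (hD.psi hp I (insert s I) z) a b =
      if hD.Desc (hD.label I₀ I b) s then hD.thetaE (insert s I) z a b else 0 := by
  have h : ∃ t, t ∉ I ∧ insert s I = insert t I := ⟨s, hs, rfl⟩
  -- The generator chosen in the definition of `psi` is determined by the two sets.
  have h1 : h.choose = s := by
    have h2 : h.choose ∈ insert s I :=
      (Finset.ext_iff.1 h.choose_spec.2 _).2 (Finset.mem_insert_self _ _)
    exact (Finset.mem_insert.1 h2).resolve_right h.choose_spec.1
  unfold psi
  rw [dif_pos h, (hD.exists_psi hp h.choose_spec.2).choose_spec]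
  simp only [h1]

theorem psi_mem_filt_one {I : Finset σ} (hs : s ∉ I) (z : (coeffXe R D I₀).obj (insert s I)) :
    hD.psi hp I (insert s I) z ∈ hD.filt R I₀ 1 I := by
  intro a b hb
  rw [hD.thetaE_psi hp hs, if_neg]
  intro h
  have := h.lt
  omega

theorem psi_mem_filt {I : Finset σ} (hs : s ∉ I) {n : ℕ}
    {z : (coeffXe R D I₀).obj (insert s I)} (hz : z ∈ hD.filt R I₀ n (insert s I)) :
    hD.psi hp I (insert s I) z ∈ hD.filt R I₀ n I := by
  intro a b hb
  rw [hD.thetaE_psi hp hs]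
  split_ifs with h
  · refine hz _ _ ?_
    rwa [hD.label_insert h.lt]
  · rfl

open Classical in
theorem thetaE_psi_phi {I : Finset σ} (hs : s ∉ I) {n : ℕ} {z : (coeffXe R D I₀).obj I}
    (hz : z ∈ hD.filt R I₀ n I) (a : G) {b : G} (hb : len hD.s (hD.label I₀ I b) < n + 1) :
    hD.thetaE I (hD.psi hp I (insert s I) (CoeffSystem.phi (coeffXe R D I₀) I (insert s I) z)) a b =
      if hD.Desc (hD.label I₀ I b) s then hD.thetaE I z a b else 0 := by
  rw [hD.thetaE_psi hp hs]
  refine if_ctx_congr Iff.rfl (fun h => ?_) fun _ => rfl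
  exact hD.thetaE_phi_insert hz hb h a

open Classical in
-- This holds exactly, not only on a layer. If `s` is the chosen descent of the label of `b`,
-- exactly one coset in `P_{I∪s} / P_I` carries that label; otherwise no coset has chosen descent
-- `s`, since `label_insert` would give `b` the same label.
theorem thetaE_phi_psi {I : Finset σ} (hs : s ∉ I) (z : (coeffXe R D I₀).obj (insert s I))
    (a b : G) :
    hD.thetaE (insert s I)
      (CoeffSystem.phi (coeffXe R D I₀) I (insert s I) (hD.psi hp I (insert s I) z)) a b =
      if hD.Desc (hD.label I₀ (insert s I) b) s then hD.thetaE (insert s I) z a b else 0 := by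
  obtain ⟨T, hT⟩ := exists_isTransversal (D.parabolic (insert s I)) (D.parabolic I)
  rw [hD.thetaE_phi (Finset.subset_insert s I) hT]
  have key : ∀ c ∈ T, ∀ h : hD.Desc (hD.label I₀ I (c⁻¹ * b)) s,
      hD.label I₀ I (c⁻¹ * b) = hD.label I₀ (insert s I) b := by
    intro c hc h
    rw [← hD.label_insert h.lt, hD.label_parabolic_mul (inv_mem (hT.subset c hc))]
  simp only [hD.thetaE_psi hp hs]
  split_ifs with h
  · obtain ⟨g, hg, e⟩ := hD.exists_label_mul_eq (A := I₀) (Finset.subset_insert s I) b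
    obtain ⟨c, ⟨hc, hcg⟩, hu⟩ := hT.exists_unique g⁻¹ (inv_mem hg)
    have e1 : c⁻¹ * b = c⁻¹ * g⁻¹ * (g * b) := by group
    have e2 : hD.label I₀ I (c⁻¹ * b) = hD.label I₀ (insert s I) b := by
      rw [e1, hD.label_parabolic_mul hcg, e]
    rw [Finset.sum_eq_single_of_mem c hc, if_pos (by rwa [e2]),
      hD.thetaE_mul_mem z (hT.subset c hc)]
    intro d hd hdc
    refine if_neg fun h' => hdc (hu d ⟨hd, ?_⟩)
    have h4 : d⁻¹ * c ∈ D.parabolic I := by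
      refine hD.mem_parabolic_of_label_eq (A := I₀) (b := c⁻¹ * b) (s := s) (by rw [e2]; exact h.lt)
        (mem_mul (inv_mem (hT.subset d hd)) (hT.subset c hc)) ?_
      have e3 : d⁻¹ * c * (c⁻¹ * b) = d⁻¹ * b := by group
      rw [e3, key d hd h', e2]
    have e4 : d⁻¹ * g⁻¹ = d⁻¹ * c * (c⁻¹ * g⁻¹) := by group
    rw [e4]
    exact mem_mul h4 hcg
  · refine Finset.sum_eq_zero fun c hc => if_neg fun h' => h ?_
    rwa [← key c hc h']

end Contraction

end BNData.IsSplit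

end SplitBN
end

noncomputable section
set_option linter.unusedSectionVars false

namespace SplitBN

namespace BNData.IsSplit

variable {G : Type u} [Group G] {σ : Type} {D : BNData G σ} {p : ℕ} (hD : D.IsSplit p) [Finite G]
  {R : Type v} [CommRing R] {I₀ : Finset σ}

/-! ### Behaviour of `psi` and `φ` on successive layers -/

section Filtration

variable [DecidableEq σ] [Fact p.Prime] (hp : IsUnit (p : R))

theorem eq_zero_of_mem_filt {I : Finset σ} {x : (coeffXe R D I₀).obj I} (hp : IsUnit (p : R))
    (hx : x ∈ hD.filt R I₀ (len hD.s hD.w0 + 1) I) : x = 0 := by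
  refine hD.thetaE_injective hp ?_
  rw [map_zero]
  funext a b
  refine hx a b ?_
  have := hD.len_w0_mul (hD.label I₀ I b)
  omega

theorem mem_filt_one_of_not_subset {I : Finset σ} (hI : ¬ I ⊆ I₀) (x : (coeffXe R D I₀).obj I) :
    x ∈ hD.filt R I₀ 1 I := by
  intro a b hb
  have h1 : hD.label I₀ I b = 1 := hD.cox.len_eq_zero.1 (by omega)
  exact absurd (hD.label_eq_one_iff.1 h1).1 hI

/-- A label different from `1` has a single chosen descent, which lies in `I` or outside it.
Accordingly exactly one of the terms `φψ` and `ψφ` reproduces the value at `b`, and the others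
vanish. -/
theorem sum_phi_psi_add_sum_psi_phi_sub_mem_filt [Fintype σ] {n : ℕ} {I : Finset σ}
    {x : (coeffXe R D I₀).obj I} (hx : x ∈ hD.filt R I₀ (n + 1) I) :
    ∑ s ∈ I, CoeffSystem.phi (coeffXe R D I₀) (I.erase s) I (hD.psi hp (I.erase s) I x) +
      ∑ t ∈ Iᶜ, hD.psi hp I (insert t I) (CoeffSystem.phi (coeffXe R D I₀) I (insert t I) x) - x ∈
        hD.filt R I₀ (n + 2) I := by
  classical
  intro a b hb
  have h1 : ∀ s ∈ I, hD.thetaE I (CoeffSystem.phi (coeffXe R D I₀) (I.erase s) I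
      (hD.psi hp (I.erase s) I x)) a b =
      if hD.Desc (hD.label I₀ I b) s then hD.thetaE I x a b else 0 := by
    intro s hs
    obtain ⟨K, hK, rfl⟩ : ∃ K, s ∉ K ∧ I = insert s K :=
      ⟨I.erase s, Finset.notMem_erase s I, (Finset.insert_erase hs).symm⟩
    rw [Finset.erase_insert hK, hD.thetaE_phi_psi hp hK]
  have h2 : ∀ t ∈ Iᶜ, hD.thetaE I (hD.psi hp I (insert t I)
      (CoeffSystem.phi (coeffXe R D I₀) I (insert t I) x)) a b =
      if hD.Desc (hD.label I₀ I b) t then hD.thetaE I x a b else 0 := fun t ht =>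
    hD.thetaE_psi_phi hp (Finset.mem_compl.1 ht) hx a hb
  rw [map_sub, map_add, map_sum, map_sum, Pi.sub_apply, Pi.sub_apply, Pi.add_apply, Pi.add_apply,
    Finset.sum_apply, Finset.sum_apply, Finset.sum_apply, Finset.sum_apply, Finset.sum_congr rfl h1,
    Finset.sum_congr rfl h2, Finset.sum_add_sum_compl, sub_eq_zero]
  by_cases h : hD.label I₀ I b = 1
  · rw [hx a b (by rw [h, len_one]; omega)]
    exact Finset.sum_eq_zero fun _ _ => ite_self _
  · obtain ⟨i, hi⟩ := hD.exists_desc h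
    rw [Finset.sum_eq_single i (fun j _ hj => if_neg fun h' => hj (h'.eq hi))
      (fun h => absurd (Finset.mem_univ _) h), if_pos hi]

theorem phi_phi {I J K : Finset σ} (h : I ≤ J) (h' : J ≤ K) (x : (coeffXe R D I₀).obj I) :
    CoeffSystem.phi (coeffXe R D I₀) J K (CoeffSystem.phi (coeffXe R D I₀) I J x) =
      CoeffSystem.phi (coeffXe R D I₀) I K x := by
  rw [CoeffSystem.phi_of_le _ h, CoeffSystem.phi_of_le _ h', CoeffSystem.phi_of_le _ (h.trans h'),
    ← homOfLE_comp h h', Functor.map_comp]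
  rfl

/-- Split `x` into `φψx` and `x - φψx`. On the first part the two compositions agree by
functoriality of `φ` and `sum_desc_apply`; the second part vanishes where `t` is the chosen descent,
and `ψφ` annihilates it on this layer. -/
theorem phi_psi_sub_psi_phi_mem_filt {n : ℕ} {K : Finset σ} {s t : σ} (ht : t ∉ K)
    (hts : t ∉ insert s K) {x : (coeffXe R D I₀).obj (insert t K)}
    (hx : x ∈ hD.filt R I₀ n (insert t K)) :
    CoeffSystem.phi (coeffXe R D I₀) K (insert s K) (hD.psi hp K (insert t K) x) -
      hD.psi hp (insert s K) (insert t (insert s K))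
        (CoeffSystem.phi (coeffXe R D I₀) (insert t K) (insert t (insert s K)) x) ∈
      hD.filt R I₀ (n + 1) (insert s K) := by
  classical
  have hKs := Finset.subset_insert s K
  have hKt := Finset.subset_insert t K
  have hst := Finset.subset_insert t (insert s K)
  have hts' : insert t K ⊆ insert t (insert s K) := Finset.insert_subset_insert t hKs
  set y := hD.psi hp K (insert t K) x with hy
  have hyF : y ∈ hD.filt R I₀ n K := hD.psi_mem_filt hp ht hx
  set x' := CoeffSystem.phi (coeffXe R D I₀) K (insert t K) y with hx'
  have hx'F : x - x' ∈ hD.filt R I₀ n (insert t K) := sub_mem hx (hD.phi_mem_filt hKt hyF)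
  intro a b hb
  have e1 : hD.thetaE (insert s K) (hD.psi hp (insert s K) (insert t (insert s K))
      (CoeffSystem.phi (coeffXe R D I₀) (insert t K) (insert t (insert s K)) x')) a b =
      hD.thetaE (insert s K) (CoeffSystem.phi (coeffXe R D I₀) K (insert s K) y) a b := by
    rw [hx', phi_phi hKt hts', ← phi_phi hKs hst,
      hD.thetaE_psi_phi hp hts (hD.phi_mem_filt hKs hyF) a hb]
    obtain ⟨T, hT⟩ := exists_isTransversal (D.parabolic (insert s K)) (D.parabolic K)
    rw [hD.sum_desc_apply hKs hT hyF hb, hD.thetaE_phi hKs hT]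
    refine Finset.sum_congr rfl fun c _ => ?_
    rw [hy, hD.thetaE_psi hp ht]
    split_ifs <;> rfl
  have e2 : hD.thetaE (insert s K) (hD.psi hp (insert s K) (insert t (insert s K))
      (CoeffSystem.phi (coeffXe R D I₀) (insert t K) (insert t (insert s K)) (x - x'))) a b = 0 := by
    rw [hD.thetaE_psi hp hts]
    by_cases h : hD.Desc (hD.label I₀ (insert s K) b) t
    · have hl := hD.label_insert h.lt
      obtain ⟨T, hT⟩ := exists_isTransversal (D.parabolic (insert t (insert s K)))
        (D.parabolic (insert t K))
      have h1 := hD.sum_desc_apply hts' hT hx'F (by rwa [hl]) t a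
      rw [hl] at h1
      rw [h1]
      refine Finset.sum_eq_zero fun c _ => ?_
      rw [map_sub, Pi.sub_apply, Pi.sub_apply, hx', hy, hD.thetaE_phi_psi hp ht]
      split_ifs
      · rw [sub_self]
      · rfl
    · rw [if_neg h]
  have e3 : x = x' + (x - x') := (add_sub_cancel _ _).symm
  rw [e3, map_add, map_add, map_sub, map_add, Pi.sub_apply, Pi.sub_apply, Pi.add_apply,
    Pi.add_apply, e1, e2, add_zero, sub_self]

end Filtration

/-! ### Restriction to the cells with label `1` and the main homotopy equivalence -/

section Restriction

include hD in
-- `P_L` is the product of `U_{I₀}` and `P_L ∩ L_{I₀}`, and `U_{I₀}` is contained in `P_K` and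
-- normalised by `L_{I₀}`.
theorem isTransversal_map {K L : Finset I₀} {T : Finset (D.levi I₀)}
    (hT : IsTransversal ((D.leviData I₀).parabolic L) ((D.leviData I₀).parabolic K) T) :
    IsTransversal (D.parabolic (L.map (Function.Embedding.subtype _)))
      (D.parabolic (K.map (Function.Embedding.subtype _)))
      (T.map (Function.Embedding.subtype _)) := by
  constructor
  · intro c hc
    obtain ⟨c, hc', rfl⟩ := Finset.mem_map.1 hc
    exact hD.mem_leviData_parabolic.1 (hT.subset c hc')
  · intro h hh
    obtain ⟨u, hu, l, hl, rfl⟩ := hD.exists_unip_mul_parabolic_inf (map_subset L) hh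
    obtain ⟨hl, hl'⟩ := Subgroup.mem_inf.1 hl
    have key : ∀ c : D.levi I₀, (c : G)⁻¹ * (u * l) ∈
        D.parabolic (K.map (Function.Embedding.subtype _)) ↔
        c⁻¹ * ⟨l, hl'⟩ ∈ (D.leviData I₀).parabolic K := by
      intro c
      rw [hD.mem_leviData_parabolic]
      have e : (c : G)⁻¹ * (u * l) = (c : G)⁻¹ * u * (c : G)⁻¹⁻¹ * ((c : G)⁻¹ * l) := by group
      rw [e, Subgroup.mul_mem_cancel_left]
      · rfl
      · exact hD.U_le_parabolic _ (hD.unip_le_U _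
          (D.unip_normal I₀ inf_le_left _ (inv_mem c.2) _ hu))
    obtain ⟨c, ⟨hc, hcl⟩, huniq⟩ := hT.exists_unique ⟨l, hl'⟩ (hD.mem_leviData_parabolic.2 hl)
    refine ⟨c, ⟨Finset.mem_map_of_mem _ hc, (key c).2 hcl⟩, ?_⟩
    rintro _ ⟨hd, hd'⟩
    obtain ⟨d, hdT, rfl⟩ := Finset.mem_map.1 hd
    exact congrArg _ (huniq d ⟨hdT, (key d).1 hd'⟩)

theorem exists_unip_mul_levi_mul_oppUnip {K : Finset I₀} {b : G}
    (hb : hD.label I₀ (K.map (Function.Embedding.subtype _)) b = 1) :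
    ∃ l : D.levi I₀, ∃ u ∈ D.unip I₀, ∃ v ∈ hD.oppUnip I₀, b = u * l * v := by
  obtain ⟨-, h, hh, hq⟩ := hD.label_eq_one_iff.1 hb
  obtain ⟨u, hu, x, hx, e⟩ := hD.exists_unip_mul_parabolic_inf (map_subset K) (inv_mem hh)
  obtain ⟨v, hv, l, hl, e'⟩ := hD.exists_oppUnip_mul_levi hq
  refine ⟨⟨x * l, mem_mul (Subgroup.mem_inf.1 hx).2 hl⟩, u, hu, l⁻¹ * v * l, ?_, ?_⟩
  · rw [← hD.conj_oppUnip (inv_mem (Subgroup.mem_inf.1 hl).2), mem_conj]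
    have : l⁻¹⁻¹ * (l⁻¹ * v * l) * l⁻¹ = v := by group
    rwa [this]
  · have : b = h⁻¹ * (h * b) := by group
    rw [this, e, e']
    group

/-- Uniqueness of the Levi part in `U_{I₀} L_{I₀} U⁻`, from `U_{I₀} ∩ P⁻ = 1` and `U⁻ ∩ P_{I₀} = 1`.
-/
theorem levi_eq_of_mul_eq {u u' v v' : G} {l l' : D.levi I₀} (hu : u ∈ D.unip I₀)
    (hu' : u' ∈ D.unip I₀) (hv : v ∈ hD.oppUnip I₀) (hv' : v' ∈ hD.oppUnip I₀)
    (h : u * l * v = u' * l' * v') : l = l' := by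
  have h1 : u'⁻¹ * u = l' * v' * v⁻¹ * (l : G)⁻¹ := by
    have : u'⁻¹ * (u * l * v) * v⁻¹ * (l : G)⁻¹ = u'⁻¹ * u := by group
    rw [← this, h]
    group
  have hP := hD.oppUnip_le_oppParabolic I₀
  have h2 := hD.unip_inf_oppParabolic (mem_mul (inv_mem hu') hu) (by
    rw [h1]
    exact mem_mul (mem_mul (mem_mul (Subgroup.mem_inf.1 l'.2).2 (hP hv')) (inv_mem (hP hv)))
      (inv_mem (Subgroup.mem_inf.1 l.2).2))
  rw [h2] at h1
  have h3 : v' * v⁻¹ = (l' : G)⁻¹ * l := by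
    have : (l' : G)⁻¹ * (l' * v' * v⁻¹ * (l : G)⁻¹) * l = v' * v⁻¹ := by group
    rw [← this, ← h1]
    group
  have h4 := hD.oppUnip_inf_parabolic (mem_mul hv' (inv_mem hv)) (by
    rw [h3]
    exact (Subgroup.mem_inf.1 (mem_mul (inv_mem l'.2) l.2)).1)
  rw [h4] at h3
  exact (Subtype.ext (inv_mul_eq_one.1 h3.symm)).symm

variable [Fact p.Prime] (hp : IsUnit (p : R))
include hp

theorem exists_rho (K : Finset I₀) :
    ∃ ρ : (coeffXe R D I₀).obj (K.map (Function.Embedding.subtype _))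
      →ₗ[MonoidAlgebra R G ⊗[ℤ] (MonoidAlgebra R (D.levi I₀))ᵐᵒᵖ] (coeffXLevi R D I₀).obj K,
      ∀ z a (l : D.levi I₀), thetaL D K (ρ z) a l = hD.thetaE _ z a l := by
  let Φ : (coeffXe R D I₀).obj (K.map (Function.Embedding.subtype _)) →+
      (G → D.levi I₀ → R) :=
    { toFun z a l := hD.thetaE _ z a l
      map_zero' := by rw [map_zero]; rfl
      map_add' z z' := by rw [map_add]; rfl }
  refine (exists_linearMap (thetaL D K) thetaL_injective Φ (fun z => ?_) ?_).imp
    fun F hF z a l => congrFun (congrFun (hF z) a) l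
  · refine hD.exists_thetaL_eq hp _ ?_ ?_ ?_
    · intro x l h hh
      exact hD.thetaE_mul_mem z (hD.mem_leviData_parabolic.1 hh) x l
    · intro x l u hu
      exact hD.thetaE_unip_mul z (hD.mem_leviData_unip.1 hu) x l
    · intro x l u hu
      have hu' := D.unip_anti (map_subset K) hu
      have := hD.thetaE_mul_mem z (hD.unip_le_parabolic _ hu') x (u * l)
      rw [inv_mul_cancel_left] at this
      exact this.trans (hD.thetaE_unip_mul z hu' x l)
  · intro g l r r' z y h
    funext a m
    have h1 := congrFun (congrFun h (g⁻¹ * a)) (m * l⁻¹)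
    rw [thetaL_smul, h1]
    exact (hD.thetaE_smul g l r r' z a m).symm

/-- The restriction of functions from `G × G` to `G × L_{I₀}`. -/
def rho (K : Finset I₀) : (coeffXe R D I₀).obj (K.map (Function.Embedding.subtype _))
      →ₗ[MonoidAlgebra R G ⊗[ℤ] (MonoidAlgebra R (D.levi I₀))ᵐᵒᵖ] (coeffXLevi R D I₀).obj K :=
  (hD.exists_rho hp K).choose

theorem thetaL_rho {K : Finset I₀}
    (z : (coeffXe R D I₀).obj (K.map (Function.Embedding.subtype _))) (a : G) (l : D.levi I₀) :
    thetaL D K (hD.rho hp K z) a l = hD.thetaE _ z a l :=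
  (hD.exists_rho hp K).choose_spec z a l

theorem rho_surjective (K : Finset I₀) :
    Function.Surjective (hD.rho hp K : (coeffXe R D I₀).obj (K.map (Function.Embedding.subtype _)) →
      (coeffXLevi R D I₀).obj K) := by
  classical
  intro y
  set K' := K.map (Function.Embedding.subtype _) with hK'
  have h1 : ∀ b, ∃ l : D.levi I₀, hD.label I₀ K' b = 1 →
      ∃ u ∈ D.unip I₀, ∃ v ∈ hD.oppUnip I₀, b = u * l * v := by
    intro b
    by_cases hb : hD.label I₀ K' b = 1
    · exact (hD.exists_unip_mul_levi_mul_oppUnip hb).imp fun l hl _ => hl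
    · exact ⟨1, fun h => absurd h hb⟩
  choose lev hlev using h1
  have hlabel : ∀ (l : D.levi I₀) u, u ∈ D.unip I₀ → ∀ v ∈ hD.oppUnip I₀,
      hD.label I₀ K' (u * l * v) = 1 := by
    intro l u hu v hv
    refine hD.label_eq_one_iff.2 ⟨map_subset K, u⁻¹,
      inv_mem (hD.U_le_parabolic _ (hD.unip_le_U _ hu)), ?_⟩
    have : u⁻¹ * (u * l * v) = l * v := by group
    rw [this]
    exact mem_mul (Subgroup.mem_inf.1 l.2).2 (hD.oppUnip_le_oppParabolic _ hv)
  have hlev' : ∀ (l : D.levi I₀) u, u ∈ D.unip I₀ → ∀ v ∈ hD.oppUnip I₀,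
      lev (u * l * v) = l := by
    intro l u hu v hv
    obtain ⟨u', hu', v', hv', e⟩ := hlev _ (hlabel l u hu v hv)
    exact (hD.levi_eq_of_mul_eq hu hu' hv hv' e).symm
  -- The given function on `G × L_{I₀}` is extended through the Levi part of `b ∈ U_{I₀} L_{I₀} U⁻`
  -- and by `0` to all other cells; the invariances then follow from uniqueness of that part.
  let f : G → G → R := fun a b =>
    if hD.label I₀ K' b = 1 then thetaL D K y a (lev b) else 0
  have hf : ∀ a (l : D.levi I₀) u, u ∈ D.unip I₀ → ∀ v ∈ hD.oppUnip I₀,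
      f a (u * l * v) = thetaL D K y a l := by
    intro a l u hu v hv
    change (if _ then _ else _) = _
    rw [if_pos (hlabel l u hu v hv), hlev' l u hu v hv]
  have hf0 : ∀ a b, hD.label I₀ K' b ≠ 1 → f a b = 0 := fun a b hb => if_neg hb
  suffices h : ∃ z : (coeffXe R D I₀).obj K', hD.thetaE K' z = f by
    obtain ⟨z, hz⟩ := h
    refine ⟨z, thetaL_injective (funext fun a => funext fun l => ?_)⟩
    rw [thetaL_rho, hz]
    have := hf a l 1 (one_mem _) 1 (one_mem _)
    rwa [one_mul, mul_one] at this
  refine hD.exists_thetaE_eq hp f ?_ ?_ ?_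
  · intro a b h hh
    by_cases hb : hD.label I₀ K' b = 1
    · obtain ⟨u, hu, v, hv, e⟩ := hlev b hb
      obtain ⟨u₀, hu₀, x, hx, rfl⟩ := hD.exists_unip_mul_parabolic_inf (map_subset K) hh
      obtain ⟨hx, hx'⟩ := Subgroup.mem_inf.1 hx
      lift x to D.levi I₀ using hx'
      have e1 : (u₀ * x)⁻¹ * b = ((x : G)⁻¹ * (u₀⁻¹ * u) * (x : G)⁻¹⁻¹) *
          ((x⁻¹ * lev b : D.levi I₀) : G) * v := by
        conv_lhs => rw [e]
        simp only [Subgroup.coe_mul, Subgroup.coe_inv]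
        group
      have e2 : f a b = thetaL D K y a (lev b) := if_pos hb
      rw [e1, hf _ _ _ (D.unip_normal I₀ inf_le_left _ (inv_mem x.2) _
        (mem_mul (inv_mem hu₀) hu)) _ hv, e2, ← mul_assoc,
        thetaL_mul_parabolic _ _ (hD.mem_leviData_parabolic.2 hx), thetaL_mul_unip _ _ hu₀]
    · rw [hf0 _ _ hb, hf0]
      rwa [hD.label_parabolic_mul (inv_mem hh)]
  · intro a b w hw
    by_cases hb : hD.label I₀ K' b = 1
    · obtain ⟨u, hu, v, hv, e⟩ := hlev b hb
      obtain ⟨u₀, hu₀, x, hx, rfl⟩ := hD.exists_unip_mul_unip_inf (map_subset K) hw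
      obtain ⟨hx, hx'⟩ := Subgroup.mem_inf.1 hx
      lift x to D.levi I₀ using hx'
      have e1 : (u₀ * x) * b = (u₀ * ((x : G) * u * (x : G)⁻¹)) *
          ((x * lev b : D.levi I₀) : G) * v := by
        conv_lhs => rw [e]
        simp only [Subgroup.coe_mul]
        group
      have e2 : f a b = thetaL D K y a (lev b) := if_pos hb
      rw [e1, hf _ _ _ (mem_mul hu₀ (D.unip_normal I₀ inf_le_left _ x.2 _ hu)) _ hv, e2,
        thetaL_unip_mul _ _ (hD.mem_leviData_unip.2 hx)]
    · rw [hf0 _ _ hb, hf0]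
      rwa [hD.label_parabolic_mul (hD.unip_le_parabolic _ hw)]
  · intro a b v hv
    by_cases hb : hD.label I₀ K' b = 1
    · obtain ⟨u, hu, v', hv', e⟩ := hlev b hb
      have e1 : b * v = u * lev b * (v' * v) := by
        conv_lhs => rw [e]
        group
      have e2 : f a b = thetaL D K y a (lev b) := if_pos hb
      rw [e1, hf _ _ _ hu _ (mem_mul hv' hv), e2]
    · rw [hf0 _ _ hb, hf0]
      have := hD.label_mul (A := I₀) (y := b) (one_mem (D.parabolic K'))
        (hD.oppUnip_le_oppParabolic I₀ hv)
      rw [one_mul] at this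
      rwa [this]

theorem rho_phi {K L : Finset I₀} (h : K ≤ L)
    (x : (coeffXe R D I₀).obj (K.map (Function.Embedding.subtype _))) :
    hD.rho hp L (CoeffSystem.phi (coeffXe R D I₀) _ _ x) =
      CoeffSystem.phi (coeffXLevi R D I₀) K L (hD.rho hp K x) := by
  refine thetaL_injective (funext fun a => funext fun l => ?_)
  obtain ⟨T, hT⟩ := exists_isTransversal ((D.leviData I₀).parabolic L)
    ((D.leviData I₀).parabolic K)
  rw [thetaL_rho, thetaL_phi h hT,
    hD.thetaE_phi (Finset.map_subset_map.2 h) (hD.isTransversal_map hT), Finset.sum_map]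
  exact Finset.sum_congr rfl fun c _ => (hD.thetaL_rho hp x _ (c⁻¹ * l)).symm

/-- The cells with label `1` are covered by `U_{I₀} L_{I₀} U⁻`, so by invariance vanishing on them
is vanishing on `L_{I₀}`. -/
theorem mem_filt_one_iff {K : Finset I₀}
    (x : (coeffXe R D I₀).obj (K.map (Function.Embedding.subtype _))) :
    x ∈ hD.filt R I₀ 1 _ ↔ hD.rho hp K x = 0 := by
  have h0 : hD.rho hp K x = 0 ↔ ∀ a (l : D.levi I₀), hD.thetaE _ x a l = 0 := by
    rw [← thetaL_injective.eq_iff (a := hD.rho hp K x), map_zero]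
    simp only [← hD.thetaL_rho hp x]
    exact ⟨fun h a l => congrFun (congrFun h a) l, fun h => funext fun a => funext fun l => h a l⟩
  rw [h0]
  constructor
  · intro h a l
    refine h a l ?_
    rw [hD.label_eq_one_iff.2 ⟨map_subset K, 1, one_mem _, ?_⟩, len_one]
    · exact one_pos
    · rw [one_mul]
      exact (Subgroup.mem_inf.1 l.2).2
  · intro h a b hb
    obtain ⟨l, u, hu, v, hv, rfl⟩ := hD.exists_unip_mul_levi_mul_oppUnip (b := b)
      (hD.cox.len_eq_zero.1 (Nat.lt_one_iff.1 hb))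
    rw [hD.thetaE_mul_oppUnip x hv, hD.thetaE_unip_mul x (D.unip_anti (map_subset K) hu), h]

include hD in
theorem nonempty_coeffKb_coeffXe_iso [Fintype σ] [LinearOrder σ] :
    Nonempty (coeffKb (coeffXe R D I₀) ≅ coeffKb (coeffXLevi R D I₀)) := by
  refine nonempty_coeffKb_iso I₀ (coeffXe R D I₀) (coeffXLevi R D I₀) (hD.rho hp)
    (hD.rho_surjective hp) (fun K L x h => hD.rho_phi hp h x) (hD.psi hp)
    (hD.filt R I₀) (len hD.s hD.w0) (fun K x => hD.mem_filt_one_iff hp x)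
    (fun I hI x => hD.mem_filt_one_of_not_subset hI x)
    (fun I x hx => hD.eq_zero_of_mem_filt hp hx) (fun n I J h x hx => hD.phi_mem_filt h hx)
    (fun I s hs x => hD.psi_mem_filt_one hp hs x)
    (fun n I x hx => hD.sum_phi_psi_add_sum_psi_phi_sub_mem_filt hp hx) ?_
  intro n I s hs t ht x hx
  -- The set `I` is renamed as `K ∪ {s}` so that erasing `s` yields `K`, the form in which the
  -- comparison of `φψ` and `ψφ` was proved.
  obtain ⟨K, hK, rfl⟩ : ∃ K, s ∉ K ∧ I = insert s K :=
    ⟨I.erase s, Finset.notMem_erase s I, (Finset.insert_erase hs).symm⟩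
  have e : (insert s K).erase s = K := Finset.erase_insert hK
  revert x
  rw [e]
  intro x hx
  exact hD.phi_psi_sub_psi_phi_mem_filt hp (fun h => ht (Finset.mem_insert_of_mem h)) ht hx

end Restriction

end BNData.IsSplit

end SplitBN
end

noncomputable section
set_option linter.unusedSectionVars false

namespace SplitBN

/-! ### Exchange of the left and right actions by involutions -/

section Swap

variable {A B C : Type*} [Ring A] [Ring B] [Ring C] [StarRing A] [StarRing B] [StarRing C]

variable (A B) in
/-- For rings with involutions, the isomorphism `a ⊗ b ↦ b* ⊗ a*`. -/
def swapHom : A ⊗[ℤ] Bᵐᵒᵖ →+* B ⊗[ℤ] Aᵐᵒᵖ :=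
  (Algebra.TensorProduct.comm ℤ Aᵐᵒᵖ B).toRingEquiv.toRingHom.comp
    (Algebra.TensorProduct.map (starRingEquiv (R := A)).toRingHom.toIntAlgHom
      (starRingEquiv (R := B)).symm.toRingHom.toIntAlgHom).toRingHom

/-- `f` exchanges the left and the right action. -/
def IsAnti {M : Bimod.{w} A B} {M' : Bimod.{w} B A} (f : M →+ M') : Prop :=
  ∀ (a : A) (b : B) (m : M), f ((a ⊗ₜ[ℤ] op b : A ⊗[ℤ] Bᵐᵒᵖ) • m) =
    (star b ⊗ₜ[ℤ] op (star a) : B ⊗[ℤ] Aᵐᵒᵖ) • f m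

theorem IsAnti.map_smul {M : Bimod.{w} A B} {M' : Bimod.{w} B A} {f : M →+ M'} (hf : IsAnti f)
    (x : A ⊗[ℤ] Bᵐᵒᵖ) (m : M) : f (x • m) = swapHom A B x • f m := by
  induction x using TensorProduct.induction_on with
  | zero =>
    refine (congrArg f (zero_smul (A ⊗[ℤ] Bᵐᵒᵖ) m)).trans ((map_zero f).trans ?_)
    exact ((congrArg (· • f m) (map_zero (swapHom A B))).trans
      (zero_smul (B ⊗[ℤ] Aᵐᵒᵖ) (f m))).symm
  | add x y hx hy => rw [add_smul, map_add, map_add, add_smul, hx, hy]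
  | tmul a b => exact hf a b.unop m

theorem IsAnti.symm {M : Bimod.{w} A B} {M' : Bimod.{w} B A} {f : M ≃+ M'}
    (hf : IsAnti f.toAddMonoidHom) : IsAnti f.symm.toAddMonoidHom := by
  intro b a m
  apply f.injective
  refine (f.apply_symm_apply _).trans (Eq.trans ?_ (hf (star a) (star b) (f.symm m)).symm)
  rw [star_star, star_star]
  exact congrArg _ (f.apply_symm_apply _).symm

/-- The functor from `B`-`A`-bimodules to `A`-`B`-bimodules given by the involutions. -/
def swap : Bimod.{w} B A ⥤ Bimod.{w} A B := ModuleCat.restrictScalars (swapHom A B)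

instance : (swap : Bimod.{w} B A ⥤ Bimod.{w} A B).Additive :=
  inferInstanceAs (ModuleCat.restrictScalars (swapHom A B)).Additive

/-- An anti-isomorphism as an isomorphism of bimodules. -/
def isoOfAnti {M : Bimod.{w} A B} {M' : Bimod.{w} B A} (f : M ≃+ M')
    (hf : IsAnti f.toAddMonoidHom) : M ≅ swap.obj M' :=
  let e : M ≃ₗ[A ⊗[ℤ] Bᵐᵒᵖ] (swap.obj M' : Bimod.{w} A B) :=
    { toFun := f
      invFun := f.symm
      left_inv := f.left_inv
      right_inv := f.right_inv
      map_add' := f.map_add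
      map_smul' := hf.map_smul }
  e.toModuleIso

theorem nonempty_iso_of_anti {σ : Type} {M : CoeffSystem.{w} σ (A ⊗[ℤ] Bᵐᵒᵖ)}
    {M' : CoeffSystem.{w} σ (B ⊗[ℤ] Aᵐᵒᵖ)} (f : ∀ I, M.obj I ≃+ M'.obj I)
    (hf : ∀ I, IsAnti (f I).toAddMonoidHom)
    (h : ∀ {I J} (φ : I ⟶ J) x, f J ((M.map φ).hom x) = (M'.map φ).hom (f I x)) :
    Nonempty (M ≅ M' ⋙ swap) :=
  ⟨NatIso.ofComponents (fun I => isoOfAnti (f I) (hf I)) fun φ =>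
    ModuleCat.hom_ext (LinearMap.ext (h φ))⟩

/-- `m ⊗ n ↦ g n ⊗ f m` -/
def swapTensorHom {M : Bimod.{w} A B} {N : Bimod.{w} B C} {N' : Bimod.{w} B A} {M' : Bimod.{w} C B}
    (f : M →+ N') (g : N →+ M') (hf : IsAnti f) (hg : IsAnti g) :
    bimodTensor M N →+ bimodTensor M' N' :=
  bimodTensor.liftAdd (AddMonoidHom.mk' (fun m => AddMonoidHom.mk'
      (fun n => (bimodTensor.tmul (g n) (f m) : bimodTensor M' N'))
      fun n n' => (congrArg (bimodTensor.tmul · _) (map_add g n n')).trans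
        (bimodTensor.add_tmul _ _ _))
      fun m m' => AddMonoidHom.ext fun n => (congrArg (bimodTensor.tmul _) (map_add f m m')).trans
        (bimodTensor.tmul_add _ _ _)) (by
    intro m b n
    change bimodTensor.tmul (g n) (f _) = bimodTensor.tmul (g _) (f m)
    have h1 := hf 1 b m
    have h2 := hg b 1 n
    rw [star_one] at h1 h2
    exact (congrArg _ h1).trans ((bimodTensor.tmul_balanced _ _ _).symm.trans
      (congrArg (bimodTensor.tmul · _) h2.symm)))

/-- The anti-isomorphism `M ⊗_B N ≅ M' ⊗_B N'`, `m ⊗ n ↦ g n ⊗ f m`. -/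
def swapTensor {M : Bimod.{w} A B} {N : Bimod.{w} B C} {N' : Bimod.{w} B A} {M' : Bimod.{w} C B}
    (f : M ≃+ N') (g : N ≃+ M') (hf : IsAnti f.toAddMonoidHom) (hg : IsAnti g.toAddMonoidHom) :
    bimodTensor M N ≃+ bimodTensor M' N' :=
  AddMonoidHom.toAddEquiv (swapTensorHom _ _ hf hg) (swapTensorHom _ _ hg.symm hf.symm)
    (bimodTensor.addHom_ext fun _ _ => congrArg₂ bimodTensor.tmul (f.symm_apply_apply _)
      (g.symm_apply_apply _))
    (bimodTensor.addHom_ext fun _ _ => congrArg₂ bimodTensor.tmul (g.apply_symm_apply _)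
      (f.apply_symm_apply _))

theorem isAnti_swapTensor {M : Bimod.{w} A B} {N : Bimod.{w} B C} {N' : Bimod.{w} B A}
    {M' : Bimod.{w} C B} (f : M ≃+ N') (g : N ≃+ M') (hf : IsAnti f.toAddMonoidHom)
    (hg : IsAnti g.toAddMonoidHom) : IsAnti (swapTensor f g hf hg).toAddMonoidHom := by
  intro a c z
  induction z using bimodTensor.induction with
  | zero => rw [smul_zero, map_zero, smul_zero]
  | add x y hx hy => rw [smul_add, map_add, map_add, smul_add, hx, hy]
  | tmul m n =>
    have h1 := hf a 1 m
    have h2 := hg 1 c n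
    rw [star_one] at h1 h2
    exact congrArg₂ bimodTensor.tmul h2 h1

variable {f : C →+* B} {e : B} {h : ∀ c, Commute e (f c)}

/-- An anti-isomorphism `Y ≅ Y'` restricts to `e Y ≅ Y' e`. -/
def cutAnti (he : star e = e) {Y : Bimod.{w} B A}
    {Y' : Bimod.{w} A B} (s : Y ≃+ Y') (hs : IsAnti s.toAddMonoidHom) :
    (leftCut A f e h).obj Y ≃+ (rightCut A f e h).obj Y' where
  toFun y := ⟨s y.1, by
    obtain ⟨_, y, rfl⟩ := y
    refine ⟨s y, ?_⟩
    have := hs e 1 y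
    rw [star_one, he] at this
    exact this.symm⟩
  invFun y := ⟨s.symm y.1, by
    obtain ⟨_, y, rfl⟩ := y
    refine ⟨s.symm y, ?_⟩
    have := hs.symm 1 e y
    rw [star_one, he] at this
    exact this.symm⟩
  left_inv y := Subtype.ext (s.symm_apply_apply _)
  right_inv y := Subtype.ext (s.apply_symm_apply _)
  map_add' y z := Subtype.ext (s.map_add _ _)

theorem isAnti_cutAnti (hf : ∀ c, f (star c) = star (f c)) (he : star e = e) {Y : Bimod.{w} B A}
    {Y' : Bimod.{w} A B} (s : Y ≃+ Y') (hs : IsAnti s.toAddMonoidHom) :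
    IsAnti (cutAnti (h := h) he s hs).toAddMonoidHom := by
  intro c a y
  refine Subtype.ext ((hs (f c) a y.1).trans ?_)
  rw [← hf]
  rfl

/-- The involution of `A`, as an anti-isomorphism. -/
def regularAnti (A : Type w) [Ring A] [StarRing A] : regular A ≃+ regular A where
  toFun x := (star (show A from x) : A)
  invFun x := (star (show A from x) : A)
  left_inv x := star_star (show A from x)
  right_inv x := star_star (show A from x)
  map_add' x y := star_add (show A from x) (show A from y)

theorem isAnti_regularAnti (A : Type w) [Ring A] [StarRing A] :
    IsAnti (regularAnti A).toAddMonoidHom := by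
  intro a b x
  refine (congrArg (regularAnti A) (regular_smul A a b x)).trans (Eq.trans ?_ (regular_smul A _ _ _).symm)
  change star (a * (show A from x) * b) = star b * star (show A from x) * star a
  rw [star_mul, star_mul, mul_assoc]

theorem cutAnti_map (he : star e = e) {Y Z : Bimod.{w} B A} {Y' Z' : Bimod.{w} A B}
    (s : Y ≃+ Y') (hs : IsAnti s.toAddMonoidHom) (t : Z ≃+ Z') (ht : IsAnti t.toAddMonoidHom)
    (g : Y ⟶ Z) (g' : Y' ⟶ Z') (hg : ∀ y, t (g.hom y) = g'.hom (s y))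
    (y : (leftCut A f e h).obj Y) :
    cutAnti he t ht (((leftCut A f e h).map g).hom y) =
      ((rightCut A f e h).map g').hom (cutAnti he s hs y) :=
  Subtype.ext (hg y.1)

theorem nonempty_leftCut_iso (hf : ∀ c, f (star c) = star (f c)) (he : star e = e) {σ : Type}
    {M : CoeffSystem.{w} σ (B ⊗[ℤ] Aᵐᵒᵖ)} {M' : CoeffSystem.{w} σ (A ⊗[ℤ] Bᵐᵒᵖ)}
    (s : ∀ I, M.obj I ≃+ M'.obj I) (hs : ∀ I, IsAnti (s I).toAddMonoidHom)
    (h' : ∀ {I J} (φ : I ⟶ J) x, s J ((M.map φ).hom x) = (M'.map φ).hom (s I x)) :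
    Nonempty (M ⋙ leftCut A f e h ≅ (M' ⋙ rightCut A f e h) ⋙ swap) :=
  nonempty_iso_of_anti (M := M ⋙ leftCut A f e h) (M' := M' ⋙ rightCut A f e h)
    (fun I => cutAnti (h := h) he (s I) (hs I)) (fun _ => isAnti_cutAnti hf _ _ _)
    fun φ x => cutAnti_map _ _ _ _ _ _ _ (h' φ) x

theorem swapTensor_map {M M₂ : Bimod.{w} A B} {N : Bimod.{w} B C} {N' N₂' : Bimod.{w} B A}
    {M' : Bimod.{w} C B} (s : M ≃+ N') (hs : IsAnti s.toAddMonoidHom) (t : M₂ ≃+ N₂')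
    (ht : IsAnti t.toAddMonoidHom) (r : N ≃+ M') (hr : IsAnti r.toAddMonoidHom) (g : M ⟶ M₂)
    (g' : N' ⟶ N₂') (hg : ∀ y, t (g.hom y) = g'.hom (s y)) (z : bimodTensor M N) :
    swapTensor t r ht hr (((tensorRight A N).map g).hom z) =
      ((tensorLeft A M').map g').hom (swapTensor s r hs hr z) := by
  refine DFunLike.congr_fun (bimodTensor.addHom_ext
    (f := (swapTensor t r ht hr).toAddMonoidHom.comp
      ((tensorRight A N).map g).hom.toAddMonoidHom)
    (g := ((tensorLeft A M').map g').hom.toAddMonoidHom.comp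
      (swapTensor s r hs hr).toAddMonoidHom) fun m n => ?_) z
  exact congrArg (bimodTensor.tmul _) (hg m)

theorem nonempty_tensorRight_iso {σ : Type} {M : CoeffSystem.{w} σ (A ⊗[ℤ] Bᵐᵒᵖ)}
    {M' : CoeffSystem.{w} σ (B ⊗[ℤ] Aᵐᵒᵖ)} (s : ∀ I, M.obj I ≃+ M'.obj I)
    (hs : ∀ I, IsAnti (s I).toAddMonoidHom)
    (h : ∀ {I J} (φ : I ⟶ J) x, s J ((M.map φ).hom x) = (M'.map φ).hom (s I x))
    {N : Bimod.{w} B C} {N' : Bimod.{w} C B} (r : N ≃+ N') (hr : IsAnti r.toAddMonoidHom) :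
    Nonempty (M ⋙ tensorRight A N ≅ (M' ⋙ tensorLeft A N') ⋙ swap) :=
  nonempty_iso_of_anti (M := M ⋙ tensorRight A N) (M' := M' ⋙ tensorLeft A N')
    (fun I => swapTensor (s I) r (hs I) hr) (fun _ => isAnti_swapTensor _ _ _ _)
    fun φ x => swapTensor_map _ _ _ _ _ _ _ _ (h φ) x

end Swap

/-! ### The involution on `A e`, `e A` and their tensor product -/

section Piece

variable {A : Type w} {C C' : Type*} [Ring A] [Ring C] [Ring C'] [StarRing A] [StarRing C]
  [StarRing C'] {f' : C' →+* A} {e' : A} {hc : ∀ x, Commute e' (f' x)}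
  {f : C →+* A} {e : A} {h : ∀ c, Commute e (f c)}

/-- The involution of `A`, as a map from `e A` to `A e`. -/
def pieceAnti (he : star e = e) : leftPiece f e h ≃+ rightPiece f e h :=
  cutAnti he (regularAnti A) (isAnti_regularAnti A)

theorem isAnti_pieceAnti (hf : ∀ c, f (star c) = star (f c)) (he : star e = e) :
    IsAnti (pieceAnti (h := h) he).toAddMonoidHom :=
  isAnti_cutAnti hf _ _ _

theorem pieceAnti_inclusion (he : star e = e) (he' : star e' = e') (h₁ : e * e' = e)
    (h₂ : e' * e = e) (y : leftPiece f e h) :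
    pieceAnti he' (leftPiece.inclusion (f' := f') (h' := hc) h₂ y) =
      rightPiece.inclusion h₁ (pieceAnti he y) :=
  rightPiece.val_injective rfl

theorem pieceAnti_symm_inclusion (he : star e = e) (he' : star e' = e') (h₁ : e * e' = e)
    (h₂ : e' * e = e) (x : rightPiece f e h) :
    (pieceAnti he').symm (rightPiece.inclusion (f' := f') (h' := hc) h₁ x) =
      leftPiece.inclusion h₂ ((pieceAnti he).symm x) := by
  rw [AddEquiv.symm_apply_eq, pieceAnti_inclusion he he' h₁ h₂, AddEquiv.apply_symm_apply]

/-- The map `x ⊗ y ↦ y* ⊗ x*` on `A e ⊗_C e A`. -/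
def pieceTensorAnti (hf : ∀ c, f (star c) = star (f c)) (he : star e = e) :
    bimodTensor (rightPiece f e h) (leftPiece f e h) ≃+
      bimodTensor (rightPiece f e h) (leftPiece f e h) :=
  swapTensor (pieceAnti he).symm (pieceAnti he) (isAnti_pieceAnti hf he).symm
    (isAnti_pieceAnti hf he)

theorem isAnti_pieceTensorAnti (hf : ∀ c, f (star c) = star (f c)) (he : star e = e) :
    IsAnti (pieceTensorAnti (h := h) hf he).toAddMonoidHom :=
  isAnti_swapTensor _ _ _ _

theorem pieceTensorAnti_pieceRestr (hf : ∀ c, f (star c) = star (f c)) (he : star e = e)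
    (hf' : ∀ c, f' (star c) = star (f' c)) (he' : star e' = e') (h₁ : e * e' = e)
    (h₂ : e' * e = e) (β : C →+* C') (hβ : ∀ c, f' (β c) = f c)
    (z : bimodTensor (rightPiece f e h) (leftPiece f e h)) :
    pieceTensorAnti hf' he' ((pieceRestr (h' := hc) h₁ h₂ β hβ).hom z) =
      (pieceRestr h₁ h₂ β hβ).hom (pieceTensorAnti hf he z) := by
  refine DFunLike.congr_fun (bimodTensor.addHom_ext
    (f := (pieceTensorAnti hf' he').toAddMonoidHom.comp
      (pieceRestr (h' := hc) h₁ h₂ β hβ).hom.toAddMonoidHom)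
    (g := (pieceRestr h₁ h₂ β hβ).hom.toAddMonoidHom.comp
      (pieceTensorAnti hf he).toAddMonoidHom) fun m n => ?_) z
  exact congrArg₂ bimodTensor.tmul (pieceAnti_inclusion he he' h₁ h₂ n)
    (pieceAnti_symm_inclusion he he' h₁ h₂ m)

end Piece

/-! ### Inversion as an involution of the group algebra -/

section GroupAlgebra

variable {G : Type u} [Group G] [Finite G] {R : Type v} [CommRing R]

theorem invol_invol (x : MonoidAlgebra R G) : (invol R (invol R x).unop).unop = x := by
  induction x using MonoidAlgebra.induction_on with
  | of g => rw [invol_of, unop_op, invol_of, unop_op, inv_inv]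
  | add x y hx hy => rw [map_add, MulOpposite.unop_add, map_add, MulOpposite.unop_add, hx, hy]
  | smul r x hx => rw [map_smul, unop_smul, map_smul, unop_smul, hx]

/-- The involution of `RG` given by inversion. -/
instance : StarRing (MonoidAlgebra R G) where
  star x := (invol R x).unop
  star_involutive := invol_invol
  star_mul x y := by rw [map_mul, unop_mul]
  star_add x y := by rw [map_add, MulOpposite.unop_add]

theorem incl_star (H : Subgroup G) (x : MonoidAlgebra R H) :
    incl R H (star x) = star (incl R H x) := by
  change incl R H (invol R x).unop = (invol R (incl R H x)).unop
  induction x using MonoidAlgebra.induction_on with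
  | of g => rw [invol_of, incl_of, invol_of, unop_op, unop_op, incl_of]; rfl
  | add x y hx hy => rw [map_add, MulOpposite.unop_add, map_add, map_add, map_add, MulOpposite.unop_add, hx, hy]
  | smul r x hx =>
    have h : ∀ y : MonoidAlgebra R H, incl R H (r • y) = r • incl R H y := fun y => by simp [incl]
    rw [map_smul, unop_smul, h, h, map_smul, unop_smul, hx]

theorem star_idem (V : Subgroup G) : star (idem R V) = idem R V :=
  congrArg unop (invol_idem R V)

end GroupAlgebra

/-! ### Passage from the right-hand to the left-hand isomorphism -/

namespace BNData

variable {G : Type u} [Group G] {σ : Type} (D : BNData G σ) [Finite G] (R : Type v) [CommRing R]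

theorem star_e (I : Finset σ) : star (D.e R I) = D.e R I := star_idem _

/-- `x ⊗ y ↦ y* ⊗ x*` -/
def coeffXAnti (I : Finset σ) : (D.coeffX R).obj I ≃+ (D.coeffX R).obj I :=
  pieceTensorAnti (incl_star _) (D.star_e R I)

theorem isAnti_coeffXAnti (I : Finset σ) : IsAnti (D.coeffXAnti R I).toAddMonoidHom :=
  isAnti_pieceTensorAnti _ _

theorem coeffXAnti_map {I J : Finset σ} (φ : I ⟶ J) (x : (D.coeffX R).obj I) :
    D.coeffXAnti R J (((D.coeffX R).map φ).hom x) =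
      ((D.coeffX R).map φ).hom (D.coeffXAnti R I x) :=
  pieceTensorAnti_pieceRestr _ _ _ _ _ _ _ (incl_inclusion R _) x

variable (I₀ : Finset σ)

theorem nonempty_eMul_iso :
    Nonempty (D.coeffX R ⋙ D.eMul R I₀ ≅ (D.coeffX R ⋙ D.mulE R I₀) ⋙ swap) :=
  nonempty_leftCut_iso (incl_star _) (D.star_e R I₀) (D.coeffXAnti R) (D.isAnti_coeffXAnti R)
    (D.coeffXAnti_map R)

theorem nonempty_tensorERG_iso :
    Nonempty ((D.leviData I₀).coeffX R ⋙ D.tensorERG R I₀ ≅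
      ((D.leviData I₀).coeffX R ⋙ D.RGeTensor R I₀) ⋙ swap) :=
  nonempty_tensorRight_iso ((D.leviData I₀).coeffXAnti R) ((D.leviData I₀).isAnti_coeffXAnti R)
    ((D.leviData I₀).coeffXAnti_map R) (pieceAnti (D.star_e R I₀))
    (isAnti_pieceAnti (incl_star _) (D.star_e R I₀))

variable {D} {p : ℕ} [Fact p.Prime] (hD : D.IsSplit p) (hp : IsUnit (p : R)) [Fintype σ]
  [LinearOrder σ]
include hD hp

theorem IsSplit.nonempty_mulE_X_iso :
    Nonempty ((mapKb (D.mulE R I₀)).obj (D.X R) ≅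
      (mapKb (D.RGeTensor R I₀)).obj ((D.leviData I₀).X R)) := by
  obtain ⟨e⟩ := hD.nonempty_coeffKb_coeffXe_iso (I₀ := I₀) hp
  exact ⟨mapCoeffKbIso (D.mulE R I₀) (D.coeffX R) ≪≫ e ≪≫
    (mapCoeffKbIso (D.RGeTensor R I₀) ((D.leviData I₀).coeffX R)).symm⟩

/-- Inversion identifies `e_{I₀} X(G)` with `X(G) e_{I₀}` and `X(L_{I₀}) ⊗ e_{I₀}RG` with `RGe_{I₀}
⊗ X(L_{I₀})`, with the two actions exchanged. The isomorphism already obtained is transported along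
the functor `swap`. -/
theorem IsSplit.nonempty_eMul_X_iso :
    Nonempty ((mapKb (D.eMul R I₀)).obj (D.X R) ≅
      (mapKb (D.tensorERG R I₀)).obj ((D.leviData I₀).X R)) := by
  obtain ⟨e⟩ := hD.nonempty_coeffKb_coeffXe_iso (I₀ := I₀) hp
  obtain ⟨e₁⟩ := D.nonempty_eMul_iso R I₀
  obtain ⟨e₂⟩ := D.nonempty_tensorERG_iso R I₀
  obtain ⟨e₁'⟩ := nonempty_coeffKb_iso_of_iso e₁
  obtain ⟨e₂'⟩ := nonempty_coeffKb_iso_of_iso e₂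
  exact ⟨mapCoeffKbIso (D.eMul R I₀) (D.coeffX R) ≪≫ e₁' ≪≫
    (mapCoeffKbIso swap (D.coeffX R ⋙ D.mulE R I₀)).symm ≪≫ (mapKb swap).mapIso e ≪≫
    mapCoeffKbIso swap ((D.leviData I₀).coeffX R ⋙ D.RGeTensor R I₀) ≪≫ e₂'.symm ≪≫
    (mapCoeffKbIso (D.tensorERG R I₀) ((D.leviData I₀).coeffX R)).symm⟩

end BNData

end SplitBN
end

/-- Let `G` be a finite group with a split BN-pair of characteristic `p` and let `R` be a commutative
ring in which `p` is invertible. For every `I₀ ⊆ S`, `X(G) e_{I₀} ≅ RG e_{I₀} ⊗_{L_{I₀}} X(L_{I₀})`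
in `K^b(RG ⊗ (RL_{I₀})°)` and `e_{I₀} X(G) ≅ X(L_{I₀}) ⊗_{L_{I₀}} e_{I₀} RG` in
`K^b(RL_{I₀} ⊗ RG°)`. -/
theorem theorem9 {G : Type u} [Group G] [Finite G] {σ : Type} [Fintype σ] [LinearOrder σ]
    (p : ℕ) [Fact p.Prime] (D : SplitBN.BNData G σ) (hD : D.IsSplit p)
    (R : Type v) [CommRing R] (hp : IsUnit (p : R)) (I₀ : Finset σ) :
    Nonempty ((SplitBN.mapKb (D.mulE R I₀)).obj (D.X R) ≅
      (SplitBN.mapKb (D.RGeTensor R I₀)).obj ((D.leviData I₀).X R)) ∧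
    Nonempty ((SplitBN.mapKb (D.eMul R I₀)).obj (D.X R) ≅
      (SplitBN.mapKb (D.tensorERG R I₀)).obj ((D.leviData I₀).X R)) := by
  exact ⟨SplitBN.BNData.IsSplit.nonempty_mulE_X_iso R I₀ hD hp,
    SplitBN.BNData.IsSplit.nonempty_eMul_X_iso R I₀ hD hp⟩
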